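/- Let $\mathcal M$ be an arbitrary monoidal bicategory, i.e. a tricategory with one object, with tensor product written as juxtaposition and unit $I$. (No strictness, completeness, or other hypothesis is made; the constraint isomorphisms of $\mathcal M$ are suppressed below. Composition of arrows is written $g\circ f$ or $gf$.) **Right skew monoidales.** A right skew monoidale $(M,i,m,\alpha,\lambda,\rho)$ in $\mathcal M$ consists of an object $M$, arrows $m:MM\to M$ and $i:I\to M$, and (not necessarily invertible) cells $$\alpha:m(1m)\Rightarrow m(m1),\qquad \lambda:1\Rightarrow m(i1),\qquad \rho:m(1i)\Rightarrow 1,$$ satisfying the five skew monoidale axioms: (SKM1) the pentagon for $\alpha$ on $MMMM$; (SKM2) on $MM$, the composite $m\Rightarrow m(1m)(1i1)\Rightarrow m(m1)(1i1)\Rightarrow m$ of $1\lambda$, $\alpha$, $\rho1$ is the identity; (SKM3) on $MM$, the composite $m\Rightarrow m(i1)m= m(1m)(i11)\Rightarrow m(m1)(i11)$ of $\lambda$ and $\alpha$ equals $\lambda1$; (SKM4) on $MM$, the composite $m(1m)(11i)\Rightarrow m(m1)(11i)= m(1i)m\Rightarrow m$ of $\alpha$ and $\rho$ equals $1\rho$;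 (SKM5) on $I$, the composite $i\Rightarrow m(i1)i= m(1i)i\Rightarrow i$ of $\lambda$ and $\rho$ is the identity (the two unit constraints $II\to I$ being identified by their canonical isomorphism). A right skew monoidale *whose unit has a right adjoint* is a right skew monoidale together with a chosen adjunction $i\dashv i^*$ in $\mathcal M$, with unit $\eta:1\Rightarrow i^*i$ and counit $\varepsilon:ii^*\Rightarrow1$. Every adjunction $i\dashv i^*$ with $i:I\to R$ induces a right skew monoidal structure on $R$, with product $i^*1:RR\to R$, unit $i$, invertible associator given by the coherence isomorphism $(i^*1)(1\,i^*1)\cong(i^*1)(i^*11)$, left unitor $\eta1:1\Rightarrow(i^*1)(i1)$, and right unitor $(i^*1)(1i)\cong ii^*\Rightarrow1$ given by $\varepsilon$. **Oplax actions.** Let $(M,i,m,\alpha,\lambda,\rho)$ be a right skew monoidale. An oplax $M$-action on an object $A$ is an arrow $a:AM\to A$ with cells $a^2:a(1m)\Rightarrow a(a1)$ and $a^0:a(1i)\Rightarrow1$ such that: (OLA1) the pentagon holds on $AMMM$ (the evident analogue of SKM1, with $\alpha$ in the place where only $M$'s occur and $a^2$ elsewhere); (OLA2) on $AM$, the composite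 $a(1m)(11i)\Rightarrow a(a1)(11i)=a(1i)a\Rightarrow a$ of $a^2$ and $a^0$ equals $1\rho$; (OLA3) on $AM$, the composite $a\Rightarrow a(1m)(1i1)\Rightarrow a(a1)(1i1)\Rightarrow a$ of $1\lambda$, $a^2$, $a^01$ is the identity. A cell of oplax actions $(a,a^2,a^0)\to(a',a'^2,a'^0)$ is a cell $a\Rightarrow a'$ of $\mathcal M$ compatible with the associators and right unitors. **The simplicial object $\mathrm{OplaxAct}(\mathcal M)$ in $\mathbf{Cat}$.** * $0$-simplices: the discrete category on the pairs $(R,i\dashv i^*)$ of an object $R$ and an adjunction with $i:I\to R$ in $\mathcal M$; $R$ is regarded as a right skew monoidale with the structure induced by $i\dashv i^*$. * $1$-simplices from $(R,i\dashv i^*)$ to $(S,j\dashv j^*)$: oplax $R$-actions $s:SR\to S$ on $S$ and their cells. * $2$-simplices on $(R,i\dashv i^*),(S,j\dashv j^*),(T,k\dashv k^*)$: quadruples $(s,t,v,\alpha)$ where $s:SR\to S$, $t:TS\to T$, $v:TR\to T$ are $1$-simplices and $\alpha:t(1s)\Rightarrow v(t1)$ is a cell such that: (2SIM1) on $TSSR$,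 the composite $t(1\,j^*1)(11s)\cong t(1s)(1\,j^*11)\Rightarrow v(t1)(1\,j^*11)\Rightarrow v(t1)(t11)$ of $\alpha$ and $t^21$ equals the composite $t(1\,j^*1)(11s)\Rightarrow t(t1)(11s)\cong t(1s)(t11)\Rightarrow v(t1)(t11)$ of $t^2$ and $\alpha$; (2SIM2) on $TSRR$, the composite $t(1s)(11\,i^*1)\Rightarrow t(1s)(1s1)\Rightarrow v(t1)(1s1)\Rightarrow v(v1)(t11)$ of $1s^2$, $\alpha$, $\alpha1$ equals the composite $t(1s)(11\,i^*1)\Rightarrow v(t1)(11\,i^*1)\cong v(1\,i^*1)(t11)\Rightarrow v(v1)(t11)$ of $\alpha$ and $v^2$; (2SIM3) on $TS$, the composite $t(1s)(11i)\Rightarrow v(t1)(11i)\cong v(1i)t\Rightarrow t$ of $\alpha$ and $v^0$ equals $1s^0$. Arrows are triples of cells of oplax actions commuting with the cells $\alpha$. * $3$-simplices on $R,S,T,U$: quadruples of $2$-simplices $\alpha$ on $R,S,T$, $\beta$ on $R,S,U$, $\gamma$ on $R,T,U$, $\zeta$ on $S,T,U$ with matching edges $s:SR\to S$, $t:TS\to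 T$, $v:TR\to T$, $p:UT\to U$, $x:US\to U$, $y:UR\to U$, such that the composite $p(1t)(11s)\Rightarrow p(1v)(1t1)\Rightarrow y(p1)(1t1)\Rightarrow y(x1)(p11)$ of $1\alpha,\gamma,\zeta1$ equals the composite $p(1t)(11s)\Rightarrow x(p1)(11s)\cong x(1s)(p11)\Rightarrow y(x1)(p11)$ of $\zeta,\beta$; arrows are matching quadruples of arrows of $2$-simplices. * Degeneracies: $s_0(R,i\dashv i^*)=i^*1:RR\to R$, the regular action of the induced skew monoidale; for a $1$-simplex $t:TS\to T$ over $(S,j\dashv j^*),(T,k\dashv k^*)$, $s_0t$ has square $t^2:t(1\,j^*1)\Rightarrow t(t1)$ and $s_1t$ has square the coherence isomorphism $(k^*1)(1t)\cong t(k^*11)$; and degenerate $3$-simplices are the corresponding quadruples of $2$-simplices. The object is $3$-coskeletal. Let $\mathrm{OplaxAct}(\mathcal M)^{(0)}$ be the simplicial set obtained by taking sets of objects in each dimension. **Monads of oplax actions.** The Catalan simplicial set $\mathbb C$ is the $2$-coskeletal simplicial set with a unique $0$-simplex $\star$; two $1$-simplices $e=s_0\star$ and $c$; and five $2$-simplices,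 determined by their edges $(\partial_2,\partial_0,\partial_1)$ (that is, $01$, $12$, $02$): the degenerate ones $(e,e,e)$, $(e,c,c)=s_0c$, $(c,e,c)=s_1c$, and the nondegenerate ones $\mu_0=(e,e,c)$ and $\mu_2=(c,c,c)$. A *monad of oplax actions* in $\mathcal M$ is a simplicial map $\mathbb C\to\mathrm{OplaxAct}(\mathcal M)^{(0)}$. **Theorem.** In every monoidal bicategory $\mathcal M$, monads of oplax actions are in bijection with right skew monoidales whose unit has a right adjoint. Explicitly, there is a bijection that sends a monad of oplax actions $f$ to a right skew monoidale $(R,i,m,\alpha,\lambda,\rho)$ with an adjunction $i\dashv i^*$ such that, writing $$\kappa:\ i^*1\Rightarrow m(i1)(i^*1)\cong m(ii^*1)\Rightarrow m$$ for the mate of $\lambda$ (the composite of $\lambda$ and $\varepsilon1$): * $f(\star)=(R,i\dashv i^*)$; * $f(c)$ is the oplax action $m:RR\to R$ with right unitor $\rho$ and associator the composite of $1\kappa:m(1\,i^*1)\Rightarrow m(1m)$ followed by $\alpha:m(1m)\Rightarrow m(m1)$; * the square of $f(\mu_2)$ is $\alpha:m(1m)\Rightarrow m(m1)$; * the square of $f(\mu_0)$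 is $(i^*1)(1\,i^*1)\cong(i^*1)(i^*11)\Rightarrow m(i^*11)$, the coherence isomorphism followed by $\kappa$. -/

import Mathlib

open CategoryTheory Bicategory
open scoped Pseudofunctor.StrongTrans CategoryTheory.Prod

universe w v u w₁ v₁ u₁ w₂ v₂ u₂ w₃ v₃ u₃

namespace MonBicat

/-! ## Monoidal bicategories -/

/-- The pseudofunctor into a product of bicategories with the given two components. -/
def pairing {B : Type u₁} [Bicategory.{w₁, v₁} B] {C : Type u₂} [Bicategory.{w₂, v₂} C]
    {D : Type u₃} [Bicategory.{w₃, v₃} D] (F : B ⥤ᵖ C) (G : B ⥤ᵖ D) : B ⥤ᵖ (C × D) where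
  obj X := (F.obj X, G.obj X)
  map f := F.map f ×ₘ G.map f
  map₂ η := F.map₂ η ×ₘ G.map₂ η
  map₂_id f := Prod.ext (F.map₂_id f) (G.map₂_id f)
  map₂_comp η θ := Prod.ext (F.map₂_comp η θ) (G.map₂_comp η θ)
  mapId X := Iso.prod (F.mapId X) (G.mapId X)
  mapComp f g := Iso.prod (F.mapComp f g) (G.mapComp f g)
  map₂_whisker_left f _ _ η := Prod.ext (F.map₂_whisker_left f η) (G.map₂_whisker_left f η)
  map₂_whisker_right η h := Prod.ext (F.map₂_whisker_right η h) (G.map₂_whisker_right η h)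
  map₂_associator f g h := Prod.ext (F.map₂_associator f g h) (G.map₂_associator f g h)
  map₂_left_unitor f := Prod.ext (F.map₂_left_unitor f) (G.map₂_left_unitor f)
  map₂_right_unitor f := Prod.ext (F.map₂_right_unitor f) (G.map₂_right_unitor f)

section

variable {B : Type u} [Bicategory.{w, v} B]

/-- The three projections `B × B × B ⥤ᵖ B`. -/
def fst₃ : (B × B × B) ⥤ᵖ B := (Bicategory.Prod.fst B (B × B)).toPseudofunctor

def snd₃ : (B × B × B) ⥤ᵖ B :=
  (Bicategory.Prod.snd B (B × B)).toPseudofunctor.comp (Bicategory.Prod.fst B B).toPseudofunctor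

def thd₃ : (B × B × B) ⥤ᵖ B :=
  (Bicategory.Prod.snd B (B × B)).toPseudofunctor.comp (Bicategory.Prod.snd B B).toPseudofunctor

/-- `(X, Y, Z) ↦ (X ⊠ Y) ⊠ Z`. -/
def tensorLeft₃ (T : (B × B) ⥤ᵖ B) : (B × B × B) ⥤ᵖ B :=
  (pairing ((pairing fst₃ snd₃).comp T) thd₃).comp T

/-- `(X, Y, Z) ↦ X ⊠ (Y ⊠ Z)`. -/
def tensorRight₃ (T : (B × B) ⥤ᵖ B) : (B × B × B) ⥤ᵖ B :=
  (pairing fst₃ ((pairing snd₃ thd₃).comp T)).comp T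

end

/-- The first layer of a monoidal bicategory: the tensor product pseudofunctor, the unit object,
and the associativity and unit constraints, which are adjoint equivalences in the bicategories of
pseudofunctors, strong (i.e. pseudonatural) transformations and modifications. -/
class TensorStruct (B : Type u) [Bicategory.{w, v} B] where
  /-- The tensor product. -/
  tensor : (B × B) ⥤ᵖ B
  /-- The unit object. -/
  one : B
  /-- `(X ⊠ Y) ⊠ Z ≌ X ⊠ (Y ⊠ Z)`, pseudonaturally. -/
  assoc : tensorLeft₃ tensor ≌ tensorRight₃ tensor
  /-- `I ⊠ X ≌ X`, pseudonaturally. -/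
  leftUnit : (Bicategory.Prod.sectR one B).toPseudofunctor.comp tensor ≌ Pseudofunctor.id B
  /-- `X ⊠ I ≌ X`, pseudonaturally. -/
  rightUnit : (Bicategory.Prod.sectL B one).toPseudofunctor.comp tensor ≌ Pseudofunctor.id B

section Components

variable {B : Type u} [Bicategory.{w, v} B] [TensorStruct B]

/-- The tensor product of objects. -/
abbrev tObj (X Y : B) : B := TensorStruct.tensor.obj (X, Y)

infixr:70 " ⊠ " => tObj

variable (B) in
/-- The unit object. -/
abbrev unitObj : B := TensorStruct.one

/-- The tensor product of 1-cells. -/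
def tHom {X X' Y Y' : B} (f : X ⟶ X') (g : Y ⟶ Y') : X ⊠ Y ⟶ X' ⊠ Y' :=
  TensorStruct.tensor.map (f ×ₘ g)

infixr:85 " ⊠₁ " => tHom

/-- The tensor product of 2-cells. -/
def tHom₂ {X X' Y Y' : B} {f f' : X ⟶ X'} {g g' : Y ⟶ Y'} (η : f ⟶ f') (θ : g ⟶ g') :
    f ⊠₁ g ⟶ f' ⊠₁ g' :=
  TensorStruct.tensor.map₂ (η ×ₘ θ)

infixr:85 " ⊠₂ " => tHom₂

/-- The tensor product of invertible 2-cells. -/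
def tIso {X X' Y Y' : B} {f f' : X ⟶ X'} {g g' : Y ⟶ Y'} (η : f ≅ f') (θ : g ≅ g') :
    f ⊠₁ g ≅ f' ⊠₁ g' :=
  TensorStruct.tensor.map₂Iso (Iso.prod η θ)

/-- The tensor product preserves composition of 1-cells up to isomorphism. -/
def tComp {X X' X'' Y Y' Y'' : B} (f : X ⟶ X') (f' : X' ⟶ X'') (g : Y ⟶ Y') (g' : Y' ⟶ Y'') :
    (f ≫ f') ⊠₁ (g ≫ g') ≅ f ⊠₁ g ≫ f' ⊠₁ g' :=
  TensorStruct.tensor.mapComp (f ×ₘ g) (f' ×ₘ g')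

/-- The tensor product preserves identity 1-cells up to isomorphism. -/
def tId (X Y : B) : 𝟙 X ⊠₁ 𝟙 Y ≅ 𝟙 (X ⊠ Y) :=
  TensorStruct.tensor.mapId (X, Y)

/-- `X ⊠ (f ≫ g) ≅ (X ⊠ f) ≫ (X ⊠ g)`. -/
def wL (X : B) {Y Y' Y'' : B} (f : Y ⟶ Y') (g : Y' ⟶ Y'') :
    𝟙 X ⊠₁ (f ≫ g) ≅ 𝟙 X ⊠₁ f ≫ 𝟙 X ⊠₁ g :=
  tIso (λ_ (𝟙 X)).symm (Iso.refl _) ≪≫ tComp _ _ _ _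

/-- `(f ≫ g) ⊠ X ≅ (f ⊠ X) ≫ (g ⊠ X)`. -/
def wR {Y Y' Y'' : B} (f : Y ⟶ Y') (g : Y' ⟶ Y'') (X : B) :
    (f ≫ g) ⊠₁ 𝟙 X ≅ f ⊠₁ 𝟙 X ≫ g ⊠₁ 𝟙 X :=
  tIso (Iso.refl _) (λ_ (𝟙 X)).symm ≪≫ tComp _ _ _ _

/-- `wL` for a composite of three 1-cells. -/
def wL₃ (X : B) {Y Y' Y'' Y''' : B} (f : Y ⟶ Y') (g : Y' ⟶ Y'') (h : Y'' ⟶ Y''') :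
    𝟙 X ⊠₁ (f ≫ g ≫ h) ≅ 𝟙 X ⊠₁ f ≫ 𝟙 X ⊠₁ g ≫ 𝟙 X ⊠₁ h :=
  wL X f (g ≫ h) ≪≫ whiskerLeftIso _ (wL X g h)

/-- `wR` for a composite of three 1-cells. -/
def wR₃ {Y Y' Y'' Y''' : B} (f : Y ⟶ Y') (g : Y' ⟶ Y'') (h : Y'' ⟶ Y''') (X : B) :
    (f ≫ g ≫ h) ⊠₁ 𝟙 X ≅ f ⊠₁ 𝟙 X ≫ g ⊠₁ 𝟙 X ≫ h ⊠₁ 𝟙 X :=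
  wR f (g ≫ h) X ≪≫ whiskerLeftIso _ (wR g h X)

/-- The interchange isomorphism. -/
def inter {X X' Y Y' : B} (f : X ⟶ X') (g : Y ⟶ Y') :
    f ⊠₁ 𝟙 Y ≫ 𝟙 X' ⊠₁ g ≅ 𝟙 X ⊠₁ g ≫ f ⊠₁ 𝟙 Y' :=
  (tComp _ _ _ _).symm ≪≫ tIso (ρ_ f ≪≫ (λ_ f).symm) (λ_ g ≪≫ (ρ_ g).symm) ≪≫ tComp _ _ _ _

/-- The invertible square with identity sides. -/
def idSq {X Y : B} (f : X ⟶ Y) : f ≫ 𝟙 Y ≅ 𝟙 X ≫ f := ρ_ f ≪≫ (λ_ f).symm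

/-- The tensor product of two invertible squares. -/
def tSq {X X' Z Z' Y Y' W W' : B} {f : X ⟶ X'} {p' : X' ⟶ Z'} {p : X ⟶ Z} {h : Z ⟶ Z'}
    {g : Y ⟶ Y'} {q' : Y' ⟶ W'} {q : Y ⟶ W} {k : W ⟶ W'}
    (σ : f ≫ p' ≅ p ≫ h) (τ : g ≫ q' ≅ q ≫ k) :
    f ⊠₁ g ≫ p' ⊠₁ q' ≅ p ⊠₁ q ≫ h ⊠₁ k :=
  (tComp _ _ _ _).symm ≪≫ tIso σ τ ≪≫ tComp _ _ _ _

/-- The pasting of two adjacent invertible squares. -/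
def pasteSq {X X' Y Y' Z Z' : B} {f : X ⟶ X'} {p : X ⟶ Y} {p' : X' ⟶ Y'} {g : Y ⟶ Y'}
    {q : Y ⟶ Z} {q' : Y' ⟶ Z'} {h : Z ⟶ Z'} (σ : f ≫ p' ≅ p ≫ g) (τ : g ≫ q' ≅ q ≫ h) :
    f ≫ p' ≫ q' ≅ (p ≫ q) ≫ h :=
  (α_ _ _ _).symm ≪≫ whiskerRightIso σ q' ≪≫ α_ _ _ _ ≪≫ whiskerLeftIso p τ ≪≫ (α_ _ _ _).symm

/-- The components of the associativity constraint. -/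
def as (X Y Z : B) : (X ⊠ Y) ⊠ Z ⟶ X ⊠ (Y ⊠ Z) := TensorStruct.assoc.hom.app (X, Y, Z)

/-- The components of the left unit constraint. -/
def lu (X : B) : unitObj B ⊠ X ⟶ X := TensorStruct.leftUnit.hom.app X

/-- The components of the right unit constraint. -/
def ru (X : B) : X ⊠ unitObj B ⟶ X := TensorStruct.rightUnit.hom.app X

/-- The pseudonaturality of the associativity constraint. -/
def asNat {X X' Y Y' Z Z' : B} (f : X ⟶ X') (g : Y ⟶ Y') (h : Z ⟶ Z') :
    (f ⊠₁ g) ⊠₁ h ≫ as X' Y' Z' ≅ as X Y Z ≫ f ⊠₁ (g ⊠₁ h) :=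
  TensorStruct.assoc.hom.naturality (f ×ₘ g ×ₘ h)

/-- The pseudonaturality of the left unit constraint. -/
def luNat {X X' : B} (f : X ⟶ X') : 𝟙 (unitObj B) ⊠₁ f ≫ lu X' ≅ lu X ≫ f :=
  TensorStruct.leftUnit.hom.naturality f

/-- The pseudonaturality of the right unit constraint. -/
def ruNat {X X' : B} (f : X ⟶ X') : f ⊠₁ 𝟙 (unitObj B) ≫ ru X' ≅ ru X ≫ f :=
  TensorStruct.rightUnit.hom.naturality f

/-- The pseudonaturality of the associativity constraint in the first variable. -/
def asL {X X' : B} (f : X ⟶ X') (Y Z : B) :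
    (f ⊠₁ 𝟙 Y) ⊠₁ 𝟙 Z ≫ as X' Y Z ≅ as X Y Z ≫ f ⊠₁ 𝟙 (Y ⊠ Z) :=
  asNat f (𝟙 Y) (𝟙 Z) ≪≫ whiskerLeftIso _ (tIso (Iso.refl f) (tId Y Z))

/-- The pseudonaturality of the associativity constraint in the second variable. -/
def asM (X : B) {Y Y' : B} (f : Y ⟶ Y') (Z : B) :
    (𝟙 X ⊠₁ f) ⊠₁ 𝟙 Z ≫ as X Y' Z ≅ as X Y Z ≫ 𝟙 X ⊠₁ (f ⊠₁ 𝟙 Z) :=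
  asNat (𝟙 X) f (𝟙 Z)

/-- The pseudonaturality of the associativity constraint in the third variable. -/
def asR (X Y : B) {Z Z' : B} (f : Z ⟶ Z') :
    𝟙 (X ⊠ Y) ⊠₁ f ≫ as X Y Z' ≅ as X Y Z ≫ 𝟙 X ⊠₁ (𝟙 Y ⊠₁ f) :=
  whiskerRightIso (tIso (tId X Y).symm (Iso.refl f)) _ ≪≫ asNat (𝟙 X) (𝟙 Y) f

end Components

/-- The second layer of a monoidal bicategory: the invertible modifications filling the pentagon
and the three unit triangles. -/
class MonoidalStruct (B : Type u) [Bicategory.{w, v} B] extends TensorStruct B where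
  /-- The pentagon modification. -/
  pent (X Y Z W : B) :
    as X Y Z ⊠₁ 𝟙 W ≫ as X (Y ⊠ Z) W ≫ 𝟙 X ⊠₁ as Y Z W ≅ as (X ⊠ Y) Z W ≫ as X Y (Z ⊠ W)
  pent_naturality {X X' Y Y' Z Z' W W' : B}
    (f : X ⟶ X') (g : Y ⟶ Y') (h : Z ⟶ Z') (k : W ⟶ W') :
    ((f ⊠₁ g) ⊠₁ h) ⊠₁ k ◁ (pent X' Y' Z' W').hom ≫
        (pasteSq (asNat (f ⊠₁ g) h k) (asNat f g (h ⊠₁ k))).hom =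
      (pasteSq (tSq (asNat f g h) (idSq k))
          (pasteSq (asNat f (g ⊠₁ h) k) (tSq (idSq f) (asNat g h k)))).hom ≫
        (pent X Y Z W).hom ▷ (f ⊠₁ (g ⊠₁ (h ⊠₁ k)))
  /-- The middle triangle modification. -/
  midTri (X Y : B) : as X (unitObj B) Y ≫ 𝟙 X ⊠₁ lu Y ≅ ru X ⊠₁ 𝟙 Y
  midTri_naturality {X X' Y Y' : B} (f : X ⟶ X') (g : Y ⟶ Y') :
    (f ⊠₁ 𝟙 (unitObj B)) ⊠₁ g ◁ (midTri X' Y').hom ≫ (tSq (ruNat f) (idSq g)).hom =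
      (pasteSq (asNat f (𝟙 (unitObj B)) g) (tSq (idSq f) (luNat g))).hom ≫
        (midTri X Y).hom ▷ (f ⊠₁ g)
  /-- The left triangle modification. -/
  leftTri (X Y : B) : as (unitObj B) X Y ≫ lu (X ⊠ Y) ≅ lu X ⊠₁ 𝟙 Y
  leftTri_naturality {X X' Y Y' : B} (f : X ⟶ X') (g : Y ⟶ Y') :
    (𝟙 (unitObj B) ⊠₁ f) ⊠₁ g ◁ (leftTri X' Y').hom ≫ (tSq (luNat f) (idSq g)).hom =
      (pasteSq (asNat (𝟙 (unitObj B)) f g) (luNat (f ⊠₁ g))).hom ≫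
        (leftTri X Y).hom ▷ (f ⊠₁ g)
  /-- The right triangle modification. -/
  rightTri (X Y : B) : as X Y (unitObj B) ≫ 𝟙 X ⊠₁ ru Y ≅ ru (X ⊠ Y)
  rightTri_naturality {X X' Y Y' : B} (f : X ⟶ X') (g : Y ⟶ Y') :
    (f ⊠₁ g) ⊠₁ 𝟙 (unitObj B) ◁ (rightTri X' Y').hom ≫ (ruNat (f ⊠₁ g)).hom =
      (pasteSq (asNat f g (𝟙 (unitObj B))) (tSq (idSq f) (ruNat g))).hom ≫
        (rightTri X Y).hom ▷ (f ⊠₁ g)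

section Axioms

variable {B : Type u} [Bicategory.{w, v} B] [MonoidalStruct B]

open MonoidalStruct

/-- The pasting of three pentagons and one naturality square on one side of the associativity
condition for the pentagon modification. -/
def fiveLeft (V W X Y Z : B) :
    (as V W X ⊠₁ 𝟙 Y) ⊠₁ 𝟙 Z ≫ as V (W ⊠ X) Y ⊠₁ 𝟙 Z ≫ (𝟙 V ⊠₁ as W X Y) ⊠₁ 𝟙 Z ≫
        as V (W ⊠ (X ⊠ Y)) Z ≫ 𝟙 V ⊠₁ as W (X ⊠ Y) Z ≫ 𝟙 V ⊠₁ (𝟙 W ⊠₁ as X Y Z) ⟶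
      as ((V ⊠ W) ⊠ X) Y Z ≫ as (V ⊠ W) X (Y ⊠ Z) ≫ as V W (X ⊠ (Y ⊠ Z)) :=
  𝟙 _ ⊗≫ ((wR₃ _ _ _ Z).inv ≫ (pent V W X Y).hom ⊠₂ 𝟙 (𝟙 Z) ≫ (wR _ _ Z).hom) ▷
      (as V (W ⊠ (X ⊠ Y)) Z ≫ 𝟙 V ⊠₁ as W (X ⊠ Y) Z ≫ 𝟙 V ⊠₁ (𝟙 W ⊠₁ as X Y Z)) ⊗≫
    as (V ⊠ W) X Y ⊠₁ 𝟙 Z ◁ (pent V W (X ⊠ Y) Z).hom ▷ (𝟙 V ⊠₁ (𝟙 W ⊠₁ as X Y Z)) ⊗≫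
    as (V ⊠ W) X Y ⊠₁ 𝟙 Z ◁ as (V ⊠ W) (X ⊠ Y) Z ◁ (asR V W (as X Y Z)).inv ⊗≫
    (pent (V ⊠ W) X Y Z).hom ▷ as V W (X ⊠ (Y ⊠ Z)) ⊗≫ 𝟙 _

/-- The pasting of three pentagons and two naturality squares on the other side of the
associativity condition for the pentagon modification. -/
def fiveRight (V W X Y Z : B) :
    (as V W X ⊠₁ 𝟙 Y) ⊠₁ 𝟙 Z ≫ as V (W ⊠ X) Y ⊠₁ 𝟙 Z ≫ (𝟙 V ⊠₁ as W X Y) ⊠₁ 𝟙 Z ≫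
        as V (W ⊠ (X ⊠ Y)) Z ≫ 𝟙 V ⊠₁ as W (X ⊠ Y) Z ≫ 𝟙 V ⊠₁ (𝟙 W ⊠₁ as X Y Z) ⟶
      as ((V ⊠ W) ⊠ X) Y Z ≫ as (V ⊠ W) X (Y ⊠ Z) ≫ as V W (X ⊠ (Y ⊠ Z)) :=
  𝟙 _ ⊗≫ (as V W X ⊠₁ 𝟙 Y) ⊠₁ 𝟙 Z ◁ as V (W ⊠ X) Y ⊠₁ 𝟙 Z ◁ (asM V (as W X Y) Z).hom ▷
      (𝟙 V ⊠₁ as W (X ⊠ Y) Z ≫ 𝟙 V ⊠₁ (𝟙 W ⊠₁ as X Y Z)) ⊗≫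
    (as V W X ⊠₁ 𝟙 Y) ⊠₁ 𝟙 Z ◁ as V (W ⊠ X) Y ⊠₁ 𝟙 Z ◁ as V ((W ⊠ X) ⊠ Y) Z ◁
      ((wL₃ V _ _ _).inv ≫ 𝟙 (𝟙 V) ⊠₂ (pent W X Y Z).hom ≫ (wL V _ _).hom) ⊗≫
    (as V W X ⊠₁ 𝟙 Y) ⊠₁ 𝟙 Z ◁ (pent V (W ⊠ X) Y Z).hom ▷ (𝟙 V ⊠₁ as W X (Y ⊠ Z)) ⊗≫
    (asL (as V W X) Y Z).hom ▷ (as V (W ⊠ X) (Y ⊠ Z) ≫ 𝟙 V ⊠₁ as W X (Y ⊠ Z)) ⊗≫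
    as ((V ⊠ W) ⊠ X) Y Z ◁ (pent V W X (Y ⊠ Z)).hom ⊗≫ 𝟙 _

/-- One side of the left normalization condition. -/
def normLeft₁ (X Y Z : B) :
    as X (unitObj B) Y ⊠₁ 𝟙 Z ≫ as X (unitObj B ⊠ Y) Z ≫ 𝟙 X ⊠₁ as (unitObj B) Y Z ≫
        𝟙 X ⊠₁ lu (Y ⊠ Z) ⟶
      (ru X ⊠₁ 𝟙 Y) ⊠₁ 𝟙 Z ≫ as X Y Z :=
  𝟙 _ ⊗≫ as X (unitObj B) Y ⊠₁ 𝟙 Z ◁ as X (unitObj B ⊠ Y) Z ◁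
      ((wL X _ _).inv ≫ 𝟙 (𝟙 X) ⊠₂ (leftTri Y Z).hom) ⊗≫
    as X (unitObj B) Y ⊠₁ 𝟙 Z ◁ (asM X (lu Y) Z).inv ⊗≫
    ((wR _ _ Z).inv ≫ (midTri X Y).hom ⊠₂ 𝟙 (𝟙 Z)) ▷ as X Y Z ⊗≫ 𝟙 _

/-- The other side of the left normalization condition. -/
def normLeft₂ (X Y Z : B) :
    as X (unitObj B) Y ⊠₁ 𝟙 Z ≫ as X (unitObj B ⊠ Y) Z ≫ 𝟙 X ⊠₁ as (unitObj B) Y Z ≫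
        𝟙 X ⊠₁ lu (Y ⊠ Z) ⟶
      (ru X ⊠₁ 𝟙 Y) ⊠₁ 𝟙 Z ≫ as X Y Z :=
  𝟙 _ ⊗≫ (pent X (unitObj B) Y Z).hom ▷ (𝟙 X ⊠₁ lu (Y ⊠ Z)) ⊗≫
    as (X ⊠ unitObj B) Y Z ◁ (midTri X (Y ⊠ Z)).hom ⊗≫
    (asL (ru X) Y Z).inv ⊗≫ 𝟙 _

/-- One side of the right normalization condition. -/
def normRight₁ (X Y Z : B) :
    as X Y (unitObj B) ⊠₁ 𝟙 Z ≫ as X (Y ⊠ unitObj B) Z ≫ 𝟙 X ⊠₁ as Y (unitObj B) Z ≫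
        𝟙 X ⊠₁ (𝟙 Y ⊠₁ lu Z) ⟶
      ru (X ⊠ Y) ⊠₁ 𝟙 Z ≫ as X Y Z :=
  𝟙 _ ⊗≫ as X Y (unitObj B) ⊠₁ 𝟙 Z ◁ as X (Y ⊠ unitObj B) Z ◁
      ((wL X _ _).inv ≫ 𝟙 (𝟙 X) ⊠₂ (midTri Y Z).hom) ⊗≫
    as X Y (unitObj B) ⊠₁ 𝟙 Z ◁ (asM X (ru Y) Z).inv ⊗≫
    ((wR _ _ Z).inv ≫ (rightTri X Y).hom ⊠₂ 𝟙 (𝟙 Z)) ▷ as X Y Z ⊗≫ 𝟙 _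

/-- The other side of the right normalization condition. -/
def normRight₂ (X Y Z : B) :
    as X Y (unitObj B) ⊠₁ 𝟙 Z ≫ as X (Y ⊠ unitObj B) Z ≫ 𝟙 X ⊠₁ as Y (unitObj B) Z ≫
        𝟙 X ⊠₁ (𝟙 Y ⊠₁ lu Z) ⟶
      ru (X ⊠ Y) ⊠₁ 𝟙 Z ≫ as X Y Z :=
  𝟙 _ ⊗≫ (pent X Y (unitObj B) Z).hom ▷ (𝟙 X ⊠₁ (𝟙 Y ⊠₁ lu Z)) ⊗≫
    as (X ⊠ Y) (unitObj B) Z ◁ (asR X Y (lu Z)).inv ⊗≫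
    (midTri (X ⊠ Y) Z).hom ▷ as X Y Z ⊗≫ 𝟙 _

end Axioms

/-- A monoidal bicategory, i.e. a tricategory with one object. -/
class MonoidalBicategory (B : Type u) [Bicategory.{w, v} B] extends MonoidalStruct B where
  five (V W X Y Z : B) : fiveLeft V W X Y Z = fiveRight V W X Y Z
  normLeft (X Y Z : B) : normLeft₁ X Y Z = normLeft₂ X Y Z
  normRight (X Y Z : B) : normRight₁ X Y Z = normRight₂ X Y Z

section Derived

variable {B : Type u} [Bicategory.{w, v} B]

/-- Cancelling a 1-cell `e` on the right, where `e` is the left adjoint of an equivalence. -/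
def cancelRight {X Y Z : B} {f g : X ⟶ Y} {e : Y ⟶ Z} {e' : Z ⟶ Y} (η : 𝟙 Y ≅ e ≫ e')
    (φ : f ≫ e ≅ g ≫ e) : f ≅ g :=
  (ρ_ f).symm ≪≫ whiskerLeftIso f η ≪≫ (α_ _ _ _).symm ≪≫ whiskerRightIso φ e' ≪≫
    α_ _ _ _ ≪≫ whiskerLeftIso g η.symm ≪≫ ρ_ g

/-- Cancelling a 1-cell `e` on the left, where `e` is the left adjoint of an equivalence. -/
def cancelLeft {X Y Z : B} {f g : Y ⟶ Z} {e : X ⟶ Y} {e' : Y ⟶ X} (κ : e' ≫ e ≅ 𝟙 Y)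
    (φ : e ≫ f ≅ e ≫ g) : f ≅ g :=
  (λ_ f).symm ≪≫ whiskerRightIso κ.symm f ≪≫ α_ _ _ _ ≪≫ whiskerLeftIso e' φ ≪≫
    (α_ _ _ _).symm ≪≫ whiskerRightIso κ g ≪≫ λ_ g

variable [TensorStruct B]

/-- The components of the unit of the adjoint equivalence `lu`. -/
def luUnit (X : B) : 𝟙 (unitObj B ⊠ X) ≅ lu X ≫ TensorStruct.leftUnit.inv.app X where
  hom := (TensorStruct.leftUnit (B := B)).unit.hom.as.app X
  inv := (TensorStruct.leftUnit (B := B)).unit.inv.as.app X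
  hom_inv_id := congrArg (fun Γ => Γ.as.app X) (TensorStruct.leftUnit (B := B)).unit.hom_inv_id
  inv_hom_id := congrArg (fun Γ => Γ.as.app X) (TensorStruct.leftUnit (B := B)).unit.inv_hom_id

/-- The components of the counit of the adjoint equivalence `ru`. -/
def ruCounit (X : B) : TensorStruct.rightUnit.inv.app X ≫ ru X ≅ 𝟙 X where
  hom := (TensorStruct.rightUnit (B := B)).counit.hom.as.app X
  inv := (TensorStruct.rightUnit (B := B)).counit.inv.as.app X
  hom_inv_id := congrArg (fun Γ => Γ.as.app X) (TensorStruct.rightUnit (B := B)).counit.hom_inv_id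
  inv_hom_id := congrArg (fun Γ => Γ.as.app X) (TensorStruct.rightUnit (B := B)).counit.inv_hom_id

/-- The canonical isomorphism between the two left unit constraints `I ⊠ (I ⊠ X) ⟶ I ⊠ X`. -/
def luLu (X : B) : lu (unitObj B ⊠ X) ≅ 𝟙 (unitObj B) ⊠₁ lu X :=
  cancelRight (luUnit X) (luNat (lu X)).symm

end Derived

variable (B : Type u) [Bicategory.{w, v} B] [MonoidalStruct B] in
/-- The canonical isomorphism between the left and the right unit constraint `I ⊠ I ⟶ I`. -/
def luRu : lu (unitObj B) ≅ ru (unitObj B) :=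
  cancelLeft (ruCounit (unitObj B ⊠ unitObj B)) <|
    (ruNat (lu (unitObj B))).symm ≪≫
      whiskerRightIso ((MonoidalStruct.leftTri (unitObj B) (unitObj B)).symm ≪≫
        whiskerLeftIso _ (luLu (unitObj B)) ≪≫
        MonoidalStruct.midTri (unitObj B) (unitObj B)) (ru (unitObj B)) ≪≫
      ruNat (ru (unitObj B))

/-! ## Diagrams of cells -/

section Cells

variable {B : Type u} [Bicategory.{w, v} B] [MonoidalBicategory B]

open MonoidalStruct

/-- The type of squares `t ∘ (1 ⊠ s) ⟹ v ∘ (t ⊠ 1)` from `(T ⊠ S) ⊠ R` to `T`. -/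
abbrev Sq {R S T : B} (s : S ⊠ R ⟶ S) (t : T ⊠ S ⟶ T) (v : T ⊠ R ⟶ T) : Type w :=
  as T S R ≫ 𝟙 T ⊠₁ s ≫ t ⟶ t ⊠₁ 𝟙 R ≫ v

section Tetra

variable {R S T U : B} {s : S ⊠ R ⟶ S} {t : T ⊠ S ⟶ T} {v : T ⊠ R ⟶ T} {p : U ⊠ T ⟶ U}
  {x : U ⊠ S ⟶ U} {y : U ⊠ R ⟶ U}

/-- The pasting of `1 ⊠ α`, `γ` and `ζ ⊠ 1`. -/
def tetraLeft (α : Sq s t v) (γ : Sq v p y) (ζ : Sq t p x) :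
    as U T S ⊠₁ 𝟙 R ≫ as U (T ⊠ S) R ≫ 𝟙 U ⊠₁ as T S R ≫ 𝟙 U ⊠₁ (𝟙 T ⊠₁ s) ≫ 𝟙 U ⊠₁ t ≫ p ⟶
      (p ⊠₁ 𝟙 S) ⊠₁ 𝟙 R ≫ x ⊠₁ 𝟙 R ≫ y :=
  𝟙 _ ⊗≫ as U T S ⊠₁ 𝟙 R ◁ as U (T ⊠ S) R ◁
      ((wL₃ U _ _ _).inv ≫ 𝟙 (𝟙 U) ⊠₂ α ≫ (wL U _ _).hom) ▷ p ⊗≫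
    as U T S ⊠₁ 𝟙 R ◁ (asM U t R).inv ▷ (𝟙 U ⊠₁ v ≫ p) ⊗≫
    as U T S ⊠₁ 𝟙 R ◁ (𝟙 U ⊠₁ t) ⊠₁ 𝟙 R ◁ γ ⊗≫
    ((wR₃ _ _ _ R).inv ≫ ζ ⊠₂ 𝟙 (𝟙 R) ≫ (wR _ _ R).hom) ▷ y ⊗≫ 𝟙 _

/-- The pasting of `ζ`, an interchange isomorphism and `β`. -/
def tetraRight (β : Sq s x y) (ζ : Sq t p x) :
    as U T S ⊠₁ 𝟙 R ≫ as U (T ⊠ S) R ≫ 𝟙 U ⊠₁ as T S R ≫ 𝟙 U ⊠₁ (𝟙 T ⊠₁ s) ≫ 𝟙 U ⊠₁ t ≫ p ⟶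
      (p ⊠₁ 𝟙 S) ⊠₁ 𝟙 R ≫ x ⊠₁ 𝟙 R ≫ y :=
  𝟙 _ ⊗≫ (pent U T S R).hom ▷ (𝟙 U ⊠₁ (𝟙 T ⊠₁ s) ≫ 𝟙 U ⊠₁ t ≫ p) ⊗≫
    as (U ⊠ T) S R ◁ (asR U T s).inv ▷ (𝟙 U ⊠₁ t ≫ p) ⊗≫
    as (U ⊠ T) S R ◁ 𝟙 (U ⊠ T) ⊠₁ s ◁ ζ ⊗≫
    as (U ⊠ T) S R ◁ (inter p s).inv ▷ x ⊗≫
    (asL p S R).inv ▷ (𝟙 U ⊠₁ s ≫ x) ⊗≫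
    (p ⊠₁ 𝟙 S) ⊠₁ 𝟙 R ◁ β ⊗≫ 𝟙 _

/-- The "composing" condition for four squares in a tetrahedral configuration. -/
def Tetra (α : Sq s t v) (β : Sq s x y) (γ : Sq v p y) (ζ : Sq t p x) : Prop :=
  tetraLeft α γ ζ = tetraRight β ζ

end Tetra

/-- Compatibility of a square with cells `s ∘ (1 ⊠ i) ⟹ 1` and `v ∘ (1 ⊠ i) ⟹ 1`. -/
def UnitCompat {R S T : B} {s : S ⊠ R ⟶ S} {t : T ⊠ S ⟶ T} {v : T ⊠ R ⟶ T}
    (i : unitObj B ⟶ R) (s₀ : 𝟙 S ⊠₁ i ≫ s ⟶ ru S) (v₀ : 𝟙 T ⊠₁ i ≫ v ⟶ ru T)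
    (α : Sq s t v) : Prop :=
  (𝟙 _ ⊗≫ as T S (unitObj B) ◁ ((wL T _ _).inv ≫ 𝟙 (𝟙 T) ⊠₂ s₀) ▷ t ⊗≫
      (rightTri T S).hom ▷ t ⊗≫ 𝟙 _ :
    as T S (unitObj B) ≫ 𝟙 T ⊠₁ (𝟙 S ⊠₁ i) ≫ 𝟙 T ⊠₁ s ≫ t ⟶ ru (T ⊠ S) ≫ t) =
  𝟙 _ ⊗≫ (asR T S i).inv ▷ (𝟙 T ⊠₁ s ≫ t) ⊗≫
    𝟙 (T ⊠ S) ⊠₁ i ◁ α ⊗≫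
    (inter t i).inv ▷ v ⊗≫
    t ⊠₁ 𝟙 (unitObj B) ◁ v₀ ⊗≫
    (ruNat t).hom ⊗≫ 𝟙 _

/-- The triangle condition relating an associator square, a right unitor cell of an action `a`,
and a left unitor cell of the multiplication `m`. -/
def Triangle {M A : B} {i : unitObj B ⟶ M} {m : M ⊠ M ⟶ M} {a : A ⊠ M ⟶ A}
    (lam : lu M ⟶ i ⊠₁ 𝟙 M ≫ m) (a₀ : 𝟙 A ⊠₁ i ≫ a ⟶ ru A) (a₂ : Sq m a a) : Prop :=
  (𝟙 _ ⊗≫ (midTri A M).inv ▷ a ⊗≫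
      as A (unitObj B) M ◁ (𝟙 (𝟙 A) ⊠₂ lam ≫ (wL A _ _).hom) ▷ a ⊗≫
      (asM A i M).inv ▷ (𝟙 A ⊠₁ m ≫ a) ⊗≫
      (𝟙 A ⊠₁ i) ⊠₁ 𝟙 M ◁ a₂ ⊗≫
      ((wR _ _ M).inv ≫ a₀ ⊠₂ 𝟙 (𝟙 M)) ▷ a ⊗≫ 𝟙 _ :
    ru A ⊠₁ 𝟙 M ≫ a ⟶ ru A ⊠₁ 𝟙 M ≫ a) = 𝟙 _

end Cells

/-! ## Right skew monoidales and oplax actions -/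

section Skew

variable {B : Type u} [Bicategory.{w, v} B] [MonoidalBicategory B]

open MonoidalStruct

/-- The data of a right skew monoidale on `M` with unit `i`: a product `m`, an associator
`m ∘ (1 ⊠ m) ⟹ m ∘ (m ⊠ 1)`, a left unitor `1 ⟹ m ∘ (i ⊠ 1)` and a right unitor
`m ∘ (1 ⊠ i) ⟹ 1`. -/
@[ext]
structure SkewData {M : B} (i : unitObj B ⟶ M) where
  mul : M ⊠ M ⟶ M
  assoc : Sq mul mul mul
  lam : lu M ⟶ i ⊠₁ 𝟙 M ≫ mul
  rho : 𝟙 M ⊠₁ i ≫ mul ⟶ ru M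

/-- The five axioms of a right skew monoidale. -/
structure SkewData.IsSkewMonoidale {M : B} {i : unitObj B ⟶ M} (D : SkewData i) : Prop where
  pentagon : Tetra D.assoc D.assoc D.assoc D.assoc
  triangle : Triangle D.lam D.rho D.assoc
  lam_assoc :
    (𝟙 _ ⊗≫ (leftTri M M).inv ▷ D.mul ⊗≫
        as (unitObj B) M M ◁ (luNat D.mul).inv ⊗≫
        as (unitObj B) M M ◁ 𝟙 (unitObj B) ⊠₁ D.mul ◁ D.lam ⊗≫
        as (unitObj B) M M ◁ (inter i D.mul).inv ▷ D.mul ⊗≫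
        (asL i M M).inv ▷ (𝟙 M ⊠₁ D.mul ≫ D.mul) ⊗≫
        (i ⊠₁ 𝟙 M) ⊠₁ 𝟙 M ◁ D.assoc ⊗≫ 𝟙 _ :
      lu M ⊠₁ 𝟙 M ≫ D.mul ⟶ (i ⊠₁ 𝟙 M) ⊠₁ 𝟙 M ≫ D.mul ⊠₁ 𝟙 M ≫ D.mul) =
    𝟙 _ ⊗≫ (D.lam ⊠₂ 𝟙 (𝟙 M) ≫ (wR _ _ M).hom) ▷ D.mul ⊗≫ 𝟙 _
  assoc_rho : UnitCompat i D.rho D.rho D.assoc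
  lam_rho :
    (𝟙 _ ⊗≫ (luNat i).inv ⊗≫ 𝟙 (unitObj B) ⊠₁ i ◁ D.lam ⊗≫ (inter i i).inv ▷ D.mul ⊗≫
        i ⊠₁ 𝟙 (unitObj B) ◁ D.rho ⊗≫ (ruNat i).hom ⊗≫ 𝟙 _ :
      lu (unitObj B) ≫ i ⟶ ru (unitObj B) ≫ i) = (luRu B).hom ▷ i

variable (B) in
/-- A right skew monoidale. -/
structure RightSkewMonoidale where
  obj : B
  unit : unitObj B ⟶ obj
  data : SkewData unit
  isSkew : data.IsSkewMonoidale

variable (B) in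
/-- A right skew monoidale whose unit has a right adjoint. -/
structure RightSkewMonoidaleWithRightAdjoint extends RightSkewMonoidale B where
  right : RightAdjoint unit

/-- The data of an oplax action on `A`, with respect to the data of a right skew monoidale on `M`:
an arrow `a`, an associator `a ∘ (1 ⊠ m) ⟹ a ∘ (a ⊠ 1)` and a right unitor `a ∘ (1 ⊠ i) ⟹ 1`. -/
@[ext]
structure ActionData {M : B} {i : unitObj B ⟶ M} (D : SkewData i) (A : B) where
  act : A ⊠ M ⟶ A
  act₂ : Sq D.mul act act
  act₀ : 𝟙 A ⊠₁ i ≫ act ⟶ ru A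

/-- The three axioms of an oplax action. -/
structure ActionData.IsOplaxAction {M : B} {i : unitObj B ⟶ M} {D : SkewData i} {A : B}
    (a : ActionData D A) : Prop where
  assoc : Tetra D.assoc a.act₂ a.act₂ a.act₂
  assoc_unit : UnitCompat i D.rho a.act₀ a.act₂
  triangle : Triangle D.lam a.act₀ a.act₂

/-- An oplax action. -/
structure OplaxAction {M : B} {i : unitObj B ⟶ M} (D : SkewData i) (A : B)
    extends ActionData D A where
  isOplax : toActionData.IsOplaxAction

/-- The regular action of a right skew monoidale on itself. -/
def SkewData.regular {M : B} {i : unitObj B ⟶ M} (D : SkewData i) : ActionData D M where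
  act := D.mul
  act₂ := D.assoc
  act₀ := D.rho

/-- The compatibility of cells `σ`, `τ`, `ν` with squares `α`, `α'`. -/
def SqCompat {R S T : B} {s s' : S ⊠ R ⟶ S} {t t' : T ⊠ S ⟶ T} {v v' : T ⊠ R ⟶ T}
    (α : Sq s t v) (α' : Sq s' t' v') (σ : s ⟶ s') (τ : t ⟶ t') (ν : v ⟶ v') : Prop :=
  as T S R ◁ ((𝟙 (𝟙 T) ⊠₂ σ) ▷ t ≫ 𝟙 T ⊠₁ s' ◁ τ) ≫ α' =
    α ≫ (τ ⊠₂ 𝟙 (𝟙 R)) ▷ v ≫ t' ⊠₁ 𝟙 R ◁ ν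

/-- A cell of oplax actions. -/
@[ext]
structure OplaxAction.Cell {M : B} {i : unitObj B ⟶ M} {D : SkewData i} {A : B}
    (a a' : OplaxAction D A) where
  cell : a.act ⟶ a'.act
  act₂_compat : SqCompat a.act₂ a'.act₂ (𝟙 D.mul) cell cell
  act₀_compat : 𝟙 A ⊠₁ i ◁ cell ≫ a'.act₀ = a.act₀

theorem tHom₂_id {X X' Y Y' : B} (f : X ⟶ X') (g : Y ⟶ Y') :
    𝟙 f ⊠₂ 𝟙 g = 𝟙 (f ⊠₁ g) :=
  TensorStruct.tensor.map₂_id (f ×ₘ g)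

theorem tHom₂_comp {X X' Y Y' : B} {f f' f'' : X ⟶ X'} {g g' g'' : Y ⟶ Y'}
    (η : f ⟶ f') (η' : f' ⟶ f'') (θ : g ⟶ g') (θ' : g' ⟶ g'') :
    (η ≫ η') ⊠₂ (θ ≫ θ') = η ⊠₂ θ ≫ η' ⊠₂ θ' :=
  (TensorStruct.tensor (B := B)).map₂_comp (a := (X, Y)) (b := (X', Y')) (f := f ×ₘ g)
    (g := f' ×ₘ g') (h := f'' ×ₘ g'') (η ×ₘ θ) (η' ×ₘ θ')

theorem SqCompat.id {R S T : B} {s : S ⊠ R ⟶ S} {t : T ⊠ S ⟶ T} {v : T ⊠ R ⟶ T}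
    (α : Sq s t v) : SqCompat α α (𝟙 s) (𝟙 t) (𝟙 v) := by
  simp [SqCompat, tHom₂_id]

theorem SqCompat.comp {R S T : B} {s s' s'' : S ⊠ R ⟶ S} {t t' t'' : T ⊠ S ⟶ T}
    {v v' v'' : T ⊠ R ⟶ T} {α : Sq s t v} {α' : Sq s' t' v'} {α'' : Sq s'' t'' v''}
    {σ : s ⟶ s'} {τ : t ⟶ t'} {ν : v ⟶ v'} {σ' : s' ⟶ s''} {τ' : t' ⟶ t''} {ν' : v' ⟶ v''}
    (h : SqCompat α α' σ τ ν) (h' : SqCompat α' α'' σ' τ' ν') :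
    SqCompat α α'' (σ ≫ σ') (τ ≫ τ') (ν ≫ ν') := by
  unfold SqCompat at *
  have e₁ : 𝟙 (𝟙 T) ⊠₂ (σ ≫ σ') = 𝟙 (𝟙 T) ⊠₂ σ ≫ 𝟙 (𝟙 T) ⊠₂ σ' := by
    rw [← tHom₂_comp, Category.comp_id]
  have e₂ : (τ ≫ τ') ⊠₂ 𝟙 (𝟙 R) = τ ⊠₂ 𝟙 (𝟙 R) ≫ τ' ⊠₂ 𝟙 (𝟙 R) := by
    rw [← tHom₂_comp, Category.comp_id]
  have l : (𝟙 (𝟙 T) ⊠₂ (σ ≫ σ')) ▷ t ≫ 𝟙 T ⊠₁ s'' ◁ (τ ≫ τ') =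
      ((𝟙 (𝟙 T) ⊠₂ σ) ▷ t ≫ 𝟙 T ⊠₁ s' ◁ τ) ≫ (𝟙 (𝟙 T) ⊠₂ σ') ▷ t' ≫ 𝟙 T ⊠₁ s'' ◁ τ' := by
    rw [e₁, comp_whiskerRight, whiskerLeft_comp, Category.assoc, Category.assoc,
      ← whisker_exchange_assoc]
  have r : ((τ ≫ τ') ⊠₂ 𝟙 (𝟙 R)) ▷ v ≫ t'' ⊠₁ 𝟙 R ◁ (ν ≫ ν') =
      ((τ ⊠₂ 𝟙 (𝟙 R)) ▷ v ≫ t' ⊠₁ 𝟙 R ◁ ν) ≫ (τ' ⊠₂ 𝟙 (𝟙 R)) ▷ v' ≫ t'' ⊠₁ 𝟙 R ◁ ν' := by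
    rw [e₂, comp_whiskerRight, whiskerLeft_comp, Category.assoc, Category.assoc,
      ← whisker_exchange_assoc]
  rw [l, r, whiskerLeft_comp, Category.assoc, h', ← Category.assoc, h, Category.assoc]

/-- The category of oplax actions. -/
instance {M : B} {i : unitObj B ⟶ M} (D : SkewData i) (A : B) : Category (OplaxAction D A) where
  Hom a a' := OplaxAction.Cell a a'
  id a := ⟨𝟙 _, SqCompat.id _, by simp⟩
  comp φ ψ := ⟨φ.cell ≫ ψ.cell, by
    simpa using φ.act₂_compat.comp ψ.act₂_compat, by
    rw [whiskerLeft_comp, Category.assoc, ψ.act₀_compat, φ.act₀_compat]⟩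
  id_comp φ := OplaxAction.Cell.ext (Category.id_comp _)
  comp_id φ := OplaxAction.Cell.ext (Category.comp_id _)
  assoc φ ψ χ := OplaxAction.Cell.ext (Category.assoc _ _ _)

end Skew

/-! ## The simplicial object of oplax actions -/

section OplaxAct

variable (B : Type u) [Bicategory.{w, v} B] [MonoidalBicategory B]

/-- A 0-simplex: an object `R` with an adjunction `i ⊣ i*` between the unit object and `R`. -/
structure ZeroSimplex where
  obj : B
  unit : unitObj B ⟶ obj
  right : RightAdjoint unit

variable {B}

namespace ZeroSimplex

open MonoidalStruct

/-- The arrow `i* ⊠ 1 : R ⊠ R ⟶ R`. -/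
abbrev mul (X : ZeroSimplex B) : X.obj ⊠ X.obj ⟶ X.obj := X.right.right ⊠₁ 𝟙 X.obj ≫ lu X.obj

/-- The coherence isomorphism `(i* ⊠ 1) ∘ (1 ⊠ r) ≅ r ∘ ((i* ⊠ 1) ⊠ 1)`. -/
def slide (X : ZeroSimplex B) {R : B} (r : X.obj ⊠ R ⟶ X.obj) : Sq r X.mul r :=
  𝟙 _ ⊗≫ as X.obj X.obj R ◁ (inter X.right.right r).inv ▷ lu X.obj ⊗≫
    as X.obj X.obj R ◁ X.right.right ⊠₁ 𝟙 (X.obj ⊠ R) ◁ (luNat r).hom ⊗≫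
    (asL X.right.right X.obj R).inv ▷ (lu (X.obj ⊠ R) ≫ r) ⊗≫
    (X.right.right ⊠₁ 𝟙 X.obj) ⊠₁ 𝟙 R ◁ (leftTri X.obj R).hom ▷ r ⊗≫
    (wR (X.right.right ⊠₁ 𝟙 X.obj) (lu X.obj) R).inv ▷ r ⊗≫ 𝟙 _

/-- The right skew monoidal structure on `R` induced by the adjunction `i ⊣ i*`, with product
`i* ⊠ 1`, unit `i`, left unitor given by the unit and right unitor given by the counit. -/
def skew (X : ZeroSimplex B) : SkewData X.unit where
  mul := X.mul
  assoc := X.slide X.mul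
  lam := 𝟙 _ ⊗≫ ((tId (unitObj B) X.obj).inv ≫ X.right.adj.unit ⊠₂ 𝟙 (𝟙 X.obj) ≫
    (wR X.unit X.right.right X.obj).hom) ▷ lu X.obj ⊗≫ 𝟙 _
  rho := 𝟙 _ ⊗≫ (inter X.right.right X.unit).inv ▷ lu X.obj ⊗≫
    X.right.right ⊠₁ 𝟙 (unitObj B) ◁ (luNat X.unit).hom ⊗≫
    X.right.right ⊠₁ 𝟙 (unitObj B) ◁ (luRu B).hom ▷ X.unit ⊗≫
    (ruNat X.right.right).hom ▷ X.unit ⊗≫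
    ru X.obj ◁ X.right.adj.counit ⊗≫ 𝟙 _

end ZeroSimplex

/-- The three axioms for a square between oplax actions to be a 2-simplex. -/
structure IsTwoSimplex {R S T : ZeroSimplex B} (s : OplaxAction R.skew S.obj)
    (t : OplaxAction S.skew T.obj) (v : OplaxAction R.skew T.obj)
    (α : Sq s.act t.act v.act) : Prop where
  middle : Tetra (S.slide s.act) α α t.act₂
  right : Tetra s.act₂ v.act₂ α α
  unit : UnitCompat R.unit s.act₀ v.act₀ α

/-- An `n`-simplex with prescribed vertices: compatible 1-, 2- and 3-simplices for all chains of
at most four vertices, whose degenerate members are the degenerate simplices. The 1-simplex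
`s₀ R` is the regular action of `R.skew`, and the 2-simplices `s₀ t` and `s₁ t` are given by
the associator of `t` and by `slide`. A 3-simplex is a tetrahedron of 2-simplices satisfying
`Tetra`, and the simplicial object is 3-coskeletal, so nothing is added above dimension 3. -/
structure Simplex (n : ℕ) (X : Fin (n + 1) → ZeroSimplex B) where
  edge (i j : Fin (n + 1)) (h : i ≤ j) : OplaxAction (X i).skew (X j).obj
  tri (i j k : Fin (n + 1)) (h : i ≤ j) (h' : j ≤ k) :
    Sq (edge i j h).act (edge j k h').act (edge i k (h.trans h')).act
  tri_is (i j k : Fin (n + 1)) (h : i ≤ j) (h' : j ≤ k) :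
    IsTwoSimplex (edge i j h) (edge j k h') (edge i k (h.trans h')) (tri i j k h h')
  tetra (i j k l : Fin (n + 1)) (h : i ≤ j) (h' : j ≤ k) (h'' : k ≤ l) :
    Tetra (tri i j k h h') (tri i j l h (h'.trans h'')) (tri i k l (h.trans h') h'')
      (tri j k l h' h'')
  edge_self (i : Fin (n + 1)) : (edge i i le_rfl).toActionData = (X i).skew.regular
  tri_left (i j : Fin (n + 1)) (h : i ≤ j) : HEq (tri i i j le_rfl h) (edge i j h).act₂
  tri_right (i j : Fin (n + 1)) (h : i ≤ j) :
    HEq (tri i j j h le_rfl) ((X j).slide (edge i j h).act)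

/-- A morphism of `n`-simplices: compatible cells of oplax actions on all edges. -/
@[ext]
structure SimplexHom {n : ℕ} {X : Fin (n + 1) → ZeroSimplex B} (x y : Simplex n X) where
  cell (i j : Fin (n + 1)) (h : i ≤ j) : x.edge i j h ⟶ y.edge i j h
  compat (i j k : Fin (n + 1)) (h : i ≤ j) (h' : j ≤ k) :
    SqCompat (x.tri i j k h h') (y.tri i j k h h') (cell i j h).cell (cell j k h').cell
      (cell i k (h.trans h')).cell
  cell_self (i : Fin (n + 1)) : (cell i i le_rfl).cell =
    eqToHom (congrArg ActionData.act ((x.edge_self i).trans (y.edge_self i).symm))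

/-- The category of `n`-simplices with prescribed vertices. -/
instance (n : ℕ) (X : Fin (n + 1) → ZeroSimplex B) : Category (Simplex n X) where
  Hom x y := SimplexHom x y
  id x := ⟨fun _ _ _ => 𝟙 _, fun _ _ _ _ _ => SqCompat.id _, fun _ => rfl⟩
  comp φ ψ := ⟨fun i j h => φ.cell i j h ≫ ψ.cell i j h,
    fun i j k h h' => (φ.compat i j k h h').comp (ψ.compat i j k h h'), fun i =>
      (congrArg₂ (· ≫ ·) (φ.cell_self i) (ψ.cell_self i)).trans (eqToHom_trans _ _)⟩
  id_comp φ := SimplexHom.ext (by funext i j h; exact Category.id_comp (φ.cell i j h))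
  comp_id φ := SimplexHom.ext (by funext i j h; exact Category.comp_id (φ.cell i j h))
  assoc φ ψ χ := SimplexHom.ext (by
    funext i j h; exact Category.assoc (φ.cell i j h) (ψ.cell i j h) (χ.cell i j h))

/-- Reindexing of simplices along a monotone map. -/
def Simplex.reindex {m n : ℕ} (θ : Fin (m + 1) →o Fin (n + 1))
    (X : Fin (n + 1) → ZeroSimplex B) : Simplex n X ⥤ Simplex m (fun i => X (θ i)) where
  obj x :=
    { edge := fun i j h => x.edge (θ i) (θ j) (θ.monotone h)
      tri := fun i j k h h' => x.tri (θ i) (θ j) (θ k) (θ.monotone h) (θ.monotone h')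
      tri_is := fun i j k h h' => x.tri_is (θ i) (θ j) (θ k) (θ.monotone h) (θ.monotone h')
      tetra := fun i j k l h h' h'' => x.tetra (θ i) (θ j) (θ k) (θ l) (θ.monotone h)
        (θ.monotone h') (θ.monotone h'')
      edge_self := fun i => x.edge_self (θ i)
      tri_left := fun i j h => x.tri_left (θ i) (θ j) (θ.monotone h)
      tri_right := fun i j h => x.tri_right (θ i) (θ j) (θ.monotone h) }
  map φ :=
    { cell := fun i j h => φ.cell (θ i) (θ j) (θ.monotone h)
      compat := fun i j k h h' =>
        φ.compat (θ i) (θ j) (θ k) (θ.monotone h) (θ.monotone h')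
      cell_self := fun i => φ.cell_self (θ i) }

variable (B) in
/-- The category of `n`-simplices: the coproduct over all families of vertices. -/
abbrev SimplexCat (n : ℕ) : Type (max u v w) :=
  Σ X : Fin (n + 1) → ZeroSimplex B, Simplex n X

/-- The functor between categories of simplices induced by a monotone map. -/
def SimplexCat.reindex {m n : ℕ} (θ : Fin (m + 1) →o Fin (n + 1)) :
    SimplexCat B n ⥤ SimplexCat B m :=
  Sigma.desc fun X => Simplex.reindex θ X ⋙ Sigma.incl fun i => X (θ i)

variable (B) in
/-- The simplicial object in `Cat` of oplax actions. -/
def oplaxAct : SimplicialObject Cat.{max u v w, max u v w} where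
  obj n := Cat.of (SimplexCat B n.unop.len)
  map θ := (SimplexCat.reindex θ.unop.toOrderHom).toCatHom
  map_id n := by
    apply Cat.Hom.ext
    refine CategoryTheory.Functor.hext (fun x => rfl) ?_
    rintro _ _ ⟨φ⟩
    rfl
  map_comp θ ψ := by
    apply Cat.Hom.ext
    refine CategoryTheory.Functor.hext (fun x => rfl) ?_
    rintro _ _ ⟨φ⟩
    rfl

/-- The underlying simplicial set of a simplicial object in `Cat`. -/
def underlyingSSet (X : SimplicialObject Cat.{v₁, u₁}) : SSet.{u₁} := X ⋙ Cat.objects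

end OplaxAct

/-! ## The Catalan simplicial set -/

/-- The `n`-simplices of the Catalan simplicial set. An edge is either the degenerate 1-simplex `e`
(`false`) or the nondegenerate 1-simplex `c` (`true`). The 2-simplices are the degenerate
ones `s₀ e = s₁ e`, `s₀ c`, `s₁ c` together with one 2-simplex with edges `(e, e, c)` and one with edges
`(c, c, c)`. Everything else is given by coskeletality. -/
@[ext]
structure CatalanSimplex (n : ℕ) : Type u where
  edge (i j : Fin (n + 1)) (h : i ≤ j) : Bool
  edge_self (i : Fin (n + 1)) : edge i i le_rfl = false
  tri (i j k : Fin (n + 1)) (h : i ≤ j) (h' : j ≤ k) :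
    (edge i j h || edge j k h') ≤ edge i k (h.trans h')

/-- The Catalan simplicial set. -/
def catalan : SSet.{u} where
  obj n := CatalanSimplex.{u} n.unop.len
  map θ := ↾fun x =>
    { edge := fun i j h => x.edge (θ.unop.toOrderHom i) (θ.unop.toOrderHom j)
        (θ.unop.toOrderHom.monotone h)
      edge_self := fun i => x.edge_self (θ.unop.toOrderHom i)
      tri := fun i j k h h' => x.tri (θ.unop.toOrderHom i) (θ.unop.toOrderHom j)
        (θ.unop.toOrderHom k) (θ.unop.toOrderHom.monotone h) (θ.unop.toOrderHom.monotone h') }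

/-- The 2-simplex of the Catalan simplicial set with edges `(c, c, c)`. -/
def catalanMul : CatalanSimplex.{u} 2 where
  edge i j _ := decide (i ≠ j)
  edge_self i := by simp
  tri := by decide

/-- The 2-simplex of the Catalan simplicial set with edges `(e, e, c)`. -/
def catalanUnit : CatalanSimplex.{u} 2 where
  edge i j _ := decide (i = 0 ∧ j = 2)
  edge_self := by decide
  tri := by decide

/-! ## Monads of oplax actions -/

section Monads

variable (B : Type u) [Bicategory.{w, v} B] [MonoidalBicategory B]

/-- A monad of oplax actions: a simplicial map from the Catalan simplicial set to the underlying
simplicial set of the simplicial object of oplax actions. -/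
abbrev MonadOfOplaxActions : Type (max u v w) :=
  catalan.{max u v w} ⟶ underlyingSSet (oplaxAct B)

variable {B}

namespace RightSkewMonoidaleWithRightAdjoint

variable (M : RightSkewMonoidaleWithRightAdjoint B)

/-- The 0-simplex given by the unit and its right adjoint. -/
abbrev zero : ZeroSimplex B := ⟨M.obj, M.unit, M.right⟩

/-- The mate `i* ⊠ 1 ⟹ m` of the left unitor. -/
def mate : M.zero.mul ⟶ M.data.mul :=
  𝟙 _ ⊗≫ M.right.right ⊠₁ 𝟙 M.obj ◁ M.data.lam ⊗≫
    ((wR M.right.right M.unit M.obj).inv ≫ M.right.adj.counit ⊠₂ 𝟙 (𝟙 M.obj) ≫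
      (tId M.obj M.obj).hom) ▷ M.data.mul ⊗≫ 𝟙 _

/-- The oplax action underlying a right skew monoidale whose unit has a right adjoint. -/
def action : ActionData M.zero.skew M.obj where
  act := M.data.mul
  act₂ := as M.obj M.obj M.obj ◁ (𝟙 (𝟙 M.obj) ⊠₂ M.mate) ▷ M.data.mul ≫ M.data.assoc
  act₀ := M.data.rho

/-- The square `m ∘ ((i* ⊠ 1) ⊠ 1) ⟸ (i* ⊠ 1) ∘ (1 ⊠ (i* ⊠ 1))` obtained from the mate of the left
unitor. -/
def unitSq : Sq M.zero.mul M.zero.mul M.data.mul :=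
  M.zero.slide M.zero.mul ≫ M.zero.mul ⊠₁ 𝟙 M.obj ◁ M.mate

end RightSkewMonoidaleWithRightAdjoint

/-- A monad of oplax actions `f` corresponds to a right skew monoidale `M` whose unit has a right
adjoint if all its vertices are the object of `M` with the given adjunction, its nondegenerate
1-simplex is the underlying oplax action of `M`, its multiplication 2-simplex is the associator
of `M`, and its unit 2-simplex is the square obtained from the left unitor of `M`. -/
structure Corresponds (f : MonadOfOplaxActions B) (M : RightSkewMonoidaleWithRightAdjoint B) :
    Prop where
  mul : ∃ x : Simplex 2 (fun _ => M.zero),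
    f.app (Opposite.op (SimplexCategory.mk 2)) catalanMul = (⟨fun _ => M.zero, x⟩ : SimplexCat B 2) ∧
      (x.edge 0 1 (by decide)).toActionData = M.action ∧
      (x.edge 1 2 (by decide)).toActionData = M.action ∧
      (x.edge 0 2 (by decide)).toActionData = M.action ∧
      HEq (x.tri 0 1 2 (by decide) (by decide)) M.data.assoc
  unit : ∃ x : Simplex 2 (fun _ => M.zero),
    f.app (Opposite.op (SimplexCategory.mk 2)) catalanUnit = (⟨fun _ => M.zero, x⟩ : SimplexCat B 2) ∧
      (x.edge 0 2 (by decide)).toActionData = M.action ∧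
      HEq (x.tri 0 1 2 (by decide) (by decide)) M.unitSq

end Monads

end MonBicat

/-! A simplicial map out of the Catalan simplicial set is known once its values in low dimensions
are known: a vertex `(R, i ⊣ i*)`, an action `m` with associator `a₂` and right unitor `ρ`, and two
squares `θ` (the value at `(e, e, c)`) and `α` (the value at `(c, c, c)`). All other 2-simplices are
degenerate. The conditions on these cells are the axioms of the action, the axioms of the two
squares, and one tetrahedron equation for each 3-simplex; those that do not hold automatically are
listed in `MonadLaws`. The theorem therefore compares solutions of `MonadLaws` with left unitors `λ`
making `(i, m, α, λ, ρ)` a right skew monoidale.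

From a skew monoidale, pass to the mate `κ : i*1 ⇒ m` of `λ` under the adjunction `i ⊠ R ⊣ i* ⊠ R`.
By `lam_assoc_iff_mate` and `lam_rho_iff_mate`, the two axioms that begin with `λ` alone say that
`κ` carries the coherence square `slideOf` to `α`, and the right unitor induced by the counit to
`ρ`. Put `θ` equal to the coherence square followed by `κ`, and `a₂` equal to `1κ` followed by `α`.
Each tetrahedron law then arises from the pentagon for `α`, or from the coherence tetrahedron
`tetra_slideOf`, by replacing edges `i*1` with `m` along `κ` (`monadLaws_of_skew`).

Conversely, `κ` is read off from `θ` by filling in the unit: precompose with the induced left unitor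
and postcompose with the induced right unitor. The principle `Tetra.eq_of_triangleMap` says what a
tetrahedron equation becomes when the unit is filled in; applied to two of the laws it forces `θ`
and `a₂` to have the form above (`MonadLaws.exists_mate`). The two mate equations are then obtained
only after whiskering with `i*1`. This is enough: whiskering with `i*1` detects whatever whiskering
with `i` detects (`whiskerLeft_eq_of_adjunction`), and in the axioms for `λ` the cells in question
occur whiskered with `i`. The same cancellation recovers `λ` from `θ`, which gives injectivity.

Because no strictness is assumed, much of the work is coherence. Pastings are put into a normal form
in which 1-cells are right-associated composites and associators are invisible. The axioms also have
to be completed by derived coherence laws: `pent_leftTri`, `pent_rightTri`, `leftTri_rightTri`, and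
`unitTri_eq`, which compares the two unit constraints of the unit object. These give the properties
of the coherence square and of the induced unitors. -/

namespace MonBicat

set_option linter.unusedSectionVars false

/-! ### Pseudofunctoriality of the tensor product and pseudonaturality of its constraints -/

section TensorLaws

variable {B : Type u} [Bicategory.{w, v} B] [MonoidalBicategory B]

theorem tHom₂_whiskerLeft {X X' X'' Y Y' Y'' : B} (f : X ⟶ X') (g : Y ⟶ Y') {h h' : X' ⟶ X''}
    {k k' : Y' ⟶ Y''} (η : h ⟶ h') (θ : k ⟶ k') :
    (f ◁ η) ⊠₂ (g ◁ θ) = (tComp f h g k).hom ≫ f ⊠₁ g ◁ η ⊠₂ θ ≫ (tComp f h' g k').inv :=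
  (TensorStruct.tensor (B := B)).map₂_whisker_left (a := (X, Y)) (b := (X', Y')) (c := (X'', Y''))
    (f ×ₘ g) (g := h ×ₘ k) (h := h' ×ₘ k') (η ×ₘ θ)

theorem tHom₂_whiskerRight {X X' X'' Y Y' Y'' : B} {f f' : X ⟶ X'} {g g' : Y ⟶ Y'} (η : f ⟶ f')
    (θ : g ⟶ g') (h : X' ⟶ X'') (k : Y' ⟶ Y'') :
    (η ▷ h) ⊠₂ (θ ▷ k) = (tComp f h g k).hom ≫ η ⊠₂ θ ▷ h ⊠₁ k ≫ (tComp f' h g' k).inv :=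
  (TensorStruct.tensor (B := B)).map₂_whisker_right (a := (X, Y)) (b := (X', Y')) (c := (X'', Y''))
    (f := f ×ₘ g) (g := f' ×ₘ g') (η ×ₘ θ) (h ×ₘ k)

theorem tHom₂_associator {X X' X'' X''' Y Y' Y'' Y''' : B} (f : X ⟶ X') (f' : X' ⟶ X'')
    (f'' : X'' ⟶ X''') (g : Y ⟶ Y') (g' : Y' ⟶ Y'') (g'' : Y'' ⟶ Y''') :
    (α_ f f' f'').hom ⊠₂ (α_ g g' g'').hom = (tComp (f ≫ f') f'' (g ≫ g') g'').hom ≫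
      (tComp f f' g g').hom ▷ f'' ⊠₁ g'' ≫ (α_ _ _ _).hom ≫
      f ⊠₁ g ◁ (tComp f' f'' g' g'').inv ≫ (tComp f (f' ≫ f'') g (g' ≫ g'')).inv :=
  (TensorStruct.tensor (B := B)).map₂_associator (a := (X, Y)) (b := (X', Y')) (c := (X'', Y''))
    (d := (X''', Y''')) (f ×ₘ g) (f' ×ₘ g') (f'' ×ₘ g'')

theorem tHom₂_leftUnitor {X X' Y Y' : B} (f : X ⟶ X') (g : Y ⟶ Y') :
    (λ_ f).hom ⊠₂ (λ_ g).hom =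
      (tComp (𝟙 X) f (𝟙 Y) g).hom ≫ (tId X Y).hom ▷ f ⊠₁ g ≫ (λ_ _).hom :=
  (TensorStruct.tensor (B := B)).map₂_left_unitor (a := (X, Y)) (b := (X', Y')) (f ×ₘ g)

theorem tHom₂_rightUnitor {X X' Y Y' : B} (f : X ⟶ X') (g : Y ⟶ Y') :
    (ρ_ f).hom ⊠₂ (ρ_ g).hom =
      (tComp f (𝟙 X') g (𝟙 Y')).hom ≫ f ⊠₁ g ◁ (tId X' Y').hom ≫ (ρ_ _).hom :=
  (TensorStruct.tensor (B := B)).map₂_right_unitor (a := (X, Y)) (b := (X', Y')) (f ×ₘ g)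

theorem tComp_naturality_left {X X' X'' Y Y' Y'' : B} {f f' : X ⟶ X'} {g g' : Y ⟶ Y'}
    (η : f ⟶ f') (θ : g ⟶ g') (h : X' ⟶ X'') (k : Y' ⟶ Y'') :
    (η ▷ h) ⊠₂ (θ ▷ k) ≫ (tComp f' h g' k).hom = (tComp f h g k).hom ≫ η ⊠₂ θ ▷ h ⊠₁ k := by
  simp [tHom₂_whiskerRight]

theorem tComp_naturality_right {X X' X'' Y Y' Y'' : B} (f : X ⟶ X') (g : Y ⟶ Y')
    {h h' : X' ⟶ X''} {k k' : Y' ⟶ Y''} (η : h ⟶ h') (θ : k ⟶ k') :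
    (f ◁ η) ⊠₂ (g ◁ θ) ≫ (tComp f h' g k').hom = (tComp f h g k).hom ≫ f ⊠₁ g ◁ η ⊠₂ θ := by
  simp [tHom₂_whiskerLeft]

@[simp] theorem tIso_hom {X X' Y Y' : B} {f f' : X ⟶ X'} {g g' : Y ⟶ Y'} (η : f ≅ f')
    (θ : g ≅ g') : (tIso η θ).hom = η.hom ⊠₂ θ.hom := rfl

@[simp] theorem tIso_inv {X X' Y Y' : B} {f f' : X ⟶ X'} {g g' : Y ⟶ Y'} (η : f ≅ f')
    (θ : g ≅ g') : (tIso η θ).inv = η.inv ⊠₂ θ.inv := rfl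

theorem asNat_naturality {X X' Y Y' Z Z' : B} {f f' : X ⟶ X'} {g g' : Y ⟶ Y'} {h h' : Z ⟶ Z'}
    (η : f ⟶ f') (θ : g ⟶ g') (ζ : h ⟶ h') :
    (η ⊠₂ θ) ⊠₂ ζ ▷ as X' Y' Z' ≫ (asNat f' g' h').hom =
      (asNat f g h).hom ≫ as X Y Z ◁ η ⊠₂ (θ ⊠₂ ζ) :=
  (TensorStruct.assoc (B := B)).hom.naturality_naturality (a := (X, Y, Z)) (b := (X', Y', Z'))
    (f := f ×ₘ g ×ₘ h) (g := f' ×ₘ g' ×ₘ h') (η ×ₘ θ ×ₘ ζ)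

theorem fst₃_mapId (X Y Z : B) : ((fst₃ (B := B)).mapId (X, Y, Z)).hom = 𝟙 (𝟙 X) := rfl

theorem snd₃_mapId (X Y Z : B) : ((snd₃ (B := B)).mapId (X, Y, Z)).hom = 𝟙 (𝟙 Y) :=
  Category.comp_id (𝟙 (𝟙 Y))

theorem thd₃_mapId (X Y Z : B) : ((thd₃ (B := B)).mapId (X, Y, Z)).hom = 𝟙 (𝟙 Z) :=
  Category.comp_id (𝟙 (𝟙 Z))

theorem asNat_id (X Y Z : B) :
    (asNat (𝟙 X) (𝟙 Y) (𝟙 Z)).hom ≫ as X Y Z ◁ (𝟙 (𝟙 X) ⊠₂ (tId Y Z).hom ≫ (tId _ _).hom) =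
      ((tId X Y).hom ⊠₂ 𝟙 (𝟙 Z) ≫ (tId _ _).hom) ▷ as X Y Z ≫ (λ_ _).hom ≫ (ρ_ _).inv := by
  have := (TensorStruct.assoc (B := B)).hom.naturality_id (X, Y, Z)
  -- The unit comparison of the composite pseudofunctor contains identity cells contributed by the
  -- projections; they are absorbed here and in `e2`.
  have e1 : ((tensorRight₃ (TensorStruct.tensor (B := B))).mapId (X, Y, Z)).hom =
      𝟙 (𝟙 X) ⊠₂ (tId Y Z).hom ≫ (tId _ _).hom := by
    change ((fst₃ (B := B)).mapId (X, Y, Z)).hom ⊠₂ (((snd₃ (B := B)).mapId (X, Y, Z)).hom ⊠₂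
      ((thd₃ (B := B)).mapId (X, Y, Z)).hom ≫ (tId Y Z).hom) ≫ (tId _ _).hom = _
    rw [fst₃_mapId, snd₃_mapId, thd₃_mapId]
    change 𝟙 (𝟙 X) ⊠₂ (𝟙 (𝟙 Y) ⊠₂ 𝟙 (𝟙 Z) ≫ (tId Y Z).hom) ≫ (tId X (Y ⊠ Z)).hom = _
    rw [tHom₂_id, Category.id_comp]
  have e2 : ((tensorLeft₃ (TensorStruct.tensor (B := B))).mapId (X, Y, Z)).hom =
      (tId X Y).hom ⊠₂ 𝟙 (𝟙 Z) ≫ (tId _ _).hom := by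
    change (((fst₃ (B := B)).mapId (X, Y, Z)).hom ⊠₂ ((snd₃ (B := B)).mapId (X, Y, Z)).hom ≫
      (tId X Y).hom) ⊠₂ ((thd₃ (B := B)).mapId (X, Y, Z)).hom ≫ (tId _ _).hom = _
    rw [fst₃_mapId, snd₃_mapId, thd₃_mapId]
    change (𝟙 (𝟙 X) ⊠₂ 𝟙 (𝟙 Y) ≫ (tId X Y).hom) ⊠₂ 𝟙 (𝟙 Z) ≫ (tId (X ⊠ Y) Z).hom = _
    rw [tHom₂_id, Category.id_comp]
  rw [e1, e2] at this
  exact this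

section

variable {X X' X'' Y Y' Y'' Z Z' Z'' : B} (f : X ⟶ X') (f' : X' ⟶ X'') (g : Y ⟶ Y')
  (g' : Y' ⟶ Y'') (h : Z ⟶ Z') (h' : Z' ⟶ Z'')

theorem fst₃_mapComp : ((fst₃ (B := B)).mapComp (a := (X, Y, Z)) (b := (X', Y', Z'))
    (c := (X'', Y'', Z'')) (f ×ₘ g ×ₘ h) (f' ×ₘ g' ×ₘ h')).hom = 𝟙 (f ≫ f') := rfl

theorem snd₃_mapComp : ((snd₃ (B := B)).mapComp (a := (X, Y, Z)) (b := (X', Y', Z'))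
    (c := (X'', Y'', Z'')) (f ×ₘ g ×ₘ h) (f' ×ₘ g' ×ₘ h')).hom = 𝟙 (g ≫ g') :=
  Category.comp_id (𝟙 (g ≫ g'))

theorem thd₃_mapComp : ((thd₃ (B := B)).mapComp (a := (X, Y, Z)) (b := (X', Y', Z'))
    (c := (X'', Y'', Z'')) (f ×ₘ g ×ₘ h) (f' ×ₘ g' ×ₘ h')).hom = 𝟙 (h ≫ h') :=
  Category.comp_id (𝟙 (h ≫ h'))

theorem asNat_comp :
    (asNat (f ≫ f') (g ≫ g') (h ≫ h')).hom ≫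
        as X Y Z ◁ (𝟙 (f ≫ f') ⊠₂ (tComp g g' h h').hom ≫ (tComp _ _ _ _).hom) =
      ((tComp f f' g g').hom ⊠₂ 𝟙 (h ≫ h') ≫ (tComp _ _ _ _).hom) ▷ as X'' Y'' Z'' ≫
        (α_ _ _ _).hom ≫ (f ⊠₁ g) ⊠₁ h ◁ (asNat f' g' h').hom ≫ (α_ _ _ _).inv ≫
          (asNat f g h).hom ▷ f' ⊠₁ (g' ⊠₁ h') ≫ (α_ _ _ _).hom := by
  have := (TensorStruct.assoc (B := B)).hom.naturality_comp (a := (X, Y, Z)) (b := (X', Y', Z'))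
    (c := (X'', Y'', Z'')) (f ×ₘ g ×ₘ h) (f' ×ₘ g' ×ₘ h')
  have e1 : ((tensorRight₃ (TensorStruct.tensor (B := B))).mapComp (a := (X, Y, Z))
      (b := (X', Y', Z')) (c := (X'', Y'', Z'')) (f ×ₘ g ×ₘ h) (f' ×ₘ g' ×ₘ h')).hom =
      𝟙 (f ≫ f') ⊠₂ (tComp g g' h h').hom ≫ (tComp _ _ _ _).hom := by
    change ((fst₃ (B := B)).mapComp (a := (X, Y, Z)) (b := (X', Y', Z')) (c := (X'', Y'', Z''))
        (f ×ₘ g ×ₘ h) (f' ×ₘ g' ×ₘ h')).hom ⊠₂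
      (((snd₃ (B := B)).mapComp (a := (X, Y, Z)) (b := (X', Y', Z')) (c := (X'', Y'', Z''))
          (f ×ₘ g ×ₘ h) (f' ×ₘ g' ×ₘ h')).hom ⊠₂
        ((thd₃ (B := B)).mapComp (a := (X, Y, Z)) (b := (X', Y', Z')) (c := (X'', Y'', Z''))
          (f ×ₘ g ×ₘ h) (f' ×ₘ g' ×ₘ h')).hom ≫ (tComp g g' h h').hom) ≫ (tComp _ _ _ _).hom = _
    rw [fst₃_mapComp, snd₃_mapComp, thd₃_mapComp]
    change 𝟙 (f ≫ f') ⊠₂ (𝟙 (g ≫ g') ⊠₂ 𝟙 (h ≫ h') ≫ (tComp g g' h h').hom) ≫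
      (tComp f f' (g ⊠₁ h) (g' ⊠₁ h')).hom = _
    rw [tHom₂_id, Category.id_comp]
  have e2 : ((tensorLeft₃ (TensorStruct.tensor (B := B))).mapComp (a := (X, Y, Z))
      (b := (X', Y', Z')) (c := (X'', Y'', Z'')) (f ×ₘ g ×ₘ h) (f' ×ₘ g' ×ₘ h')).hom =
      (tComp f f' g g').hom ⊠₂ 𝟙 (h ≫ h') ≫ (tComp _ _ _ _).hom := by
    change (((fst₃ (B := B)).mapComp (a := (X, Y, Z)) (b := (X', Y', Z')) (c := (X'', Y'', Z''))
        (f ×ₘ g ×ₘ h) (f' ×ₘ g' ×ₘ h')).hom ⊠₂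
      ((snd₃ (B := B)).mapComp (a := (X, Y, Z)) (b := (X', Y', Z')) (c := (X'', Y'', Z''))
          (f ×ₘ g ×ₘ h) (f' ×ₘ g' ×ₘ h')).hom ≫ (tComp f f' g g').hom) ⊠₂
        ((thd₃ (B := B)).mapComp (a := (X, Y, Z)) (b := (X', Y', Z')) (c := (X'', Y'', Z''))
          (f ×ₘ g ×ₘ h) (f' ×ₘ g' ×ₘ h')).hom ≫ (tComp _ _ _ _).hom = _
    rw [fst₃_mapComp, snd₃_mapComp, thd₃_mapComp]
    change (𝟙 (f ≫ f') ⊠₂ 𝟙 (g ≫ g') ≫ (tComp f f' g g').hom) ⊠₂ 𝟙 (h ≫ h') ≫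
      (tComp (f ⊠₁ g) (f' ⊠₁ g') h h').hom = _
    rw [tHom₂_id, Category.id_comp]
  rw [e1, e2] at this
  exact this

end

theorem luNat_naturality {X X' : B} {f f' : X ⟶ X'} (η : f ⟶ f') :
    𝟙 (𝟙 (unitObj B)) ⊠₂ η ▷ lu X' ≫ (luNat f').hom = (luNat f).hom ≫ lu X ◁ η :=
  (TensorStruct.leftUnit (B := B)).hom.naturality_naturality η

theorem ruNat_naturality {X X' : B} {f f' : X ⟶ X'} (η : f ⟶ f') :
    η ⊠₂ 𝟙 (𝟙 (unitObj B)) ▷ ru X' ≫ (ruNat f').hom = (ruNat f).hom ≫ ru X ◁ η :=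
  (TensorStruct.rightUnit (B := B)).hom.naturality_naturality η

theorem luNat_id (X : B) :
    (luNat (𝟙 X)).hom = (tId (unitObj B) X).hom ▷ lu X ≫ (λ_ _).hom ≫ (ρ_ _).inv := by
  have e : (((Bicategory.Prod.sectR (unitObj B) B).toPseudofunctor.comp
      TensorStruct.tensor).mapId X).hom = (tId (unitObj B) X).hom := by
    change 𝟙 (𝟙 _) ⊠₂ 𝟙 (𝟙 X) ≫ (tId (unitObj B) X).hom = _
    rw [tHom₂_id, Category.id_comp]
  have h : (luNat (𝟙 X)).hom ≫ lu X ◁ 𝟙 (𝟙 X) = (((Bicategory.Prod.sectR (unitObj B)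
      B).toPseudofunctor.comp TensorStruct.tensor).mapId X).hom ▷ lu X ≫ (λ_ _).hom ≫ (ρ_ _).inv :=
    (TensorStruct.leftUnit (B := B)).hom.naturality_id X
  rw [e, whiskerLeft_id, Category.comp_id] at h
  exact h

theorem ruNat_id (X : B) :
    (ruNat (𝟙 X)).hom = (tId X (unitObj B)).hom ▷ ru X ≫ (λ_ _).hom ≫ (ρ_ _).inv := by
  have e : (((Bicategory.Prod.sectL B (unitObj B)).toPseudofunctor.comp
      TensorStruct.tensor).mapId X).hom = (tId X (unitObj B)).hom := by
    change 𝟙 (𝟙 _) ⊠₂ 𝟙 (𝟙 _) ≫ (tId X (unitObj B)).hom = _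
    rw [tHom₂_id, Category.id_comp]
  have h : (ruNat (𝟙 X)).hom ≫ ru X ◁ 𝟙 (𝟙 X) = (((Bicategory.Prod.sectL B
      (unitObj B)).toPseudofunctor.comp TensorStruct.tensor).mapId X).hom ▷ ru X ≫
        (λ_ _).hom ≫ (ρ_ _).inv :=
    (TensorStruct.rightUnit (B := B)).hom.naturality_id X
  rw [e, whiskerLeft_id, Category.comp_id] at h
  exact h

theorem luNat_comp {X X' X'' : B} (f : X ⟶ X') (g : X' ⟶ X'') :
    (luNat (f ≫ g)).hom = (wL _ f g).hom ▷ lu X'' ≫ (α_ _ _ _).hom ≫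
      𝟙 (unitObj B) ⊠₁ f ◁ (luNat g).hom ≫ (α_ _ _ _).inv ≫ (luNat f).hom ▷ g ≫
        (α_ _ _ _).hom := by
  -- The section functor splits the identity by a right unitor and `wL` splits it by a left unitor;
  -- the two unitors agree on an identity 1-cell.
  have e : (((Bicategory.Prod.sectR (unitObj B) B).toPseudofunctor.comp
      TensorStruct.tensor).mapComp f g).hom = (wL (unitObj B) f g).hom := by
    change (ρ_ (𝟙 _)).inv ⊠₂ 𝟙 (f ≫ g) ≫ (tComp _ _ f g).hom =
      (λ_ (𝟙 _)).inv ⊠₂ 𝟙 (f ≫ g) ≫ (tComp _ _ f g).hom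
    rw [unitors_inv_equal]
  have h : (luNat (f ≫ g)).hom ≫ lu X ◁ 𝟙 (f ≫ g) = (((Bicategory.Prod.sectR (unitObj B)
      B).toPseudofunctor.comp TensorStruct.tensor).mapComp f g).hom ▷ lu X'' ≫ (α_ _ _ _).hom ≫
      𝟙 (unitObj B) ⊠₁ f ◁ (luNat g).hom ≫ (α_ _ _ _).inv ≫ (luNat f).hom ▷ g ≫
        (α_ _ _ _).hom :=
    (TensorStruct.leftUnit (B := B)).hom.naturality_comp f g
  rw [e, whiskerLeft_id, Category.comp_id] at h
  exact h

theorem ruNat_comp {X X' X'' : B} (f : X ⟶ X') (g : X' ⟶ X'') :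
    (ruNat (f ≫ g)).hom = (wR f g _).hom ▷ ru X'' ≫ (α_ _ _ _).hom ≫
      f ⊠₁ 𝟙 (unitObj B) ◁ (ruNat g).hom ≫ (α_ _ _ _).inv ≫ (ruNat f).hom ▷ g ≫
        (α_ _ _ _).hom := by
  have h : (ruNat (f ≫ g)).hom ≫ ru X ◁ 𝟙 (f ≫ g) = (wR f g _).hom ▷ ru X'' ≫ (α_ _ _ _).hom ≫
      f ⊠₁ 𝟙 (unitObj B) ◁ (ruNat g).hom ≫ (α_ _ _ _).inv ≫ (ruNat f).hom ▷ g ≫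
        (α_ _ _ _).hom :=
    (TensorStruct.rightUnit (B := B)).hom.naturality_comp f g
  rw [whiskerLeft_id, Category.comp_id] at h
  exact h

end TensorLaws

/-! ### Whiskering between right-associated composites -/

section Gluing

variable {B : Type u} [Bicategory.{w, v} B]

/-- The right-associated composite `fk` of a right-associated composite `f` and a 1-cell `k`. -/
class Glue {X Y Z : B} (f : X ⟶ Y) (k : Y ⟶ Z) (fk : outParam (X ⟶ Z)) where
  iso : f ≫ k ≅ fk

instance (priority := low) Glue.base {X Y Z : B} (f : X ⟶ Y) (k : Y ⟶ Z) : Glue f k (f ≫ k) :=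
  ⟨Iso.refl _⟩

instance Glue.comp {X Y Z W : B} (f : X ⟶ Y) (g : Y ⟶ Z) (k : Z ⟶ W) (gk : Y ⟶ W)
    [Glue g k gk] : Glue (f ≫ g) k (f ≫ gk) :=
  ⟨α_ f g k ≪≫ whiskerLeftIso f Glue.iso⟩

/-- Right whiskering of a 2-cell between right-associated composites. -/
def cellAt {X Y Z : B} {f g : X ⟶ Y} (c : f ⟶ g) (k : Y ⟶ Z) {fk gk : X ⟶ Z} [Glue f k fk]
    [Glue g k gk] : fk ⟶ gk :=
  (Glue.iso (f := f) (k := k)).inv ≫ c ▷ k ≫ (Glue.iso (f := g) (k := k)).hom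

infixl:82 " ⊳ " => cellAt

/-- Left whiskering of a 2-cell with a right-associated composite. -/
def preW {X Y Z : B} (f : X ⟶ Y) {k k' : Y ⟶ Z} (ξ : k ⟶ k') {fk fk' : X ⟶ Z} [Glue f k fk]
    [Glue f k' fk'] : fk ⟶ fk' :=
  (Glue.iso (f := f) (k := k)).inv ≫ f ◁ ξ ≫ (Glue.iso (f := f) (k := k')).hom

section

variable {X Y Z W : B} {f g h : X ⟶ Y} {k k' : Y ⟶ Z}

@[simp] theorem preW_base (f : X ⟶ Y) (ξ : k ⟶ k') : preW f ξ = f ◁ ξ := by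
  simp [preW, Glue.iso]

@[simp] theorem preW_comp (f : X ⟶ Y) (e : Y ⟶ Z) {k k' : Z ⟶ W} (ξ : k ⟶ k') {ek ek' : Y ⟶ W}
    [Glue e k ek] [Glue e k' ek'] : preW (f ≫ e) ξ = f ◁ preW e ξ := by
  simp [preW, Glue.iso]

theorem cellAt_base {f g : X ⟶ Y} (c : f ⟶ g) (k : Y ⟶ Z) : c ⊳ k = c ▷ k := by
  simp [cellAt, Glue.iso]

@[simp] theorem cellAt_id (f : X ⟶ Y) (k : Y ⟶ Z) {fk : X ⟶ Z} [Glue f k fk] :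
    𝟙 f ⊳ k = 𝟙 fk := by
  simp [cellAt]

theorem cellAt_comp (c : f ⟶ g) (d : g ⟶ h) (k : Y ⟶ Z) {fk gk hk : X ⟶ Z} [Glue f k fk]
    [Glue g k gk] [Glue h k hk] : (c ≫ d) ⊳ k = c ⊳ k ≫ d ⊳ k := by
  simp [cellAt]

theorem cellAt_whiskerLeft (e : W ⟶ X) (c : f ⟶ g) (k : Y ⟶ Z) {fk gk : X ⟶ Z} [Glue f k fk]
    [Glue g k gk] : (e ◁ c) ⊳ k = e ◁ c ⊳ k := by
  simp [cellAt, Glue.iso]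

@[simp]
theorem cellAt_hom_inv (c : f ≅ g) (k : Y ⟶ Z) {fk gk : X ⟶ Z} [Glue f k fk] [Glue g k gk] :
    c.hom ⊳ k ≫ c.inv ⊳ k = 𝟙 fk := by
  rw [← cellAt_comp, Iso.hom_inv_id, cellAt_id]

@[simp]
theorem cellAt_hom_inv_assoc (c : f ≅ g) (k : Y ⟶ Z) {fk gk l : X ⟶ Z} [Glue f k fk] [Glue g k gk]
    (d : fk ⟶ l) : c.hom ⊳ k ≫ c.inv ⊳ k ≫ d = d := by
  rw [← Category.assoc, cellAt_hom_inv, Category.id_comp]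

/-- Interchange for two cells acting on disjoint stretches of a composite. In normal form this is
the rule by which independent cells of a pasting are reordered. -/
theorem cellAt_exchange (c : f ⟶ g) (ξ : k ⟶ k') {fk gk fk' gk' : X ⟶ Z} [Glue f k fk]
    [Glue g k gk] [Glue f k' fk'] [Glue g k' gk'] :
    c ⊳ k ≫ preW g ξ = preW f ξ ≫ c ⊳ k' := by
  simp [cellAt, preW, whisker_exchange_assoc]

end

/-- Associativity of gluing. -/
class GlueAssoc {X Y Z W : B} (f : X ⟶ Y) (k : Y ⟶ Z) (l : Z ⟶ W) {fk : X ⟶ Z} {fkl : X ⟶ W}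
    {kl : Y ⟶ W} [Glue f k fk] [Glue fk l fkl] [Glue k l kl] [Glue f kl fkl] : Prop where
  eq : (Glue.iso (f := f) (k := k)).hom ▷ l ≫ (Glue.iso (f := fk) (k := l)).hom =
    (α_ f k l).hom ≫ f ◁ (Glue.iso (f := k) (k := l)).hom ≫ (Glue.iso (f := f) (k := kl)).hom

instance (priority := low) GlueAssoc.base {X Y Z W : B} (f : X ⟶ Y) (k : Y ⟶ Z) (l : Z ⟶ W)
    {kl : Y ⟶ W} [Glue k l kl] : GlueAssoc f k l :=
  ⟨by simp [Glue.iso]⟩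

instance GlueAssoc.comp {V X Y Z W : B} (e : V ⟶ X) (f : X ⟶ Y) (k : Y ⟶ Z) (l : Z ⟶ W)
    {fk : X ⟶ Z} {fkl : X ⟶ W} {kl : Y ⟶ W} [Glue f k fk] [Glue fk l fkl] [Glue k l kl]
    [Glue f kl fkl] [GlueAssoc f k l] : GlueAssoc (e ≫ f) k l :=
  ⟨by
    have := GlueAssoc.eq (f := f) (k := k) (l := l) (fk := fk) (fkl := fkl) (kl := kl)
    simp only [Glue.iso, Iso.trans_hom, whiskerLeftIso_hom, comp_whiskerRight, Category.assoc,
      whisker_assoc, Iso.inv_hom_id_assoc, ← whiskerLeft_comp, this]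
    simp⟩

/-- Whiskering in two steps and in one step differ by an associator, and `GlueAssoc` says that the
chosen gluings absorb it. This is what lets nested whiskerings collapse without leaving associators
behind. -/
theorem cellAt_cellAt {X Y Z W : B} {f g : X ⟶ Y} (c : f ⟶ g) (k : Y ⟶ Z) (l : Z ⟶ W)
    {fk gk : X ⟶ Z} {fkl gkl : X ⟶ W} {kl : Y ⟶ W} [Glue f k fk] [Glue fk l fkl] [Glue k l kl]
    [Glue f kl fkl] [Glue g k gk] [Glue gk l gkl] [Glue g kl gkl] [GlueAssoc f k l]
    [GlueAssoc g k l] : (c ⊳ k) ⊳ l = c ⊳ kl := by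
  have h1 := GlueAssoc.eq (f := f) (k := k) (l := l) (fk := fk) (fkl := fkl) (kl := kl)
  have h2 := GlueAssoc.eq (f := g) (k := k) (l := l) (fk := gk) (fkl := gkl) (kl := kl)
  simp only [cellAt, Iso.inv_comp_eq]
  rw [comp_whiskerRight, comp_whiskerRight, Category.assoc, Category.assoc, h2]
  have h3 : (Glue.iso (f := fk) (k := l)).hom ≫ (Glue.iso (f := f) (k := kl)).inv =
      (Glue.iso (f := f) (k := k)).inv ▷ l ≫ (α_ f k l).hom ≫
        f ◁ (Glue.iso (f := k) (k := l)).hom := by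
    rw [Iso.comp_inv_eq, Category.assoc, Category.assoc, ← h1, ← comp_whiskerRight_assoc]
    simp
  rw [reassoc_of% h3, whisker_exchange_assoc]
  simp

theorem cellAt_whiskerRight {X Y Z W : B} {f g : X ⟶ Y} (c : f ⟶ g) (k : Y ⟶ Z) (l : Z ⟶ W) {kl : Y ⟶ W}
    [Glue k l kl] : (c ▷ k) ⊳ l = c ▷ kl := by
  rw [← cellAt_base, cellAt_cellAt, cellAt_base]

section

variable {X Y Z W V U : B}

theorem exch₁₁ {f g : X ⟶ Y} (c : f ⟶ g) {k k' : Y ⟶ W} (ξ : k ⟶ k') :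
    c ▷ k ≫ g ◁ ξ = f ◁ ξ ≫ c ▷ k' := (whisker_exchange c ξ).symm

theorem exch₂₂ {f₁ : X ⟶ V} {f₂ : V ⟶ Y} {g₁ : X ⟶ Z} {g₂ : Z ⟶ Y} (c : f₁ ≫ f₂ ⟶ g₁ ≫ g₂)
    {k k' : Y ⟶ W} (ξ : k ⟶ k') : c ⊳ k ≫ g₁ ◁ g₂ ◁ ξ = f₁ ◁ f₂ ◁ ξ ≫ c ⊳ k' := by
  simpa using cellAt_exchange c ξ

end

end Gluing

/-! ### Tensoring right-associated composites with an object -/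

section Tensoring

variable {B : Type u} [Bicategory.{w, v} B] [MonoidalBicategory B]

notation:86 X:87 " ◃ " f:86 => tHom (𝟙 X) f
notation:86 f:86 " ▹ " X:87 => tHom f (𝟙 X)

section

variable {X Y Z W : B}

theorem wR_whiskerLeft (f : X ⟶ Y) {g g' : Y ⟶ Z} (η : g ⟶ g') :
    (f ◁ η) ⊠₂ 𝟙 (𝟙 W) = (wR f g W).hom ≫ f ▹ W ◁ η ⊠₂ 𝟙 (𝟙 W) ≫ (wR f g' W).inv :=
  ((Bicategory.Prod.sectL B W).toPseudofunctor.comp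
    TensorStruct.tensor).map₂_whisker_left f η

theorem wR_whiskerRight {f f' : X ⟶ Y} (η : f ⟶ f') (g : Y ⟶ Z) :
    (η ▷ g) ⊠₂ 𝟙 (𝟙 W) = (wR f g W).hom ≫ η ⊠₂ 𝟙 (𝟙 W) ▷ g ▹ W ≫ (wR f' g W).inv :=
  ((Bicategory.Prod.sectL B W).toPseudofunctor.comp
    TensorStruct.tensor).map₂_whisker_right η g

theorem wR_associator {V : B} (f : X ⟶ Y) (g : Y ⟶ Z) (h : Z ⟶ V) :
    (α_ f g h).hom ⊠₂ 𝟙 (𝟙 W) = (wR (f ≫ g) h W).hom ≫ (wR f g W).hom ▷ h ▹ W ≫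
      (α_ _ _ _).hom ≫ f ▹ W ◁ (wR g h W).inv ≫ (wR f (g ≫ h) W).inv :=
  ((Bicategory.Prod.sectL B W).toPseudofunctor.comp
    TensorStruct.tensor).map₂_associator f g h

/-- Makes the general pseudofunctor laws available for `wL`; the unitors used in the two splittings
of the identity coincide. -/
theorem wL_eq_mapComp (f : X ⟶ Y) (g : Y ⟶ Z) : wL W f g =
    ((Bicategory.Prod.sectR W B).toPseudofunctor.comp TensorStruct.tensor).mapComp f g := by
  have h : wL W f g = tIso (ρ_ (𝟙 W)).symm (Iso.refl _) ≪≫ tComp _ _ _ _ := by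
    ext
    simp [wL, unitors_inv_equal]
  exact h

theorem wL_whiskerLeft (f : X ⟶ Y) {g g' : Y ⟶ Z} (η : g ⟶ g') :
    𝟙 (𝟙 W) ⊠₂ (f ◁ η) = (wL W f g).hom ≫ W ◃ f ◁ 𝟙 (𝟙 W) ⊠₂ η ≫ (wL W f g').inv := by
  rw [wL_eq_mapComp, wL_eq_mapComp]
  exact ((Bicategory.Prod.sectR W B).toPseudofunctor.comp
    TensorStruct.tensor).map₂_whisker_left f η

theorem wL_whiskerRight {f f' : X ⟶ Y} (η : f ⟶ f') (g : Y ⟶ Z) :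
    𝟙 (𝟙 W) ⊠₂ (η ▷ g) = (wL W f g).hom ≫ 𝟙 (𝟙 W) ⊠₂ η ▷ W ◃ g ≫ (wL W f' g).inv := by
  rw [wL_eq_mapComp, wL_eq_mapComp]
  exact ((Bicategory.Prod.sectR W B).toPseudofunctor.comp
    TensorStruct.tensor).map₂_whisker_right η g

theorem wL_associator {V : B} (f : X ⟶ Y) (g : Y ⟶ Z) (h : Z ⟶ V) :
    𝟙 (𝟙 W) ⊠₂ (α_ f g h).hom = (wL W (f ≫ g) h).hom ≫ (wL W f g).hom ▷ W ◃ h ≫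
      (α_ _ _ _).hom ≫ W ◃ f ◁ (wL W g h).inv ≫ (wL W f (g ≫ h)).inv := by
  rw [wL_eq_mapComp, wL_eq_mapComp, wL_eq_mapComp, wL_eq_mapComp]
  exact ((Bicategory.Prod.sectR W B).toPseudofunctor.comp
    TensorStruct.tensor).map₂_associator f g h

end

/-- The image `f'` of a right-associated composite `f` under tensoring with `Z` on the right. -/
class ImgR (Z : B) {X Y : B} (f : X ⟶ Y) (f' : outParam (X ⊠ Z ⟶ Y ⊠ Z)) where
  iso : f ▹ Z ≅ f'

instance (priority := low) ImgR.base (Z : B) {X Y : B} (f : X ⟶ Y) : ImgR Z f (f ▹ Z) :=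
  ⟨Iso.refl _⟩

instance ImgR.comp (Z : B) {X Y W : B} (f : X ⟶ Y) (g : Y ⟶ W) (g' : Y ⊠ Z ⟶ W ⊠ Z)
    [ImgR Z g g'] : ImgR Z (f ≫ g) (f ▹ Z ≫ g') :=
  ⟨wR f g Z ≪≫ whiskerLeftIso _ ImgR.iso⟩

/-- The image `f'` of a right-associated composite `f` under tensoring with `Z` on the left. -/
class ImgL (Z : B) {X Y : B} (f : X ⟶ Y) (f' : outParam (Z ⊠ X ⟶ Z ⊠ Y)) where
  iso : Z ◃ f ≅ f'

instance (priority := low) ImgL.base (Z : B) {X Y : B} (f : X ⟶ Y) : ImgL Z f (Z ◃ f) :=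
  ⟨Iso.refl _⟩

instance ImgL.comp (Z : B) {X Y W : B} (f : X ⟶ Y) (g : Y ⟶ W) (g' : Z ⊠ Y ⟶ Z ⊠ W)
    [ImgL Z g g'] : ImgL Z (f ≫ g) (Z ◃ f ≫ g') :=
  ⟨wL Z f g ≪≫ whiskerLeftIso _ ImgL.iso⟩

/-- Tensoring a 2-cell between right-associated composites with `Z` on the right. -/
def rOn {X Y : B} {f g : X ⟶ Y} (c : f ⟶ g) (Z : B) {f' g' : X ⊠ Z ⟶ Y ⊠ Z} [ImgR Z f f']
    [ImgR Z g g'] : f' ⟶ g' :=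
  (ImgR.iso (Z := Z) (f := f)).inv ≫ c ⊠₂ 𝟙 (𝟙 Z) ≫ (ImgR.iso (Z := Z) (f := g)).hom

/-- Tensoring a 2-cell between right-associated composites with `Z` on the left. -/
def lOn (Z : B) {X Y : B} {f g : X ⟶ Y} (c : f ⟶ g) {f' g' : Z ⊠ X ⟶ Z ⊠ Y} [ImgL Z f f']
    [ImgL Z g g'] : f' ⟶ g' :=
  (ImgL.iso (Z := Z) (f := f)).inv ≫ 𝟙 (𝟙 Z) ⊠₂ c ≫ (ImgL.iso (Z := Z) (f := g)).hom

infixl:84 " ▹₂ " => rOn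
infixr:84 " ◃₂ " => lOn

section

variable {X Y W : B} {f g h : X ⟶ Y} (Z : B)

theorem rOn_base {f g : X ⟶ Y} (c : f ⟶ g) : c ▹₂ Z = c ⊠₂ 𝟙 (𝟙 Z) := by
  simp [rOn, ImgR.iso]

theorem lOn_base {f g : X ⟶ Y} (c : f ⟶ g) : Z ◃₂ c = 𝟙 (𝟙 Z) ⊠₂ c := by
  simp [lOn, ImgL.iso]

@[simp] theorem rOn_id {f' : X ⊠ Z ⟶ Y ⊠ Z} [ImgR Z f f'] : 𝟙 f ▹₂ Z = 𝟙 f' := by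
  simp [rOn, tHom₂_id]

@[simp] theorem lOn_id {f' : Z ⊠ X ⟶ Z ⊠ Y} [ImgL Z f f'] : Z ◃₂ 𝟙 f = 𝟙 f' := by
  simp [lOn, tHom₂_id]

theorem rOn_comp (c : f ⟶ g) (d : g ⟶ h) {f' g' h' : X ⊠ Z ⟶ Y ⊠ Z} [ImgR Z f f'] [ImgR Z g g']
    [ImgR Z h h'] : (c ≫ d) ▹₂ Z = c ▹₂ Z ≫ d ▹₂ Z := by
  have := tHom₂_comp c d (𝟙 (𝟙 Z)) (𝟙 (𝟙 Z))
  rw [Category.comp_id] at this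
  simp [rOn, this]

theorem lOn_comp (c : f ⟶ g) (d : g ⟶ h) {f' g' h' : Z ⊠ X ⟶ Z ⊠ Y} [ImgL Z f f'] [ImgL Z g g']
    [ImgL Z h h'] : Z ◃₂ (c ≫ d) = Z ◃₂ c ≫ Z ◃₂ d := by
  have := tHom₂_comp (𝟙 (𝟙 Z)) (𝟙 (𝟙 Z)) c d
  rw [Category.comp_id] at this
  simp [lOn, this]

@[simp]
theorem lOn_inv_hom (c : f ≅ g) {f' g' : Z ⊠ X ⟶ Z ⊠ Y} [ImgL Z f f'] [ImgL Z g g'] :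
    Z ◃₂ c.inv ≫ Z ◃₂ c.hom = 𝟙 g' := by
  rw [← lOn_comp, Iso.inv_hom_id, lOn_id]

theorem rOn_whiskerLeft (e : W ⟶ X) (c : f ⟶ g) {f' g' : X ⊠ Z ⟶ Y ⊠ Z} [ImgR Z f f']
    [ImgR Z g g'] : (e ◁ c) ▹₂ Z = e ▹ Z ◁ c ▹₂ Z := by
  simp [rOn, ImgR.iso, wR_whiskerLeft]

theorem lOn_whiskerLeft (e : W ⟶ X) (c : f ⟶ g) {f' g' : Z ⊠ X ⟶ Z ⊠ Y} [ImgL Z f f']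
    [ImgL Z g g'] : Z ◃₂ (e ◁ c) = Z ◃ e ◁ Z ◃₂ c := by
  simp [lOn, ImgL.iso, wL_whiskerLeft]

end

/-- Compatibility of gluing with tensoring on the right. -/
class GlueR (Z : B) {X Y W : B} (f : X ⟶ Y) (k : Y ⟶ W) {fk : X ⟶ W} {f' : X ⊠ Z ⟶ Y ⊠ Z}
    {k' : Y ⊠ Z ⟶ W ⊠ Z} {fk' : X ⊠ Z ⟶ W ⊠ Z} [Glue f k fk] [ImgR Z f f'] [ImgR Z k k']
    [ImgR Z fk fk'] [Glue f' k' fk'] : Prop where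
  eq : (Glue.iso (f := f) (k := k)).hom ⊠₂ 𝟙 (𝟙 Z) ≫ (ImgR.iso (Z := Z) (f := fk)).hom =
    (wR f k Z).hom ≫ (ImgR.iso (Z := Z) (f := f)).hom ▷ k ▹ Z ≫
      f' ◁ (ImgR.iso (Z := Z) (f := k)).hom ≫ (Glue.iso (f := f') (k := k')).hom

instance (priority := low) GlueR.base (Z : B) {X Y W : B} (f : X ⟶ Y) (k : Y ⟶ W)
    {k' : Y ⊠ Z ⟶ W ⊠ Z} [ImgR Z k k'] : GlueR Z f k :=
  ⟨by simp [Glue.iso, ImgR.iso, tHom₂_id]⟩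

instance GlueR.comp (Z : B) {V X Y W : B} (e : V ⟶ X) (f : X ⟶ Y) (k : Y ⟶ W) {fk : X ⟶ W}
    {f' : X ⊠ Z ⟶ Y ⊠ Z} {k' : Y ⊠ Z ⟶ W ⊠ Z} {fk' : X ⊠ Z ⟶ W ⊠ Z} [Glue f k fk] [ImgR Z f f']
    [ImgR Z k k'] [ImgR Z fk fk'] [Glue f' k' fk'] [GlueR Z f k] : GlueR Z (e ≫ f) k :=
  ⟨by
    have := GlueR.eq (Z := Z) (f := f) (k := k) (fk := fk) (f' := f') (k' := k') (fk' := fk')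
    have h := tHom₂_comp (α_ e f k).hom (e ◁ (Glue.iso (f := f) (k := k)).hom) (𝟙 (𝟙 Z)) (𝟙 (𝟙 Z))
    rw [Category.comp_id] at h
    simp only [Glue.iso, ImgR.iso, Iso.trans_hom, whiskerLeftIso_hom, h, wR_whiskerLeft,
      wR_associator, Category.assoc, Iso.inv_hom_id_assoc, comp_whiskerRight]
    simp only [← whiskerLeft_comp, this, Iso.inv_hom_id_assoc]
    simp⟩

/-- After cancelling the invertible comparison at the source, `GlueR` for `f` and `g` moves all
gluings to the outside, and what remains is naturality of `wR` in its first argument. -/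
theorem rOn_cellAt (Z : B) {X Y W : B} {f g : X ⟶ Y} (c : f ⟶ g) (k : Y ⟶ W) {fk gk : X ⟶ W}
    {f' g' : X ⊠ Z ⟶ Y ⊠ Z} {k' : Y ⊠ Z ⟶ W ⊠ Z} {fk' gk' : X ⊠ Z ⟶ W ⊠ Z}
    [Glue f k fk] [ImgR Z f f'] [ImgR Z k k'] [ImgR Z fk fk'] [Glue f' k' fk']
    [Glue g k gk] [ImgR Z g g'] [ImgR Z gk gk'] [Glue g' k' gk'] [GlueR Z f k] [GlueR Z g k] :
    (c ⊳ k) ▹₂ Z = c ▹₂ Z ⊳ k' := by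
  have h1 := GlueR.eq (Z := Z) (f := f) (k := k) (fk := fk) (f' := f') (k' := k') (fk' := fk')
  have h2 := GlueR.eq (Z := Z) (f := g) (k := k) (fk := gk) (f' := g') (k' := k') (fk' := gk')
  have h3 : (c ⊳ k) ⊠₂ 𝟙 (𝟙 Z) = (Glue.iso (f := f) (k := k)).inv ⊠₂ 𝟙 (𝟙 Z) ≫
      (c ▷ k) ⊠₂ 𝟙 (𝟙 Z) ≫ (Glue.iso (f := g) (k := k)).hom ⊠₂ 𝟙 (𝟙 Z) := by
    rw [← tHom₂_comp, ← tHom₂_comp, Category.comp_id, Category.comp_id]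
    rfl
  have h4 : (Glue.iso (f := f) (k := k)).hom ⊠₂ 𝟙 (𝟙 Z) ≫
      (Glue.iso (f := f) (k := k)).inv ⊠₂ 𝟙 (𝟙 Z) = 𝟙 _ := by
    rw [← tHom₂_comp, Category.comp_id, Iso.hom_inv_id, tHom₂_id]
  have : IsIso ((Glue.iso (f := f) (k := k)).hom ⊠₂ 𝟙 (𝟙 Z) ≫
      (ImgR.iso (Z := Z) (f := fk)).hom) := by
    rw [h1]
    infer_instance
  rw [← cancel_epi ((Glue.iso (f := f) (k := k)).hom ⊠₂ 𝟙 (𝟙 Z) ≫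
    (ImgR.iso (Z := Z) (f := fk)).hom)]
  · rw [rOn, h3]
    simp only [Category.assoc, Iso.hom_inv_id_assoc, reassoc_of% h4, h2, wR_whiskerRight,
      Iso.inv_hom_id_assoc]
    rw [reassoc_of% h1, cellAt, rOn, Iso.hom_inv_id_assoc]
    simp [whisker_exchange_assoc]

/-- Compatibility of gluing with tensoring on the left. -/
class GlueL (Z : B) {X Y W : B} (f : X ⟶ Y) (k : Y ⟶ W) {fk : X ⟶ W} {f' : Z ⊠ X ⟶ Z ⊠ Y}
    {k' : Z ⊠ Y ⟶ Z ⊠ W} {fk' : Z ⊠ X ⟶ Z ⊠ W} [Glue f k fk] [ImgL Z f f'] [ImgL Z k k']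
    [ImgL Z fk fk'] [Glue f' k' fk'] : Prop where
  eq : 𝟙 (𝟙 Z) ⊠₂ (Glue.iso (f := f) (k := k)).hom ≫ (ImgL.iso (Z := Z) (f := fk)).hom =
    (wL Z f k).hom ≫ (ImgL.iso (Z := Z) (f := f)).hom ▷ Z ◃ k ≫
      f' ◁ (ImgL.iso (Z := Z) (f := k)).hom ≫ (Glue.iso (f := f') (k := k')).hom

instance (priority := low) GlueL.base (Z : B) {X Y W : B} (f : X ⟶ Y) (k : Y ⟶ W)
    {k' : Z ⊠ Y ⟶ Z ⊠ W} [ImgL Z k k'] : GlueL Z f k :=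
  ⟨by simp [Glue.iso, ImgL.iso, tHom₂_id]⟩

instance GlueL.comp (Z : B) {V X Y W : B} (e : V ⟶ X) (f : X ⟶ Y) (k : Y ⟶ W) {fk : X ⟶ W}
    {f' : Z ⊠ X ⟶ Z ⊠ Y} {k' : Z ⊠ Y ⟶ Z ⊠ W} {fk' : Z ⊠ X ⟶ Z ⊠ W} [Glue f k fk] [ImgL Z f f']
    [ImgL Z k k'] [ImgL Z fk fk'] [Glue f' k' fk'] [GlueL Z f k] : GlueL Z (e ≫ f) k :=
  ⟨by
    have := GlueL.eq (Z := Z) (f := f) (k := k) (fk := fk) (f' := f') (k' := k') (fk' := fk')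
    have h := tHom₂_comp (𝟙 (𝟙 Z)) (𝟙 (𝟙 Z)) (α_ e f k).hom (e ◁ (Glue.iso (f := f) (k := k)).hom)
    rw [Category.comp_id] at h
    simp only [Glue.iso, ImgL.iso, Iso.trans_hom, whiskerLeftIso_hom, h, wL_whiskerLeft,
      wL_associator, Category.assoc, Iso.inv_hom_id_assoc, comp_whiskerRight]
    simp only [← whiskerLeft_comp, this, Iso.inv_hom_id_assoc]
    simp⟩

theorem lOn_cellAt (Z : B) {X Y W : B} {f g : X ⟶ Y} (c : f ⟶ g) (k : Y ⟶ W) {fk gk : X ⟶ W}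
    {f' g' : Z ⊠ X ⟶ Z ⊠ Y} {k' : Z ⊠ Y ⟶ Z ⊠ W} {fk' gk' : Z ⊠ X ⟶ Z ⊠ W}
    [Glue f k fk] [ImgL Z f f'] [ImgL Z k k'] [ImgL Z fk fk'] [Glue f' k' fk']
    [Glue g k gk] [ImgL Z g g'] [ImgL Z gk gk'] [Glue g' k' gk'] [GlueL Z f k] [GlueL Z g k] :
    Z ◃₂ (c ⊳ k) = Z ◃₂ c ⊳ k' := by
  have h1 := GlueL.eq (Z := Z) (f := f) (k := k) (fk := fk) (f' := f') (k' := k') (fk' := fk')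
  have h2 := GlueL.eq (Z := Z) (f := g) (k := k) (fk := gk) (f' := g') (k' := k') (fk' := gk')
  have h3 : 𝟙 (𝟙 Z) ⊠₂ (c ⊳ k) = 𝟙 (𝟙 Z) ⊠₂ (Glue.iso (f := f) (k := k)).inv ≫
      𝟙 (𝟙 Z) ⊠₂ (c ▷ k) ≫ 𝟙 (𝟙 Z) ⊠₂ (Glue.iso (f := g) (k := k)).hom := by
    rw [← tHom₂_comp, ← tHom₂_comp, Category.comp_id, Category.comp_id]
    rfl
  have h4 : 𝟙 (𝟙 Z) ⊠₂ (Glue.iso (f := f) (k := k)).hom ≫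
      𝟙 (𝟙 Z) ⊠₂ (Glue.iso (f := f) (k := k)).inv = 𝟙 _ := by
    rw [← tHom₂_comp, Category.comp_id, Iso.hom_inv_id, tHom₂_id]
  have : IsIso (𝟙 (𝟙 Z) ⊠₂ (Glue.iso (f := f) (k := k)).hom ≫
      (ImgL.iso (Z := Z) (f := fk)).hom) := by
    rw [h1]
    infer_instance
  rw [← cancel_epi (𝟙 (𝟙 Z) ⊠₂ (Glue.iso (f := f) (k := k)).hom ≫
    (ImgL.iso (Z := Z) (f := fk)).hom)]
  · rw [lOn, h3]
    simp only [Category.assoc, Iso.hom_inv_id_assoc, reassoc_of% h4, h2, wL_whiskerRight,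
      Iso.inv_hom_id_assoc]
    rw [reassoc_of% h1, cellAt, lOn, Iso.hom_inv_id_assoc]
    simp [whisker_exchange_assoc]

end Tensoring

/-! ### Interchange isomorphisms and tensor products of squares -/

section Cubical

variable {B : Type u} [Bicategory.{w, v} B] [MonoidalBicategory B]

theorem tHom₂_comp_assoc {X X' Y Y' : B} {f f' f'' : X ⟶ X'} {g g' g'' : Y ⟶ Y'}
    (η : f ⟶ f') (η' : f' ⟶ f'') (θ : g ⟶ g') (θ' : g' ⟶ g'') {h : X ⊠ Y ⟶ X' ⊠ Y'}
    (c : f'' ⊠₁ g'' ⟶ h) :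
    η ⊠₂ θ ≫ η' ⊠₂ θ' ≫ c = (η ≫ η') ⊠₂ (θ ≫ θ') ≫ c := by
  rw [tHom₂_comp, Category.assoc]

section

variable {X X' X'' X''' Y Y' Y'' Y''' : B} (f : X ⟶ X') (f' : X' ⟶ X'')
    (f'' : X'' ⟶ X''') (g : Y ⟶ Y') (g' : Y' ⟶ Y'') (g'' : Y'' ⟶ Y''')

theorem tHom₂_inv_hom {h h' : X ⟶ X'} {k k' : Y ⟶ Y'} (e : h ≅ h') (e' : k ≅ k') :
    e.inv ⊠₂ e'.inv ≫ e.hom ⊠₂ e'.hom = 𝟙 _ := by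
  rw [← tHom₂_comp, Iso.inv_hom_id, Iso.inv_hom_id, tHom₂_id]

theorem tHom₂_hom_inv {h h' : X ⟶ X'} {k k' : Y ⟶ Y'} (e : h ≅ h') (e' : k ≅ k') :
    e.hom ⊠₂ e'.hom ≫ e.inv ⊠₂ e'.inv = 𝟙 _ := by
  rw [← tHom₂_comp, Iso.hom_inv_id, Iso.hom_inv_id, tHom₂_id]

theorem tComp_assoc : (tComp (f ≫ f') f'' (g ≫ g') g'').hom ≫
      (tComp f f' g g').hom ▷ f'' ⊠₁ g'' ≫ (α_ _ _ _).hom =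
    (α_ f f' f'').hom ⊠₂ (α_ g g' g'').hom ≫ (tComp f (f' ≫ f'') g (g' ≫ g'')).hom ≫
      f ⊠₁ g ◁ (tComp f' f'' g' g'').hom := by
  rw [tHom₂_associator]
  simp

theorem tComp_assoc_inv : (tComp f (f' ≫ f'') g (g' ≫ g'')).hom ≫
      f ⊠₁ g ◁ (tComp f' f'' g' g'').hom ≫ (α_ _ _ _).inv =
    (α_ f f' f'').inv ⊠₂ (α_ g g' g'').inv ≫ (tComp (f ≫ f') f'' (g ≫ g') g'').hom ≫
      (tComp f f' g g').hom ▷ f'' ⊠₁ g'' := by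
  have h := tComp_assoc f f' f'' g g' g''
  rw [← cancel_mono (α_ _ _ _).hom]
  simp only [Category.assoc, Iso.inv_hom_id, Category.comp_id, h]
  rw [← Category.assoc (_ ⊠₂ _), tHom₂_inv_hom, Category.id_comp]

end

theorem inter_hom {X X' Y Y' : B} (f : X ⟶ X') (g : Y ⟶ Y') : (inter f g).hom =
    (tComp f (𝟙 X') (𝟙 Y) g).inv ≫ ((ρ_ f).hom ≫ (λ_ f).inv) ⊠₂ ((λ_ g).hom ≫ (ρ_ g).inv) ≫
      (tComp (𝟙 X) f g (𝟙 Y')).hom := rfl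

theorem inter_naturality_left {X X' Y Y' : B} {f f' : X ⟶ X'} (η : f ⟶ f') (g : Y ⟶ Y') :
    (η ▹₂ Y) ▷ X' ◃ g ≫ (inter f' g).hom = (inter f g).hom ≫ X ◃ g ◁ (η ▹₂ Y') := by
  rw [rOn_base, rOn_base, inter_hom, inter_hom, ← cancel_epi (tComp f (𝟙 X') (𝟙 Y) g).hom]
  have h1 := tComp_naturality_left η (𝟙 (𝟙 Y)) (𝟙 X') g
  have h2 := tComp_naturality_right (𝟙 X) g η (𝟙 (𝟙 Y'))
  simp only [Category.assoc, Iso.hom_inv_id_assoc, ← reassoc_of% h1, ← h2, tHom₂_comp_assoc]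
  simp

theorem inter_naturality_right {X X' Y Y' : B} (f : X ⟶ X') {g g' : Y ⟶ Y'} (η : g ⟶ g') :
    f ▹ Y ◁ (X' ◃₂ η) ≫ (inter f g').hom = (inter f g).hom ≫ (X ◃₂ η) ▷ f ▹ Y' := by
  rw [lOn_base, lOn_base, inter_hom, inter_hom, ← cancel_epi (tComp f (𝟙 X') (𝟙 Y) g).hom]
  have h1 := tComp_naturality_right f (𝟙 Y) (𝟙 (𝟙 X')) η
  have h2 := tComp_naturality_left (𝟙 (𝟙 X)) η f (𝟙 Y')
  simp only [Category.assoc, Iso.hom_inv_id_assoc, ← reassoc_of% h1, ← h2, tHom₂_comp_assoc]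
  simp

theorem wR_hom {X X' X'' : B} (f : X ⟶ X') (g : X' ⟶ X'') (Y : B) : (wR f g Y).hom =
    𝟙 (f ≫ g) ⊠₂ (λ_ (𝟙 Y)).inv ≫ (tComp f g (𝟙 Y) (𝟙 Y)).hom := rfl

theorem wL_hom {X X' X'' : B} (f : X ⟶ X') (g : X' ⟶ X'') (Y : B) : (wL Y f g).hom =
    (λ_ (𝟙 Y)).inv ⊠₂ 𝟙 (f ≫ g) ≫ (tComp (𝟙 Y) (𝟙 Y) f g).hom := rfl

/-- The comparisons `tComp` are pushed past the tensored cells until each side is a single tensor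
product of cells followed by the same comparisons. The two tensor factors then agree by coherence in
the bicategory. -/
theorem inter_comp_left {X X' X'' Y Y' : B} (f : X ⟶ X') (f' : X' ⟶ X'') (g : Y ⟶ Y') :
    (inter (f ≫ f') g).hom ≫ X ◃ g ◁ (wR f f' Y').hom =
      (wR f f' Y).hom ⊳ (X'' ◃ g) ≫ f ▹ Y ◁ (inter f' g).hom ≫
        (inter f g).hom ⊳ (f' ▹ Y') := by
  rw [← cancel_epi (tComp (f ≫ f') (𝟙 X'') (𝟙 Y) g).hom]
  simp only [cellAt, Glue.iso, inter_hom, wR_hom, Iso.refl_inv, Iso.trans_hom, Iso.trans_inv,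
    whiskerLeftIso_hom, whiskerLeftIso_inv, Iso.refl_hom, whiskerLeft_id, Category.comp_id,
    Category.id_comp, Category.assoc, Iso.hom_inv_id_assoc, comp_whiskerRight, whiskerLeft_comp]
  have a1 := tComp_naturality_right (𝟙 X) g (𝟙 (f ≫ f')) (λ_ (𝟙 Y')).inv
  have a2 := tComp_naturality_left (𝟙 (f ≫ f')) (λ_ (𝟙 Y)).inv (𝟙 X'') g
  have a3 := tComp_naturality_right f (𝟙 Y) ((ρ_ f').hom ≫ (λ_ f').inv) ((λ_ g).hom ≫ (ρ_ g).inv)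
  have a4 := tComp_naturality_left ((ρ_ f).hom ≫ (λ_ f).inv) ((λ_ g).hom ≫ (ρ_ g).inv) f' (𝟙 Y')
  have b1 := tComp_assoc f f' (𝟙 X'') (𝟙 Y) (𝟙 Y) g
  have b2 := tComp_assoc_inv f (𝟙 X') f' (𝟙 Y) g (𝟙 Y')
  have b3 := tComp_assoc (𝟙 X) f f' g (𝟙 Y') (𝟙 Y')
  rw [← reassoc_of% a1, ← reassoc_of% a2, reassoc_of% b1]
  simp only [whiskerLeft_hom_inv_assoc]
  rw [← reassoc_of% a3, reassoc_of% b2]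
  simp only [hom_inv_whiskerRight_assoc]
  rw [← reassoc_of% a4, b3]
  simp only [tHom₂_comp_assoc]
  congr 2
  · bicategory
  · bicategory

theorem inter_comp_right {X X' Y Y' Y'' : B} (f : X ⟶ X') (g : Y ⟶ Y') (g' : Y' ⟶ Y'') :
    (inter f (g ≫ g')).hom ≫ (wL X g g').hom ⊳ (f ▹ Y'') =
      f ▹ Y ◁ (wL X' g g').hom ≫ (inter f g).hom ⊳ (X' ◃ g') ≫
        X ◃ g ◁ (inter f g').hom := by
  rw [← cancel_epi (tComp f (𝟙 X') (𝟙 Y) (g ≫ g')).hom]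
  simp only [cellAt, Glue.iso, inter_hom, wL_hom, Iso.refl_inv, Iso.trans_hom, Iso.trans_inv,
    whiskerLeftIso_hom, whiskerLeftIso_inv, Iso.refl_hom, whiskerLeft_id, Category.comp_id,
    Category.id_comp, Category.assoc, Iso.hom_inv_id_assoc, comp_whiskerRight, whiskerLeft_comp]
  have a1 := tComp_naturality_left (λ_ (𝟙 X)).inv (𝟙 (g ≫ g')) f (𝟙 Y'')
  have a2 := tComp_naturality_right f (𝟙 Y) (λ_ (𝟙 X')).inv (𝟙 (g ≫ g'))
  have a3 := tComp_naturality_left ((ρ_ f).hom ≫ (λ_ f).inv) ((λ_ g).hom ≫ (ρ_ g).inv) (𝟙 X') g'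
  have a4 := tComp_naturality_right (𝟙 X) g ((ρ_ f).hom ≫ (λ_ f).inv)
    ((λ_ g').hom ≫ (ρ_ g').inv)
  have b1 := tComp_assoc (𝟙 X) (𝟙 X) f g g' (𝟙 Y'')
  have b2 := tComp_assoc_inv f (𝟙 X') (𝟙 X') (𝟙 Y) g g'
  have b3 := tComp_assoc (𝟙 X) f (𝟙 X') g (𝟙 Y') g'
  rw [← reassoc_of% a1, b1, ← reassoc_of% a2, reassoc_of% b2]
  simp only [hom_inv_whiskerRight_assoc]
  rw [← reassoc_of% a3, reassoc_of% b3]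
  simp only [whiskerLeft_hom_inv_assoc]
  rw [← reassoc_of% a4]
  simp only [tHom₂_comp_assoc]
  congr 2
  · bicategory
  · bicategory

section

variable {X X' X'' Y Y' Y'' Z Z' Z'' K L M : B} {f : X ⟶ X'} {f' : X' ⟶ X''} {g : Y ⟶ Y'}
  {g' : Y' ⟶ Y''} {h : Z ⟶ Z'} {h' : Z' ⟶ Z''} {k : X ⟶ K} {k' : K ⟶ X''} {l : Y ⟶ L}
  {l' : L ⟶ Y''} {m : Z ⟶ M} {m' : M ⟶ Z''}

theorem tSq_hom (u : f ≫ f' ≅ k ≫ k') (v : g ≫ g' ≅ l ≫ l') : (tSq u v).hom =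
    (tComp f f' g g').inv ≫ u.hom ⊠₂ v.hom ≫ (tComp k k' l l').hom := rfl

theorem tSq_inv (u : f ≫ f' ≅ k ≫ k') (v : g ≫ g' ≅ l ≫ l') :
    (tSq u v).inv = (tSq u.symm v.symm).hom := by
  simp [tSq]

theorem tSq_idSq (f : X ⟶ X') (g : Y ⟶ Y') : (tSq (idSq f) (idSq g)).hom =
    f ⊠₁ g ◁ (tId X' Y').hom ≫ (idSq (f ⊠₁ g)).hom ≫ (tId X Y).inv ▷ f ⊠₁ g := by
  have h1 := tHom₂_leftUnitor f g
  have h2 := tHom₂_rightUnitor f g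
  have h3 : (idSq f).hom ⊠₂ (idSq g).hom ≫ (λ_ f).hom ⊠₂ (λ_ g).hom =
      (ρ_ f).hom ⊠₂ (ρ_ g).hom := by
    rw [← tHom₂_comp]
    simp [idSq]
  rw [tSq_hom, Iso.inv_comp_eq, ← cancel_mono ((tId X Y).hom ▷ f ⊠₁ g ≫ (λ_ _).hom),
    Category.assoc, ← h1, h3, h2]
  simp [idSq]

/-- Pseudonaturality of the associativity constraint in cubical form: it follows from naturality on
2-cells and compatibility with composition. Since `inter` is a tensor product of squares with
identity sides, the compatibilities of interchange with associativity are special cases. -/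
theorem asNat_tSq (u : f ≫ f' ≅ k ≫ k') (v : g ≫ g' ≅ l ≫ l') (w : h ≫ h' ≅ m ≫ m') :
    (tSq (tSq u v) w).hom ⊳ as X'' Y'' Z'' ≫ (k ⊠₁ l) ⊠₁ m ◁ (asNat k' l' m').hom ≫
        (asNat k l m).hom ⊳ k' ⊠₁ (l' ⊠₁ m') =
      (f ⊠₁ g) ⊠₁ h ◁ (asNat f' g' h').hom ≫ (asNat f g h).hom ⊳ f' ⊠₁ (g' ⊠₁ h') ≫
        as X Y Z ◁ (tSq u (tSq v w)).hom := by
  have n := asNat_naturality u.hom v.hom w.hom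
  have c1 := asNat_comp f f' g g' h h'
  have c2 := asNat_comp k k' l l' m m'
  have e1 : ((tComp f f' g g').hom ⊠₂ 𝟙 (h ≫ h') ≫ (tComp _ _ _ _).hom) ≫
      (tSq (tSq u v) w).hom =
      (u.hom ⊠₂ v.hom) ⊠₂ w.hom ≫ ((tComp k k' l l').hom ⊠₂ 𝟙 (m ≫ m') ≫ (tComp _ _ _ _).hom) := by
    simp only [tSq_hom, Category.assoc, Iso.hom_inv_id_assoc, tHom₂_comp_assoc, Category.id_comp,
      Category.comp_id]
  have e2 : (𝟙 (f ≫ f') ⊠₂ (tComp g g' h h').hom ≫ (tComp _ _ _ _).hom) ≫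
      (tSq u (tSq v w)).hom =
      u.hom ⊠₂ (v.hom ⊠₂ w.hom) ≫ (𝟙 (k ≫ k') ⊠₂ (tComp l l' m m').hom ≫ (tComp _ _ _ _).hom) := by
    simp only [tSq_hom, Category.assoc, Iso.hom_inv_id_assoc, tHom₂_comp_assoc, Category.id_comp,
      Category.comp_id]
  have i1 : IsIso ((tComp f f' g g').hom ⊠₂ 𝟙 (h ≫ h') ≫ (tComp _ _ _ _).hom) :=
    inferInstanceAs (IsIso (tIso (tComp f f' g g') (Iso.refl (h ≫ h')) ≪≫ tComp _ _ _ _).hom)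
  rw [← cancel_epi ((α_ ((f ⊠₁ g) ⊠₁ h) ((f' ⊠₁ g') ⊠₁ h') (as X'' Y'' Z'')).hom),
    ← cancel_epi (((tComp f f' g g').hom ⊠₂ 𝟙 (h ≫ h') ≫ (tComp _ _ _ _).hom) ▷ as X'' Y'' Z'')]
  simp only [cellAt, Glue.iso, Iso.refl_inv, Iso.trans_hom, Iso.trans_inv,
    whiskerLeftIso_hom, whiskerLeftIso_inv, Iso.refl_hom, whiskerLeft_id, Category.comp_id,
    Category.id_comp, Category.assoc, Iso.hom_inv_id_assoc]
  rw [← reassoc_of% c1, ← comp_whiskerRight_assoc, e1, comp_whiskerRight_assoc, ← c2,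
    reassoc_of% n, ← whiskerLeft_comp, ← whiskerLeft_comp, e2]

end

end Cubical

/-! ### Maps of squares -/

section SquareMaps

variable {B : Type u} [Bicategory.{w, v} B]

/-- A map of squares which is the identity on two of the sides. -/
def SqMap {X X' Z Z' : B} {f f₂ : X ⟶ X'} {p' : X' ⟶ Z'} {p : X ⟶ Z} {h h₂ : Z ⟶ Z'}
    (σ : f ≫ p' ≅ p ≫ h) (σ₂ : f₂ ≫ p' ≅ p ≫ h₂) (a : f ⟶ f₂) (b : h ⟶ h₂) : Prop :=
  a ▷ p' ≫ σ₂.hom = σ.hom ≫ p ◁ b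

namespace SqMap

variable {X X' Y Y' Z Z' W W' : B} {f f₂ f₃ : X ⟶ X'} {p' : X' ⟶ Z'} {p : X ⟶ Z}
  {h h₂ h₃ : Z ⟶ Z'} {σ : f ≫ p' ≅ p ≫ h} {σ₂ : f₂ ≫ p' ≅ p ≫ h₂} {σ₃ : f₃ ≫ p' ≅ p ≫ h₃}
  {a : f ⟶ f₂} {b : h ⟶ h₂} {a' : f₂ ⟶ f₃} {b' : h₂ ⟶ h₃}

theorem refl (σ : f ≫ p' ≅ p ≫ h) : SqMap σ σ (𝟙 f) (𝟙 h) := by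
  simp [SqMap]

theorem comp (m : SqMap σ σ₂ a b) (m' : SqMap σ₂ σ₃ a' b') : SqMap σ σ₃ (a ≫ a') (b ≫ b') := by
  unfold SqMap at *
  rw [comp_whiskerRight, Category.assoc, m', reassoc_of% m, whiskerLeft_comp]

theorem congr (m : SqMap σ σ₂ a b) {c : f ⟶ f₂} {d : h ⟶ h₂} (hc : a = c) (hd : b = d) :
    SqMap σ σ₂ c d := by
  subst hc hd
  exact m

theorem symm {a : f ≅ f₂} {b : h ≅ h₂} (m : SqMap σ σ₂ a.hom b.hom) :
    SqMap σ₂ σ a.inv b.inv := by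
  unfold SqMap at *
  rw [← cancel_epi (a.hom ▷ p'), ← cancel_mono (p ◁ b.hom)]
  simp [m]

theorem paste {q : Z ⟶ W} {q' : Z' ⟶ W'} {k k₂ : W ⟶ W'} {τ : h ≫ q' ≅ q ≫ k}
    {τ₂ : h₂ ≫ q' ≅ q ≫ k₂} {c : k ⟶ k₂} (m : SqMap σ σ₂ a b) (n : SqMap τ τ₂ b c) :
    SqMap (pasteSq σ τ) (pasteSq σ₂ τ₂) a c := by
  unfold SqMap at *
  simp only [pasteSq, Iso.trans_hom, Iso.symm_hom, whiskerRightIso_hom, whiskerLeftIso_hom,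
    Category.assoc, comp_whiskerLeft, whiskerRight_comp, Iso.hom_inv_id_assoc,
    Iso.inv_hom_id_assoc, ← whiskerLeft_comp_assoc, ← n]
  simp only [← comp_whiskerRight_assoc, m]
  simp

/-- Modification squares are transported along maps of squares. -/
theorem transport {c' d' : X' ⟶ Z'} {c d : X ⟶ Z} {m : c' ⟶ d'} {m' : c ⟶ d} {A : f ≫ d' ≅ d ≫ h}
    {A₂ : f₂ ≫ d' ≅ d ≫ h₂} {C : f ≫ c' ≅ c ≫ h} {C₂ : f₂ ≫ c' ≅ c ≫ h₂} [IsIso a]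
    (e : f ◁ m ≫ A.hom = C.hom ≫ m' ▷ h) (hA : SqMap A A₂ a b) (hC : SqMap C C₂ a b) :
    f₂ ◁ m ≫ A₂.hom = C₂.hom ≫ m' ▷ h₂ := by
  unfold SqMap at *
  rw [← cancel_epi (a ▷ c'), ← whisker_exchange_assoc, hA, reassoc_of% e, reassoc_of% hC,
    whisker_exchange]

end SqMap

theorem idSq_id (X : B) : idSq (𝟙 X) = Iso.refl (𝟙 X ≫ 𝟙 X) := by
  ext
  simp [idSq]

end SquareMaps

/-! ### Maps between the constraint squares -/

section Cubical

variable {B : Type u} [Bicategory.{w, v} B] [MonoidalBicategory B]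

instance {X X' Y Y' : B} {f f' : X ⟶ X'} {g g' : Y ⟶ Y'} (η : f ⟶ f') (θ : g ⟶ g') [IsIso η]
    [IsIso θ] : IsIso (η ⊠₂ θ) :=
  inferInstanceAs (IsIso (tIso (asIso η) (asIso θ)).hom)

section

variable {X X' Y Y' Z Z' W W' : B}

theorem SqMap.tensor {f f₂ : X ⟶ X'} {p' : X' ⟶ Z'} {p : X ⟶ Z} {h h₂ : Z ⟶ Z'}
    {σ : f ≫ p' ≅ p ≫ h} {σ₂ : f₂ ≫ p' ≅ p ≫ h₂} {a : f ⟶ f₂} {b : h ⟶ h₂} {g g₂ : Y ⟶ Y'}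
    {q' : Y' ⟶ W'} {q : Y ⟶ W} {k k₂ : W ⟶ W'} {τ : g ≫ q' ≅ q ≫ k} {τ₂ : g₂ ≫ q' ≅ q ≫ k₂}
    {c : g ⟶ g₂} {d : k ⟶ k₂} (m : SqMap σ σ₂ a b) (n : SqMap τ τ₂ c d) :
    SqMap (tSq σ τ) (tSq σ₂ τ₂) (a ⊠₂ c) (b ⊠₂ d) := by
  unfold SqMap at *
  have h1 := tComp_naturality_left a c p' q'
  have h2 := tComp_naturality_right p q b d
  rw [tSq_hom, tSq_hom, ← cancel_epi (tComp f p' g q').hom]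
  simp only [Category.assoc, Iso.hom_inv_id_assoc, ← reassoc_of% h1, ← h2, tHom₂_comp_assoc, m, n]

theorem SqMap.asNat {f f' : X ⟶ X'} {g g' : Y ⟶ Y'} {h h' : Z ⟶ Z'}
    (η : f ⟶ f') (θ : g ⟶ g') (ζ : h ⟶ h') :
    SqMap (asNat f g h) (asNat f' g' h') ((η ⊠₂ θ) ⊠₂ ζ) (η ⊠₂ (θ ⊠₂ ζ)) :=
  asNat_naturality η θ ζ

theorem SqMap.asL (f : X ⟶ X') (Y Z : B) :
    SqMap (MonBicat.asNat f (𝟙 Y) (𝟙 Z)) (MonBicat.asL f Y Z) (𝟙 _) (𝟙 f ⊠₂ (tId Y Z).hom) := by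
  simp [SqMap, MonBicat.asL]

theorem SqMap.asR (f : X ⟶ X') (Y Z : B) :
    SqMap (MonBicat.asNat (𝟙 Y) (𝟙 Z) f) (MonBicat.asR Y Z f) ((tId Y Z).hom ⊠₂ 𝟙 f) (𝟙 _) := by
  have h := tHom₂_hom_inv (tId Y Z) (Iso.refl f)
  simp only [Iso.refl_hom, Iso.refl_inv] at h
  simp only [SqMap, MonBicat.asR, Iso.trans_hom, whiskerRightIso_hom, tIso_hom,
    ← comp_whiskerRight_assoc, Iso.symm_hom, Iso.refl_hom, h]
  simp

theorem SqMap.asNat_id (X Y Z : B) :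
    SqMap (MonBicat.asNat (𝟙 X) (𝟙 Y) (𝟙 Z)) (idSq (as X Y Z)).symm
      ((tId X Y).hom ⊠₂ 𝟙 (𝟙 Z) ≫ (tId _ _).hom) (𝟙 (𝟙 X) ⊠₂ (tId Y Z).hom ≫ (tId _ _).hom) :=
  (MonBicat.asNat_id X Y Z).symm

theorem SqMap.luNat_id (X : B) : SqMap (luNat (𝟙 X)) (idSq (lu X)).symm (tId _ X).hom (𝟙 _) := by
  simp [SqMap, MonBicat.luNat_id, idSq]

theorem SqMap.ruNat_id (X : B) : SqMap (ruNat (𝟙 X)) (idSq (ru X)).symm (tId X _).hom (𝟙 _) := by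
  simp [SqMap, MonBicat.ruNat_id, idSq]

theorem SqMap.luNat {f f' : X ⟶ X'} (η : f ⟶ f') :
    SqMap (luNat f) (MonBicat.luNat f') (𝟙 (𝟙 (unitObj B)) ⊠₂ η) η :=
  luNat_naturality η

theorem SqMap.ruNat {f f' : X ⟶ X'} (η : f ⟶ f') :
    SqMap (ruNat f) (MonBicat.ruNat f') (η ⊠₂ 𝟙 (𝟙 (unitObj B))) η :=
  ruNat_naturality η

theorem SqMap.tSq_idSq (f : X ⟶ X') (g : Y ⟶ Y') :
    SqMap (tSq (idSq f).symm (idSq g).symm) (idSq (f ⊠₁ g)).symm (tId X Y).hom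
      (tId X' Y').hom := by
  have h : (tSq (idSq f).symm (idSq g).symm).hom = (tSq (idSq f) (idSq g)).inv := by
    rw [tSq_inv]
  rw [SqMap, h, Iso.eq_inv_comp, MonBicat.tSq_idSq]
  simp

theorem inter_eq (f : X ⟶ X') (g : Y ⟶ Y') : inter f g = tSq (idSq f) (idSq g).symm := by
  ext
  simp [inter, tSq, idSq]

theorem inter_symm (f : X ⟶ X') (g : Y ⟶ Y') : (inter f g).symm = tSq (idSq f).symm (idSq g) := by
  ext
  simp [inter, tSq, idSq]

/-- Translates between squares tensored with an identity square, as they occur in the modification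
axioms, and the normal form `▹₂`. -/
theorem rOn_square {f : X ⟶ X'} {p' : X' ⟶ Z'} {p : X ⟶ Z} {h : Z ⟶ Z'}
    (σ : f ≫ p' ≅ p ≫ h) (Y : B) : (tSq σ (Iso.refl (𝟙 Y ≫ 𝟙 Y))).hom = σ.hom ▹₂ Y := by
  simp only [rOn, ImgR.iso, Iso.trans_hom, Iso.trans_inv, whiskerLeftIso_hom, whiskerLeftIso_inv,
    Iso.refl_hom, Iso.refl_inv, whiskerLeft_id, Category.comp_id, Category.id_comp, wR, tSq_hom,
    Category.assoc, tIso_hom, tIso_inv, Iso.symm_hom, Iso.symm_inv, tHom₂_comp_assoc]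
  simp

theorem lOn_square {f : X ⟶ X'} {p' : X' ⟶ Z'} {p : X ⟶ Z} {h : Z ⟶ Z'}
    (σ : f ≫ p' ≅ p ≫ h) (Y : B) : (tSq (Iso.refl (𝟙 Y ≫ 𝟙 Y)) σ).hom = Y ◃₂ σ.hom := by
  simp only [lOn, ImgL.iso, Iso.trans_hom, Iso.trans_inv, whiskerLeftIso_hom, whiskerLeftIso_inv,
    Iso.refl_hom, Iso.refl_inv, whiskerLeft_id, Category.comp_id, Category.id_comp, wL, tSq_hom,
    Category.assoc, tIso_hom, tIso_inv, Iso.symm_hom, Iso.symm_inv, tHom₂_comp_assoc]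
  simp

end

section

variable {X X' Y Y' Z Z' : B}

theorem asL_naturality {f f' : X ⟶ X'} (η : f ⟶ f') (Y Z : B) :
    ((η ▹₂ Y) ▹₂ Z) ▷ as X' Y Z ≫ (asL f' Y Z).hom =
      (asL f Y Z).hom ≫ as X Y Z ◁ (η ▹₂ (Y ⊠ Z)) := by
  rw [rOn_base, rOn_base, rOn_base]
  have m := SqMap.asNat η (𝟙 (𝟙 Y)) (𝟙 (𝟙 Z))
  have m₂ := (SqMap.symm (a := Iso.refl _) (b := tIso (Iso.refl f) (tId Y Z))
    (SqMap.asL f Y Z)).comp (m.comp (SqMap.asL f' Y Z))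
  refine m₂.congr ?_ ?_
  · simp
  · simp [← tHom₂_comp, tHom₂_id]

theorem asR_naturality (X Y : B) {f f' : Z ⟶ Z'} (η : f ⟶ f') :
    ((X ⊠ Y) ◃₂ η) ▷ as X Y Z' ≫ (asR X Y f').hom =
      (asR X Y f).hom ≫ as X Y Z ◁ (X ◃₂ Y ◃₂ η) := by
  rw [lOn_base, lOn_base, lOn_base]
  have m := SqMap.asNat (𝟙 (𝟙 X)) (𝟙 (𝟙 Y)) η
  have m₂ := (SqMap.symm (a := tIso (tId X Y) (Iso.refl f)) (b := Iso.refl _)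
    (SqMap.asR f X Y)).comp (m.comp (SqMap.asR f' X Y))
  refine m₂.congr ?_ ?_
  · simp [← tHom₂_comp, tHom₂_id]
  · simp

end

end Cubical

/-! ### Constraint cells in one variable: interchange and composition -/

section Cubical

variable {B : Type u} [Bicategory.{w, v} B] [MonoidalBicategory B]

variable {X X' X'' Y Y' Y'' Z Z' Z'' : B}

theorem asL_hom (f : X ⟶ X') (Y Z : B) : (asL f Y Z).hom = (asNat f (𝟙 Y) (𝟙 Z)).hom ≫
    as X Y Z ◁ 𝟙 f ⊠₂ (tId Y Z).hom := rfl

theorem asR_hom (X Y : B) (f : Z ⟶ Z') : (asR X Y f).hom = (tId X Y).inv ⊠₂ 𝟙 f ▷ as X Y Z' ≫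
    (asNat (𝟙 X) (𝟙 Y) f).hom := rfl

/-- This is `asNat_tSq` for two squares with identity sides and one identity square. Replacing
`asNat` by `asL` costs the cell identifying a tensor product of identities with an identity, and
that cell slides across by interchange. -/
theorem inter_asM_asL (f : X ⟶ X') (g : Y ⟶ Y') (Z : B) :
    ((inter f g).hom ▹₂ Z) ⊳ as X' Y' Z ≫ (X ◃ g) ▹ Z ◁ (asL f Y' Z).hom ≫
        (asM X g Z).hom ⊳ (f ▹ (Y' ⊠ Z)) =
      (f ▹ Y) ▹ Z ◁ (asM X' g Z).hom ≫ (asL f Y Z).hom ⊳ (X' ◃ (g ▹ Z)) ≫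
        as X Y Z ◁ (inter f (g ▹ Z)).hom := by
  have h := asNat_tSq (idSq f) (idSq g).symm (idSq (𝟙 Z)).symm
  have s : SqMap _ (inter f (g ▹ Z)) _ _ :=
    (inter_eq f (g ▹ Z)) ▸ (SqMap.refl (idSq f)).tensor (SqMap.tSq_idSq g (𝟙 Z))
  rw [idSq_id] at h s
  have e : (tSq (tSq (idSq f) (idSq g).symm) (Iso.refl (𝟙 Z ≫ 𝟙 Z)).symm).hom =
      (inter f g).hom ▹₂ Z := by
    rw [inter_eq]
    exact rOn_square _ _
  rw [e] at h
  simp only [asL_hom, whiskerLeft_comp, cellAt_comp, cellAt_whiskerLeft, cellAt_base,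
    Category.assoc]
  unfold SqMap at s
  rw [← whiskerLeft_comp, s, whiskerLeft_comp]
  have x := exch₂₂ (asM X g Z).hom (𝟙 f ⊠₂ (tId Y' Z).hom)
  rw [← x]
  simpa [asM] using congrArg (· ≫ as X Y Z ◁ X ◃ (g ▹ Z) ◁ 𝟙 f ⊠₂ (tId Y' Z).hom) h

theorem inter_asR_asL (f : X ⟶ X') (Y : B) (h : Z ⟶ Z') :
    (inter (f ▹ Y) h).hom ⊳ as X' Y Z' ≫ (X ⊠ Y) ◃ h ◁ (asL f Y Z').hom ≫
        (asR X Y h).hom ⊳ (f ▹ (Y ⊠ Z')) =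
      (f ▹ Y) ▹ Z ◁ (asR X' Y h).hom ≫ (asL f Y Z).hom ⊳ (X' ◃ (Y ◃ h)) ≫
        as X Y Z ◁ (inter f (Y ◃ h)).hom := by
  have e := asNat_tSq (idSq f) (idSq (𝟙 Y)) (idSq h).symm
  have s : SqMap _ (inter f (Y ◃ h)) _ _ :=
    (inter_eq f (Y ◃ h)) ▸ (SqMap.refl (idSq f)).tensor (SqMap.tSq_idSq (𝟙 Y) h)
  have t : SqMap _ (inter (f ▹ Y) h).symm _ _ :=
    (inter_symm (f ▹ Y) h) ▸ (SqMap.tSq_idSq f (𝟙 Y)).tensor (SqMap.refl (idSq h))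
  have t₂ := SqMap.symm (a := tIso (tId X Y) (Iso.refl h)) (b := tIso (tId X' Y) (Iso.refl h)) t
  have t' : (tSq (tSq (idSq f) (idSq (𝟙 Y))) (idSq h).symm).hom =
      (tSq (tSq (idSq f).symm (idSq (𝟙 Y)).symm) (idSq h)).inv := by
    rw [tSq_inv]
    congr 2
    ext
    rw [Iso.symm_hom, tSq_inv]
    rfl
  have w : (inter (f ▹ Y) h).hom ≫ (tId X Y).inv ⊠₂ 𝟙 h ▷ f ▹ Y ▹ Z' =
      f ▹ Y ▹ Z ◁ (tId X' Y).inv ⊠₂ 𝟙 h ≫ (tSq (tSq (idSq f) (idSq (𝟙 Y))) (idSq h).symm).hom := by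
    rw [t', Iso.eq_comp_inv, Category.assoc, ← Iso.eq_inv_comp]
    exact t₂
  rw [SqMap, idSq_id] at s
  rw [idSq_id] at e
  simp only [asL_hom, asR_hom, whiskerLeft_comp, cellAt_comp, cellAt_whiskerLeft, cellAt_base,
    Category.assoc]
  rw [← whiskerLeft_comp, s, whiskerLeft_comp]
  have a := exch₁₁ ((tId X Y).inv ⊠₂ 𝟙 h) (as X Y Z' ◁ 𝟙 f ⊠₂ (tId Y Z').hom)
  have b := exch₂₂ (asNat (𝟙 X) (𝟙 Y) h).hom (𝟙 f ⊠₂ (tId Y Z').hom)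
  have c := exch₁₁ ((tId X Y).inv ⊠₂ 𝟙 h) (asNat f (𝟙 Y) (𝟙 Z')).hom
  have d := congrArg (· ⊳ as X' Y Z') w
  simp only [cellAt_comp, cellAt_whiskerRight, cellAt_whiskerLeft, cellAt_base] at d
  rw [idSq_id] at d
  rw [cellAt_whiskerRight, ← reassoc_of% a, ← b, ← reassoc_of% c, reassoc_of% d, reassoc_of% e]
  rfl

theorem tHom₂_leftUnitor_inv_comp : (λ_ (𝟙 X)).inv ⊠₂ (λ_ (𝟙 Y)).inv ≫
    (tComp (𝟙 X) (𝟙 X) (𝟙 Y) (𝟙 Y)).hom ≫ (tId X Y).hom ▷ 𝟙 X ⊠₁ 𝟙 Y = (λ_ _).inv := by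
  have h := tHom₂_leftUnitor (𝟙 X) (𝟙 Y)
  have h' := tHom₂_inv_hom (λ_ (𝟙 X)) (λ_ (𝟙 Y))
  rw [h] at h'
  rw [← cancel_mono (λ_ _).hom]
  simpa using h'

theorem rOn_wR (f : X ⟶ X') (g : X' ⟶ X'') (Y Z : B) : (wR f g Y).hom ▹₂ Z =
    (𝟙 (f ≫ g) ⊠₂ (λ_ (𝟙 Y)).inv) ⊠₂ (λ_ (𝟙 Z)).inv ≫
      (tComp f g (𝟙 Y) (𝟙 Y)).hom ⊠₂ 𝟙 (𝟙 Z ≫ 𝟙 Z) ≫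
      (tComp (f ▹ Y) (g ▹ Y) (𝟙 Z) (𝟙 Z)).hom := by
  simp only [rOn, ImgR.iso, Iso.trans_hom, whiskerLeftIso_hom, Iso.refl_hom, Iso.refl_inv,
    whiskerLeft_id, Category.comp_id, Category.id_comp, wR_hom, tHom₂_comp_assoc]

/-- Apart from naturality and compatibility of `asNat` with composition, the point is `y`:
identifying `𝟙 Y ⊠₁ 𝟙 Z` with an identity on each factor agrees with doing so on the composite. -/
theorem asL_comp (f : X ⟶ X') (g : X' ⟶ X'') (Y Z : B) :
    (asL (f ≫ g) Y Z).hom ≫ as X Y Z ◁ (wR f g (Y ⊠ Z)).hom =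
      ((wR f g Y).hom ▹₂ Z) ⊳ as X'' Y Z ≫ (f ▹ Y) ▹ Z ◁ (asL g Y Z).hom ≫
        (asL f Y Z).hom ⊳ (g ▹ (Y ⊠ Z)) := by
  have h := asNat_comp f g (𝟙 Y) (𝟙 Y) (𝟙 Z) (𝟙 Z)
  have n := asNat_naturality (𝟙 (f ≫ g)) (λ_ (𝟙 Y)).inv (λ_ (𝟙 Z)).inv
  have x := exch₂₂ (asNat f (𝟙 Y) (𝟙 Z)).hom (𝟙 g ⊠₂ (tId Y Z).hom)
  have y : (𝟙 (f ≫ g) ⊠₂ (λ_ (𝟙 Y)).inv ⊠₂ (λ_ (𝟙 Z)).inv) ≫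
      (𝟙 (f ≫ g) ⊠₂ (tComp (𝟙 Y) (𝟙 Y) (𝟙 Z) (𝟙 Z)).hom ≫ (tComp _ _ _ _).hom) ≫
      f ⊠₁ 𝟙 Y ⊠₁ 𝟙 Z ◁ 𝟙 g ⊠₂ (tId Y Z).hom ≫ 𝟙 f ⊠₂ (tId Y Z).hom ▷ g ▹ (Y ⊠ Z) =
      𝟙 (f ≫ g) ⊠₂ (tId Y Z).hom ≫ (wR f g (Y ⊠ Z)).hom := by
    have h1 := tComp_naturality_right f (𝟙 Y ⊠₁ 𝟙 Z) (𝟙 g) (tId Y Z).hom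
    have h2 := tComp_naturality_left (𝟙 f) (tId Y Z).hom g (𝟙 (Y ⊠ Z))
    rw [wR_hom, whisker_exchange]
    have h1' := tComp_naturality_left (𝟙 f) (tId Y Z).hom g (𝟙 Y ⊠₁ 𝟙 Z)
    have h2' := tComp_naturality_right f (𝟙 (Y ⊠ Z)) (𝟙 g) (tId Y Z).hom
    simp only [Category.assoc, ← reassoc_of% h1', ← h2', tHom₂_comp_assoc]
    congr 2
    · simp
    · rw [reassoc_of% tHom₂_leftUnitor_inv_comp, leftUnitor_inv_naturality]
  simp only [asL_hom, whiskerLeft_comp, cellAt_comp, cellAt_whiskerLeft, cellAt_base,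
    Category.assoc, rOn_wR]
  rw [← reassoc_of% x]
  rw [← whiskerLeft_comp, ← y, whiskerLeft_comp, whiskerLeft_comp, ← reassoc_of% n, reassoc_of% h]
  simp [cellAt, Glue.iso]

theorem rOn_wL (X : B) (f : Y ⟶ Y') (g : Y' ⟶ Y'') (Z : B) : (wL X f g).hom ▹₂ Z =
    ((λ_ (𝟙 X)).inv ⊠₂ 𝟙 (f ≫ g)) ⊠₂ (λ_ (𝟙 Z)).inv ≫
      (tComp (𝟙 X) (𝟙 X) f g).hom ⊠₂ 𝟙 (𝟙 Z ≫ 𝟙 Z) ≫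
      (tComp (X ◃ f) (X ◃ g) (𝟙 Z) (𝟙 Z)).hom := by
  simp only [rOn, ImgR.iso, Iso.trans_hom, whiskerLeftIso_hom, Iso.refl_hom, Iso.refl_inv,
    whiskerLeft_id, Category.comp_id, Category.id_comp, wR_hom, wL_hom, tHom₂_comp_assoc]

theorem lOn_wR (X : B) (f : Y ⟶ Y') (g : Y' ⟶ Y'') (Z : B) : X ◃₂ (wR f g Z).hom =
    (λ_ (𝟙 X)).inv ⊠₂ (𝟙 (f ≫ g) ⊠₂ (λ_ (𝟙 Z)).inv) ≫
      𝟙 (𝟙 X ≫ 𝟙 X) ⊠₂ (tComp f g (𝟙 Z) (𝟙 Z)).hom ≫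
      (tComp (𝟙 X) (𝟙 X) (f ▹ Z) (g ▹ Z)).hom := by
  simp only [lOn, ImgL.iso, Iso.trans_hom, whiskerLeftIso_hom, Iso.refl_hom, Iso.refl_inv,
    whiskerLeft_id, Category.comp_id, Category.id_comp, wR_hom, wL_hom, tHom₂_comp_assoc]

theorem lOn_wL (X Y : B) (f : Z ⟶ Z') (g : Z' ⟶ Z'') : X ◃₂ (wL Y f g).hom =
    (λ_ (𝟙 X)).inv ⊠₂ ((λ_ (𝟙 Y)).inv ⊠₂ 𝟙 (f ≫ g)) ≫
      𝟙 (𝟙 X ≫ 𝟙 X) ⊠₂ (tComp (𝟙 Y) (𝟙 Y) f g).hom ≫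
      (tComp (𝟙 X) (𝟙 X) (Y ◃ f) (Y ◃ g)).hom := by
  simp only [lOn, ImgL.iso, Iso.trans_hom, whiskerLeftIso_hom, Iso.refl_hom, Iso.refl_inv,
    whiskerLeft_id, Category.comp_id, Category.id_comp, wL_hom, tHom₂_comp_assoc]

theorem asM_comp (X : B) (f : Y ⟶ Y') (g : Y' ⟶ Y'') (Z : B) :
    (asM X (f ≫ g) Z).hom ≫ as X Y Z ◁ (X ◃₂ (wR f g Z).hom) =
      ((wL X f g).hom ▹₂ Z) ⊳ as X Y'' Z ≫ (X ◃ f) ▹ Z ◁ (asM X g Z).hom ≫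
        (asM X f Z).hom ⊳ (X ◃ (g ▹ Z)) := by
  have h := asNat_comp (𝟙 X) (𝟙 X) f g (𝟙 Z) (𝟙 Z)
  have n := asNat_naturality (λ_ (𝟙 X)).inv (𝟙 (f ≫ g)) (λ_ (𝟙 Z)).inv
  simp only [asM, rOn_wL, lOn_wR, whiskerLeft_comp]
  rw [whiskerLeft_comp] at h
  rw [← reassoc_of% n, h]
  simp [cellAt, Glue.iso]

theorem asR_comp (X Y : B) (f : Z ⟶ Z') (g : Z' ⟶ Z'') :
    (asR X Y (f ≫ g)).hom ≫ as X Y Z ◁ (X ◃₂ (wL Y f g).hom) =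
      (wL (X ⊠ Y) f g).hom ⊳ as X Y Z'' ≫ (X ⊠ Y) ◃ f ◁ (asR X Y g).hom ≫
        (asR X Y f).hom ⊳ (X ◃ (Y ◃ g)) := by
  have h := asNat_comp (𝟙 X) (𝟙 X) (𝟙 Y) (𝟙 Y) f g
  have n := asNat_naturality (λ_ (𝟙 X)).inv (λ_ (𝟙 Y)).inv (𝟙 (f ≫ g))
  have y : ((λ_ (𝟙 X)).inv ⊠₂ (λ_ (𝟙 Y)).inv) ⊠₂ 𝟙 (f ≫ g) ≫
      ((tComp (𝟙 X) (𝟙 X) (𝟙 Y) (𝟙 Y)).hom ⊠₂ 𝟙 (f ≫ g) ≫ (tComp _ _ _ _).hom) ≫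
      (𝟙 X ⊠₁ 𝟙 Y) ⊠₁ f ◁ (tId X Y).hom ⊠₂ 𝟙 g ≫ (tId X Y).hom ⊠₂ 𝟙 f ▷ (X ⊠ Y) ◃ g =
      (tId X Y).hom ⊠₂ 𝟙 (f ≫ g) ≫ (wL (X ⊠ Y) f g).hom := by
    rw [wL_hom, whisker_exchange]
    have h1' := tComp_naturality_left (tId X Y).hom (𝟙 f) (𝟙 X ⊠₁ 𝟙 Y) g
    have h2' := tComp_naturality_right (𝟙 (X ⊠ Y)) f (tId X Y).hom (𝟙 g)
    simp only [Category.assoc, ← reassoc_of% h1', ← h2', tHom₂_comp_assoc]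
    congr 2
    · rw [reassoc_of% tHom₂_leftUnitor_inv_comp, leftUnitor_inv_naturality]
    · simp
  have z : ∀ {W W' : B} (k : W ⟶ W'), (tId X Y).inv ⊠₂ 𝟙 k ≫ (tId X Y).hom ⊠₂ 𝟙 k = 𝟙 _ :=
    fun k => tHom₂_inv_hom (tId X Y) (Iso.refl k)
  have y' : (tId X Y).inv ⊠₂ 𝟙 (f ≫ g) ≫ ((λ_ (𝟙 X)).inv ⊠₂ (λ_ (𝟙 Y)).inv) ⊠₂ 𝟙 (f ≫ g) ≫
      (tComp (𝟙 X) (𝟙 X) (𝟙 Y) (𝟙 Y)).hom ⊠₂ 𝟙 (f ≫ g) ≫ (tComp _ _ _ _).hom =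
      (wL (X ⊠ Y) f g).hom ≫ (X ⊠ Y) ◃ f ◁ (tId X Y).inv ⊠₂ 𝟙 g ≫
        (tId X Y).inv ⊠₂ 𝟙 f ▷ (𝟙 X ⊠₁ 𝟙 Y) ⊠₁ g := by
    rw [← cancel_mono ((𝟙 X ⊠₁ 𝟙 Y) ⊠₁ f ◁ (tId X Y).hom ⊠₂ 𝟙 g ≫
      (tId X Y).hom ⊠₂ 𝟙 f ▷ (X ⊠ Y) ◃ g)]
    simp only [Category.assoc] at y ⊢
    rw [y, reassoc_of% (z (f ≫ g)), ← whisker_exchange_assoc, ← whiskerLeft_comp_assoc, z,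
      whiskerLeft_id, Category.id_comp, ← comp_whiskerRight, z]
    simp
  have x := exch₁₁ ((tId X Y).inv ⊠₂ 𝟙 f) (asNat (𝟙 X) (𝟙 Y) g).hom
  have y'' := congrArg (· ⊳ as X Y Z'') y'
  simp only [cellAt_comp, cellAt_whiskerRight, cellAt_whiskerLeft, cellAt_base] at y''
  simp only [asR_hom, lOn_wL, whiskerLeft_comp, cellAt_comp, cellAt_whiskerRight, Category.assoc]
  rw [whiskerLeft_comp] at h
  rw [← reassoc_of% n, h, ← reassoc_of% x]
  rw [← reassoc_of% y'']
  simp [cellAt, Glue.iso]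

end Cubical

/-! ### Naturality of the pentagon and the triangles in each variable -/

section

variable {B : Type u} [Bicategory.{w, v} B]

theorem pasteSq_path₂ {X X₁ X₂ Y Y₁ Y₂ : B} {F : X ⟶ Y} {F₁ : X₁ ⟶ Y₁} {F₂ : X₂ ⟶ Y₂}
    {p : X ⟶ X₁} {p' : Y ⟶ Y₁} {q : X₁ ⟶ X₂} {q' : Y₁ ⟶ Y₂} {r : X ⟶ X₂} {r' : Y ⟶ Y₂}
    {m : p' ≫ q' ⟶ r'} {n : p ≫ q ⟶ r} {a : F ≫ r' ≅ r ≫ F₂} {b₁ : F ≫ p' ≅ p ≫ F₁}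
    {b₂ : F₁ ≫ q' ≅ q ≫ F₂} (h : F ◁ m ≫ a.hom = (pasteSq b₁ b₂).hom ≫ n ▷ F₂) :
    F ◁ m ≫ a.hom = b₁.hom ⊳ q' ≫ p ◁ b₂.hom ≫ n ⊳ F₂ := by
  rw [h]
  simp [pasteSq, cellAt, Glue.iso]

theorem pasteSq_path₃ {X X₁ X₂ X₃ Y Y₁ Y₂ Y₃ : B} {F : X ⟶ Y} {F₁ : X₁ ⟶ Y₁} {F₂ : X₂ ⟶ Y₂}
    {F₃ : X₃ ⟶ Y₃} {G : X₃ ⟶ X₂} {G' : Y₃ ⟶ Y₂} {p : X ⟶ X₁} {p' : Y ⟶ Y₁} {q : X₁ ⟶ X₃}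
    {q' : Y₁ ⟶ Y₃} {X₄ Y₄ : B} {F₄ : X₄ ⟶ Y₄} {s : X ⟶ X₄} {s' : Y ⟶ Y₄} {t : X₄ ⟶ X₂}
    {t' : Y₄ ⟶ Y₂} {m : p' ≫ q' ≫ G' ⟶ s' ≫ t'} {n : p ≫ q ≫ G ⟶ s ≫ t}
    {a₁ : F ≫ s' ≅ s ≫ F₄} {a₂ : F₄ ≫ t' ≅ t ≫ F₂} {b₁ : F ≫ p' ≅ p ≫ F₁}
    {b₂ : F₁ ≫ q' ≅ q ≫ F₃} {b₃ : F₃ ≫ G' ≅ G ≫ F₂}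
    (h : F ◁ m ≫ (pasteSq a₁ a₂).hom = (pasteSq b₁ (pasteSq b₂ b₃)).hom ≫ n ▷ F₂) :
    F ◁ m ≫ a₁.hom ⊳ t' ≫ s ◁ a₂.hom =
      b₁.hom ⊳ (q' ≫ G') ≫ p ◁ b₂.hom ⊳ G' ≫ p ◁ q ◁ b₃.hom ≫ n ⊳ F₂ := by
  rw [← cancel_mono (α_ s t F₂).inv]
  have e : (a₁.hom ⊳ t' ≫ s ◁ a₂.hom) ≫ (α_ s t F₂).inv = (pasteSq a₁ a₂).hom := by
    simp [pasteSq, cellAt, Glue.iso]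
  rw [Category.assoc, e, h]
  simp [pasteSq, cellAt, Glue.iso]

end

section Modifications

open MonoidalStruct

variable {B : Type u} [Bicategory.{w, v} B] [MonoidalBicategory B]

variable {X X' Y Y' Z Z' W W' : B}

/-- The modification axiom is used with identities in all variables but one. At identities the
constraint squares differ from `asL`, `inter` and their analogues only by comparison cells, which
form maps of squares; `SqMap.transport` carries the axiom along them. The variants for other
variables and for the triangles follow the same scheme. -/
theorem pent_naturality₁ (f : X ⟶ X') (Y Z W : B) :
    ((f ▹ Y) ▹ Z) ▹ W ◁ (pent X' Y Z W).hom ≫ (asL (f ▹ Y) Z W).hom ⊳ as X' Y (Z ⊠ W) ≫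
        as (X ⊠ Y) Z W ◁ (asL f Y (Z ⊠ W)).hom =
      ((asL f Y Z).hom ▹₂ W) ⊳ (as X' (Y ⊠ Z) W ≫ X' ◃ as Y Z W) ≫
        as X Y Z ▹ W ◁ (asL f (Y ⊠ Z) W).hom ⊳ (X' ◃ as Y Z W) ≫
        as X Y Z ▹ W ◁ as X (Y ⊠ Z) W ◁ (inter f (as Y Z W)).hom ≫
        (pent X Y Z W).hom ⊳ (f ▹ (Y ⊠ Z ⊠ W)) := by
  have n := pent_naturality f (𝟙 Y) (𝟙 Z) (𝟙 W)
  have hA : SqMap (pasteSq (asNat (f ⊠₁ 𝟙 Y) (𝟙 Z) (𝟙 W)) (asNat f (𝟙 Y) (𝟙 Z ⊠₁ 𝟙 W)))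
      (pasteSq (asL (f ▹ Y) Z W) (asL f Y (Z ⊠ W))) (𝟙 _)
      (𝟙 f ⊠₂ (𝟙 (𝟙 Y) ⊠₂ (tId Z W).hom) ≫ 𝟙 f ⊠₂ (tId _ _).hom) := by
    refine SqMap.paste (SqMap.asL (f ▹ Y) Z W)
      (((SqMap.asNat (𝟙 f) (𝟙 (𝟙 Y)) (tId Z W).hom).comp (SqMap.asL f Y (Z ⊠ W))).congr ?_ rfl)
    rw [tHom₂_id, Category.comp_id]
  have hC : SqMap (pasteSq (tSq (asNat f (𝟙 Y) (𝟙 Z)) (idSq (𝟙 W)))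
      (pasteSq (asNat f (𝟙 Y ⊠₁ 𝟙 Z) (𝟙 W)) (tSq (idSq f) (asNat (𝟙 Y) (𝟙 Z) (𝟙 W)))))
      (pasteSq (tSq (asL f Y Z) (idSq (𝟙 W)))
      (pasteSq (asL f (Y ⊠ Z) W) (tSq (idSq f) (idSq (as Y Z W)).symm))) (𝟙 _)
      (𝟙 f ⊠₂ (𝟙 (𝟙 Y) ⊠₂ (tId Z W).hom) ≫ 𝟙 f ⊠₂ (tId _ _).hom) := by
    refine SqMap.paste (((SqMap.asL f Y Z).tensor (SqMap.refl _)).congr (by rw [tHom₂_id]) rfl)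
      (SqMap.paste (((SqMap.asNat (𝟙 f) (tId Y Z).hom (𝟙 (𝟙 W))).comp
        (SqMap.asL f (Y ⊠ Z) W)).congr (Category.comp_id _) rfl)
        (((SqMap.refl (idSq f)).tensor (SqMap.asNat_id Y Z W)).congr ?_ ?_))
    · rw [← tHom₂_comp, Category.comp_id]
    · rw [← tHom₂_comp, Category.comp_id]
  have := pasteSq_path₃ (SqMap.transport n hA hC)
  rw [← inter_eq, idSq_id] at this
  rw [← rOn_square]
  exact this

theorem pent_naturality₂ (X : B) (g : Y ⟶ Y') (Z W : B) :
    ((X ◃ g) ▹ Z) ▹ W ◁ (pent X Y' Z W).hom ≫ (asL (X ◃ g) Z W).hom ⊳ as X Y' (Z ⊠ W) ≫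
        as (X ⊠ Y) Z W ◁ (asM X g (Z ⊠ W)).hom =
      ((asM X g Z).hom ▹₂ W) ⊳ (as X (Y' ⊠ Z) W ≫ X ◃ as Y' Z W) ≫
        as X Y Z ▹ W ◁ (asM X (g ▹ Z) W).hom ⊳ (X ◃ as Y' Z W) ≫
        as X Y Z ▹ W ◁ as X (Y ⊠ Z) W ◁ (X ◃₂ (asL g Z W).hom) ≫
        (pent X Y Z W).hom ⊳ (X ◃ (g ▹ (Z ⊠ W))) := by
  have n := pent_naturality (𝟙 X) g (𝟙 Z) (𝟙 W)
  have hA : SqMap (pasteSq (asNat (𝟙 X ⊠₁ g) (𝟙 Z) (𝟙 W)) (asNat (𝟙 X) g (𝟙 Z ⊠₁ 𝟙 W)))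
      (pasteSq (asL (X ◃ g) Z W) (asM X g (Z ⊠ W))) (𝟙 _)
      (𝟙 (𝟙 X) ⊠₂ (𝟙 g ⊠₂ (tId Z W).hom)) := by
    refine SqMap.paste (SqMap.asL (X ◃ g) Z W)
      ((SqMap.asNat (𝟙 (𝟙 X)) (𝟙 g) (tId Z W).hom).congr ?_ rfl)
    rw [tHom₂_id]
  have hC : SqMap (pasteSq (tSq (asNat (𝟙 X) g (𝟙 Z)) (idSq (𝟙 W)))
      (pasteSq (asNat (𝟙 X) (g ⊠₁ 𝟙 Z) (𝟙 W)) (tSq (idSq (𝟙 X)) (asNat g (𝟙 Z) (𝟙 W)))))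
      (pasteSq (tSq (asM X g Z) (idSq (𝟙 W)))
      (pasteSq (asM X (g ▹ Z) W) (tSq (idSq (𝟙 X)) (asL g Z W)))) (𝟙 _)
      (𝟙 (𝟙 X) ⊠₂ (𝟙 g ⊠₂ (tId Z W).hom)) :=
    SqMap.paste (SqMap.refl _) (SqMap.paste (SqMap.refl _)
      (((SqMap.refl _).tensor (SqMap.asL g Z W)).congr (by rw [tHom₂_id]) rfl))
  have := pasteSq_path₃ (SqMap.transport n hA hC)
  rw [idSq_id, idSq_id] at this
  rw [← rOn_square, ← lOn_square]
  exact this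

theorem pent_naturality₃ (X Y : B) (h : Z ⟶ Z') (W : B) :
    ((X ⊠ Y) ◃ h) ▹ W ◁ (pent X Y Z' W).hom ≫ (asM (X ⊠ Y) h W).hom ⊳ as X Y (Z' ⊠ W) ≫
        as (X ⊠ Y) Z W ◁ (asR X Y (h ▹ W)).hom =
      ((asR X Y h).hom ▹₂ W) ⊳ (as X (Y ⊠ Z') W ≫ X ◃ as Y Z' W) ≫
        as X Y Z ▹ W ◁ (asM X (Y ◃ h) W).hom ⊳ (X ◃ as Y Z' W) ≫
        as X Y Z ▹ W ◁ as X (Y ⊠ Z) W ◁ (X ◃₂ (asM Y h W).hom) ≫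
        (pent X Y Z W).hom ⊳ (X ◃ (Y ◃ (h ▹ W))) := by
  have n := pent_naturality (𝟙 X) (𝟙 Y) h (𝟙 W)
  have hA : SqMap (pasteSq (asNat (𝟙 X ⊠₁ 𝟙 Y) h (𝟙 W)) (asNat (𝟙 X) (𝟙 Y) (h ⊠₁ 𝟙 W)))
      (pasteSq (asM (X ⊠ Y) h W) (asR X Y (h ▹ W))) (((tId X Y).hom ⊠₂ 𝟙 h) ⊠₂ 𝟙 (𝟙 W))
      (𝟙 _) := by
    refine SqMap.paste (SqMap.asNat (tId X Y).hom (𝟙 h) (𝟙 (𝟙 W)))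
      ((SqMap.asR (h ▹ W) X Y).congr ?_ rfl)
    rw [tHom₂_id]
  have hC : SqMap (pasteSq (tSq (asNat (𝟙 X) (𝟙 Y) h) (idSq (𝟙 W)))
      (pasteSq (asNat (𝟙 X) (𝟙 Y ⊠₁ h) (𝟙 W)) (tSq (idSq (𝟙 X)) (asNat (𝟙 Y) h (𝟙 W)))))
      (pasteSq (tSq (asR X Y h) (idSq (𝟙 W)))
      (pasteSq (asM X (Y ◃ h) W) (tSq (idSq (𝟙 X)) (asM Y h W))))
      (((tId X Y).hom ⊠₂ 𝟙 h) ⊠₂ 𝟙 (𝟙 W)) (𝟙 _) :=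
    SqMap.paste (((SqMap.asR h X Y).tensor (SqMap.refl _)).congr rfl (by rw [tHom₂_id]))
      (SqMap.paste (SqMap.refl _) (SqMap.refl _))
  have := pasteSq_path₃ (SqMap.transport n hA hC)
  rw [idSq_id, idSq_id] at this
  rw [← rOn_square, ← lOn_square]
  exact this

theorem pent_naturality₄ (X Y Z : B) (k : W ⟶ W') :
    ((X ⊠ Y) ⊠ Z) ◃ k ◁ (pent X Y Z W').hom ≫ (asR (X ⊠ Y) Z k).hom ⊳ as X Y (Z ⊠ W') ≫
        as (X ⊠ Y) Z W ◁ (asR X Y (Z ◃ k)).hom =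
      (inter (as X Y Z) k).inv ⊳ (as X (Y ⊠ Z) W' ≫ X ◃ as Y Z W') ≫
        as X Y Z ▹ W ◁ (asR X (Y ⊠ Z) k).hom ⊳ (X ◃ as Y Z W') ≫
        as X Y Z ▹ W ◁ as X (Y ⊠ Z) W ◁ (X ◃₂ (asR Y Z k).hom) ≫
        (pent X Y Z W).hom ⊳ (X ◃ (Y ◃ (Z ◃ k))) := by
  have n := pent_naturality (𝟙 X) (𝟙 Y) (𝟙 Z) k
  have hA : SqMap (pasteSq (asNat (𝟙 X ⊠₁ 𝟙 Y) (𝟙 Z) k) (asNat (𝟙 X) (𝟙 Y) (𝟙 Z ⊠₁ k)))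
      (pasteSq (asR (X ⊠ Y) Z k) (asR X Y (Z ◃ k)))
      (((tId X Y).hom ⊠₂ 𝟙 (𝟙 Z) ≫ (tId _ _).hom) ⊠₂ 𝟙 k) (𝟙 _) := by
    refine SqMap.paste (((SqMap.asNat (tId X Y).hom (𝟙 (𝟙 Z)) (𝟙 k)).comp
      (SqMap.asR k (X ⊠ Y) Z)).congr ?_ (Category.comp_id _))
      ((SqMap.asR (Z ◃ k) X Y).congr ?_ rfl)
    · rw [← tHom₂_comp, Category.comp_id]
    · rw [tHom₂_id]
  have hC : SqMap (pasteSq (tSq (asNat (𝟙 X) (𝟙 Y) (𝟙 Z)) (idSq k))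
      (pasteSq (asNat (𝟙 X) (𝟙 Y ⊠₁ 𝟙 Z) k) (tSq (idSq (𝟙 X)) (asNat (𝟙 Y) (𝟙 Z) k))))
      (pasteSq (tSq (idSq (as X Y Z)).symm (idSq k))
      (pasteSq (asR X (Y ⊠ Z) k) (tSq (idSq (𝟙 X)) (asR Y Z k))))
      (((tId X Y).hom ⊠₂ 𝟙 (𝟙 Z) ≫ (tId _ _).hom) ⊠₂ 𝟙 k) (𝟙 _) := by
    refine SqMap.paste ((SqMap.asNat_id X Y Z).tensor (SqMap.refl _))
      (SqMap.paste (((SqMap.asNat (𝟙 (𝟙 X)) (tId Y Z).hom (𝟙 k)).comp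
        (SqMap.asR k X (Y ⊠ Z))).congr ?_ (Category.comp_id _))
      (((SqMap.refl (idSq (𝟙 X))).tensor (SqMap.asR k Y Z)).congr rfl ?_))
    · rw [← tHom₂_comp, Category.comp_id]
    · rw [tHom₂_id]
  have := pasteSq_path₃ (SqMap.transport n hA hC)
  rw [← inter_symm, idSq_id] at this
  rw [← lOn_square]
  exact this

theorem midTri_naturality₁ (f : X ⟶ X') (Y : B) :
    (f ▹ unitObj B) ▹ Y ◁ (midTri X' Y).hom ≫ (ruNat f).hom ▹₂ Y =
      (asL f (unitObj B) Y).hom ⊳ (X' ◃ lu Y) ≫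
        as X (unitObj B) Y ◁ (inter f (lu Y)).hom ≫ (midTri X Y).hom ⊳ (f ▹ Y) := by
  have n := midTri_naturality f (𝟙 Y)
  have hA : SqMap (tSq (ruNat f) (idSq (𝟙 Y))) _ (𝟙 _) (𝟙 _) := SqMap.refl _
  have hC : SqMap (pasteSq (asNat f (𝟙 (unitObj B)) (𝟙 Y)) (tSq (idSq f) (luNat (𝟙 Y))))
      (pasteSq (asL f (unitObj B) Y) (tSq (idSq f) (idSq (lu Y)).symm)) (𝟙 _) (𝟙 _) :=
    SqMap.paste (SqMap.asL f (unitObj B) Y)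
      (((SqMap.refl (idSq f)).tensor (SqMap.luNat_id Y)).congr rfl (by rw [tHom₂_id]))
  have := pasteSq_path₂ (SqMap.transport n hA hC)
  rw [← inter_eq, idSq_id] at this
  rw [← rOn_square]
  exact this

theorem midTri_naturality₂ (X : B) (g : Y ⟶ Y') :
    (X ⊠ unitObj B) ◃ g ◁ (midTri X Y').hom ≫ (inter (ru X) g).inv =
      (asR X (unitObj B) g).hom ⊳ (X ◃ lu Y') ≫
        as X (unitObj B) Y ◁ (X ◃₂ (luNat g).hom) ≫ (midTri X Y).hom ⊳ (X ◃ g) := by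
  have n := midTri_naturality (𝟙 X) g
  have hA : SqMap (tSq (ruNat (𝟙 X)) (idSq g)) (tSq (idSq (ru X)).symm (idSq g))
      ((tId X _).hom ⊠₂ 𝟙 g) (𝟙 _) :=
    ((SqMap.ruNat_id X).tensor (SqMap.refl (idSq g))).congr rfl (by rw [tHom₂_id])
  have hC : SqMap (pasteSq (asNat (𝟙 X) (𝟙 (unitObj B)) g) (tSq (idSq (𝟙 X)) (luNat g)))
      (pasteSq (asR X (unitObj B) g) (tSq (idSq (𝟙 X)) (luNat g))) ((tId X _).hom ⊠₂ 𝟙 g) (𝟙 _) :=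
    SqMap.paste (SqMap.asR g X (unitObj B)) (SqMap.refl _)
  have := pasteSq_path₂ (SqMap.transport n hA hC)
  rw [← inter_symm, idSq_id] at this
  rw [← lOn_square]
  exact this

theorem leftTri_naturality₁ (f : X ⟶ X') (Y : B) :
    (unitObj B ◃ f) ▹ Y ◁ (leftTri X' Y).hom ≫ (luNat f).hom ▹₂ Y =
      (asM (unitObj B) f Y).hom ⊳ lu (X' ⊠ Y) ≫
        as (unitObj B) X Y ◁ (luNat (f ▹ Y)).hom ≫ (leftTri X Y).hom ⊳ (f ▹ Y) := by
  have := pasteSq_path₂ (leftTri_naturality f (𝟙 Y))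
  rw [idSq_id] at this
  rw [← rOn_square]
  exact this

theorem leftTri_naturality₂ (X : B) (g : Y ⟶ Y') :
    (unitObj B ⊠ X) ◃ g ◁ (leftTri X Y').hom ≫ (inter (lu X) g).inv =
      (asR (unitObj B) X g).hom ⊳ lu (X ⊠ Y') ≫
        as (unitObj B) X Y ◁ (luNat (X ◃ g)).hom ≫ (leftTri X Y).hom ⊳ (X ◃ g) := by
  have n := leftTri_naturality (𝟙 X) g
  have hA : SqMap (tSq (luNat (𝟙 X)) (idSq g)) (tSq (idSq (lu X)).symm (idSq g))
      ((tId _ X).hom ⊠₂ 𝟙 g) (𝟙 _) :=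
    ((SqMap.luNat_id X).tensor (SqMap.refl (idSq g))).congr rfl (by rw [tHom₂_id])
  have hC : SqMap (pasteSq (asNat (𝟙 (unitObj B)) (𝟙 X) g) (luNat (X ◃ g)))
      (pasteSq (asR (unitObj B) X g) (luNat (X ◃ g))) ((tId _ X).hom ⊠₂ 𝟙 g) (𝟙 _) :=
    SqMap.paste (SqMap.asR g (unitObj B) X) (SqMap.refl _)
  have := pasteSq_path₂ (SqMap.transport n hA hC)
  rw [← inter_symm] at this
  exact this

theorem rightTri_naturality₁ (f : X ⟶ X') (Y : B) :
    (f ▹ Y) ▹ unitObj B ◁ (rightTri X' Y).hom ≫ (ruNat (f ▹ Y)).hom =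
      (asL f Y (unitObj B)).hom ⊳ (X' ◃ ru Y) ≫
        as X Y (unitObj B) ◁ (inter f (ru Y)).hom ≫ (rightTri X Y).hom ⊳ (f ▹ Y) := by
  have n := rightTri_naturality f (𝟙 Y)
  have hA : SqMap (ruNat (f ▹ Y)) _ (𝟙 _) (𝟙 _) := SqMap.refl _
  have hC : SqMap (pasteSq (asNat f (𝟙 Y) (𝟙 (unitObj B))) (tSq (idSq f) (ruNat (𝟙 Y))))
      (pasteSq (asL f Y (unitObj B)) (tSq (idSq f) (idSq (ru Y)).symm)) (𝟙 _) (𝟙 _) :=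
    SqMap.paste (SqMap.asL f Y (unitObj B))
      (((SqMap.refl (idSq f)).tensor (SqMap.ruNat_id Y)).congr rfl (by rw [tHom₂_id]))
  have := pasteSq_path₂ (SqMap.transport n hA hC)
  rw [← inter_eq] at this
  exact this

theorem rightTri_naturality₂ (X : B) (g : Y ⟶ Y') :
    (X ◃ g) ▹ unitObj B ◁ (rightTri X Y').hom ≫ (ruNat (X ◃ g)).hom =
      (asM X g (unitObj B)).hom ⊳ (X ◃ ru Y') ≫
        as X Y (unitObj B) ◁ (X ◃₂ (ruNat g).hom) ≫ (rightTri X Y).hom ⊳ (X ◃ g) := by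
  have := pasteSq_path₂ (rightTri_naturality (𝟙 X) g)
  rw [idSq_id] at this
  rw [← lOn_square]
  exact this

end Modifications

/-! ### Naturality cells along right-associated composites -/

section PathNaturality

variable {B : Type u} [Bicategory.{w, v} B]

/-- A naturality square with two of its sides replaced by right-associated composites. -/
def natPath {X Y X' Y' : B} {F F' : X ⟶ Y} {b : Y ⟶ Y'} {a : X ⟶ X'} {G G' : X' ⟶ Y'}
    (n : F ≫ b ≅ a ≫ G) (i : F ≅ F') (j : G ≅ G') {Fb : X ⟶ Y'} [Glue F' b Fb] : Fb ≅ a ≫ G' :=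
  (Glue.iso (f := F') (k := b)).symm ≪≫ whiskerRightIso i.symm b ≪≫ n ≪≫ whiskerLeftIso a j

theorem natPath_refl {X Y X' Y' : B} {F : X ⟶ Y} {b : Y ⟶ Y'} {a : X ⟶ X'} {G : X' ⟶ Y'}
    (n : F ≫ b ≅ a ≫ G) : natPath n (Iso.refl F) (Iso.refl G) = n := by
  ext
  simp [natPath, Glue.iso]

section

variable {X Y Z X' Y' Z' : B} {a : X ⟶ X'} {b : Y ⟶ Y'} {c : Z ⟶ Z'}
  {Fe : X ⟶ Y} {Ff Ff' : Y ⟶ Z} {Fef : X ⟶ Z} {Ge : X' ⟶ Y'} {Gf Gf' : Y' ⟶ Z'} {Gef : X' ⟶ Z'}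
  {ne : Fe ≫ b ≅ a ≫ Ge} {nf : Ff ≫ c ≅ b ≫ Gf} {nef : Fef ≫ c ≅ a ≫ Gef}
  {φ : Fef ≅ Fe ≫ Ff} {ψ : Gef ≅ Ge ≫ Gf}

/-- The inductive step: the naturality cell of a path is that of its tail pasted with that of its
first factor. The hypothesis `h` is the composition law of the constraint under consideration. -/
theorem natPath_comp (h : nef.hom ≫ a ◁ ψ.hom = φ.hom ⊳ c ≫ Fe ◁ nf.hom ≫ ne.hom ⊳ Gf)
    (i : Ff ≅ Ff') (j : Gf ≅ Gf') {Fc : Y ⟶ Z'} [Glue Ff' c Fc] :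
    (natPath nef (φ ≪≫ whiskerLeftIso Fe i) (ψ ≪≫ whiskerLeftIso Ge j)).hom =
      Fe ◁ (natPath nf i j).hom ≫ ne.hom ⊳ Gf' := by
  have h' : nef.hom = φ.hom ⊳ c ≫ Fe ◁ nf.hom ≫ ne.hom ⊳ Gf ≫ a ◁ ψ.inv := by
    rw [← reassoc_of% h]
    simp
  have x := exch₂₂ ne.hom j.hom
  simp only [cellAt, Glue.iso, Iso.trans_hom, Iso.trans_inv, whiskerLeftIso_hom,
    whiskerLeftIso_inv, Iso.refl_hom, Iso.refl_inv, whiskerLeft_id, Category.id_comp,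
    Category.comp_id, Category.assoc] at x
  simp [natPath, cellAt, Glue.iso, h', x]

theorem natPath_comp_inv (h : nef.hom ≫ a ◁ ψ.hom = φ.hom ⊳ c ≫ Fe ◁ nf.hom ≫ ne.hom ⊳ Gf)
    (i : Ff ≅ Ff') (j : Gf ≅ Gf') {Fc : Y ⟶ Z'} [Glue Ff' c Fc] :
    (natPath nef (φ ≪≫ whiskerLeftIso Fe i) (ψ ≪≫ whiskerLeftIso Ge j)).inv =
      ne.inv ⊳ Gf' ≫ Fe ◁ (natPath nf i j).inv := by
  rw [← cancel_epi (natPath nef (φ ≪≫ whiskerLeftIso Fe i) (ψ ≪≫ whiskerLeftIso Ge j)).hom,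
    Iso.hom_inv_id, natPath_comp h]
  simp

end

section

variable {X Y X' Y' : B} {a : X ⟶ X'} {b : Y ⟶ Y'} {F₁ F₂ F₁' F₂' : X ⟶ Y}
  {G₁ G₂ G₁' G₂' : X' ⟶ Y'} {n₁ : F₁ ≫ b ≅ a ≫ G₁} {n₂ : F₂ ≫ b ≅ a ≫ G₂} {η : F₁ ⟶ F₂}
  {θ : G₁ ⟶ G₂} {η' : F₁' ⟶ F₂'} {θ' : G₁' ⟶ G₂'} {i₁ : F₁ ≅ F₁'} {i₂ : F₂ ≅ F₂'} {j₁ : G₁ ≅ G₁'}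
  {j₂ : G₂ ≅ G₂'}

theorem natPath_naturality (h : SqMap n₁ n₂ η θ) (hη : i₁.inv ≫ η ≫ i₂.hom = η')
    (hθ : j₁.inv ≫ θ ≫ j₂.hom = θ') {k₁ k₂ : X ⟶ Y'} [Glue F₁' b k₁] [Glue F₂' b k₂] :
    η' ⊳ b ≫ (natPath n₂ i₂ j₂).hom = (natPath n₁ i₁ j₁).hom ≫ a ◁ θ' := by
  subst hη hθ
  unfold SqMap at h
  simp [natPath, cellAt, reassoc_of% h]

theorem natPath_naturality_inv (h : SqMap n₁ n₂ η θ) (hη : i₁.inv ≫ η ≫ i₂.hom = η')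
    (hθ : j₁.inv ≫ θ ≫ j₂.hom = θ') {k₁ k₂ : X ⟶ Y'} [Glue F₁' b k₁] [Glue F₂' b k₂] :
    a ◁ θ' ≫ (natPath n₂ i₂ j₂).inv = (natPath n₁ i₁ j₁).inv ≫ η' ⊳ b := by
  rw [Iso.comp_inv_eq, Category.assoc, natPath_naturality h hη hθ, Iso.inv_hom_id_assoc]

end

end PathNaturality

/-! ### The constraint cells for right-associated composites -/

section

variable {B : Type u} [Bicategory.{w, v} B] [MonoidalBicategory B]


section

variable {X X' X'' : B} (Y Z : B)

/-- `asL` for right-associated composites. -/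
def asLp (f : X ⟶ X') (Y Z : B) {f₁ : X ⊠ Y ⟶ X' ⊠ Y} {f₂ : (X ⊠ Y) ⊠ Z ⟶ (X' ⊠ Y) ⊠ Z}
    {f₃ : X ⊠ (Y ⊠ Z) ⟶ X' ⊠ (Y ⊠ Z)} {k : (X ⊠ Y) ⊠ Z ⟶ X' ⊠ (Y ⊠ Z)} [ImgR Y f f₁]
    [ImgR Z f₁ f₂] [ImgR (Y ⊠ Z) f f₃] [Glue f₂ (as X' Y Z) k] : k ≅ as X Y Z ≫ f₃ :=
  natPath (asL f Y Z) (tIso ImgR.iso (Iso.refl (𝟙 Z)) ≪≫ ImgR.iso) ImgR.iso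

theorem asLp_base (f : X ⟶ X') : asLp f Y Z = asL f Y Z := by
  rw [← natPath_refl (asL f Y Z)]
  unfold asLp
  congr 1
  ext
  simp [ImgR.iso, tHom₂_id]

section

variable (e : X ⟶ X') (f : X' ⟶ X'') {f₁ : X' ⊠ Y ⟶ X'' ⊠ Y} {f₂ : (X' ⊠ Y) ⊠ Z ⟶ (X'' ⊠ Y) ⊠ Z}
  {f₃ : X' ⊠ (Y ⊠ Z) ⟶ X'' ⊠ (Y ⊠ Z)} {k : (X' ⊠ Y) ⊠ Z ⟶ X'' ⊠ (Y ⊠ Z)} [ImgR Y f f₁]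
  [ImgR Z f₁ f₂] [ImgR (Y ⊠ Z) f f₃] [Glue f₂ (as X'' Y Z) k]

theorem asLp_eq : asLp (e ≫ f) Y Z = natPath (asL (e ≫ f) Y Z)
    ((tIso (wR e f Y) (Iso.refl (𝟙 Z)) ≪≫ wR _ _ Z) ≪≫ whiskerLeftIso _
      (tIso ImgR.iso (Iso.refl (𝟙 Z)) ≪≫ ImgR.iso)) (wR e f (Y ⊠ Z) ≪≫ whiskerLeftIso _ ImgR.iso) := by
  unfold asLp
  congr 1
  ext
  have h := tHom₂_comp (wR e f Y).hom (e ▹ Y ◁ (ImgR.iso (Z := Y) (f := f)).hom) (𝟙 (𝟙 Z)) (𝟙 (𝟙 Z))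
  rw [Category.comp_id] at h
  simp [ImgR.iso, h, wR_whiskerLeft]

theorem rOn_wR_hom : (wR e f Y).hom ▹₂ Z =
    (tIso (wR e f Y) (Iso.refl (𝟙 Z)) ≪≫ wR _ _ Z).hom := by
  simp [rOn, ImgR.iso]

theorem asLp_comp : (asLp (e ≫ f) Y Z).hom =
    (e ▹ Y) ▹ Z ◁ (asLp f Y Z).hom ≫ (asL e Y Z).hom ⊳ f₃ := by
  have h := asL_comp e f Y Z
  rw [rOn_wR_hom] at h
  rw [asLp_eq]
  exact natPath_comp h _ _

theorem asLp_comp_inv : (asLp (e ≫ f) Y Z).inv =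
    (asL e Y Z).inv ⊳ f₃ ≫ (e ▹ Y) ▹ Z ◁ (asLp f Y Z).inv := by
  have h := asL_comp e f Y Z
  rw [rOn_wR_hom] at h
  rw [asLp_eq]
  exact natPath_comp_inv h _ _

end

section

variable {f g : X ⟶ X'} (c : f ⟶ g) {f₁ g₁ : X ⊠ Y ⟶ X' ⊠ Y} {f₂ g₂ : (X ⊠ Y) ⊠ Z ⟶ (X' ⊠ Y) ⊠ Z}
  {f₃ g₃ : X ⊠ (Y ⊠ Z) ⟶ X' ⊠ (Y ⊠ Z)} {k l : (X ⊠ Y) ⊠ Z ⟶ X' ⊠ (Y ⊠ Z)} [ImgR Y f f₁]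
  [ImgR Z f₁ f₂] [ImgR (Y ⊠ Z) f f₃] [Glue f₂ (as X' Y Z) k] [ImgR Y g g₁]
  [ImgR Z g₁ g₂] [ImgR (Y ⊠ Z) g g₃] [Glue g₂ (as X' Y Z) l]

theorem rOn_rOn : (tIso (ImgR.iso (Z := Y) (f := f)) (Iso.refl (𝟙 Z)) ≪≫ ImgR.iso).inv ≫
    (c ⊠₂ 𝟙 (𝟙 Y)) ⊠₂ 𝟙 (𝟙 Z) ≫
    (tIso (ImgR.iso (Z := Y) (f := g)) (Iso.refl (𝟙 Z)) ≪≫ ImgR.iso).hom = c ▹₂ Y ▹₂ Z := by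
  simp [rOn, tHom₂_comp_assoc]

theorem asLp_naturality : (c ▹₂ Y ▹₂ Z) ⊳ as X' Y Z ≫ (asLp g Y Z).hom =
    (asLp f Y Z).hom ≫ as X Y Z ◁ c ▹₂ (Y ⊠ Z) := by
  have h := asL_naturality c Y Z
  simp only [rOn_base] at h
  exact natPath_naturality h (rOn_rOn Y Z c) rfl

theorem asLp_naturality_inv : as X Y Z ◁ c ▹₂ (Y ⊠ Z) ≫ (asLp g Y Z).inv =
    (asLp f Y Z).inv ≫ (c ▹₂ Y ▹₂ Z) ⊳ as X' Y Z := by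
  have h := asL_naturality c Y Z
  simp only [rOn_base] at h
  exact natPath_naturality_inv h (rOn_rOn Y Z c) rfl

end

end

section

variable {Y Y' Y'' : B} (X Z : B)

/-- `asM` for right-associated composites. -/
def asMp (X : B) (f : Y ⟶ Y') (Z : B) {f₁ : X ⊠ Y ⟶ X ⊠ Y'} {f₂ : (X ⊠ Y) ⊠ Z ⟶ (X ⊠ Y') ⊠ Z}
    {f₃ : Y ⊠ Z ⟶ Y' ⊠ Z} {f₄ : X ⊠ (Y ⊠ Z) ⟶ X ⊠ (Y' ⊠ Z)} {k : (X ⊠ Y) ⊠ Z ⟶ X ⊠ (Y' ⊠ Z)}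
    [ImgL X f f₁] [ImgR Z f₁ f₂] [ImgR Z f f₃] [ImgL X f₃ f₄] [Glue f₂ (as X Y' Z) k] :
    k ≅ as X Y Z ≫ f₄ :=
  natPath (asM X f Z) (tIso ImgL.iso (Iso.refl (𝟙 Z)) ≪≫ ImgR.iso)
    (tIso (Iso.refl (𝟙 X)) ImgR.iso ≪≫ ImgL.iso)

theorem asMp_base (f : Y ⟶ Y') : asMp X f Z = asM X f Z := by
  rw [← natPath_refl (asM X f Z)]
  unfold asMp
  congr 1 <;>
  · ext
    simp [ImgR.iso, ImgL.iso, tHom₂_id]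

section

variable (e : Y ⟶ Y') (f : Y' ⟶ Y'') {f₁ : X ⊠ Y' ⟶ X ⊠ Y''} {f₂ : (X ⊠ Y') ⊠ Z ⟶ (X ⊠ Y'') ⊠ Z}
  {f₃ : Y' ⊠ Z ⟶ Y'' ⊠ Z} {f₄ : X ⊠ (Y' ⊠ Z) ⟶ X ⊠ (Y'' ⊠ Z)} {k : (X ⊠ Y') ⊠ Z ⟶ X ⊠ (Y'' ⊠ Z)}
  [ImgL X f f₁] [ImgR Z f₁ f₂] [ImgR Z f f₃] [ImgL X f₃ f₄] [Glue f₂ (as X Y'' Z) k]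

theorem asMp_eq : asMp X (e ≫ f) Z = natPath (asM X (e ≫ f) Z)
    ((tIso (wL X e f) (Iso.refl (𝟙 Z)) ≪≫ wR _ _ Z) ≪≫ whiskerLeftIso _
      (tIso ImgL.iso (Iso.refl (𝟙 Z)) ≪≫ ImgR.iso))
    ((tIso (Iso.refl (𝟙 X)) (wR e f Z) ≪≫ wL X _ _) ≪≫ whiskerLeftIso _
      (tIso (Iso.refl (𝟙 X)) ImgR.iso ≪≫ ImgL.iso)) := by
  have h₁ := tHom₂_comp (wL X e f).hom (X ◃ e ◁ (ImgL.iso (Z := X) (f := f)).hom) (𝟙 (𝟙 Z)) (𝟙 (𝟙 Z))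
  have h₂ := tHom₂_comp (𝟙 (𝟙 X)) (𝟙 (𝟙 X)) (wR e f Z).hom (e ▹ Z ◁ (ImgR.iso (Z := Z) (f := f)).hom)
  rw [Category.comp_id] at h₁ h₂
  unfold asMp
  congr 1
  · ext
    simp [ImgR.iso, ImgL.iso, h₁, wR_whiskerLeft]
  · ext
    simp [ImgR.iso, ImgL.iso, h₂, wL_whiskerLeft]

theorem asMp_comp_aux : (asM X (e ≫ f) Z).hom ≫
    as X Y Z ◁ (tIso (Iso.refl (𝟙 X)) (wR e f Z) ≪≫ wL X _ _).hom =
    (tIso (wL X e f) (Iso.refl (𝟙 Z)) ≪≫ wR _ _ Z).hom ⊳ as X Y'' Z ≫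
      (X ◃ e) ▹ Z ◁ (asM X f Z).hom ≫ (asM X e Z).hom ⊳ (X ◃ (f ▹ Z)) := by
  have h := asM_comp X e f Z
  simp only [rOn, lOn, ImgR.iso, ImgL.iso] at h
  simpa using h

theorem asMp_comp : (asMp X (e ≫ f) Z).hom =
    (X ◃ e) ▹ Z ◁ (asMp X f Z).hom ≫ (asM X e Z).hom ⊳ f₄ := by
  rw [asMp_eq]
  exact natPath_comp (asMp_comp_aux X Z e f) _ _

theorem asMp_comp_inv : (asMp X (e ≫ f) Z).inv =
    (asM X e Z).inv ⊳ f₄ ≫ (X ◃ e) ▹ Z ◁ (asMp X f Z).inv := by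
  rw [asMp_eq]
  exact natPath_comp_inv (asMp_comp_aux X Z e f) _ _

end

section

variable {f g : Y ⟶ Y'} (c : f ⟶ g) {f₁ g₁ : X ⊠ Y ⟶ X ⊠ Y'} {f₂ g₂ : (X ⊠ Y) ⊠ Z ⟶ (X ⊠ Y') ⊠ Z}
  {f₃ g₃ : Y ⊠ Z ⟶ Y' ⊠ Z} {f₄ g₄ : X ⊠ (Y ⊠ Z) ⟶ X ⊠ (Y' ⊠ Z)} {k l : (X ⊠ Y) ⊠ Z ⟶ X ⊠ (Y' ⊠ Z)}
  [ImgL X f f₁] [ImgR Z f₁ f₂] [ImgR Z f f₃] [ImgL X f₃ f₄] [Glue f₂ (as X Y' Z) k]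
  [ImgL X g g₁] [ImgR Z g₁ g₂] [ImgR Z g g₃] [ImgL X g₃ g₄] [Glue g₂ (as X Y' Z) l]

theorem rOn_lOn : (tIso (ImgL.iso (Z := X) (f := f)) (Iso.refl (𝟙 Z)) ≪≫ ImgR.iso).inv ≫
    (𝟙 (𝟙 X) ⊠₂ c) ⊠₂ 𝟙 (𝟙 Z) ≫
    (tIso (ImgL.iso (Z := X) (f := g)) (Iso.refl (𝟙 Z)) ≪≫ ImgR.iso).hom = (X ◃₂ c) ▹₂ Z := by
  simp [rOn, lOn, tHom₂_comp_assoc]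

theorem lOn_rOn : (tIso (Iso.refl (𝟙 X)) (ImgR.iso (Z := Z) (f := f)) ≪≫ ImgL.iso).inv ≫
    𝟙 (𝟙 X) ⊠₂ (c ⊠₂ 𝟙 (𝟙 Z)) ≫
    (tIso (Iso.refl (𝟙 X)) (ImgR.iso (Z := Z) (f := g)) ≪≫ ImgL.iso).hom = X ◃₂ (c ▹₂ Z) := by
  simp [rOn, lOn, tHom₂_comp_assoc]

theorem asMp_naturality_inv : as X Y Z ◁ X ◃₂ (c ▹₂ Z) ≫ (asMp X g Z).inv =
    (asMp X f Z).inv ≫ ((X ◃₂ c) ▹₂ Z) ⊳ as X Y' Z :=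
  natPath_naturality_inv (SqMap.asNat _ _ _) (rOn_lOn X Z c) (lOn_rOn X Z c)

end

end

section

variable {Z Z' Z'' : B} (X Y : B)

/-- `asR` for right-associated composites. -/
def asRp (X Y : B) (f : Z ⟶ Z') {f₁ : (X ⊠ Y) ⊠ Z ⟶ (X ⊠ Y) ⊠ Z'} {f₂ : Y ⊠ Z ⟶ Y ⊠ Z'}
    {f₃ : X ⊠ (Y ⊠ Z) ⟶ X ⊠ (Y ⊠ Z')} {k : (X ⊠ Y) ⊠ Z ⟶ X ⊠ (Y ⊠ Z')} [ImgL (X ⊠ Y) f f₁]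
    [ImgL Y f f₂] [ImgL X f₂ f₃] [Glue f₁ (as X Y Z') k] : k ≅ as X Y Z ≫ f₃ :=
  natPath (asR X Y f) ImgL.iso (tIso (Iso.refl (𝟙 X)) ImgL.iso ≪≫ ImgL.iso)

theorem asRp_base (f : Z ⟶ Z') : asRp X Y f = asR X Y f := by
  rw [← natPath_refl (asR X Y f)]
  unfold asRp
  congr 1
  ext
  simp [ImgL.iso, tHom₂_id]

section

variable (e : Z ⟶ Z') (f : Z' ⟶ Z'') {f₁ : (X ⊠ Y) ⊠ Z' ⟶ (X ⊠ Y) ⊠ Z''} {f₂ : Y ⊠ Z' ⟶ Y ⊠ Z''}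
  {f₃ : X ⊠ (Y ⊠ Z') ⟶ X ⊠ (Y ⊠ Z'')} {k : (X ⊠ Y) ⊠ Z' ⟶ X ⊠ (Y ⊠ Z'')} [ImgL (X ⊠ Y) f f₁]
  [ImgL Y f f₂] [ImgL X f₂ f₃] [Glue f₁ (as X Y Z'') k]

theorem asRp_eq : asRp X Y (e ≫ f) = natPath (asR X Y (e ≫ f))
    (wL (X ⊠ Y) e f ≪≫ whiskerLeftIso _ ImgL.iso)
    ((tIso (Iso.refl (𝟙 X)) (wL Y e f) ≪≫ wL X _ _) ≪≫ whiskerLeftIso _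
      (tIso (Iso.refl (𝟙 X)) ImgL.iso ≪≫ ImgL.iso)) := by
  have h := tHom₂_comp (𝟙 (𝟙 X)) (𝟙 (𝟙 X)) (wL Y e f).hom (Y ◃ e ◁ (ImgL.iso (Z := Y) (f := f)).hom)
  rw [Category.comp_id] at h
  unfold asRp
  congr 1
  ext
  simp [ImgL.iso, h, wL_whiskerLeft]

theorem asRp_comp_aux : (asR X Y (e ≫ f)).hom ≫
    as X Y Z ◁ (tIso (Iso.refl (𝟙 X)) (wL Y e f) ≪≫ wL X _ _).hom =
    (wL (X ⊠ Y) e f).hom ⊳ as X Y Z'' ≫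
      (X ⊠ Y) ◃ e ◁ (asR X Y f).hom ≫ (asR X Y e).hom ⊳ (X ◃ (Y ◃ f)) := by
  have h := asR_comp X Y e f
  simp only [lOn, ImgL.iso] at h
  simpa using h

theorem asRp_comp : (asRp X Y (e ≫ f)).hom =
    (X ⊠ Y) ◃ e ◁ (asRp X Y f).hom ≫ (asR X Y e).hom ⊳ f₃ := by
  rw [asRp_eq]
  exact natPath_comp (asRp_comp_aux X Y e f) _ _

theorem asRp_comp_inv : (asRp X Y (e ≫ f)).inv =
    (asR X Y e).inv ⊳ f₃ ≫ (X ⊠ Y) ◃ e ◁ (asRp X Y f).inv := by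
  rw [asRp_eq]
  exact natPath_comp_inv (asRp_comp_aux X Y e f) _ _

end

section

variable {f g : Z ⟶ Z'} (c : f ⟶ g) {f₁ g₁ : (X ⊠ Y) ⊠ Z ⟶ (X ⊠ Y) ⊠ Z'} {f₂ g₂ : Y ⊠ Z ⟶ Y ⊠ Z'}
  {f₃ g₃ : X ⊠ (Y ⊠ Z) ⟶ X ⊠ (Y ⊠ Z')} {k l : (X ⊠ Y) ⊠ Z ⟶ X ⊠ (Y ⊠ Z')} [ImgL (X ⊠ Y) f f₁]
  [ImgL Y f f₂] [ImgL X f₂ f₃] [Glue f₁ (as X Y Z') k] [ImgL (X ⊠ Y) g g₁]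
  [ImgL Y g g₂] [ImgL X g₂ g₃] [Glue g₁ (as X Y Z') l]

theorem lOn_lOn : (tIso (Iso.refl (𝟙 X)) (ImgL.iso (Z := Y) (f := f)) ≪≫ ImgL.iso).inv ≫
    𝟙 (𝟙 X) ⊠₂ (𝟙 (𝟙 Y) ⊠₂ c) ≫
    (tIso (Iso.refl (𝟙 X)) (ImgL.iso (Z := Y) (f := g)) ≪≫ ImgL.iso).hom = X ◃₂ Y ◃₂ c := by
  simp [lOn, tHom₂_comp_assoc]

theorem asRp_naturality : ((X ⊠ Y) ◃₂ c) ⊳ as X Y Z' ≫ (asRp X Y g).hom =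
    (asRp X Y f).hom ≫ as X Y Z ◁ X ◃₂ Y ◃₂ c := by
  have h := asR_naturality X Y c
  simp only [lOn_base] at h
  exact natPath_naturality h rfl (lOn_lOn X Y c)

theorem asRp_naturality_inv : as X Y Z ◁ X ◃₂ Y ◃₂ c ≫ (asRp X Y g).inv =
    (asRp X Y f).inv ≫ ((X ⊠ Y) ◃₂ c) ⊳ as X Y Z' := by
  have h := asR_naturality X Y c
  simp only [lOn_base] at h
  exact natPath_naturality_inv h rfl (lOn_lOn X Y c)

end

end

section

variable {X X' X'' : B}

/-- `luNat` for right-associated composites. -/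
def lup (f : X ⟶ X') {f₁ : unitObj B ⊠ X ⟶ unitObj B ⊠ X'} {k : unitObj B ⊠ X ⟶ X'}
    [ImgL (unitObj B) f f₁] [Glue f₁ (lu X') k] : k ≅ lu X ≫ f :=
  natPath (luNat f) ImgL.iso (Iso.refl f)

theorem lup_base (f : X ⟶ X') : lup f = luNat f :=
  natPath_refl _

section

variable (e : X ⟶ X') (f : X' ⟶ X'') {f₁ : unitObj B ⊠ X' ⟶ unitObj B ⊠ X''} {k : unitObj B ⊠ X' ⟶ X''}
  [ImgL (unitObj B) f f₁] [Glue f₁ (lu X'') k]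

theorem lup_eq : lup (e ≫ f) = natPath (luNat (e ≫ f))
    (wL (unitObj B) e f ≪≫ whiskerLeftIso _ ImgL.iso)
    (Iso.refl _ ≪≫ whiskerLeftIso e (Iso.refl f)) := by
  unfold lup
  congr 1
  ext
  simp

theorem lup_comp_aux : (luNat (e ≫ f)).hom ≫ lu X ◁ (Iso.refl (e ≫ f)).hom =
    (wL (unitObj B) e f).hom ⊳ lu X'' ≫ unitObj B ◃ e ◁ (luNat f).hom ≫ (luNat e).hom ⊳ f := by
  rw [luNat_comp]
  simp [cellAt, Glue.iso]

theorem lup_comp : (lup (e ≫ f)).hom = unitObj B ◃ e ◁ (lup f).hom ≫ (luNat e).hom ⊳ f := by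
  rw [lup_eq]
  exact natPath_comp (lup_comp_aux e f) _ _

theorem lup_comp_inv : (lup (e ≫ f)).inv = (luNat e).inv ⊳ f ≫ unitObj B ◃ e ◁ (lup f).inv := by
  rw [lup_eq]
  exact natPath_comp_inv (lup_comp_aux e f) _ _

end

section

variable {f g : X ⟶ X'} (c : f ⟶ g) {f₁ g₁ : unitObj B ⊠ X ⟶ unitObj B ⊠ X'} {k l : unitObj B ⊠ X ⟶ X'}
  [ImgL (unitObj B) f f₁] [Glue f₁ (lu X') k] [ImgL (unitObj B) g g₁] [Glue g₁ (lu X') l]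

theorem lup_naturality : (unitObj B ◃₂ c) ⊳ lu X' ≫ (lup g).hom = (lup f).hom ≫ lu X ◁ c :=
  natPath_naturality (SqMap.luNat c) rfl (by simp)

end

end

section

variable {X X' X'' : B}

/-- `ruNat` for right-associated composites. -/
def rup (f : X ⟶ X') {f₁ : X ⊠ unitObj B ⟶ X' ⊠ unitObj B} {k : X ⊠ unitObj B ⟶ X'}
    [ImgR (unitObj B) f f₁] [Glue f₁ (ru X') k] : k ≅ ru X ≫ f :=
  natPath (ruNat f) ImgR.iso (Iso.refl f)

theorem rup_base (f : X ⟶ X') : rup f = ruNat f :=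
  natPath_refl _

section

variable (e : X ⟶ X') (f : X' ⟶ X'') {f₁ : X' ⊠ unitObj B ⟶ X'' ⊠ unitObj B} {k : X' ⊠ unitObj B ⟶ X''}
  [ImgR (unitObj B) f f₁] [Glue f₁ (ru X'') k]

theorem rup_eq : rup (e ≫ f) = natPath (ruNat (e ≫ f))
    (wR e f (unitObj B) ≪≫ whiskerLeftIso _ ImgR.iso)
    (Iso.refl _ ≪≫ whiskerLeftIso e (Iso.refl f)) := by
  unfold rup
  congr 1
  ext
  simp

theorem rup_comp_aux : (ruNat (e ≫ f)).hom ≫ ru X ◁ (Iso.refl (e ≫ f)).hom =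
    (wR e f (unitObj B)).hom ⊳ ru X'' ≫ e ▹ unitObj B ◁ (ruNat f).hom ≫ (ruNat e).hom ⊳ f := by
  rw [ruNat_comp]
  simp [cellAt, Glue.iso]

theorem rup_comp : (rup (e ≫ f)).hom = e ▹ unitObj B ◁ (rup f).hom ≫ (ruNat e).hom ⊳ f := by
  rw [rup_eq]
  exact natPath_comp (rup_comp_aux e f) _ _

theorem rup_comp_inv : (rup (e ≫ f)).inv = (ruNat e).inv ⊳ f ≫ e ▹ unitObj B ◁ (rup f).inv := by
  rw [rup_eq]
  exact natPath_comp_inv (rup_comp_aux e f) _ _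

end

section

variable {f g : X ⟶ X'} (c : f ⟶ g) {f₁ g₁ : X ⊠ unitObj B ⟶ X' ⊠ unitObj B} {k l : X ⊠ unitObj B ⟶ X'}
  [ImgR (unitObj B) f f₁] [Glue f₁ (ru X') k] [ImgR (unitObj B) g g₁] [Glue g₁ (ru X') l]

theorem rup_naturality : (c ▹₂ unitObj B) ⊳ ru X' ≫ (rup g).hom = (rup f).hom ≫ ru X ◁ c :=
  natPath_naturality (SqMap.ruNat c) rfl (by simp)

theorem rup_naturality_inv : ru X ◁ c ≫ (rup g).inv = (rup f).inv ≫ (c ▹₂ unitObj B) ⊳ ru X' :=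
  natPath_naturality_inv (SqMap.ruNat c) rfl (by simp)

end

end

section

variable {X X' X'' Y Y' : B} (g : Y ⟶ Y')

/-- `inter` for right-associated composites in the first variable. -/
def interLp (f : X ⟶ X') (g : Y ⟶ Y') {f₁ : X ⊠ Y ⟶ X' ⊠ Y} {f₂ : X ⊠ Y' ⟶ X' ⊠ Y'}
    {k : X ⊠ Y ⟶ X' ⊠ Y'} [ImgR Y f f₁] [ImgR Y' f f₂] [Glue f₁ (X' ◃ g) k] : k ≅ X ◃ g ≫ f₂ :=
  natPath (inter f g) ImgR.iso ImgR.iso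

theorem interLp_base (f : X ⟶ X') : interLp f g = inter f g :=
  natPath_refl _

section

variable (e : X ⟶ X') (f : X' ⟶ X'') {f₁ : X' ⊠ Y ⟶ X'' ⊠ Y} {f₂ : X' ⊠ Y' ⟶ X'' ⊠ Y'}
  {k : X' ⊠ Y ⟶ X'' ⊠ Y'} [ImgR Y f f₁] [ImgR Y' f f₂] [Glue f₁ (X'' ◃ g) k]

theorem interLp_comp : (interLp (e ≫ f) g).hom =
    e ▹ Y ◁ (interLp f g).hom ≫ (inter e g).hom ⊳ f₂ :=
  natPath_comp (inter_comp_left e f g) _ _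

theorem interLp_comp_inv : (interLp (e ≫ f) g).inv =
    (inter e g).inv ⊳ f₂ ≫ e ▹ Y ◁ (interLp f g).inv :=
  natPath_comp_inv (inter_comp_left e f g) _ _

end

section

variable {e f : X ⟶ X'} (c : e ⟶ f) {e₁ f₁ : X ⊠ Y ⟶ X' ⊠ Y} {e₂ f₂ : X ⊠ Y' ⟶ X' ⊠ Y'}
  {k l : X ⊠ Y ⟶ X' ⊠ Y'} [ImgR Y e e₁] [ImgR Y' e e₂] [Glue e₁ (X' ◃ g) k] [ImgR Y f f₁]
  [ImgR Y' f f₂] [Glue f₁ (X' ◃ g) l]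

theorem interLp_naturality_inv : X ◃ g ◁ c ▹₂ Y' ≫ (interLp f g).inv =
    (interLp e g).inv ≫ (c ▹₂ Y) ⊳ (X' ◃ g) := by
  have h := inter_naturality_left c g
  rw [rOn_base, rOn_base] at h
  exact natPath_naturality_inv h rfl rfl

end

end

section

variable {X X' Y Y' Y'' : B} (g : X ⟶ X')

/-- The inverse of `inter` for right-associated composites in the second variable. -/
def interRp (g : X ⟶ X') (f : Y ⟶ Y') {f₁ : X ⊠ Y ⟶ X ⊠ Y'} {f₂ : X' ⊠ Y ⟶ X' ⊠ Y'}
    {k : X ⊠ Y ⟶ X' ⊠ Y'} [ImgL X f f₁] [ImgL X' f f₂] [Glue f₁ (g ▹ Y') k] : k ≅ g ▹ Y ≫ f₂ :=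
  natPath (inter g f).symm ImgL.iso ImgL.iso

theorem interRp_base (f : Y ⟶ Y') : interRp g f = (inter g f).symm :=
  natPath_refl _

section

variable (e : Y ⟶ Y') (f : Y' ⟶ Y'') {f₁ : X ⊠ Y' ⟶ X ⊠ Y''} {f₂ : X' ⊠ Y' ⟶ X' ⊠ Y''}
  {k : X ⊠ Y' ⟶ X' ⊠ Y''} [ImgL X f f₁] [ImgL X' f f₂] [Glue f₁ (g ▹ Y'') k]

theorem interRp_comp_aux : (inter g (e ≫ f)).symm.hom ≫ g ▹ Y ◁ (wL X' e f).hom =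
    (wL X e f).hom ⊳ (g ▹ Y'') ≫ X ◃ e ◁ (inter g f).symm.hom ≫
      (inter g e).symm.hom ⊳ (X' ◃ f) := by
  have h := inter_comp_right g e f
  rw [Iso.symm_hom, Iso.symm_hom, Iso.symm_hom, Iso.inv_comp_eq, reassoc_of% h,
    whiskerLeft_hom_inv_assoc, cellAt_hom_inv, Category.comp_id]

theorem interRp_comp : (interRp g (e ≫ f)).hom =
    X ◃ e ◁ (interRp g f).hom ≫ (inter g e).inv ⊳ f₂ :=
  natPath_comp (interRp_comp_aux g e f) _ _

theorem interRp_comp_inv : (interRp g (e ≫ f)).inv =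
    (inter g e).hom ⊳ f₂ ≫ X ◃ e ◁ (interRp g f).inv :=
  natPath_comp_inv (interRp_comp_aux g e f) _ _

end

section

variable {e f : Y ⟶ Y'} (c : e ⟶ f) {e₁ f₁ : X ⊠ Y ⟶ X ⊠ Y'} {e₂ f₂ : X' ⊠ Y ⟶ X' ⊠ Y'}
  {k l : X ⊠ Y ⟶ X' ⊠ Y'} [ImgL X e e₁] [ImgL X' e e₂] [Glue e₁ (g ▹ Y') k] [ImgL X f f₁]
  [ImgL X' f f₂] [Glue f₁ (g ▹ Y') l]

theorem SqMap.inter_symm {e f : Y ⟶ Y'} (c : e ⟶ f) :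
    SqMap (inter g e).symm (inter g f).symm (𝟙 (𝟙 X) ⊠₂ c) (𝟙 (𝟙 X') ⊠₂ c) := by
  have h := inter_naturality_right g c
  rw [lOn_base, lOn_base] at h
  rw [SqMap, Iso.symm_hom, Iso.symm_hom, Iso.comp_inv_eq, Category.assoc, h,
    Iso.inv_hom_id_assoc]

theorem interRp_naturality : (X ◃₂ c) ⊳ (g ▹ Y') ≫ (interRp g f).hom =
    (interRp g e).hom ≫ g ▹ Y ◁ X' ◃₂ c :=
  natPath_naturality (SqMap.inter_symm g c) rfl rfl

end

end

end

/-! ### The axioms of a monoidal bicategory in normal form -/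

section Axioms

open MonoidalStruct

variable {B : Type u} [Bicategory.{w, v} B] [MonoidalBicategory B]

/-- The axiom is stated with associators inserted by `⊗≫`. Unfolding the gluing and tensoring
isomorphisms shows that the normal form is the same equation; likewise for the two normalization
conditions. -/
theorem five_path (V W X Y Z : B) :
    ((pent V W X Y).hom ▹₂ Z) ⊳
        (as V (W ⊠ (X ⊠ Y)) Z ≫ V ◃ as W (X ⊠ Y) Z ≫ V ◃ (W ◃ as X Y Z)) ≫
      as (V ⊠ W) X Y ▹ Z ◁ (pent V W (X ⊠ Y) Z).hom ⊳ (V ◃ (W ◃ as X Y Z)) ≫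
      as (V ⊠ W) X Y ▹ Z ◁ as (V ⊠ W) (X ⊠ Y) Z ◁ (asR V W (as X Y Z)).inv ≫
      (pent (V ⊠ W) X Y Z).hom ⊳ as V W (X ⊠ (Y ⊠ Z)) =
    (as V W X ▹ Y) ▹ Z ◁ as V (W ⊠ X) Y ▹ Z ◁ (asM V (as W X Y) Z).hom ⊳
        (V ◃ as W (X ⊠ Y) Z ≫ V ◃ (W ◃ as X Y Z)) ≫
      (as V W X ▹ Y) ▹ Z ◁ as V (W ⊠ X) Y ▹ Z ◁ as V ((W ⊠ X) ⊠ Y) Z ◁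
        (V ◃₂ (pent W X Y Z).hom) ≫
      (as V W X ▹ Y) ▹ Z ◁ (pent V (W ⊠ X) Y Z).hom ⊳ (V ◃ as W X (Y ⊠ Z)) ≫
      (asL (as V W X) Y Z).hom ⊳ (as V (W ⊠ X) (Y ⊠ Z) ≫ V ◃ as W X (Y ⊠ Z)) ≫
      as ((V ⊠ W) ⊠ X) Y Z ◁ (pent V W X (Y ⊠ Z)).hom := by
  have h := MonoidalBicategory.five V W X Y Z
  simp only [fiveLeft, fiveRight, bicategoricalComp, wR₃, wL₃] at h
  simp only [cellAt, rOn, lOn, Glue.iso, ImgR.iso, ImgL.iso]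
  simpa using h

theorem normLeft_path (X Y Z : B) :
    as X (unitObj B) Y ▹ Z ◁ as X (unitObj B ⊠ Y) Z ◁ (X ◃₂ (leftTri Y Z).hom) ≫
      as X (unitObj B) Y ▹ Z ◁ (asM X (lu Y) Z).inv ≫
      ((midTri X Y).hom ▹₂ Z) ⊳ as X Y Z =
    (pent X (unitObj B) Y Z).hom ⊳ (X ◃ lu (Y ⊠ Z)) ≫
      as (X ⊠ unitObj B) Y Z ◁ (midTri X (Y ⊠ Z)).hom ≫ (asL (ru X) Y Z).inv := by
  have h := MonoidalBicategory.normLeft X Y Z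
  simp only [normLeft₁, normLeft₂, bicategoricalComp] at h
  simp only [cellAt, rOn, lOn, Glue.iso, ImgR.iso, ImgL.iso]
  simpa using h

theorem normRight_path (X Y Z : B) :
    as X Y (unitObj B) ▹ Z ◁ as X (Y ⊠ unitObj B) Z ◁ (X ◃₂ (midTri Y Z).hom) ≫
      as X Y (unitObj B) ▹ Z ◁ (asM X (ru Y) Z).inv ≫
      ((rightTri X Y).hom ▹₂ Z) ⊳ as X Y Z =
    (pent X Y (unitObj B) Z).hom ⊳ (X ◃ (Y ◃ lu Z)) ≫
      as (X ⊠ Y) (unitObj B) Z ◁ (asR X Y (lu Z)).inv ≫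
      (midTri (X ⊠ Y) Z).hom ⊳ as X Y Z := by
  have h := MonoidalBicategory.normRight X Y Z
  simp only [normRight₁, normRight₂, bicategoricalComp] at h
  simp only [cellAt, rOn, lOn, Glue.iso, ImgR.iso, ImgL.iso]
  simpa using h

end Axioms

-- With these rules, simplification distributes whiskering and tensoring over composition and splits
-- constraint cells of composites. A pasting becomes a sequence of elementary cells, each whiskered
-- on both sides, so two pastings can be compared by interchange, naturality and the axioms.
attribute [simp] cellAt_comp cellAt_whiskerLeft cellAt_cellAt rOn_comp lOn_comp rOn_whiskerLeft
  lOn_whiskerLeft rOn_cellAt lOn_cellAt asLp_base asLp_comp asLp_comp_inv asMp_base asMp_comp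
  asMp_comp_inv asRp_base asRp_comp asRp_comp_inv lup_base lup_comp lup_comp_inv rup_base rup_comp
  rup_comp_inv interLp_base interLp_comp interLp_comp_inv interRp_base interRp_comp
  interRp_comp_inv

/-! ### Cancelling inverse pairs under whiskering and tensoring -/

section Cancellation

variable {B : Type u} [Bicategory.{w, v} B] {X Y Z : B}

-- Here and below the hypothesis `e` is itself discharged by simplification, so inverse pairs cancel
-- at any depth of whiskering and tensoring.
@[simp]
theorem whiskerLeft_cancel (f : X ⟶ Y) {g h : Y ⟶ Z} {c : g ⟶ h} {d : h ⟶ g} (e : c ≫ d = 𝟙 g) :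
    f ◁ c ≫ f ◁ d = 𝟙 (f ≫ g) := by
  rw [← whiskerLeft_comp, e, whiskerLeft_id]

@[simp]
theorem whiskerLeft_cancel_assoc (f : X ⟶ Y) {g h : Y ⟶ Z} {c : g ⟶ h} {d : h ⟶ g} {k : X ⟶ Z}
    (e : c ≫ d = 𝟙 g) (l : f ≫ g ⟶ k) : f ◁ c ≫ f ◁ d ≫ l = l := by
  rw [← Category.assoc, whiskerLeft_cancel f e, Category.id_comp]

@[simp]
theorem cellAt_cancel {f g : X ⟶ Y} {c : f ⟶ g} {d : g ⟶ f} (e : c ≫ d = 𝟙 f) (k : Y ⟶ Z)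
    {fk gk : X ⟶ Z} [Glue f k fk] [Glue g k gk] : c ⊳ k ≫ d ⊳ k = 𝟙 fk := by
  rw [← cellAt_comp, e, cellAt_id]

@[simp]
theorem cellAt_cancel_assoc {f g : X ⟶ Y} {c : f ⟶ g} {d : g ⟶ f} (e : c ≫ d = 𝟙 f) (k : Y ⟶ Z)
    {fk gk h : X ⟶ Z} [Glue f k fk] [Glue g k gk] (l : fk ⟶ h) : c ⊳ k ≫ d ⊳ k ≫ l = l := by
  rw [← Category.assoc, cellAt_cancel e, Category.id_comp]

variable [MonoidalBicategory B]

@[simp]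
theorem rOn_cancel {f g : X ⟶ Y} {c : f ⟶ g} {d : g ⟶ f} (e : c ≫ d = 𝟙 f) (Z : B)
    {f' g' : X ⊠ Z ⟶ Y ⊠ Z} [ImgR Z f f'] [ImgR Z g g'] : c ▹₂ Z ≫ d ▹₂ Z = 𝟙 f' := by
  rw [← rOn_comp, e, rOn_id]

@[simp]
theorem lOn_cancel {f g : X ⟶ Y} {c : f ⟶ g} {d : g ⟶ f} (e : c ≫ d = 𝟙 f) (Z : B)
    {f' g' : Z ⊠ X ⟶ Z ⊠ Y} [ImgL Z f f'] [ImgL Z g g'] : Z ◃₂ c ≫ Z ◃₂ d = 𝟙 f' := by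
  rw [← lOn_comp, e, lOn_id]

end Cancellation

/-! ### Derived coherence: preparations for the left triangle -/

section Coherence

open MonoidalStruct

local notation "𝕀" => unitObj _

variable {B : Type u} [Bicategory.{w, v} B] [MonoidalBicategory B]

/-- The naturality law solved for the inverse constraint cells, by multiplying it on both sides with
inverses. -/
theorem pent_naturality₁_inv {X X' : B} (f : X ⟶ X') (Y Z W : B) :
    as X Y Z ▹ W ◁ as X (Y ⊠ Z) W ◁ (inter f (as Y Z W)).inv ≫
        as X Y Z ▹ W ◁ (asL f (Y ⊠ Z) W).inv ⊳ (X' ◃ as Y Z W) ≫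
        ((asL f Y Z).inv ▹₂ W) ⊳ (as X' (Y ⊠ Z) W ≫ X' ◃ as Y Z W) =
      (pent X Y Z W).hom ⊳ (f ▹ (Y ⊠ Z ⊠ W)) ≫ as (X ⊠ Y) Z W ◁ (asL f Y (Z ⊠ W)).inv ≫
        (asL (f ▹ Y) Z W).inv ⊳ as X' Y (Z ⊠ W) ≫ ((f ▹ Y) ▹ Z) ▹ W ◁ (pent X' Y Z W).inv := by
  have h := congrArg (fun c => (as X Y Z ▹ W ◁ as X (Y ⊠ Z) W ◁ (inter f (as Y Z W)).inv ≫
    as X Y Z ▹ W ◁ (asL f (Y ⊠ Z) W).inv ⊳ (X' ◃ as Y Z W) ≫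
    ((asL f Y Z).inv ▹₂ W) ⊳ (as X' (Y ⊠ Z) W ≫ X' ◃ as Y Z W)) ≫ c ≫
    as (X ⊠ Y) Z W ◁ (asL f Y (Z ⊠ W)).inv ≫
        (asL (f ▹ Y) Z W).inv ⊳ as X' Y (Z ⊠ W) ≫ ((f ▹ Y) ▹ Z) ▹ W ◁ (pent X' Y Z W).inv)
    (pent_naturality₁ f Y Z W)
  simpa using h

theorem midTri_naturality₂_inv {Y Y' : B} (X : B) (g : Y ⟶ Y') :
    as X 𝕀 Y ◁ (X ◃₂ (luNat g).hom) ≫ (midTri X Y).hom ⊳ (X ◃ g) =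
      (asR X 𝕀 g).inv ⊳ (X ◃ lu Y') ≫ (X ⊠ 𝕀) ◃ g ◁ (midTri X Y').hom ≫
        (inter (ru X) g).inv := by
  rw [midTri_naturality₂]
  simp

/-- Kelly's method one dimension up. The law to be derived concerns a leading unit, whereas the
axiom `normLeft_path` needs an object `X` in front of it. So one side of the law is tensored with
`X` and continued by the middle triangle of `X` and `T`; two uses of `normLeft_path` together with
naturality bring it to the common value on the right. -/
theorem leftTri_pent_aux₁ (X T S R : B) :
    (as X 𝕀 T ▹ S) ▹ R ◁ as X (𝕀 ⊠ T) S ▹ R ◁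
      ((asM X (as 𝕀 T S) R).hom ⊳ (X ◃ as 𝕀 (T ⊠ S) R ≫ X ◃ (𝕀 ◃ as T S R) ≫ X ◃ lu (T ⊠ (S ⊠ R))) ≫
      as X ((𝕀 ⊠ T) ⊠ S) R ◁
        (X ◃₂ (as 𝕀 T S ▹ R ◁ as 𝕀 (T ⊠ S) R ◁ (luNat (as T S R)).hom ≫
          as 𝕀 T S ▹ R ◁ (leftTri (T ⊠ S) R).hom ⊳ as T S R ≫
          ((leftTri T S).hom ▹₂ R) ⊳ as T S R)) ≫
      (asM X (lu T ▹ S) R).inv ⊳ (X ◃ as T S R)) ≫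
      (as X 𝕀 T ▹ S) ▹ R ◁ ((asM X (lu T) S).inv ▹₂ R) ⊳ (as X (T ⊠ S) R ≫ X ◃ as T S R) ≫
      ((midTri X T).hom ▹₂ S ▹₂ R) ⊳ (as X T S ▹ R ≫ as X (T ⊠ S) R ≫ X ◃ as T S R) = 
     ((pent X 𝕀 T S).hom ▹₂ R) ⊳
        (as X (𝕀 ⊠ (T ⊠ S)) R ≫ X ◃ as 𝕀 (T ⊠ S) R ≫ X ◃ (𝕀 ◃ as T S R) ≫ X ◃ lu (T ⊠ (S ⊠ R))) ≫
      as (X ⊠ 𝕀) T S ▹ R ◁ (pent X 𝕀 (T ⊠ S) R).hom ⊳ (X ◃ (𝕀 ◃ as T S R) ≫ X ◃ lu (T ⊠ (S ⊠ R))) ≫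
      as (X ⊠ 𝕀) T S ▹ R ◁ as (X ⊠ 𝕀) (T ⊠ S) R ◁ (asR X 𝕀 (as T S R)).inv ⊳ (X ◃ lu (T ⊠ (S ⊠ R))) ≫
      (pent (X ⊠ 𝕀) T S R).hom ⊳ (as X 𝕀 (T ⊠ (S ⊠ R)) ≫ X ◃ lu (T ⊠ (S ⊠ R))) ≫
      as ((X ⊠ 𝕀) ⊠ T) S R ◁ as (X ⊠ 𝕀) T (S ⊠ R) ◁ (midTri X (T ⊠ (S ⊠ R))).hom ≫
      as ((X ⊠ 𝕀) ⊠ T) S R ◁ (asL (ru X) T (S ⊠ R)).inv ≫ (asL (ru X ▹ T) S R).inv ⊳ as X T (S ⊠ R) ≫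
      ((ru X ▹ T) ▹ S) ▹ R ◁ (pent X T S R).inv := by
  -- The facts collected here are whiskered instances of interchange, naturality and the axioms.
  -- Once they and the goal are in normal form, they are used as successive rewrites; the long
  -- pastings below are treated in the same way.
  have x₁ := congrArg (fun c => (as X 𝕀 T ▹ S) ▹ R ◁ as X (𝕀 ⊠ T) S ▹ R ◁ c)
    (cellAt_exchange (asM X (as 𝕀 T S) R).hom (X ◃ as 𝕀 (T ⊠ S) R ◁ X ◃₂ (luNat (as T S R)).hom ≫
      X ◃₂ (leftTri (T ⊠ S) R).hom ⊳ (X ◃ as T S R)))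
  have x₂ := congrArg (fun c => (as X 𝕀 T ▹ S) ▹ R ◁ as X (𝕀 ⊠ T) S ▹ R ◁ c ⊳ (X ◃ as T S R))
    (asMp_naturality_inv X R (leftTri T S).hom)
  have x₃ := congrArg (fun c => (c ▹₂ R) ⊳ (as X (T ⊠ S) R ≫ X ◃ as T S R)) (normLeft_path X T S)
  have x₄ := cellAt_exchange ((pent X 𝕀 T S).hom ▹₂ R) (as X (𝕀 ⊠ T ⊠ S) R ◁
    X ◃ as 𝕀 (T ⊠ S) R ◁ X ◃₂ (luNat (as T S R)).hom ≫ as X (𝕀 ⊠ T ⊠ S) R ◁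
    X ◃₂ (leftTri (T ⊠ S) R).hom ⊳ (X ◃ as T S R) ≫ (asM X (lu (T ⊠ S)) R).inv ⊳ (X ◃ as T S R))
  have x₅ := congrArg (fun c => as (X ⊠ 𝕀) T S ▹ R ◁ c ⊳ (X ◃ as T S R)) (normLeft_path X (T ⊠ S) R)
  have x₆ := congrArg (fun c => as (X ⊠ 𝕀) T S ▹ R ◁ c)
    (cellAt_exchange (pent X 𝕀 (T ⊠ S) R).hom (X ◃₂ (luNat (as T S R)).hom))
  have x₇ := congrArg (fun c => as (X ⊠ 𝕀) T S ▹ R ◁ as (X ⊠ 𝕀) (T ⊠ S) R ◁ c)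
    (midTri_naturality₂_inv X (as T S R))
  have x₈ := pent_naturality₁_inv (ru X) T S R
  have x₉ := cellAt_exchange (pent (X ⊠ 𝕀) T S R).hom (midTri X (T ⊠ S ⊠ R)).hom
  simp at x₁ x₂ x₃ x₄ x₅ x₆ x₇ x₈ x₉
  simp
  rw [reassoc_of% x₁, reassoc_of% x₂]
  simp
  rw [x₃, ← reassoc_of% x₄]
  rw [reassoc_of% x₅, ← reassoc_of% x₆]
  rw [reassoc_of% x₇, x₈]
  rw [reassoc_of% x₉]

theorem pent_naturality₂_inv {Y Y' : B} (X : B) (g : Y ⟶ Y') (Z W : B) :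
    as X Y Z ▹ W ◁ as X (Y ⊠ Z) W ◁ (X ◃₂ (asL g Z W).inv) ≫
        as X Y Z ▹ W ◁ (asM X (g ▹ Z) W).inv ⊳ (X ◃ as Y' Z W) ≫
        ((asM X g Z).inv ▹₂ W) ⊳ (as X (Y' ⊠ Z) W ≫ X ◃ as Y' Z W) =
      (pent X Y Z W).hom ⊳ (X ◃ (g ▹ (Z ⊠ W))) ≫ as (X ⊠ Y) Z W ◁ (asM X g (Z ⊠ W)).inv ≫
        (asL (X ◃ g) Z W).inv ⊳ as X Y' (Z ⊠ W) ≫ ((X ◃ g) ▹ Z) ▹ W ◁ (pent X Y' Z W).inv := by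
  have h := congrArg (fun c => (as X Y Z ▹ W ◁ as X (Y ⊠ Z) W ◁ (X ◃₂ (asL g Z W).inv) ≫
        as X Y Z ▹ W ◁ (asM X (g ▹ Z) W).inv ⊳ (X ◃ as Y' Z W) ≫
        ((asM X g Z).inv ▹₂ W) ⊳ (as X (Y' ⊠ Z) W ≫ X ◃ as Y' Z W)) ≫ c ≫
    as (X ⊠ Y) Z W ◁ (asM X g (Z ⊠ W)).inv ≫
        (asL (X ◃ g) Z W).inv ⊳ as X Y' (Z ⊠ W) ≫ ((X ◃ g) ▹ Z) ▹ W ◁ (pent X Y' Z W).inv)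
    (pent_naturality₂ X g Z W)
  simpa using h

end Coherence

/-! ### Cancelling equivalences -/

section Equivalences

variable {B : Type u} [Bicategory.{w, v} B]

/-- A 1-cell is an equivalence. -/
class IsEquivalence {X Y : B} (e : X ⟶ Y) : Prop where
  exists_inverse : ∃ e' : Y ⟶ X, Nonempty (e ≫ e' ≅ 𝟙 X) ∧ Nonempty (e' ≫ e ≅ 𝟙 Y)

instance {X Y Z : B} (e : X ⟶ Y) (f : Y ⟶ Z) [IsEquivalence e] [IsEquivalence f] :
    IsEquivalence (e ≫ f) := by
  obtain ⟨e', ⟨η⟩, ⟨κ⟩⟩ := IsEquivalence.exists_inverse (e := e)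
  obtain ⟨f', ⟨η'⟩, ⟨κ'⟩⟩ := IsEquivalence.exists_inverse (e := f)
  exact ⟨f' ≫ e',
    ⟨α_ _ _ _ ≪≫ whiskerLeftIso e ((α_ _ _ _).symm ≪≫ whiskerRightIso η' e' ≪≫ λ_ e') ≪≫ η⟩,
    ⟨α_ _ _ _ ≪≫ whiskerLeftIso f' ((α_ _ _ _).symm ≪≫ whiskerRightIso κ f ≪≫ λ_ f) ≪≫ κ'⟩⟩

variable {X Y Z : B} (e : X ⟶ Y) [IsEquivalence e]

theorem whiskerLeft_injective {f g : Y ⟶ Z} {c d : f ⟶ g} (h : e ◁ c = e ◁ d) : c = d := by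
  obtain ⟨e', -, ⟨κ⟩⟩ := IsEquivalence.exists_inverse (e := e)
  have h' : (e' ≫ e) ◁ c = (e' ≫ e) ◁ d := by simp [h]
  have h'' : 𝟙 Y ◁ c = 𝟙 Y ◁ d := by
    rw [← cancel_epi (κ.hom ▷ f), ← whisker_exchange, ← whisker_exchange, h']
  simpa using h''

theorem whiskerRight_injective {f g : Z ⟶ X} {c d : f ⟶ g} (h : c ▷ e = d ▷ e) : c = d := by
  obtain ⟨e', ⟨κ⟩, -⟩ := IsEquivalence.exists_inverse (e := e)
  have h' : c ▷ (e ≫ e') = d ▷ (e ≫ e') := by simp [h]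
  have h'' : c ▷ 𝟙 X = d ▷ 𝟙 X := by
    rw [← cancel_epi (f ◁ κ.hom), whisker_exchange, whisker_exchange, h']
  simpa using h''

theorem cellAt_injective {f g : Z ⟶ X} {c d : f ⟶ g} {fe ge : Z ⟶ Y} [Glue f e fe] [Glue g e ge]
    (h : c ⊳ e = d ⊳ e) : c = d := by
  apply whiskerRight_injective e
  simpa [cellAt] using h

end Equivalences

section

variable {B : Type u} [Bicategory.{w, v} B] [MonoidalBicategory B]

instance (X Y Z : B) : IsEquivalence (as X Y Z) :=
  ⟨TensorStruct.assoc.inv.app (X, Y, Z),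
    ⟨⟨(TensorStruct.assoc (B := B)).unit.inv.as.app (X, Y, Z),
      (TensorStruct.assoc (B := B)).unit.hom.as.app (X, Y, Z),
      congrArg (fun Γ => Γ.as.app (X, Y, Z)) (TensorStruct.assoc (B := B)).unit.inv_hom_id,
      congrArg (fun Γ => Γ.as.app (X, Y, Z)) (TensorStruct.assoc (B := B)).unit.hom_inv_id⟩⟩,
    ⟨⟨(TensorStruct.assoc (B := B)).counit.hom.as.app (X, Y, Z),
      (TensorStruct.assoc (B := B)).counit.inv.as.app (X, Y, Z),
      congrArg (fun Γ => Γ.as.app (X, Y, Z)) (TensorStruct.assoc (B := B)).counit.hom_inv_id,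
      congrArg (fun Γ => Γ.as.app (X, Y, Z)) (TensorStruct.assoc (B := B)).counit.inv_hom_id⟩⟩⟩

instance (X : B) : IsEquivalence (lu X) :=
  ⟨TensorStruct.leftUnit.inv.app X,
    ⟨⟨(TensorStruct.leftUnit (B := B)).unit.inv.as.app X,
      (TensorStruct.leftUnit (B := B)).unit.hom.as.app X,
      congrArg (fun Γ => Γ.as.app X) (TensorStruct.leftUnit (B := B)).unit.inv_hom_id,
      congrArg (fun Γ => Γ.as.app X) (TensorStruct.leftUnit (B := B)).unit.hom_inv_id⟩⟩,
    ⟨⟨(TensorStruct.leftUnit (B := B)).counit.hom.as.app X,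
      (TensorStruct.leftUnit (B := B)).counit.inv.as.app X,
      congrArg (fun Γ => Γ.as.app X) (TensorStruct.leftUnit (B := B)).counit.hom_inv_id,
      congrArg (fun Γ => Γ.as.app X) (TensorStruct.leftUnit (B := B)).counit.inv_hom_id⟩⟩⟩

instance (X : B) : IsEquivalence (ru X) :=
  ⟨TensorStruct.rightUnit.inv.app X,
    ⟨⟨(TensorStruct.rightUnit (B := B)).unit.inv.as.app X,
      (TensorStruct.rightUnit (B := B)).unit.hom.as.app X,
      congrArg (fun Γ => Γ.as.app X) (TensorStruct.rightUnit (B := B)).unit.inv_hom_id,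
      congrArg (fun Γ => Γ.as.app X) (TensorStruct.rightUnit (B := B)).unit.hom_inv_id⟩⟩,
    ⟨⟨(TensorStruct.rightUnit (B := B)).counit.hom.as.app X,
      (TensorStruct.rightUnit (B := B)).counit.inv.as.app X,
      congrArg (fun Γ => Γ.as.app X) (TensorStruct.rightUnit (B := B)).counit.hom_inv_id,
      congrArg (fun Γ => Γ.as.app X) (TensorStruct.rightUnit (B := B)).counit.inv_hom_id⟩⟩⟩

instance {X Y : B} (e : X ⟶ Y) [IsEquivalence e] (Z : B) : IsEquivalence (e ▹ Z) := by
  obtain ⟨e', ⟨η⟩, ⟨κ⟩⟩ := IsEquivalence.exists_inverse (e := e)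
  exact ⟨e' ▹ Z, ⟨(wR e e' Z).symm ≪≫ tIso η (Iso.refl _) ≪≫ tId X Z⟩,
    ⟨(wR e' e Z).symm ≪≫ tIso κ (Iso.refl _) ≪≫ tId Y Z⟩⟩

instance (Z : B) {X Y : B} (e : X ⟶ Y) [IsEquivalence e] : IsEquivalence (Z ◃ e) := by
  obtain ⟨e', ⟨η⟩, ⟨κ⟩⟩ := IsEquivalence.exists_inverse (e := e)
  exact ⟨Z ◃ e', ⟨(wL Z e e').symm ≪≫ tIso (Iso.refl _) η ≪≫ tId Z X⟩,
    ⟨(wL Z e' e).symm ≪≫ tIso (Iso.refl _) κ ≪≫ tId Z Y⟩⟩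

/-- The left unit constraint is a pseudonatural equivalence, so tensoring with the unit object is
equivalent to the identity and hence faithful on 2-cells. -/
theorem lOn_injective {X Y : B} {f g : X ⟶ Y} {c d : f ⟶ g} {f' g' : unitObj B ⊠ X ⟶ unitObj B ⊠ Y}
    [ImgL (unitObj B) f f'] [ImgL (unitObj B) g g'] (h : unitObj B ◃₂ c = unitObj B ◃₂ d) :
    c = d := by
  apply whiskerLeft_injective (lu X)
  rw [← cancel_epi (lup f (f₁ := f') (k := f' ≫ lu Y)).hom, ← lup_naturality c (g₁ := g'),
    ← lup_naturality d (g₁ := g'), h]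

theorem rOn_injective {X Y : B} {f g : X ⟶ Y} {c d : f ⟶ g} {f' g' : X ⊠ unitObj B ⟶ Y ⊠ unitObj B}
    [ImgR (unitObj B) f f'] [ImgR (unitObj B) g g'] (h : c ▹₂ unitObj B = d ▹₂ unitObj B) :
    c = d := by
  apply whiskerLeft_injective (ru X)
  rw [← cancel_epi (rup f (f₁ := f') (k := f' ≫ ru Y)).hom, ← rup_naturality c (g₁ := g'),
    ← rup_naturality d (g₁ := g'), h]

instance {X Y Z : B} {f g : X ⟶ Y} (c : f ⟶ g) [IsIso c] (k : Y ⟶ Z) {fk gk : X ⟶ Z} [Glue f k fk]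
    [Glue g k gk] : IsIso (c ⊳ k) := by
  unfold cellAt
  infer_instance

instance {X Y : B} {f g : X ⟶ Y} (c : f ⟶ g) [IsIso c] (Z : B) {f' g' : X ⊠ Z ⟶ Y ⊠ Z}
    [ImgR Z f f'] [ImgR Z g g'] : IsIso (c ▹₂ Z) :=
  ⟨inv c ▹₂ Z, by simp, by simp⟩

instance {X Y : B} {f g : X ⟶ Y} (c : f ⟶ g) [IsIso c] (Z : B) {f' g' : Z ⊠ X ⟶ Z ⊠ Y}
    [ImgL Z f f'] [ImgL Z g g'] : IsIso (Z ◃₂ c) :=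
  ⟨Z ◃₂ inv c, by simp, by simp⟩

end

/-! ### The pentagon against the left triangle -/

section Coherence

open MonoidalStruct

local notation "𝕀" => unitObj _

variable {B : Type u} [Bicategory.{w, v} B] [MonoidalBicategory B]

/-- The other side of the law, tensored with `X` and continued in the same way, has the same value;
here the associativity condition `five_path` enters, with the unit in second place. -/
theorem leftTri_pent_aux₂ (X T S R : B) :
    (as X 𝕀 T ▹ S) ▹ R ◁ as X (𝕀 ⊠ T) S ▹ R ◁
      ((asM X (as 𝕀 T S) R).hom ⊳ (X ◃ as 𝕀 (T ⊠ S) R ≫ X ◃ (𝕀 ◃ as T S R) ≫ X ◃ lu (T ⊠ (S ⊠ R))) ≫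
      as X ((𝕀 ⊠ T) ⊠ S) R ◁
        (X ◃₂ ((pent 𝕀 T S R).hom ⊳ lu (T ⊠ (S ⊠ R)) ≫
          as (𝕀 ⊠ T) S R ◁ (leftTri T (S ⊠ R)).hom ≫ (asL (lu T) S R).inv)) ≫
      (asM X (lu T ▹ S) R).inv ⊳ (X ◃ as T S R)) ≫
      (as X 𝕀 T ▹ S) ▹ R ◁ ((asM X (lu T) S).inv ▹₂ R) ⊳ (as X (T ⊠ S) R ≫ X ◃ as T S R) ≫
      ((midTri X T).hom ▹₂ S ▹₂ R) ⊳ (as X T S ▹ R ≫ as X (T ⊠ S) R ≫ X ◃ as T S R) = 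
     ((pent X 𝕀 T S).hom ▹₂ R) ⊳
        (as X (𝕀 ⊠ (T ⊠ S)) R ≫ X ◃ as 𝕀 (T ⊠ S) R ≫ X ◃ (𝕀 ◃ as T S R) ≫ X ◃ lu (T ⊠ (S ⊠ R))) ≫
      as (X ⊠ 𝕀) T S ▹ R ◁ (pent X 𝕀 (T ⊠ S) R).hom ⊳ (X ◃ (𝕀 ◃ as T S R) ≫ X ◃ lu (T ⊠ (S ⊠ R))) ≫
      as (X ⊠ 𝕀) T S ▹ R ◁ as (X ⊠ 𝕀) (T ⊠ S) R ◁ (asR X 𝕀 (as T S R)).inv ⊳ (X ◃ lu (T ⊠ (S ⊠ R))) ≫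
      (pent (X ⊠ 𝕀) T S R).hom ⊳ (as X 𝕀 (T ⊠ (S ⊠ R)) ≫ X ◃ lu (T ⊠ (S ⊠ R))) ≫
      as ((X ⊠ 𝕀) ⊠ T) S R ◁ as (X ⊠ 𝕀) T (S ⊠ R) ◁ (midTri X (T ⊠ (S ⊠ R))).hom ≫
      as ((X ⊠ 𝕀) ⊠ T) S R ◁ (asL (ru X) T (S ⊠ R)).inv ≫ (asL (ru X ▹ T) S R).inv ⊳ as X T (S ⊠ R) ≫
      ((ru X ▹ T) ▹ S) ▹ R ◁ (pent X T S R).inv := by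
  have y₁ := congrArg (fun c => (as X 𝕀 T ▹ S) ▹ R ◁ c) (pent_naturality₂_inv X (lu T) S R)
  have y₂ := congrArg (fun c => (as X 𝕀 T ▹ S) ▹ R ◁ c)
    (cellAt_exchange (pent X (𝕀 ⊠ T) S R).hom (X ◃₂ (leftTri T (S ⊠ R)).hom))
  have y₃ := cellAt_exchange ((midTri X T).hom ▹₂ S ▹₂ R) (pent X T S R).inv
  have y₄' := asLp_naturality_inv S R (midTri X T).hom
  simp at y₄'
  have y₄ := congrArg (fun c => ((asL (as X 𝕀 T) S R).hom ⊳ ((X ◃ lu T) ▹ (S ⊠ R)) ≫ c) ⊳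
    as X T (S ⊠ R)) y₄'
  have y₅ := cellAt_exchange (asL (as X 𝕀 T) S R).hom (as X (𝕀 ⊠ T) (S ⊠ R) ◁
    (X ◃₂ (leftTri T (S ⊠ R)).hom) ≫ (asM X (lu T) (S ⊠ R)).inv)
  have y₆ := congrArg (fun c => as ((X ⊠ 𝕀) ⊠ T) S R ◁ c) (normLeft_path X T (S ⊠ R))
  have y₇ := congrArg (fun c => c ⊳ (X ◃ lu (T ⊠ S ⊠ R))) (five_path X 𝕀 T S R)
  simp at y₁ y₂ y₃ y₄ y₅ y₆ y₇
  simp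
  rw [reassoc_of% y₁, ← y₃, ← reassoc_of% y₄, ← reassoc_of% y₂, ← reassoc_of% y₅, reassoc_of% y₆,
    reassoc_of% y₇]

/-- The first derived coherence law: the associativity constraint whiskered with `lu`. -/
theorem pent_leftTri (T S R : B) :
    as 𝕀 T S ▹ R ◁ as 𝕀 (T ⊠ S) R ◁ (luNat (as T S R)).hom ≫
        as 𝕀 T S ▹ R ◁ (leftTri (T ⊠ S) R).hom ⊳ as T S R ≫
        ((leftTri T S).hom ▹₂ R) ⊳ as T S R =
      (pent 𝕀 T S R).hom ⊳ lu (T ⊠ (S ⊠ R)) ≫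
        as (𝕀 ⊠ T) S R ◁ (leftTri T (S ⊠ R)).hom ≫ (asL (lu T) S R).inv := by
  -- The auxiliary object is now the unit, so that tensoring with it can be cancelled along with the
  -- invertible cells and the equivalences.
  have h := (leftTri_pent_aux₁ 𝕀 T S R).trans (leftTri_pent_aux₂ 𝕀 T S R).symm
  have h' := (cancel_epi _).1 (whiskerLeft_injective _ (whiskerLeft_injective _ ((cancel_mono _).1 h)))
  exact lOn_injective (whiskerLeft_injective _ ((cancel_mono _).1 h'))

end Coherence

/-! ### The pentagon against the right triangle -/

section Coherence

open MonoidalStruct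

local notation "𝕀" => unitObj _

variable {B : Type u} [Bicategory.{w, v} B] [MonoidalBicategory B]

theorem pent_naturality₃_inv (X Y : B) {Z Z' : B} (h : Z ⟶ Z') (W : B) :
    as X Y Z ▹ W ◁ as X (Y ⊠ Z) W ◁ (X ◃₂ (asM Y h W).inv) ≫
        as X Y Z ▹ W ◁ (asM X (Y ◃ h) W).inv ⊳ (X ◃ as Y Z' W) ≫
        ((asR X Y h).inv ▹₂ W) ⊳ (as X (Y ⊠ Z') W ≫ X ◃ as Y Z' W) =
      (pent X Y Z W).hom ⊳ (X ◃ (Y ◃ (h ▹ W))) ≫ as (X ⊠ Y) Z W ◁ (asR X Y (h ▹ W)).inv ≫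
        (asM (X ⊠ Y) h W).inv ⊳ as X Y (Z' ⊠ W) ≫ ((X ⊠ Y) ◃ h) ▹ W ◁ (pent X Y Z' W).inv := by
  have h := congrArg (fun c => (as X Y Z ▹ W ◁ as X (Y ⊠ Z) W ◁ (X ◃₂ (asM Y h W).inv) ≫
        as X Y Z ▹ W ◁ (asM X (Y ◃ h) W).inv ⊳ (X ◃ as Y Z' W) ≫
        ((asR X Y h).inv ▹₂ W) ⊳ (as X (Y ⊠ Z') W ≫ X ◃ as Y Z' W)) ≫ c ≫
    as (X ⊠ Y) Z W ◁ (asR X Y (h ▹ W)).inv ≫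
        (asM (X ⊠ Y) h W).inv ⊳ as X Y (Z' ⊠ W) ≫ ((X ⊠ Y) ◃ h) ▹ W ◁ (pent X Y Z' W).inv)
    (pent_naturality₃ X Y h W)
  simpa using h

theorem pent_naturality₄_inv (X Y Z : B) {W W' : B} (k : W ⟶ W') :
    as X Y Z ▹ W ◁ as X (Y ⊠ Z) W ◁ (X ◃₂ (asR Y Z k).inv) ≫
        as X Y Z ▹ W ◁ (asR X (Y ⊠ Z) k).inv ⊳ (X ◃ as Y Z W') ≫
        (inter (as X Y Z) k).hom ⊳ (as X (Y ⊠ Z) W' ≫ X ◃ as Y Z W') =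
      (pent X Y Z W).hom ⊳ (X ◃ (Y ◃ (Z ◃ k))) ≫ as (X ⊠ Y) Z W ◁ (asR X Y (Z ◃ k)).inv ≫
        (asR (X ⊠ Y) Z k).inv ⊳ as X Y (Z ⊠ W') ≫ ((X ⊠ Y) ⊠ Z) ◃ k ◁ (pent X Y Z W').inv := by
  have h := congrArg (fun c => (as X Y Z ▹ W ◁ as X (Y ⊠ Z) W ◁ (X ◃₂ (asR Y Z k).inv) ≫
        as X Y Z ▹ W ◁ (asR X (Y ⊠ Z) k).inv ⊳ (X ◃ as Y Z W') ≫
        (inter (as X Y Z) k).hom ⊳ (as X (Y ⊠ Z) W' ≫ X ◃ as Y Z W')) ≫ c ≫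
    as (X ⊠ Y) Z W ◁ (asR X Y (Z ◃ k)).inv ≫
        (asR (X ⊠ Y) Z k).inv ⊳ as X Y (Z ⊠ W') ≫ ((X ⊠ Y) ⊠ Z) ◃ k ◁ (pent X Y Z W').inv)
    (pent_naturality₄ X Y Z k)
  simpa using h

/-- Mirror image of the left case: the auxiliary object `W` stands behind the final unit, so that
`normRight_path` applies. This side of the law needs `five_path` and two uses of `normRight_path`;
the other side needs a single use. -/
theorem rightTri_pent_aux₁ (X Y Z W : B) :
    (as X Y Z ▹ 𝕀) ▹ W ◁ as X (Y ⊠ Z) 𝕀 ▹ W ◁ (X ◃ as Y Z 𝕀) ▹ W ◁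
      (as X (Y ⊠ Z ⊠ 𝕀) W ◁ (X ◃₂ (as Y (Z ⊠ 𝕀) W ◁ (Y ◃₂ (midTri Z W).hom) ≫
          (asM Y (ru Z) W).inv)) ≫
        (asM X (Y ◃ ru Z) W).inv ⊳ (X ◃ as Y Z W)) ≫
      ((as X Y Z ▹ 𝕀 ◁ as X (Y ⊠ Z) 𝕀 ◁ (X ◃₂ (rightTri Y Z).hom) ≫
        as X Y Z ▹ 𝕀 ◁ (rightTri X (Y ⊠ Z)).hom ≫ (ruNat (as X Y Z)).hom) ▹₂ W) ⊳
        (as X (Y ⊠ Z) W ≫ X ◃ as Y Z W) =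
    ((pent X Y Z 𝕀).hom ▹₂ W) ⊳ (as X (Y ⊠ (Z ⊠ 𝕀)) W ≫ X ◃ as Y (Z ⊠ 𝕀) W ≫
        X ◃ (Y ◃ as Z 𝕀 W) ≫ X ◃ (Y ◃ (Z ◃ lu W))) ≫
      as (X ⊠ Y) Z 𝕀 ▹ W ◁ (pent X Y (Z ⊠ 𝕀) W).hom ⊳
        (X ◃ (Y ◃ as Z 𝕀 W) ≫ X ◃ (Y ◃ (Z ◃ lu W))) ≫
      as (X ⊠ Y) Z 𝕀 ▹ W ◁ as (X ⊠ Y) (Z ⊠ 𝕀) W ◁ (asR X Y (as Z 𝕀 W)).inv ⊳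
        (X ◃ (Y ◃ (Z ◃ lu W))) ≫
      (pent (X ⊠ Y) Z 𝕀 W).hom ⊳ (as X Y (Z ⊠ (𝕀 ⊠ W)) ≫ X ◃ (Y ◃ (Z ◃ lu W))) ≫
      as ((X ⊠ Y) ⊠ Z) 𝕀 W ◁ as (X ⊠ Y) Z (𝕀 ⊠ W) ◁ (asR X Y (Z ◃ lu W)).inv ≫
      as ((X ⊠ Y) ⊠ Z) 𝕀 W ◁ (asR (X ⊠ Y) Z (lu W)).inv ⊳ as X Y (Z ⊠ W) ≫
      (midTri ((X ⊠ Y) ⊠ Z) W).hom ⊳ (as (X ⊠ Y) Z W ≫ as X Y (Z ⊠ W)) ≫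
      (ru ((X ⊠ Y) ⊠ Z) ▹ W) ◁ (pent X Y Z W).inv := by
  have x₁ := asMp_naturality_inv X W (rightTri Y Z).hom
  simp at x₁
  replace x₁ := congrArg (fun c => (as X Y Z ▹ 𝕀) ▹ W ◁ as X (Y ⊠ Z) 𝕀 ▹ W ◁
    ((asM X (as Y Z 𝕀) W).hom ⊳ (X ◃ ((Y ◃ ru Z) ▹ W)) ≫ c) ⊳ (X ◃ as Y Z W)) x₁
  have x₂ := congrArg (fun c => (as X Y Z ▹ 𝕀) ▹ W ◁ as X (Y ⊠ Z) 𝕀 ▹ W ◁ c)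
    (cellAt_exchange (asM X (as Y Z 𝕀) W).hom (X ◃₂ (as Y (Z ⊠ 𝕀) W ◁ (Y ◃₂ (midTri Z W).hom) ≫
          (asM Y (ru Z) W).inv)))
  have x₃ := congrArg (fun c => (as X Y Z ▹ 𝕀) ▹ W ◁ as X (Y ⊠ Z) 𝕀 ▹ W ◁ as X ((Y ⊠ Z) ⊠ 𝕀) W ◁
    X ◃₂ c) (normRight_path Y Z W)
  have x₄ := congrArg (fun c => (as X Y Z ▹ 𝕀) ▹ W ◁ c ⊳ (X ◃ as Y Z W)) (normRight_path X (Y ⊠ Z) W)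
  have x₅ := congrArg (fun c => (as X Y Z ▹ 𝕀) ▹ W ◁ c)
    (cellAt_exchange (pent X (Y ⊠ Z) 𝕀 W).hom (X ◃₂ (asR Y Z (lu W)).inv))
  have x₆ := congrArg (fun c => c ⊳ (as X (Y ⊠ Z) W ≫ X ◃ as Y Z W))
    (midTri_naturality₁ (as X Y Z) W)
  have x₇ := cellAt_exchange (asL (as X Y Z) 𝕀 W).hom (as X (Y ⊠ Z) (𝕀 ⊠ W) ◁
    (X ◃₂ (asR Y Z (lu W)).inv) ≫ (asR X (Y ⊠ Z) (lu W)).inv ⊳ (X ◃ as Y Z W))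
  have x₈ := congrArg (fun c => as ((X ⊠ Y) ⊠ Z) 𝕀 W ◁ c) (pent_naturality₄_inv X Y Z (lu W))
  have x₉ := cellAt_exchange (midTri ((X ⊠ Y) ⊠ Z) W).hom (pent X Y Z W).inv
  have x₁₀ := congrArg (fun c => c ⊳ (X ◃ (Y ◃ (Z ◃ lu W)))) (five_path X Y Z 𝕀 W)
  simp at x₁ x₂ x₃ x₄ x₅ x₆ x₇ x₈ x₉ x₁₀
  simp
  rw [← reassoc_of% x₁, ← reassoc_of% x₂]
  rw [reassoc_of% x₃]
  rw [reassoc_of% x₄]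
  rw [← reassoc_of% x₅]
  rw [x₆]
  rw [← reassoc_of% x₇]
  rw [reassoc_of% x₈]
  rw [← x₉]
  rw [reassoc_of% x₁₀]

theorem rightTri_pent_aux₂ (X Y Z W : B) :
    (as X Y Z ▹ 𝕀) ▹ W ◁ as X (Y ⊠ Z) 𝕀 ▹ W ◁ (X ◃ as Y Z 𝕀) ▹ W ◁
      (as X (Y ⊠ Z ⊠ 𝕀) W ◁ (X ◃₂ (as Y (Z ⊠ 𝕀) W ◁ (Y ◃₂ (midTri Z W).hom) ≫
          (asM Y (ru Z) W).inv)) ≫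
        (asM X (Y ◃ ru Z) W).inv ⊳ (X ◃ as Y Z W)) ≫
      (((pent X Y Z 𝕀).hom ⊳ (X ◃ (Y ◃ ru Z)) ≫ as (X ⊠ Y) Z 𝕀 ◁ (asR X Y (ru Z)).inv ≫
        (rightTri (X ⊠ Y) Z).hom ⊳ as X Y Z) ▹₂ W) ⊳
        (as X (Y ⊠ Z) W ≫ X ◃ as Y Z W) =
    ((pent X Y Z 𝕀).hom ▹₂ W) ⊳ (as X (Y ⊠ (Z ⊠ 𝕀)) W ≫ X ◃ as Y (Z ⊠ 𝕀) W ≫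
        X ◃ (Y ◃ as Z 𝕀 W) ≫ X ◃ (Y ◃ (Z ◃ lu W))) ≫
      as (X ⊠ Y) Z 𝕀 ▹ W ◁ (pent X Y (Z ⊠ 𝕀) W).hom ⊳
        (X ◃ (Y ◃ as Z 𝕀 W) ≫ X ◃ (Y ◃ (Z ◃ lu W))) ≫
      as (X ⊠ Y) Z 𝕀 ▹ W ◁ as (X ⊠ Y) (Z ⊠ 𝕀) W ◁ (asR X Y (as Z 𝕀 W)).inv ⊳
        (X ◃ (Y ◃ (Z ◃ lu W))) ≫
      (pent (X ⊠ Y) Z 𝕀 W).hom ⊳ (as X Y (Z ⊠ (𝕀 ⊠ W)) ≫ X ◃ (Y ◃ (Z ◃ lu W))) ≫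
      as ((X ⊠ Y) ⊠ Z) 𝕀 W ◁ as (X ⊠ Y) Z (𝕀 ⊠ W) ◁ (asR X Y (Z ◃ lu W)).inv ≫
      as ((X ⊠ Y) ⊠ Z) 𝕀 W ◁ (asR (X ⊠ Y) Z (lu W)).inv ⊳ as X Y (Z ⊠ W) ≫
      (midTri ((X ⊠ Y) ⊠ Z) W).hom ⊳ (as (X ⊠ Y) Z W ≫ as X Y (Z ⊠ W)) ≫
      (ru ((X ⊠ Y) ⊠ Z) ▹ W) ◁ (pent X Y Z W).inv := by
  have y₁ := cellAt_exchange ((pent X Y Z 𝕀).hom ▹₂ W) (as X (Y ⊠ Z ⊠ 𝕀) W ◁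
    (X ◃₂ (as Y (Z ⊠ 𝕀) W ◁ (Y ◃₂ (midTri Z W).hom) ≫ (asM Y (ru Z) W).inv)) ≫
    (asM X (Y ◃ ru Z) W).inv ⊳ (X ◃ as Y Z W))
  have y₂ := congrArg (fun c => as (X ⊠ Y) Z 𝕀 ▹ W ◁ c) (pent_naturality₃_inv X Y (ru Z) W)
  have y₃ := cellAt_exchange ((rightTri (X ⊠ Y) Z).hom ▹₂ W) (pent X Y Z W).inv
  have y₄ := congrArg (fun c => as (X ⊠ Y) Z 𝕀 ▹ W ◁ c)
    (cellAt_exchange (pent X Y (Z ⊠ 𝕀) W).hom (X ◃₂ (Y ◃₂ (midTri Z W).hom)))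
  have y₅ := congrArg (fun c => as (X ⊠ Y) Z 𝕀 ▹ W ◁ as (X ⊠ Y) (Z ⊠ 𝕀) W ◁ c)
    (asRp_naturality_inv X Y (midTri Z W).hom)
  have y₆ := congrArg (fun c => c ⊳ as X Y (Z ⊠ W)) (normRight_path (X ⊠ Y) Z W)
  have y₇ := cellAt_exchange (pent (X ⊠ Y) Z 𝕀 W).hom (asR X Y (Z ◃ lu W)).inv
  simp at y₁ y₂ y₃ y₄ y₅ y₆ y₇
  simp
  rw [← reassoc_of% y₁]
  rw [reassoc_of% y₂]
  rw [← y₃]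
  rw [← reassoc_of% y₄]
  rw [reassoc_of% y₅]
  rw [reassoc_of% y₆]
  rw [← reassoc_of% y₇]

/-- Both sides have the same value after tensoring on the right with an object; that object is taken
to be the unit, and tensoring with it is faithful. -/
theorem pent_rightTri (X Y Z : B) :
    as X Y Z ▹ 𝕀 ◁ as X (Y ⊠ Z) 𝕀 ◁ (X ◃₂ (rightTri Y Z).hom) ≫
        as X Y Z ▹ 𝕀 ◁ (rightTri X (Y ⊠ Z)).hom ≫ (ruNat (as X Y Z)).hom =
      (pent X Y Z 𝕀).hom ⊳ (X ◃ (Y ◃ ru Z)) ≫ as (X ⊠ Y) Z 𝕀 ◁ (asR X Y (ru Z)).inv ≫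
        (rightTri (X ⊠ Y) Z).hom ⊳ as X Y Z := by
  have h := (rightTri_pent_aux₁ X Y Z 𝕀).trans (rightTri_pent_aux₂ X Y Z 𝕀).symm
  exact rOn_injective (cellAt_injective _ ((cancel_epi _).1 h))

end Coherence

/-! ### The left triangle against the right triangle -/

section Coherence

open MonoidalStruct

local notation "𝕀" => unitObj _

variable {B : Type u} [Bicategory.{w, v} B] [MonoidalBicategory B]

theorem leftTri_rightTri_aux₁ (Z X : B) :
    as Z 𝕀 X ▹ 𝕀 ◁ (as Z (𝕀 ⊠ X) 𝕀 ◁ (Z ◃₂ ((leftTri X 𝕀).hom ⊳ ru X ≫ (ruNat (lu X)).hom)) ≫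
        (rightTri Z (𝕀 ⊠ X)).hom ⊳ (Z ◃ lu X)) ≫
      (ruNat (as Z 𝕀 X)).hom ⊳ (Z ◃ lu X) ≫ ru ((Z ⊠ 𝕀) ⊠ X) ◁ (midTri Z X).hom =
    (pent Z 𝕀 X 𝕀).hom ⊳ (Z ◃ lu (X ⊠ 𝕀) ≫ Z ◃ ru X) ≫
      as (Z ⊠ 𝕀) X 𝕀 ◁ (midTri Z (X ⊠ 𝕀)).hom ⊳ (Z ◃ ru X) ≫
      as (Z ⊠ 𝕀) X 𝕀 ◁ (inter (ru Z) (ru X)).hom ≫ (rightTri (Z ⊠ 𝕀) X).hom ⊳ (ru Z ▹ X) := by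
  have h := congrArg (fun c => (asM Z (lu X) 𝕀).inv ⊳ (Z ◃ ru X) ≫ c) (rightTri_naturality₂ Z (lu X))
  simp at h
  have x₁ := congrArg (fun c => as Z 𝕀 X ▹ 𝕀 ◁ c) h
  have x₂ := rup_naturality (midTri Z X).hom
  have x₃ := cellAt_exchange ((midTri Z X).hom ▹₂ 𝕀) (rightTri Z X).hom
  have x₄ := congrArg (fun c => c ⊳ (Z ◃ ru X)) (normLeft_path Z X 𝕀)
  have x₅ := rightTri_naturality₁ (ru Z) X
  simp at x₁ x₂ x₃ x₄ x₅
  simp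
  rw [← reassoc_of% x₁, ← x₂, ← reassoc_of% x₃, reassoc_of% x₄, x₅]
  simp

theorem leftTri_rightTri_aux₂ (Z X : B) :
    as Z 𝕀 X ▹ 𝕀 ◁ (as Z (𝕀 ⊠ X) 𝕀 ◁ (Z ◃₂ (as 𝕀 X 𝕀 ◁ (luNat (ru X)).inv ≫
          (rightTri 𝕀 X).hom ⊳ lu X)) ≫
        (rightTri Z (𝕀 ⊠ X)).hom ⊳ (Z ◃ lu X)) ≫
      (ruNat (as Z 𝕀 X)).hom ⊳ (Z ◃ lu X) ≫ ru ((Z ⊠ 𝕀) ⊠ X) ◁ (midTri Z X).hom =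
    (pent Z 𝕀 X 𝕀).hom ⊳ (Z ◃ lu (X ⊠ 𝕀) ≫ Z ◃ ru X) ≫
      as (Z ⊠ 𝕀) X 𝕀 ◁ (midTri Z (X ⊠ 𝕀)).hom ⊳ (Z ◃ ru X) ≫
      as (Z ⊠ 𝕀) X 𝕀 ◁ (inter (ru Z) (ru X)).hom ≫ (rightTri (Z ⊠ 𝕀) X).hom ⊳ (ru Z ▹ X) := by
  have y₁ := congrArg (fun c => c ⊳ (Z ◃ lu X)) (pent_rightTri Z 𝕀 X)
  have y₂ := cellAt_exchange (rightTri (Z ⊠ 𝕀) X).hom (midTri Z X).hom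
  have h := congrArg (fun c => as Z 𝕀 (X ⊠ 𝕀) ◁ (Z ◃₂ (luNat (ru X)).inv) ≫ c ≫
    (inter (ru Z) (ru X)).hom) (midTri_naturality₂_inv Z (ru X))
  simp at h
  have y₃ := congrArg (fun c => as (Z ⊠ 𝕀) X 𝕀 ◁ c) h
  have y₄ := cellAt_exchange (pent Z 𝕀 X 𝕀).hom (Z ◃₂ (luNat (ru X)).inv)
  simp at y₁ y₂ y₃ y₄
  simp
  rw [reassoc_of% y₁, y₂, reassoc_of% y₃, reassoc_of% y₄]

/-- After tensoring with an object `Z` in front, one side is computed from `normLeft_path` and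
naturality of the right triangle, the other from `pent_rightTri`. Taking `Z` to be the unit allows
cancellation. The law is needed for the right unitor of the coherence square. -/
theorem leftTri_rightTri (X : B) :
    (leftTri X 𝕀).hom ⊳ ru X ≫ (ruNat (lu X)).hom =
      as 𝕀 X 𝕀 ◁ (luNat (ru X)).inv ≫ (rightTri 𝕀 X).hom ⊳ lu X := by
  have h := (leftTri_rightTri_aux₁ 𝕀 X).trans (leftTri_rightTri_aux₂ 𝕀 X).symm
  exact lOn_injective (whiskerLeft_injective _ ((cancel_mono _).1
    (whiskerLeft_injective _ ((cancel_mono _).1 h))))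

end Coherence

/-! ### The two unit constraints of the unit object -/

section Equivalences

variable {B : Type u} [Bicategory.{w, v} B] {X Y Z : B}

/-- No triangle identity for `η` is required: whiskering with `e'` can be cancelled, and after it
the claim is interchange with `η`. -/
theorem whiskerRight_cancelRight {f g : X ⟶ Y} {e : Y ⟶ Z} [IsEquivalence e] {e' : Z ⟶ Y}
    [IsEquivalence e'] (η : 𝟙 Y ≅ e ≫ e') (φ : f ≫ e ≅ g ≫ e) :
    (cancelRight η φ).hom ▷ e = φ.hom := by
  apply whiskerRight_injective e'
  rw [← cancel_epi (α_ _ _ _).inv, ← cancel_mono (α_ _ _ _).hom, ← cancel_epi (f ◁ η.hom)]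
  have h : (cancelRight η φ).hom ▷ e ▷ e' = (α_ f e e').hom ≫
      (cancelRight η φ).hom ▷ (e ≫ e') ≫ (α_ g e e').inv := by simp
  rw [h]
  simp only [Category.assoc, Iso.inv_hom_id_assoc, Iso.inv_hom_id, Category.comp_id]
  rw [whisker_exchange, cancelRight]
  simp

theorem whiskerLeft_cancelLeft {f g : Y ⟶ Z} {e : X ⟶ Y} [IsEquivalence e] {e' : Y ⟶ X}
    [IsEquivalence e'] (κ : e' ≫ e ≅ 𝟙 Y) (φ : e ≫ f ≅ e ≫ g) :
    e ◁ (cancelLeft κ φ).hom = φ.hom := by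
  apply whiskerLeft_injective e'
  rw [← cancel_epi (α_ _ _ _).hom, ← cancel_mono (α_ _ _ _).inv, ← cancel_mono (κ.hom ▷ g)]
  have h : e' ◁ e ◁ (cancelLeft κ φ).hom = (α_ e' e f).inv ≫
      (e' ≫ e) ◁ (cancelLeft κ φ).hom ≫ (α_ e' e g).hom := by simp
  rw [h]
  simp only [Category.assoc, Iso.hom_inv_id_assoc, Iso.hom_inv_id, Category.comp_id]
  rw [whisker_exchange, cancelLeft]
  simp

end Equivalences

section Coherence

open MonoidalStruct

local notation "𝕀" => unitObj _

variable {B : Type u} [Bicategory.{w, v} B] [MonoidalBicategory B]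

/-- The components of the inverse of the left unit constraint. -/
def luInv (X : B) : X ⟶ 𝕀 ⊠ X := TensorStruct.leftUnit.inv.app X

/-- The components of the inverse of the right unit constraint. -/
def ruInv (X : B) : X ⟶ X ⊠ 𝕀 := TensorStruct.rightUnit.inv.app X

instance (X : B) : IsEquivalence (luInv X) :=
  ⟨lu X,
    ⟨⟨(TensorStruct.leftUnit (B := B)).counit.hom.as.app X,
      (TensorStruct.leftUnit (B := B)).counit.inv.as.app X,
      congrArg (fun Γ => Γ.as.app X) (TensorStruct.leftUnit (B := B)).counit.hom_inv_id,
      congrArg (fun Γ => Γ.as.app X) (TensorStruct.leftUnit (B := B)).counit.inv_hom_id⟩⟩,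
    ⟨(luUnit X).symm⟩⟩

instance (X : B) : IsEquivalence (ruInv X) :=
  ⟨ru X, ⟨ruCounit X⟩,
    ⟨⟨(TensorStruct.rightUnit (B := B)).unit.inv.as.app X,
      (TensorStruct.rightUnit (B := B)).unit.hom.as.app X,
      congrArg (fun Γ => Γ.as.app X) (TensorStruct.rightUnit (B := B)).unit.inv_hom_id,
      congrArg (fun Γ => Γ.as.app X) (TensorStruct.rightUnit (B := B)).unit.hom_inv_id⟩⟩⟩

theorem luLu_lu (X : B) : (luLu X).hom ⊳ lu X = (luNat (lu X)).inv := by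
  rw [cellAt_base]
  exact whiskerRight_cancelRight (e := lu X) (e' := luInv X) (luUnit X) (luNat (lu X)).symm

/-- Tested after composing with the equivalence `lu X'`, where `luLu` turns into an inverse
naturality cell of `lu`. The compatibility with tensor products below is proved by the same device.
-/
theorem luLu_naturality {X X' : B} (f : X ⟶ X') :
    𝕀 ◃ (𝕀 ◃ f) ◁ (luLu X').hom ≫ (𝕀 ◃₂ (luNat f).hom) =
      (luNat (𝕀 ◃ f)).hom ≫ (luLu X).hom ⊳ (𝕀 ◃ f) := by
  apply cellAt_injective (lu X')
  have x₁ := lup_naturality (luNat f).hom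
  have x₂ := cellAt_exchange (luLu X).hom (luNat f).hom
  have x₃ := congrArg (fun c => c ⊳ f) (luLu_lu X)
  simp at x₁ x₂ x₃
  rw [← cancel_mono (𝕀 ◃ lu X ◁ (luNat f).hom), ← cancel_mono ((luNat (lu X)).hom ⊳ f)]
  simp [luLu_lu]
  rw [x₁, reassoc_of% x₂, x₃]
  simp

theorem luLu_tensor (Y X : B) :
    ((luLu Y).hom ▹₂ X) ⊳ as 𝕀 Y X ≫ (asM 𝕀 (lu Y) X).hom ≫
        as 𝕀 (𝕀 ⊠ Y) X ◁ (𝕀 ◃₂ (leftTri Y X).inv) =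
      (leftTri (𝕀 ⊠ Y) X).inv ⊳ as 𝕀 Y X ≫ as 𝕀 (𝕀 ⊠ Y) X ◁ (luNat (as 𝕀 Y X)).inv ≫
        as 𝕀 (𝕀 ⊠ Y) X ◁ 𝕀 ◃ as 𝕀 Y X ◁ (luLu (Y ⊠ X)).hom := by
  apply cellAt_injective (lu (Y ⊠ X))
  rw [← cancel_mono (as 𝕀 (𝕀 ⊠ Y) X ◁ (𝕀 ◃₂ (leftTri Y X).hom) ⊳ lu (Y ⊠ X)),
    ← cancel_mono (as 𝕀 (𝕀 ⊠ Y) X ◁ (luNat (lu Y ▹ X)).hom),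
    ← cancel_mono ((leftTri (𝕀 ⊠ Y) X).hom ⊳ (lu Y ▹ X))]
  have x₁ := leftTri_naturality₁ (lu Y) X
  have x₂ := cellAt_exchange ((luLu Y).hom ▹₂ X) (leftTri Y X).hom
  have x₃ := congrArg (fun c => c ▹₂ X) (luLu_lu Y)
  have x₄ := lup_naturality (leftTri Y X).hom
  simp at x₄
  replace x₄ := congrArg (fun c => as 𝕀 (𝕀 ⊠ Y) X ◁ ((luNat (as 𝕀 Y X)).inv ⊳ lu (Y ⊠ X) ≫
    𝕀 ◃ as 𝕀 Y X ◁ (luNat (lu (Y ⊠ X))).inv ≫ c)) x₄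
  have x₅ := cellAt_exchange (leftTri (𝕀 ⊠ Y) X).inv (leftTri Y X).hom
  simp at x₁ x₂ x₃ x₄ x₅
  simp [luLu_lu]
  rw [← x₁, reassoc_of% x₂, reassoc_of% x₃, reassoc_of% x₄, reassoc_of% x₅]
  simp

/-- The unit constraint `lu (unitObj B) ▹ X ≅ ru (unitObj B) ▹ X` obtained from the triangles. -/
def unitTri (X : B) : lu (unitObj B) ▹ X ≅ ru (unitObj B) ▹ X :=
  (leftTri (unitObj B) X).symm ≪≫ whiskerLeftIso _ (luLu X) ≪≫ midTri (unitObj B) X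

/-- The three factors of `unitTri` are compared separately: the left triangle by `pent_leftTri`, the
cell `luLu` by `luLu_tensor`, the middle triangle by `normLeft_path`. -/
theorem unitTri_tensor (Y X : B) :
    ((unitTri Y).hom ▹₂ X) ⊳ as 𝕀 Y X ≫ (asL (ru 𝕀) Y X).hom =
      (asL (lu (𝕀 : B)) Y X).hom ≫ as (𝕀 ⊠ 𝕀) Y X ◁ (unitTri (Y ⊠ X)).hom := by
  have z₁ := congrArg (fun c => ((leftTri 𝕀 Y).inv ▹₂ X) ⊳ as 𝕀 Y X ≫ as 𝕀 𝕀 Y ▹ X ◁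
    ((leftTri (𝕀 ⊠ Y) X).inv ⊳ as 𝕀 Y X ≫ as 𝕀 (𝕀 ⊠ Y) X ◁ (luNat (as 𝕀 Y X)).inv) ≫ c ≫
    (asL (lu (𝕀 : B)) Y X).hom ≫ as (𝕀 ⊠ 𝕀) Y X ◁ (leftTri 𝕀 (Y ⊠ X)).inv ≫
    (pent 𝕀 𝕀 Y X).inv ⊳ lu (𝕀 ⊠ (Y ⊠ X))) (pent_leftTri 𝕀 Y X)
  have z₂ := congrArg (fun c => as 𝕀 𝕀 Y ▹ X ◁ ((asM 𝕀 (lu Y) X).hom ≫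
    as 𝕀 (𝕀 ⊠ Y) X ◁ (𝕀 ◃₂ (leftTri Y X).inv)) ≫ c ≫ (asL (ru 𝕀) Y X).hom) (normLeft_path 𝕀 Y X)
  have z₃ := congrArg (fun c => as 𝕀 𝕀 Y ▹ X ◁ c) (luLu_tensor Y X)
  have z₄ := cellAt_exchange (pent 𝕀 𝕀 Y X).hom (luLu (Y ⊠ X)).hom
  simp at z₁ z₂ z₃ z₄
  simp [unitTri]
  rw [z₂, reassoc_of% z₃, ← reassoc_of% z₄, ← reassoc_of% z₁]
  simp

theorem unitTri_naturality {X X' : B} (f : X ⟶ X') :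
    (𝕀 ⊠ 𝕀) ◃ f ◁ (unitTri X').hom ≫ (inter (ru 𝕀) f).inv =
      (inter (lu (𝕀 : B)) f).inv ≫ (unitTri X).hom ⊳ (𝕀 ◃ f) := by
  have z₁ := congrArg (fun c => (𝕀 ⊠ 𝕀) ◃ f ◁ (leftTri 𝕀 X').inv ≫ c ≫ (leftTri 𝕀 X).inv ⊳ (𝕀 ◃ f))
    (leftTri_naturality₂ 𝕀 f)
  have z₂ := midTri_naturality₂ 𝕀 f
  have z₃ := cellAt_exchange (asR 𝕀 𝕀 f).hom (luLu X').hom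
  have z₄ := congrArg (fun c => as 𝕀 𝕀 X ◁ c) (luLu_naturality f)
  simp at z₁ z₂ z₃ z₄
  simp [unitTri]
  rw [z₂, ← reassoc_of% z₃, reassoc_of% z₄, reassoc_of% z₁]

/-- The isomorphism `luRu` was defined by cancelling a right unit constraint from `unitTri` at the
unit object, conjugated by naturality cells. Naturality of `ru` undoes the cancellation. -/
theorem unitTri_unitObj : (unitTri (unitObj B)).hom = (luRu B).hom ▹₂ 𝕀 := by
  apply cellAt_injective (ru 𝕀)
  have h := rup_naturality (luRu B).hom
  have e : ru (𝕀 ⊠ 𝕀) ◁ (luRu B).hom = (ruNat (lu (𝕀 : B))).inv ≫ (unitTri 𝕀).hom ▷ ru 𝕀 ≫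
    (ruNat (ru 𝕀)).hom := whiskerLeft_cancelLeft (e := ru (𝕀 ⊠ 𝕀))
    (e' := ruInv (𝕀 ⊠ 𝕀)) (ruCounit (𝕀 ⊠ 𝕀)) _
  rw [e, ← cellAt_base] at h
  simp at h
  exact h.symm

/-- The case of the unit object holds by construction. Tensoring it with `X` gives the case of `𝕀 ⊠
X`, and naturality along the equivalence `lu X` brings it back to `X`. -/
theorem unitTri_eq (X : B) : (unitTri X).hom = (luRu B).hom ▹₂ X := by
  have h₁ := unitTri_tensor 𝕀 X
  have h₂ := asLp_naturality 𝕀 X (luRu B).hom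
  have h₃ := unitTri_naturality (lu X)
  have h₄ := interLp_naturality_inv (lu X) (luRu B).hom
  simp at h₂ h₄
  rw [unitTri_unitObj, h₂, cancel_epi] at h₁
  rw [← whiskerLeft_injective _ h₁, ← h₄, cancel_mono] at h₃
  exact whiskerLeft_injective _ h₃

end Coherence

/-! ### Tensoring squares and moving 1-cells past actions -/

section Hat

open MonoidalStruct

local notation "𝕀" => unitObj _

variable {B : Type u} [Bicategory.{w, v} B] [MonoidalBicategory B]

variable {R S T : B} {s : S ⊠ R ⟶ S} {t : T ⊠ S ⟶ T} {v : T ⊠ R ⟶ T}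

/-- The square on `Z ⊠ T`, `Z ⊠ S`, `Z ⊠ R` induced by a square on `T`, `S`, `R`. -/
def hat (Z : B) (α : Sq s t v) : as (Z ⊠ T) S R ≫ (Z ⊠ T) ◃ s ≫ as Z T S ≫ Z ◃ t ⟶
    as Z T S ▹ R ≫ (Z ◃ t) ▹ R ≫ as Z T R ≫ Z ◃ v :=
  as (Z ⊠ T) S R ◁ (asR Z T s).hom ⊳ (Z ◃ t) ≫ (pent Z T S R).inv ⊳ (Z ◃ (T ◃ s) ≫ Z ◃ t) ≫
    as Z T S ▹ R ◁ as Z (T ⊠ S) R ◁ (Z ◃₂ α) ≫ as Z T S ▹ R ◁ (asM Z t R).inv ⊳ (Z ◃ v)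

/-- The coherence isomorphism moving `p` past the action `Z ◃ s`. -/
def shift {Z Z' : B} (p : Z ⟶ Z') (s : S ⊠ R ⟶ S) :
    as Z S R ≫ Z ◃ s ≫ p ▹ S ⟶ (p ▹ S) ▹ R ≫ as Z' S R ≫ Z' ◃ s :=
  as Z S R ◁ (inter p s).inv ≫ (asL p S R).inv ⊳ (Z' ◃ s)

/-- The coherence isomorphism moving `lu` past the action `𝕀 ◃ s`. -/
def shiftLu (s : S ⊠ R ⟶ S) : as 𝕀 S R ≫ 𝕀 ◃ s ≫ lu S ⟶ lu S ▹ R ≫ s :=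
  as 𝕀 S R ◁ (luNat s).hom ≫ (leftTri S R).hom ⊳ s

/-- Naturality of the tensored square in the left tensor factor. Its ingredients are naturality of
the pentagon in its first variable and the compatibility of interchange with associativity in the
second and third variables. -/
theorem hat_shift {Z Z' : B} (p : Z ⟶ Z') (α : Sq s t v) :
    hat Z α ⊳ (p ▹ T) ≫ as Z T S ▹ R ◁ (Z ◃ t) ▹ R ◁ shift p v ≫
        (shift p t ▹₂ R) ⊳ (as Z' T R ≫ Z' ◃ v) =
      as (Z ⊠ T) S R ◁ (Z ⊠ T) ◃ s ◁ shift p t ≫ shift (p ▹ T) s ⊳ (as Z' T S ≫ Z' ◃ t) ≫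
        ((p ▹ T) ▹ S) ▹ R ◁ hat Z' α := by
  have x₁ := congrArg (fun c => as Z T S ▹ R ◁ c) (cellAt_exchange (asM Z t R).inv (inter p v).inv)
  have x₂ := congrArg (fun c => ((asM Z t R).inv ⊳ (p ▹ (T ⊠ R)) ≫ (Z ◃ t) ▹ R ◁ (asL p T R).inv ≫
    ((inter p t).inv ▹₂ R) ⊳ as Z' T R) ≫ c ≫ as Z (T ⊠ S) R ◁ (inter p (t ▹ R)).inv ≫
    (asL p (T ⊠ S) R).inv ⊳ (Z' ◃ (t ▹ R)) ≫ (p ▹ (T ⊠ S)) ▹ R ◁ (asM Z' t R).inv)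
    (inter_asM_asL p t R)
  simp at x₂
  replace x₂ := congrArg (fun c => as Z T S ▹ R ◁ c ⊳ (Z' ◃ v)) x₂
  have x₃ := congrArg (fun c => as Z T S ▹ R ◁ as Z (T ⊠ S) R ◁ c) (interRp_naturality p α)
  have x₄ := congrArg (fun c => as Z T S ▹ R ◁ c) (cellAt_exchange (asL p (T ⊠ S) R).inv (Z' ◃₂ α))
  have x₅ := cellAt_exchange ((asL p T S).inv ▹₂ R) (as Z' (T ⊠ S) R ◁ (Z' ◃₂ α) ≫
    (asM Z' t R).inv ⊳ (Z' ◃ v))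
  have x₆ := congrArg (fun c => c ⊳ (Z' ◃ (T ◃ s) ≫ Z' ◃ t)) (pent_naturality₁_inv p T S R)
  have x₇ := cellAt_exchange (pent Z T S R).inv (Z ◃ (T ◃ s) ◁ (inter p t).inv ≫
    (inter p (T ◃ s)).inv ⊳ (Z' ◃ t))
  have x₈ := congrArg (fun c => ((Z ⊠ T) ◃ s ◁ (asL p T S).inv ≫ (inter (p ▹ T) s).inv ⊳ as Z' T S) ≫
    c ≫ as Z T (S ⊠ R) ◁ (inter p (T ◃ s)).inv ≫ (asL p T (S ⊠ R)).inv ⊳ (Z' ◃ (T ◃ s)))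
    (inter_asR_asL p T s)
  simp at x₈
  replace x₈ := congrArg (fun c => as (Z ⊠ T) S R ◁ c ⊳ (Z' ◃ t)) x₈
  have x₉ := congrArg (fun c => as (Z ⊠ T) S R ◁ c) (cellAt_exchange (asR Z T s).hom (inter p t).inv)
  have x₁₀ := cellAt_exchange (asL (p ▹ T) S R).inv ((asR Z' T s).hom ⊳ (Z' ◃ t))
  simp at x₁ x₂ x₃ x₄ x₅ x₆ x₇ x₈ x₉ x₁₀
  simp [hat, shift]
  rw [reassoc_of% x₁]
  rw [← reassoc_of% x₂]
  rw [reassoc_of% x₃]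
  rw [← reassoc_of% x₄]
  rw [← x₅]
  rw [reassoc_of% x₆]
  rw [reassoc_of% x₇]
  simp
  rw [reassoc_of% x₉]
  rw [reassoc_of% x₈]
  rw [reassoc_of% x₁₀]

/-- The analogue with `p` replaced by the left unit constraint. The essential input is
`pent_leftTri`, in place of the naturality of the pentagon. -/
theorem hat_shiftLu (α : Sq s t v) :
    hat 𝕀 α ⊳ lu T ≫ as 𝕀 T S ▹ R ◁ (𝕀 ◃ t) ▹ R ◁ shiftLu v ≫ (shiftLu t ▹₂ R) ⊳ v =
      as (𝕀 ⊠ T) S R ◁ (𝕀 ⊠ T) ◃ s ◁ shiftLu t ≫ shift (lu T) s ⊳ t ≫ (lu T ▹ S) ▹ R ◁ α := by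
  have y₁ := congrArg (fun c => as 𝕀 T S ▹ R ◁ c) (cellAt_exchange (asM 𝕀 t R).inv (luNat v).hom)
  have y₂ := congrArg (fun c => as 𝕀 T S ▹ R ◁ ((asM 𝕀 t R).inv ⊳ lu (T ⊠ R) ≫ c) ⊳ v)
    (leftTri_naturality₁ t R)
  have y₃ := congrArg (fun c => as 𝕀 T S ▹ R ◁ as 𝕀 (T ⊠ S) R ◁ c) (lup_naturality α)
  have y₄ := congrArg (fun c => as 𝕀 T S ▹ R ◁ c) (cellAt_exchange (leftTri (T ⊠ S) R).hom α)
  have y₅ := cellAt_exchange ((leftTri T S).hom ▹₂ R) α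
  have y₆ := congrArg (fun c => c ⊳ (T ◃ s ≫ t)) (pent_leftTri T S R)
  have y₇ := cellAt_exchange (pent 𝕀 T S R).inv (𝕀 ◃ (T ◃ s) ◁ (luNat t).hom ≫
    (luNat (T ◃ s)).hom ⊳ t)
  have y₈ := congrArg (fun c => as (𝕀 ⊠ T) S R ◁ c ⊳ t) (leftTri_naturality₂ T s)
  have y₉ := congrArg (fun c => as (𝕀 ⊠ T) S R ◁ c) (cellAt_exchange (asR 𝕀 T s).hom (luNat t).hom)
  simp at y₁ y₂ y₃ y₄ y₅ y₆ y₇ y₈ y₉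
  simp [hat, shift, shiftLu]
  rw [reassoc_of% y₁]
  rw [reassoc_of% y₂]
  rw [reassoc_of% y₃]
  rw [← reassoc_of% y₄]
  rw [← y₅]
  rw [reassoc_of% y₆]
  rw [reassoc_of% y₇]
  simp
  rw [reassoc_of% y₉, reassoc_of% y₈]

end Hat

/-! ### The tetrahedron, unit and triangle conditions in normal form -/

section Paths

open MonoidalStruct

local notation "𝕀" => unitObj _

variable {B : Type u} [Bicategory.{w, v} B] [MonoidalBicategory B]

section

variable {R S T U : B} {s : S ⊠ R ⟶ S} {t : T ⊠ S ⟶ T} {v : T ⊠ R ⟶ T} {p : U ⊠ T ⟶ U}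
  {x : U ⊠ S ⟶ U} {y : U ⊠ R ⟶ U}

/-- The pentagon and associativity cells on the right are moved to the left, where together with `1
⊠ α` they form `hat U α`. The condition then has three cells on each side. -/
theorem tetra_iff (α : Sq s t v) (β : Sq s x y) (γ : Sq v p y) (ζ : Sq t p x) :
    Tetra α β γ ζ ↔ hat U α ⊳ p ≫ as U T S ▹ R ◁ (U ◃ t) ▹ R ◁ γ ≫ (ζ ▹₂ R) ⊳ y =
      as (U ⊠ T) S R ◁ (U ⊠ T) ◃ s ◁ ζ ≫ shift p s ⊳ x ≫ (p ▹ S) ▹ R ◁ β := by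
  have h₁ : tetraLeft α γ ζ = as U T S ▹ R ◁ as U (T ⊠ S) R ◁ (U ◃₂ α) ⊳ p ≫
      as U T S ▹ R ◁ (asM U t R).inv ⊳ (U ◃ v ≫ p) ≫ as U T S ▹ R ◁ (U ◃ t) ▹ R ◁ γ ≫
      (ζ ▹₂ R) ⊳ y := by
    simp only [tetraLeft, bicategoricalComp, wR₃, wL₃, cellAt, rOn, lOn, Glue.iso, ImgR.iso,
      ImgL.iso]
    simp
  have h₂ : tetraRight β ζ = (pent U T S R).hom ⊳ (U ◃ (T ◃ s) ≫ U ◃ t ≫ p) ≫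
      as (U ⊠ T) S R ◁ (asR U T s).inv ⊳ (U ◃ t ≫ p) ≫ as (U ⊠ T) S R ◁ (U ⊠ T) ◃ s ◁ ζ ≫
      shift p s ⊳ x ≫ (p ▹ S) ▹ R ◁ β := by
    simp only [tetraRight, bicategoricalComp, cellAt, Glue.iso, shift]
    simp
  rw [Tetra, h₁, h₂, ← cancel_epi (as (U ⊠ T) S R ◁ (asR U T s).hom ⊳ (U ◃ t ≫ p) ≫
    (pent U T S R).inv ⊳ (U ◃ (T ◃ s) ≫ U ◃ t ≫ p))]
  simp [hat]

/-- If `p` factors as `e ≫ f`, moving `p` past an action factors accordingly. The tetrahedron can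
thus be verified by passing one factor at a time. -/
theorem tetra_of_comp {W : B} {e : U ⊠ T ⟶ W} {f : W ⟶ U} (φ : p ≅ e ≫ f)
    {α : Sq s t v} {β : Sq s x y} {γ : Sq v p y} {ζ : Sq t p x}
    {γ' : as U T R ≫ U ◃ v ≫ e ≫ f ⟶ e ▹ R ≫ f ▹ R ≫ y}
    {ζ' : as U T S ≫ U ◃ t ≫ e ≫ f ⟶ e ▹ S ≫ f ▹ S ≫ x}
    (hγ : γ ≫ (φ.hom ▹₂ R) ⊳ y = as U T R ◁ U ◃ v ◁ φ.hom ≫ γ')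
    (hζ : ζ ≫ (φ.hom ▹₂ S) ⊳ x = as U T S ◁ U ◃ t ◁ φ.hom ≫ ζ')
    (h : hat U α ⊳ (e ≫ f) ≫ as U T S ▹ R ◁ (U ◃ t) ▹ R ◁ γ' ≫ (ζ' ▹₂ R) ⊳ y =
      as (U ⊠ T) S R ◁ (U ⊠ T) ◃ s ◁ ζ' ≫ shift e s ⊳ (f ▹ S ≫ x) ≫
        (e ▹ S) ▹ R ◁ shift f s ⊳ x ≫ (e ▹ S) ▹ R ◁ (f ▹ S) ▹ R ◁ β) : Tetra α β γ ζ := by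
  rw [tetra_iff, ← cancel_mono ((φ.hom ▹₂ S ▹₂ R) ⊳ (x ▹ R ≫ y))]
  have x₁ := congrArg (fun c => (c ▹₂ R) ⊳ y) hζ
  have x₂ := congrArg (fun c => as U T S ▹ R ◁ (U ◃ t) ▹ R ◁ c) hγ
  have x₃ := cellAt_exchange (hat U α) φ.hom
  have x₄ := cellAt_exchange (φ.hom ▹₂ S ▹₂ R) β
  have x₅ := congrArg (fun c => c ⊳ (U ◃ s ≫ x)) (asLp_naturality_inv S R φ.hom)
  have x₆ := congrArg (fun c => as (U ⊠ T) S R ◁ c ⊳ x) (interLp_naturality_inv s φ.hom)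
  have x₇ := congrArg (fun c => as (U ⊠ T) S R ◁ (U ⊠ T) ◃ s ◁ c) hζ
  have x₈ := congrArg (fun c => c ⊳ x) (cellAt_exchange (asL e S R).inv (inter f s).inv)
  simp at x₁ x₂ x₃ x₄ x₅ x₆ x₇ x₈ h
  simp [shift] at h ⊢
  rw [x₁]
  rw [reassoc_of% x₂]
  rw [reassoc_of% x₃]
  rw [h]
  rw [← x₄]
  rw [← reassoc_of% x₅]
  rw [← reassoc_of% x₆]
  rw [reassoc_of% x₇]
  rw [reassoc_of% x₈]

end

section

variable {R S T : B} {s : S ⊠ R ⟶ S} {t : T ⊠ S ⟶ T} {v : T ⊠ R ⟶ T}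

theorem unitCompat_iff (i : 𝕀 ⟶ R) (s₀ : S ◃ i ≫ s ⟶ ru S) (v₀ : T ◃ i ≫ v ⟶ ru T)
    (α : Sq s t v) : UnitCompat i s₀ v₀ α ↔
      as T S 𝕀 ◁ (T ◃₂ s₀) ⊳ t ≫ (rightTri T S).hom ⊳ t =
        (asR T S i).inv ⊳ (T ◃ s ≫ t) ≫ (T ⊠ S) ◃ i ◁ α ≫ (inter t i).inv ⊳ v ≫ t ▹ 𝕀 ◁ v₀ ≫
          (ruNat t).hom := by
  have h₁ : (𝟙 _ ⊗≫ as T S (unitObj B) ◁ ((wL T _ _).inv ≫ 𝟙 (𝟙 T) ⊠₂ s₀) ▷ t ⊗≫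
      (rightTri T S).hom ▷ t ⊗≫ 𝟙 _ :
      as T S (unitObj B) ≫ 𝟙 T ⊠₁ (𝟙 S ⊠₁ i) ≫ 𝟙 T ⊠₁ s ≫ t ⟶ ru (T ⊠ S) ≫ t) =
      as T S 𝕀 ◁ (T ◃₂ s₀) ⊳ t ≫ (rightTri T S).hom ⊳ t := by
    simp only [bicategoricalComp, cellAt, lOn, Glue.iso, ImgL.iso]
    simp
  have h₂ : (𝟙 _ ⊗≫ (asR T S i).inv ▷ (𝟙 T ⊠₁ s ≫ t) ⊗≫ 𝟙 (T ⊠ S) ⊠₁ i ◁ α ⊗≫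
      (inter t i).inv ▷ v ⊗≫ t ⊠₁ 𝟙 (unitObj B) ◁ v₀ ⊗≫ (ruNat t).hom ⊗≫ 𝟙 _ :
      as T S (unitObj B) ≫ 𝟙 T ⊠₁ (𝟙 S ⊠₁ i) ≫ 𝟙 T ⊠₁ s ≫ t ⟶ ru (T ⊠ S) ≫ t) =
      (asR T S i).inv ⊳ (T ◃ s ≫ t) ≫ (T ⊠ S) ◃ i ◁ α ≫ (inter t i).inv ⊳ v ≫ t ▹ 𝕀 ◁ v₀ ≫
        (ruNat t).hom := by
    simp only [bicategoricalComp, cellAt, Glue.iso]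
    simp
  rw [UnitCompat, h₁, h₂]

theorem triangle_iff {M A : B} {i : 𝕀 ⟶ M} {m : M ⊠ M ⟶ M} {a : A ⊠ M ⟶ A}
    (lam : lu M ⟶ i ▹ M ≫ m) (a₀ : A ◃ i ≫ a ⟶ ru A) (a₂ : Sq m a a) : Triangle lam a₀ a₂ ↔
      as A 𝕀 M ◁ (A ◃₂ lam) ⊳ a ≫ (asM A i M).inv ⊳ (A ◃ m ≫ a) ≫ (A ◃ i) ▹ M ◁ a₂ ≫
        (a₀ ▹₂ M) ⊳ a = (midTri A M).hom ⊳ a := by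
  have h : (𝟙 _ ⊗≫ (midTri A M).inv ▷ a ⊗≫
      as A (unitObj B) M ◁ (𝟙 (𝟙 A) ⊠₂ lam ≫ (wL A _ _).hom) ▷ a ⊗≫
      (asM A i M).inv ▷ (𝟙 A ⊠₁ m ≫ a) ⊗≫
      (𝟙 A ⊠₁ i) ⊠₁ 𝟙 M ◁ a₂ ⊗≫
      ((wR _ _ M).inv ≫ a₀ ⊠₂ 𝟙 (𝟙 M)) ▷ a ⊗≫ 𝟙 _ :
      ru A ⊠₁ 𝟙 M ≫ a ⟶ ru A ⊠₁ 𝟙 M ≫ a) =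
      (midTri A M).inv ⊳ a ≫ as A 𝕀 M ◁ (A ◃₂ lam) ⊳ a ≫ (asM A i M).inv ⊳ (A ◃ m ≫ a) ≫
        (A ◃ i) ▹ M ◁ a₂ ≫ (a₀ ▹₂ M) ⊳ a := by
    simp only [bicategoricalComp, cellAt, rOn, lOn, Glue.iso, ImgR.iso, ImgL.iso]
    simp
  rw [Triangle, h, ← cancel_epi ((midTri A M).hom ⊳ a)]
  simp

end

end Paths

/-! ### The coherence square and its tetrahedra -/

section Slide

open MonoidalStruct

local notation "𝕀" => unitObj _

variable {B : Type u} [Bicategory.{w, v} B] [MonoidalBicategory B] {M : B} {j : M ⟶ 𝕀}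
  {h : M ⊠ M ⟶ M} (φ : h ≅ j ▹ M ≫ lu M)

/-- The coherence isomorphism `(j ⊠ 1) ∘ (1 ⊠ r) ≅ r ∘ ((j ⊠ 1) ⊠ 1)` along an isomorphism between
`h` and `j ⊠ 1`. -/
def slideOf {R : B} (r : M ⊠ R ⟶ M) : Sq r h r :=
  as M M R ◁ M ◃ r ◁ φ.hom ≫ shift j r ⊳ lu M ≫ (j ▹ M) ▹ R ◁ shiftLu r ≫ (φ.inv ▹₂ R) ⊳ r

theorem slideOf_eq {R : B} (r : M ⊠ R ⟶ M) :
    slideOf φ r ≫ (φ.hom ▹₂ R) ⊳ r = as M M R ◁ M ◃ r ◁ φ.hom ≫ shift j r ⊳ lu M ≫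
      (j ▹ M) ▹ R ◁ shiftLu r := by
  simp [slideOf]

/-- The coherence square moves first `j` and then `lu` past an action. The cell `α` passes through
these two moves by `hat_shift` and `hat_shiftLu`. This is the source of all tetrahedra built from
coherence cells. -/
theorem tetra_slideOf {R S : B} {s : S ⊠ R ⟶ S} {t : M ⊠ S ⟶ M} {v : M ⊠ R ⟶ M} (α : Sq s t v) :
    Tetra α α (slideOf φ v) (slideOf φ t) := by
  refine tetra_of_comp φ (slideOf_eq φ v) (slideOf_eq φ t) ?_
  have x₁ := congrArg (fun c => c ⊳ lu M) (hat_shift j α)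
  have x₂ := congrArg (fun c => ((j ▹ M) ▹ S) ▹ R ◁ c) (hat_shiftLu α)
  have x₃ := cellAt_exchange (shift j t ▹₂ R) (shiftLu v)
  have x₄ := cellAt_exchange (shift (j ▹ M) s) (shiftLu t)
  simp at x₁ x₂ x₃ x₄ ⊢
  rw [← reassoc_of% x₃]
  rw [reassoc_of% x₁]
  rw [x₂]
  rw [← reassoc_of% x₄]

/-- For a 0-simplex the product is literally the composite, so `φ` is an identity. In the general
statements `h` is a separate variable so that normal forms treat it as a single 1-cell and do not
split it. -/
theorem ZeroSimplex.slide_eq (X : ZeroSimplex B) {R : B} (r : X.obj ⊠ R ⟶ X.obj) :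
    X.slide r = slideOf (Iso.refl _) r := by
  have h := congrArg (fun c => c ≫ (X.right.right ▹ X.obj) ▹ R ◁ (leftTri X.obj R).hom ⊳ r)
    (cellAt_exchange (asL X.right.right X.obj R).inv (luNat r).hom)
  simp at h
  simp only [slideOf]
  simp [shift, shiftLu]
  rw [reassoc_of% h]
  simp only [slide, bicategoricalComp, cellAt, rOn, Glue.iso, ImgR.iso]
  simp [tHom₂_id]

end Slide

/-! ### Naturality and unit compatibility of the coherence square -/

section Slide

open MonoidalStruct

local notation "𝕀" => unitObj _

variable {B : Type u} [Bicategory.{w, v} B] [MonoidalBicategory B] {M : B} {j : M ⟶ 𝕀}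
  {h : M ⊠ M ⟶ M} (φ : h ≅ j ▹ M ≫ lu M)

theorem slideOf_naturality {R : B} {r r' : M ⊠ R ⟶ M} (c : r ⟶ r') :
    as M M R ◁ (M ◃₂ c) ⊳ h ≫ slideOf φ r' = slideOf φ r ≫ h ▹ R ◁ c := by
  have x₁ := congrArg (fun d => as M M R ◁ d) (cellAt_exchange (M ◃₂ c) φ.hom)
  have x₂ := congrArg (fun d => as M M R ◁ d ⊳ lu M) (interRp_naturality j c)
  have x₃ := cellAt_exchange (asL j M R).inv ((𝕀 ◃₂ c) ⊳ lu M)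
  have x₄ := congrArg (fun d => (j ▹ M) ▹ R ◁ as 𝕀 M R ◁ d) (lup_naturality c)
  have x₅ := congrArg (fun d => (j ▹ M) ▹ R ◁ d) (cellAt_exchange (leftTri M R).hom c)
  have x₆ := cellAt_exchange (φ.inv ▹₂ R) c
  simp at x₁ x₂ x₃ x₄ x₅ x₆
  simp [slideOf, shift, shiftLu]
  rw [reassoc_of% x₁, reassoc_of% x₂, ← reassoc_of% x₃, reassoc_of% x₄, ← reassoc_of% x₅, ← x₆]

/-- The unit condition with `φ` removed. The derived law `leftTri_rightTri` handles the part with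
`lu`, and naturality of the right triangle in `j` handles the other part; the rest is naturality and
interchange. -/
theorem unitCompat_slideOf_aux {R : B} (i : 𝕀 ⟶ R) {r : M ⊠ R ⟶ M} (r₀ : M ◃ i ≫ r ⟶ ru M) :
    as M M 𝕀 ◁ (M ◃₂ r₀) ⊳ (j ▹ M ≫ lu M) ≫ (rightTri M M).hom ⊳ (j ▹ M ≫ lu M) =
      (asR M M i).inv ⊳ (M ◃ r ≫ j ▹ M ≫ lu M) ≫
        (M ⊠ M) ◃ i ◁ (shift j r ⊳ lu M ≫ (j ▹ M) ▹ R ◁ shiftLu r) ≫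
        (inter (j ▹ M) i).inv ⊳ (lu M ▹ R ≫ r) ≫ (j ▹ M) ▹ 𝕀 ◁ (inter (lu M) i).inv ⊳ r ≫
        (j ▹ M) ▹ 𝕀 ◁ lu M ▹ 𝕀 ◁ r₀ ≫ (j ▹ M) ▹ 𝕀 ◁ (ruNat (lu M)).hom ≫
        (ruNat (j ▹ M)).hom ⊳ lu M := by
  have xa := congrArg (fun c => as M M 𝕀 ◁ (inter j (ru M)).inv ≫ (asL j M 𝕀).inv ⊳ (𝕀 ◃ ru M) ≫ c)
    (rightTri_naturality₁ j M)
  simp at xa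
  replace xa := congrArg (fun c => c ⊳ lu M) xa
  have xb := congrArg (fun c => as 𝕀 M 𝕀 ◁ (luNat (ru M)).hom ≫ c) (leftTri_rightTri M)
  simp at xb
  replace xb := congrArg (fun c => (j ▹ M) ▹ 𝕀 ◁ c) xb
  have xc := congrArg (fun c => as M M 𝕀 ◁ c ⊳ lu M) (interRp_naturality j r₀)
  have xd := cellAt_exchange (asL j M 𝕀).inv ((𝕀 ◃₂ r₀) ⊳ lu M)
  have xe := congrArg (fun c => (j ▹ M) ▹ 𝕀 ◁ as 𝕀 M 𝕀 ◁ c) (lup_naturality r₀)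
  have xf := congrArg (fun c => (j ▹ M) ▹ 𝕀 ◁ c) (cellAt_exchange (leftTri M 𝕀).hom r₀)
  have xg := cellAt_exchange (asR M M i).inv ((inter j r).inv ⊳ lu M)
  have xh := cellAt_exchange (inter (j ▹ M) i).inv (as 𝕀 M R ◁ (luNat r).hom ≫ (leftTri M R).hom ⊳ r)
  have xi := congrArg (fun c => ((asR M M i).inv ⊳ (j ▹ (M ⊠ R)) ≫ (M ⊠ M) ◃ i ◁ (asL j M R).inv ≫
    (inter (j ▹ M) i).inv ⊳ as 𝕀 M R) ≫ c ≫ as M M 𝕀 ◁ (inter j (M ◃ i)).inv ≫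
    (asL j M 𝕀).inv ⊳ (𝕀 ◃ (M ◃ i)) ≫ (j ▹ M) ▹ 𝕀 ◁ (asR 𝕀 M i).inv) (inter_asR_asL j M i)
  simp at xi
  replace xi := congrArg (fun c => c ⊳ (𝕀 ◃ r ≫ lu M)) xi
  have xj := congrArg (fun c => (j ▹ M) ▹ 𝕀 ◁ c) (cellAt_exchange (asR 𝕀 M i).inv (luNat r).hom)
  have xk := congrArg (fun c => (j ▹ M) ▹ 𝕀 ◁ ((asR 𝕀 M i).inv ⊳ lu (M ⊠ R) ≫ c) ⊳ r)
    (leftTri_naturality₂ M i)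
  simp at xa xb xc xd xe xf xg xh xi xj xk
  simp [shift, shiftLu]
  rw [← xa]
  rw [← reassoc_of% xb]
  rw [reassoc_of% xc]
  rw [← reassoc_of% xd]
  rw [reassoc_of% xe]
  rw [← reassoc_of% xf]
  rw [reassoc_of% xg]
  rw [← reassoc_of% xh]
  rw [← reassoc_of% xi]
  rw [reassoc_of% xj]
  rw [reassoc_of% xk]

theorem unitCompat_slideOf {R : B} (i : 𝕀 ⟶ R) {r : M ⊠ R ⟶ M} (r₀ : M ◃ i ≫ r ⟶ ru M) :
    UnitCompat i r₀ r₀ (slideOf φ r) := by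
  rw [unitCompat_iff, ← cancel_mono (ru (M ⊠ M) ◁ φ.hom)]
  have x₁ := unitCompat_slideOf_aux (j := j) i r₀
  have x₂ := congrArg (fun d => as M M 𝕀 ◁ d) (cellAt_exchange (M ◃₂ r₀) φ.hom)
  have x₃ := cellAt_exchange (rightTri M M).hom φ.hom
  have x₄ := rup_naturality φ.hom
  have x₅ := cellAt_exchange (φ.hom ▹₂ 𝕀) r₀
  have x₆ := congrArg (fun d => d ⊳ r) (interLp_naturality_inv i φ.hom)
  have x₇ := congrArg (fun d => (M ⊠ M) ◃ i ◁ d) (slideOf_eq φ r)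
  have x₈ := cellAt_exchange (asR M M i).inv (M ◃ r ◁ φ.hom)
  simp at x₁ x₂ x₃ x₄ x₅ x₆ x₇ x₈
  simp
  rw [x₃]
  rw [reassoc_of% x₂]
  rw [x₁]
  rw [← x₄]
  rw [← reassoc_of% x₅]
  rw [← reassoc_of% x₆]
  rw [reassoc_of% x₇]
  rw [reassoc_of% x₈]

end Slide

/-! ### Mates under an adjunction -/

section Adjunction

variable {B : Type u} [Bicategory.{w, v} B] {a b c d : B} {i : a ⟶ b} {j : b ⟶ a} (adj : i ⊣ j)

/-- The action of the counit of an adjunction on a 1-cell. -/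
def counitAt (h : b ⟶ c) : j ≫ i ≫ h ⟶ h := (α_ _ _ _).inv ≫ adj.counit ▷ h ≫ (λ_ h).hom

theorem homEquiv₁_eq {g : a ⟶ c} {h : b ⟶ c} (γ : g ⟶ i ≫ h) :
    adj.homEquiv₁ γ = j ◁ γ ≫ counitAt adj h := by
  simp [Adjunction.homEquiv₁_apply, counitAt]

theorem counitAt_naturality {h h' : b ⟶ c} (θ : h ⟶ h') :
    j ◁ i ◁ θ ≫ counitAt adj h' = counitAt adj h ≫ θ := by
  have e := whisker_exchange adj.counit θ
  simp at e
  rw [← cancel_epi (α_ _ _ _).hom]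
  simp [counitAt, reassoc_of% e]

theorem homEquiv₁_comp {g : a ⟶ c} {h h' : b ⟶ c} (γ : g ⟶ i ≫ h) (θ : h ⟶ h') :
    adj.homEquiv₁ (γ ≫ i ◁ θ) = adj.homEquiv₁ γ ≫ θ := by
  rw [homEquiv₁_eq, homEquiv₁_eq, whiskerLeft_comp, Category.assoc, counitAt_naturality,
    Category.assoc]

theorem homEquiv₁_comp_left {g g' : a ⟶ c} {h : b ⟶ c} (σ : g' ⟶ g) (γ : g ⟶ i ≫ h) :
    adj.homEquiv₁ (σ ≫ γ) = j ◁ σ ≫ adj.homEquiv₁ γ := by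
  simp [Adjunction.homEquiv₁_apply]

theorem counitAt_comp (h : b ⟶ c) (k : c ⟶ d) : counitAt adj (h ≫ k) = counitAt adj h ⊳ k := by
  simp [counitAt, cellAt, Glue.iso]

/-- The counit ends in an identity 1-cell, which gluing does not absorb. Preceded by a 1-cell `e`
and followed by a unitor it becomes a cell between composites without identities, and this form is
compatible with gluing. -/
theorem cellAt_counit {e : d ⟶ b} {k : b ⟶ c} :
    (e ◁ adj.counit ≫ (ρ_ e).hom) ⊳ k = e ◁ counitAt adj k := by
  simp [counitAt, cellAt, Glue.iso]

/-- The mate of `γ` depends only on `j ◁ γ`, and passing to mates is a bijection. So the right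
adjoint can be cancelled from cells whose target begins with `i`. -/
theorem whiskerLeft_right_injective (adj : i ⊣ j) {g : a ⟶ c} {h : b ⟶ c} {γ γ' : g ⟶ i ≫ h}
    (e : j ◁ γ = j ◁ γ') : γ = γ' := by
  apply adj.homEquiv₁.injective
  rw [homEquiv₁_eq, homEquiv₁_eq, e]

end Adjunction

/-! ### Tensoring an adjunction with an object -/

section TensorAdjunction

open MonoidalStruct

local notation "𝕀" => unitObj _

variable {B : Type u} [Bicategory.{w, v} B] [MonoidalBicategory B] {a b : B} {i : a ⟶ b}
  {j : b ⟶ a} (adj : i ⊣ j)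

/-- The pseudofunctor tensoring with `X` on the right. -/
def tensorOn (X : B) : B ⥤ᵖ B := (Bicategory.Prod.sectL B X).toPseudofunctor.comp TensorStruct.tensor

theorem tensorOn_mapComp (X : B) {Y Y' Y'' : B} (f : Y ⟶ Y') (g : Y' ⟶ Y'') :
    (tensorOn X).mapComp f g = wR f g X := by
  ext
  simp [tensorOn, wR, tIso, tComp]
  rfl

theorem tensorOn_map₂ (X : B) {Y Y' : B} {f g : Y ⟶ Y'} (c : f ⟶ g) :
    (tensorOn X).map₂ c = c ⊠₂ 𝟙 (𝟙 X) := rfl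

theorem tensorOn_mapId (X Y : B) : (tensorOn X).mapId Y = tId Y X := by
  ext
  simp only [tensorOn, tId, Pseudofunctor.comp_mapId]
  exact (congrArg (· ≫ _) (TensorStruct.tensor.map₂_id _)).trans (Category.id_comp _)

/-- The adjunction `i ⊠ X ⊣ j ⊠ X`. -/
def adjOn (X : B) : i ▹ X ⊣ j ▹ X := (tensorOn X).mapAdjunction adj

theorem adjOn_counit (X : B) : (adjOn adj X).counit =
    (wR j i X).inv ≫ adj.counit ⊠₂ 𝟙 (𝟙 X) ≫ (tId b X).hom := by
  rw [← tensorOn_mapComp, ← tensorOn_mapId]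
  simp [adjOn, Pseudofunctor.mapAdjunction, ← tensorOn_map₂]
  rfl

theorem adjOn_unit (X : B) : (adjOn adj X).unit =
    (tId a X).inv ≫ adj.unit ⊠₂ 𝟙 (𝟙 X) ≫ (wR i j X).hom := by
  rw [← tensorOn_mapComp, ← tensorOn_mapId]
  simp [adjOn, Pseudofunctor.mapAdjunction, ← tensorOn_map₂]
  rfl

variable {c d : B}

theorem rOn_counit_eq {e : c ⟶ b} (X : B) :
    (e ◁ adj.counit ≫ (ρ_ e).hom) ▹₂ X = e ▹ X ◁ (adjOn adj X).counit ≫ (ρ_ (e ▹ X)).hom := by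
  have h := (tensorOn X).map₂_right_unitor e
  rw [tensorOn_mapComp, tensorOn_mapId, tensorOn_map₂] at h
  have h' : (ρ_ e).hom ⊠₂ 𝟙 (𝟙 X) =
    (wR e (𝟙 b) X).hom ≫ e ▹ X ◁ (tId b X).hom ≫ (ρ_ (e ▹ X)).hom := h
  have n : (e ◁ adj.counit) ⊠₂ 𝟙 (𝟙 X) = _ := wR_whiskerLeft (W := X) e adj.counit
  have m : (e ◁ adj.counit ≫ (ρ_ e).hom) ⊠₂ 𝟙 (𝟙 X) =
      (wR e (j ≫ i) X).hom ≫ e ▹ X ◁ adj.counit ⊠₂ 𝟙 (𝟙 X) ≫ e ▹ X ◁ (tId b X).hom ≫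
        (ρ_ (e ▹ X)).hom := by
    have q := tHom₂_comp (e ◁ adj.counit) (ρ_ e).hom (𝟙 (𝟙 X)) (𝟙 (𝟙 X))
    rw [Category.comp_id] at q
    rw [q, n, h']
    simp
  rw [adjOn_counit]
  simp only [rOn, ImgR.iso]
  rw [m]
  simp

theorem rOn_counit {e : c ⟶ b} (X : B) {k : b ⊠ X ⟶ d} :
    ((e ◁ adj.counit ≫ (ρ_ e).hom) ▹₂ X) ⊳ k = e ▹ X ◁ counitAt (adjOn adj X) k := by
  rw [rOn_counit_eq, cellAt_counit]

theorem rOn_counitAt (X : B) {h : b ⟶ c} :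
    counitAt adj h ▹₂ X = counitAt (adjOn adj X) (h ▹ X) := by
  -- A 1-cell in front of the counit is needed to bring it into normal form; the equivalence `ru b`
  -- serves, since it can be cancelled again.
  apply whiskerLeft_injective (ru b ▹ X)
  rw [← rOn_whiskerLeft, ← cellAt_counit, rOn_cellAt, rOn_counit]

theorem homEquiv₁_rOn (X : B) {g : a ⟶ c} {h : b ⟶ c} (γ : g ⟶ i ≫ h) {k : c ⊠ X ⟶ d} :
    (adjOn adj X).homEquiv₁ ((γ ▹₂ X) ⊳ k) = (adj.homEquiv₁ γ ▹₂ X) ⊳ k := by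
  rw [homEquiv₁_eq, homEquiv₁_eq, counitAt_comp, ← rOn_counitAt]
  simp

end TensorAdjunction

/-! ### The triangle axiom of the induced structure -/

section InducedTriangle

open MonoidalStruct

local notation "𝕀" => unitObj _

variable {B : Type u} [Bicategory.{w, v} B] [MonoidalBicategory B] {M : B} {i : 𝕀 ⟶ M} {j : M ⟶ 𝕀}
  {h : M ⊠ M ⟶ M} (φ : h ≅ j ▹ M ≫ lu M)

/-- The part of the triangle axiom left once `j` has been moved out of the way. Here `unitTri_eq` is
used: the middle triangle at the unit has to be compared with `luRu`, which occurs in the induced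
right unitor. -/
theorem midTri_lam (lam : lu M ⟶ i ▹ M ≫ h) :
    as 𝕀 𝕀 M ◁ (𝕀 ◃₂ lam) ⊳ lu M ≫ (asM 𝕀 i M).inv ⊳ (𝕀 ◃ h ≫ lu M) ≫
        (𝕀 ◃ i) ▹ M ◁ shiftLu h ≫ ((luNat i).hom ▹₂ M) ⊳ h ≫ ((luRu B).hom ▹₂ M) ⊳ (i ▹ M ≫ h) =
      (midTri 𝕀 M).hom ⊳ lu M ≫ ru 𝕀 ▹ M ◁ lam := by
  have xa := congrArg (fun c => ((asM 𝕀 i M).inv ⊳ lu (M ⊠ M) ≫ c) ⊳ h) (leftTri_naturality₁ i M)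
  have xb := cellAt_exchange (asM 𝕀 i M).inv (luNat h).hom
  have xc := congrArg (fun c => as 𝕀 𝕀 M ◁ c) (lup_naturality lam)
  have xd := cellAt_exchange (leftTri 𝕀 M).hom lam
  have xe := cellAt_exchange ((luRu B).hom ▹₂ M) lam
  have xf := congrArg (fun c => c ⊳ lu M) (unitTri_eq M)
  have xg := luLu_lu M
  simp [unitTri] at xa xb xc xd xe xf xg
  simp [shiftLu]
  rw [reassoc_of% xb]
  rw [reassoc_of% xa]
  rw [reassoc_of% xc]
  rw [← reassoc_of% xd]
  rw [← xe]
  rw [← reassoc_of% xf]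
  rw [reassoc_of% (congrArg (fun c => as 𝕀 𝕀 M ◁ c) xg)]
  simp

theorem midTri_lam_shift (lam : lu M ⟶ i ▹ M ≫ h) :
    as M 𝕀 M ◁ (M ◃₂ lam) ⊳ (j ▹ M ≫ lu M) ≫ (asM M i M).inv ⊳ (M ◃ h ≫ j ▹ M ≫ lu M) ≫
        (M ◃ i) ▹ M ◁ (shift j h ⊳ lu M ≫ (j ▹ M) ▹ M ◁ shiftLu h) ≫
        (((inter j i).inv ⊳ lu M ≫ j ▹ 𝕀 ◁ (luNat i).hom ≫ j ▹ 𝕀 ◁ (luRu B).hom ⊳ i ≫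
          (ruNat j).hom ⊳ i) ▹₂ M) ⊳ h =
      (midTri M M).hom ⊳ (j ▹ M ≫ lu M) ≫ ru M ▹ M ◁ j ▹ M ◁ lam := by
  have xa := congrArg (fun c => (asL j 𝕀 M).inv ⊳ (𝕀 ◃ lu M) ≫ c) (midTri_naturality₁ j M)
  simp at xa
  replace xa := congrArg (fun c => as M 𝕀 M ◁ (inter j (lu M)).inv ⊳ lu M ≫ c ⊳ lu M) xa
  have xb := congrArg (fun c => (j ▹ 𝕀) ▹ M ◁ c) (midTri_lam lam)
  have xc := congrArg (fun c => ((asM M i M).inv ⊳ (j ▹ (M ⊠ M)) ≫ (M ◃ i) ▹ M ◁ (asL j M M).inv ≫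
    (inter j i).inv ▹₂ M ⊳ as 𝕀 M M) ≫ c ≫ as M 𝕀 M ◁ (inter j (i ▹ M)).inv ≫
    (asL j 𝕀 M).inv ⊳ (𝕀 ◃ (i ▹ M)) ≫ (j ▹ 𝕀) ▹ M ◁ (asM 𝕀 i M).inv) (inter_asM_asL j i M)
  simp at xc
  replace xc := congrArg (fun c => c ⊳ (𝕀 ◃ h ≫ lu M)) xc
  have xd := congrArg (fun c => as M 𝕀 M ◁ c ⊳ lu M) (interRp_naturality j lam)
  have xe := cellAt_exchange (asL j 𝕀 M).inv ((𝕀 ◃₂ lam) ⊳ lu M)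
  have xf := cellAt_exchange ((inter j i).inv ▹₂ M) (shiftLu h)
  have xg := cellAt_exchange (asM M i M).inv ((inter j h).inv ⊳ lu M)
  have xh := cellAt_exchange ((ruNat j).hom ▹₂ M) lam
  simp at xa xb xc xd xe xf xg xh
  simp [shift]
  rw [reassoc_of% xg, ← reassoc_of% xf, ← reassoc_of% xc, reassoc_of% xd, ← reassoc_of% xe,
    reassoc_of% xb, ← xh, reassoc_of% xa]

/-- The right unitor induced by an adjunction `i ⊣ j`. -/
def rhoOf (adj : i ⊣ j) : M ◃ i ≫ h ⟶ ru M :=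
  M ◃ i ◁ φ.hom ≫ (inter j i).inv ⊳ lu M ≫ j ▹ 𝕀 ◁ (luNat i).hom ≫
    j ▹ 𝕀 ◁ (luRu B).hom ⊳ i ≫ (ruNat j).hom ⊳ i ≫ ru M ◁ adj.counit ≫ (ρ_ (ru M)).hom

/-- After `midTri_lam_shift`, the left unitor and the counit combine into the mate of `lam`. By
hypothesis this is `φ.inv`, and it cancels the `φ.hom` left over from the coherence square. -/
theorem triangle_slideOf (adj : i ⊣ j) {lam : lu M ⟶ i ▹ M ≫ h}
    (hlam : (adjOn adj M).homEquiv₁ lam = φ.inv) :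
    Triangle lam (rhoOf φ adj) (slideOf φ h) := by
  rw [triangle_iff]
  have hr : rhoOf φ adj = M ◃ i ◁ φ.hom ≫ ((inter j i).inv ⊳ lu M ≫ j ▹ 𝕀 ◁ (luNat i).hom ≫
      j ▹ 𝕀 ◁ (luRu B).hom ⊳ i ≫ (ruNat j).hom ⊳ i) ≫ ru M ◁ adj.counit ≫ (ρ_ (ru M)).hom := by
    simp [rhoOf]
  have xa := midTri_lam_shift (j := j) lam
  have xb := rOn_counit adj (e := ru M) M (k := h)
  have xc := congrArg (fun c => (M ◃ i) ▹ M ◁ c) (slideOf_eq φ h)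
  have xd := cellAt_exchange (asM M i M).inv (M ◃ h ◁ φ.hom)
  have xe := congrArg (fun c => as M 𝕀 M ◁ c) (cellAt_exchange (M ◃₂ lam) φ.hom)
  have xf := congrArg (fun c => ru M ▹ M ◁ c) ((homEquiv₁_eq _ _).symm.trans hlam)
  have xg := cellAt_exchange (midTri M M).hom φ.hom
  rw [hr]
  simp at xa xb xc xd xe xf xg
  simp
  rw [reassoc_of% xc]
  rw [reassoc_of% xd, reassoc_of% xe, reassoc_of% xa, xb, xf, ← reassoc_of% xg]
  simp

end InducedTriangle

/-! ### The induced skew monoidale and the left unitor axioms in normal form -/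

section SkewPaths

open MonoidalStruct

local notation "𝕀" => unitObj _

variable {B : Type u} [Bicategory.{w, v} B] [MonoidalBicategory B]

theorem ZeroSimplex.skew_rho (X : ZeroSimplex B) :
    X.skew.rho = rhoOf (M := X.obj) (h := X.mul) (Iso.refl _) X.right.adj := by
  simp only [ZeroSimplex.skew, rhoOf, bicategoricalComp, cellAt, Glue.iso]
  simp

/-- The induced left unitor is, up to coherence, the unit of the tensored adjunction, whose mate is
an identity. The arguments with mates use the induced left unitor only through this property. -/
theorem ZeroSimplex.homEquiv₁_lam (X : ZeroSimplex B) :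
    (adjOn X.right.adj X.obj).homEquiv₁ X.skew.lam = 𝟙 X.mul := by
  apply (adjOn X.right.adj X.obj).homEquiv₁.symm.injective
  rw [Equiv.symm_apply_apply]
  have h := (adjOn X.right.adj X.obj).homEquiv₁_symm_apply
    (𝟙 (X.right.right ▹ X.obj ≫ lu X.obj))
  refine Eq.trans ?_ h.symm
  simp [ZeroSimplex.skew, bicategoricalComp, adjOn_unit]

theorem ZeroSimplex.triangle (X : ZeroSimplex B) :
    Triangle X.skew.lam X.skew.rho (X.slide X.mul) := by
  rw [X.skew_rho, X.slide_eq]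
  exact triangle_slideOf (Iso.refl _) X.right.adj X.homEquiv₁_lam

theorem lam_assoc_iff {M : B} {i : 𝕀 ⟶ M} (D : SkewData i) :
    ((𝟙 _ ⊗≫ (leftTri M M).inv ▷ D.mul ⊗≫
        as (unitObj B) M M ◁ (luNat D.mul).inv ⊗≫
        as (unitObj B) M M ◁ 𝟙 (unitObj B) ⊠₁ D.mul ◁ D.lam ⊗≫
        as (unitObj B) M M ◁ (inter i D.mul).inv ▷ D.mul ⊗≫
        (asL i M M).inv ▷ (𝟙 M ⊠₁ D.mul ≫ D.mul) ⊗≫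
        (i ⊠₁ 𝟙 M) ⊠₁ 𝟙 M ◁ D.assoc ⊗≫ 𝟙 _ :
      lu M ⊠₁ 𝟙 M ≫ D.mul ⟶ (i ⊠₁ 𝟙 M) ⊠₁ 𝟙 M ≫ D.mul ⊠₁ 𝟙 M ≫ D.mul) =
    𝟙 _ ⊗≫ (D.lam ⊠₂ 𝟙 (𝟙 M) ≫ (wR _ _ M).hom) ▷ D.mul ⊗≫ 𝟙 _) ↔
    as 𝕀 M M ◁ 𝕀 ◃ D.mul ◁ D.lam ≫ shift i D.mul ⊳ D.mul ≫ (i ▹ M) ▹ M ◁ D.assoc =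
      shiftLu D.mul ≫ (D.lam ▹₂ M) ⊳ D.mul := by
  have h : (𝟙 _ ⊗≫ (leftTri M M).inv ▷ D.mul ⊗≫
        as (unitObj B) M M ◁ (luNat D.mul).inv ⊗≫
        as (unitObj B) M M ◁ 𝟙 (unitObj B) ⊠₁ D.mul ◁ D.lam ⊗≫
        as (unitObj B) M M ◁ (inter i D.mul).inv ▷ D.mul ⊗≫
        (asL i M M).inv ▷ (𝟙 M ⊠₁ D.mul ≫ D.mul) ⊗≫
        (i ⊠₁ 𝟙 M) ⊠₁ 𝟙 M ◁ D.assoc ⊗≫ 𝟙 _ :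
      lu M ⊠₁ 𝟙 M ≫ D.mul ⟶ (i ⊠₁ 𝟙 M) ⊠₁ 𝟙 M ≫ D.mul ⊠₁ 𝟙 M ≫ D.mul) =
      (leftTri M M).inv ⊳ D.mul ≫ as 𝕀 M M ◁ (luNat D.mul).inv ≫ as 𝕀 M M ◁ 𝕀 ◃ D.mul ◁ D.lam ≫
        shift i D.mul ⊳ D.mul ≫ (i ▹ M) ▹ M ◁ D.assoc := by
    simp only [shift, bicategoricalComp, cellAt, Glue.iso]
    simp
  have h' : (𝟙 _ ⊗≫ (D.lam ⊠₂ 𝟙 (𝟙 M) ≫ (wR _ _ M).hom) ▷ D.mul ⊗≫ 𝟙 _ :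
      lu M ⊠₁ 𝟙 M ≫ D.mul ⟶ (i ⊠₁ 𝟙 M) ⊠₁ 𝟙 M ≫ D.mul ⊠₁ 𝟙 M ≫ D.mul) =
      (D.lam ▹₂ M) ⊳ D.mul := by
    simp only [bicategoricalComp, cellAt, rOn, Glue.iso, ImgR.iso]
    simp
  have : IsIso (shiftLu D.mul) := by unfold shiftLu; infer_instance
  rw [h, h', ← cancel_epi (shiftLu D.mul)]
  simp [shiftLu]

theorem lam_rho_iff {M : B} {i : 𝕀 ⟶ M} (D : SkewData i) :
    ((𝟙 _ ⊗≫ (luNat i).inv ⊗≫ 𝟙 (unitObj B) ⊠₁ i ◁ D.lam ⊗≫ (inter i i).inv ▷ D.mul ⊗≫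
        i ⊠₁ 𝟙 (unitObj B) ◁ D.rho ⊗≫ (ruNat i).hom ⊗≫ 𝟙 _ :
      lu (unitObj B) ≫ i ⟶ ru (unitObj B) ≫ i) = (luRu B).hom ▷ i) ↔
    (luNat i).inv ≫ 𝕀 ◃ i ◁ D.lam ≫ (inter i i).inv ⊳ D.mul ≫ i ▹ 𝕀 ◁ D.rho ≫ (ruNat i).hom =
      (luRu B).hom ⊳ i := by
  have h : (𝟙 _ ⊗≫ (luNat i).inv ⊗≫ 𝟙 (unitObj B) ⊠₁ i ◁ D.lam ⊗≫ (inter i i).inv ▷ D.mul ⊗≫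
        i ⊠₁ 𝟙 (unitObj B) ◁ D.rho ⊗≫ (ruNat i).hom ⊗≫ 𝟙 _ :
      lu (unitObj B) ≫ i ⟶ ru (unitObj B) ≫ i) =
      (luNat i).inv ≫ 𝕀 ◃ i ◁ D.lam ≫ (inter i i).inv ⊳ D.mul ≫ i ▹ 𝕀 ◁ D.rho ≫
        (ruNat i).hom := by
    simp only [bicategoricalComp, cellAt, Glue.iso]
    simp
  rw [h, cellAt_base]

theorem whiskerRight_id_tHom₂ {X Y Z W : B} {f g : X ⟶ Y} (c : f ⟶ g) (k : Z ⊠ Y ⟶ W) :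
    (𝟙 (𝟙 Z) ⊠₂ c) ▷ k = (Z ◃₂ c) ⊳ k := by
  rw [cellAt_base, lOn_base]

namespace RightSkewMonoidaleWithRightAdjoint

variable (M : RightSkewMonoidaleWithRightAdjoint B)

theorem mate_eq : M.mate = (adjOn M.right.adj M.obj).homEquiv₁ M.data.lam := by
  rw [homEquiv₁_eq, counitAt, adjOn_counit]
  simp [mate, bicategoricalComp]

end RightSkewMonoidaleWithRightAdjoint

end SkewPaths

/-! ### Changing one edge of a configuration along a cell -/

section TetraNaturality

open MonoidalStruct

local notation "𝕀" => unitObj _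

variable {B : Type u} [Bicategory.{w, v} B] [MonoidalBicategory B]

section

variable {R S T U : B} {s s' : S ⊠ R ⟶ S} {t t' : T ⊠ S ⟶ T} {v v' : T ⊠ R ⟶ T} {p : U ⊠ T ⟶ U}
  {x x' : U ⊠ S ⟶ U} {y y' : U ⊠ R ⟶ U}

/-- In this and the following lemmas one edge of a tetrahedron is changed along `κ`. Where the edge
occurs in the third face, as `t` in `α` or `x` in `β`, a hypothesis says that `κ` commutes with the
two versions of that face; otherwise whiskering with `κ` suffices. -/
theorem Tetra.natural_fst (κ : s' ⟶ s) {α : Sq s t v} {β : Sq s x y} {γ : Sq v p y} {ζ : Sq t p x}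
    (e : Tetra α β γ ζ) :
    Tetra (as T S R ◁ (T ◃₂ κ) ⊳ t ≫ α) (as U S R ◁ (U ◃₂ κ) ⊳ x ≫ β) γ ζ := by
  rw [tetra_iff] at e ⊢
  have x₁ := asRp_naturality U T κ
  simp at x₁
  replace x₁ := congrArg (fun c => as (U ⊠ T) S R ◁ c ⊳ (U ◃ t ≫ p)) x₁
  have x₂ := congrArg (fun c => as (U ⊠ T) S R ◁ c) (cellAt_exchange ((U ⊠ T) ◃₂ κ) ζ)
  have x₃ := congrArg (fun c => as (U ⊠ T) S R ◁ c ⊳ x) (interRp_naturality p κ)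
  have x₄ := cellAt_exchange (asL p S R).inv ((U ◃₂ κ) ⊳ x)
  have x₅ := cellAt_exchange (pent U T S R).inv ((U ◃₂ (T ◃₂ κ)) ⊳ (U ◃ t ≫ p))
  simp [hat, shift] at e x₁ x₂ x₃ x₄ x₅ ⊢
  rw [reassoc_of% x₅, ← reassoc_of% x₁, e, reassoc_of% x₂, reassoc_of% x₃, ← reassoc_of% x₄]

theorem Tetra.dinatural_snd (κ : t ⟶ t') {α : Sq s t v} {α' : Sq s t' v} {β : Sq s x y}
    {γ : Sq v p y} {ζ : Sq t' p x} (h : α ≫ (κ ▹₂ R) ⊳ v = as T S R ◁ T ◃ s ◁ κ ≫ α')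
    (e : Tetra α' β γ ζ) : Tetra α β γ (as U T S ◁ (U ◃₂ κ) ⊳ p ≫ ζ) := by
  rw [tetra_iff] at e ⊢
  have x₁ := congrArg (fun c => as U T S ▹ R ◁ c) (cellAt_exchange ((U ◃₂ κ) ▹₂ R) γ)
  have x₂ := asMp_naturality_inv U R κ
  simp at x₂
  replace x₂ := congrArg (fun c => as U T S ▹ R ◁ c ⊳ (U ◃ v ≫ p)) x₂
  have x₃ := congrArg (fun c => as U T S ▹ R ◁ as U (T ⊠ S) R ◁ (U ◃₂ c) ⊳ p) h
  have x₄ := cellAt_exchange (pent U T S R).inv (U ◃ (T ◃ s) ◁ (U ◃₂ κ) ⊳ p)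
  have x₅ := congrArg (fun c => as (U ⊠ T) S R ◁ c)
    (cellAt_exchange (asR U T s).hom ((U ◃₂ κ) ⊳ p))
  simp [hat] at e x₁ x₂ x₃ x₄ x₅ ⊢
  rw [← reassoc_of% x₁, ← reassoc_of% x₂, reassoc_of% x₃, reassoc_of% x₄, reassoc_of% x₅, e]

theorem tetra_dinatural_third (κ : v ⟶ v') {α : Sq s t v} {β : Sq s x y}
    {γ : Sq v' p y} {ζ : Sq t p x} :
    Tetra (α ≫ t ▹ R ◁ κ) β γ ζ ↔ Tetra α β (as U T R ◁ (U ◃₂ κ) ⊳ p ≫ γ) ζ := by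
  rw [tetra_iff, tetra_iff]
  have x₁ := congrArg (fun c => as U T S ▹ R ◁ c)
    (cellAt_exchange (asM U t R).inv ((U ◃₂ κ) ⊳ p))
  simp [hat] at x₁ ⊢
  rw [reassoc_of% x₁]

theorem Tetra.dinatural_mid (κ : x ⟶ x') {α : Sq s t v} {β : Sq s x y} {β' : Sq s x' y}
    {γ : Sq v p y} {ζ : Sq t p x} (h : β ≫ (κ ▹₂ R) ⊳ y = as U S R ◁ U ◃ s ◁ κ ≫ β')
    (e : Tetra α β γ ζ) : Tetra α β' γ (ζ ≫ p ▹ S ◁ κ) := by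
  rw [tetra_iff] at e ⊢
  have x₁ := congrArg (fun c => (p ▹ S) ▹ R ◁ c) h
  have x₂ := cellAt_exchange (asL p S R).inv (U ◃ s ◁ κ)
  have x₃ := congrArg (fun c => as (U ⊠ T) S R ◁ c) (cellAt_exchange (inter p s).inv κ)
  simp [shift] at e x₁ x₂ x₃ ⊢
  rw [reassoc_of% e, x₁, reassoc_of% x₂, reassoc_of% x₃]

theorem Tetra.natural_last (κ : y ⟶ y') {α : Sq s t v} {β : Sq s x y} {γ : Sq v p y}
    {ζ : Sq t p x} (e : Tetra α β γ ζ) : Tetra α (β ≫ x ▹ R ◁ κ) (γ ≫ p ▹ R ◁ κ) ζ := by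
  rw [tetra_iff] at e ⊢
  have x₁ := cellAt_exchange (ζ ▹₂ R) κ
  simp at e x₁ ⊢
  rw [← x₁, reassoc_of% e]

end

section

variable {R S T : B} {s s' : S ⊠ R ⟶ S} {t : T ⊠ S ⟶ T} {v v' : T ⊠ R ⟶ T} {i : 𝕀 ⟶ R}

theorem UnitCompat.dinatural (κ : s ⟶ s') {s₀ : S ◃ i ≫ s' ⟶ ru S} {v₀ : T ◃ i ≫ v ⟶ ru T}
    {α : Sq s' t v} (e : UnitCompat i s₀ v₀ α) :
    UnitCompat i (S ◃ i ◁ κ ≫ s₀) v₀ (as T S R ◁ (T ◃₂ κ) ⊳ t ≫ α) := by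
  rw [unitCompat_iff] at e ⊢
  have x₁ := cellAt_exchange (asR T S i).inv ((T ◃₂ κ) ⊳ t)
  simp at e x₁ ⊢
  rw [reassoc_of% x₁, e]

theorem unitCompat_naturality (κ : v ⟶ v') {s₀ : S ◃ i ≫ s ⟶ ru S} {v₀ : T ◃ i ≫ v' ⟶ ru T}
    {α : Sq s t v} :
    UnitCompat i s₀ (T ◃ i ◁ κ ≫ v₀) α ↔ UnitCompat i s₀ v₀ (α ≫ t ▹ R ◁ κ) := by
  rw [unitCompat_iff, unitCompat_iff]
  have x₁ := cellAt_exchange (inter t i).inv κ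
  simp at x₁ ⊢
  rw [reassoc_of% x₁]

end

theorem triangle_dinatural {M A : B} {i : 𝕀 ⟶ M} {h m : M ⊠ M ⟶ M} {a : A ⊠ M ⟶ A}
    {lam : lu M ⟶ i ▹ M ≫ h} (κ : h ⟶ m) {a₀ : A ◃ i ≫ a ⟶ ru A} {a₂ : Sq m a a} :
    Triangle (lam ≫ i ▹ M ◁ κ) a₀ a₂ ↔ Triangle lam a₀ (as A M M ◁ (A ◃₂ κ) ⊳ a ≫ a₂) := by
  rw [triangle_iff, triangle_iff]
  have x₁ := cellAt_exchange (asM A i M).inv ((A ◃₂ κ) ⊳ a)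
  simp at x₁ ⊢
  rw [reassoc_of% x₁]

end TetraNaturality

/-! ### Filling the unit into a tetrahedron -/

section TriangleMap

open MonoidalStruct

local notation "𝕀" => unitObj _

variable {B : Type u} [Bicategory.{w, v} B] [MonoidalBicategory B] {M T U : B} {i : 𝕀 ⟶ M}
  {h : M ⊠ M ⟶ M}

/-- The composite of a left unitor cell, a square and a right unitor cell is the mate of `a`. -/
def TriangleMap {t v : T ⊠ M ⟶ T} (lam : lu M ⟶ i ▹ M ≫ h) (t₀ : T ◃ i ≫ t ⟶ ru T) (α : Sq h t v)
    (a : t ⟶ v) : Prop :=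
  as T 𝕀 M ◁ (T ◃₂ lam) ⊳ t ≫ (asM T i M).inv ⊳ (T ◃ h ≫ t) ≫ (T ◃ i) ▹ M ◁ α ≫ (t₀ ▹₂ M) ⊳ v =
    (midTri T M).hom ⊳ t ≫ ru T ▹ M ◁ a

/-- Evaluates the side of a tetrahedron equation containing `shift p h` and `β`: once the unitors
are filled in, only `b` is left, carried past `p` by naturality of the middle triangle. -/
theorem TriangleMap.tensor {V : B} {x y : U ⊠ M ⟶ U} {lam : lu M ⟶ i ▹ M ≫ h}
    {x₀ : U ◃ i ≫ x ⟶ ru U}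
    {β : Sq h x y} {b : x ⟶ y} (e : TriangleMap lam x₀ β b) (p : V ⟶ U) :
    as V 𝕀 M ◁ (V ◃₂ lam) ⊳ (p ▹ M ≫ x) ≫ (asM V i M).inv ⊳ (V ◃ h ≫ p ▹ M ≫ x) ≫
        (V ◃ i) ▹ M ◁ (shift p h ⊳ x ≫ (p ▹ M) ▹ M ◁ β) ≫
        ((inter p i).inv ▹₂ M) ⊳ (x ▹ M ≫ y) ≫ (p ▹ 𝕀) ▹ M ◁ (x₀ ▹₂ M) ⊳ y ≫
        ((ruNat p).hom ▹₂ M) ⊳ y =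
      (midTri V M).hom ⊳ (p ▹ M ≫ x) ≫ ru V ▹ M ◁ p ▹ M ◁ b := by
  rw [TriangleMap] at e
  have xa := congrArg (fun c => (asL p 𝕀 M).inv ⊳ (U ◃ lu M) ≫ c) (midTri_naturality₁ p M)
  simp at xa
  replace xa := congrArg (fun c => as V 𝕀 M ◁ (inter p (lu M)).inv ⊳ x ≫ c ⊳ x) xa
  have xb := congrArg (fun c => (p ▹ 𝕀) ▹ M ◁ c) e
  have xc := congrArg (fun c => ((asM V i M).inv ⊳ (p ▹ (M ⊠ M)) ≫ (V ◃ i) ▹ M ◁ (asL p M M).inv ≫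
    (inter p i).inv ▹₂ M ⊳ as U M M) ≫ c ≫ as V 𝕀 M ◁ (inter p (i ▹ M)).inv ≫
    (asL p 𝕀 M).inv ⊳ (U ◃ (i ▹ M)) ≫ (p ▹ 𝕀) ▹ M ◁ (asM U i M).inv) (inter_asM_asL p i M)
  simp at xc
  replace xc := congrArg (fun c => c ⊳ (U ◃ h ≫ x)) xc
  have xd := congrArg (fun c => as V 𝕀 M ◁ c ⊳ x) (interRp_naturality p lam)
  have xe := cellAt_exchange (asL p 𝕀 M).inv ((U ◃₂ lam) ⊳ x)
  have xf := cellAt_exchange ((inter p i).inv ▹₂ M) β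
  have xg := cellAt_exchange (asM V i M).inv ((inter p h).inv ⊳ x)
  have xh := cellAt_exchange ((ruNat p).hom ▹₂ M) b
  simp at xa xb xc xd xe xf xg xh
  simp [shift]
  rw [reassoc_of% xg, ← reassoc_of% xf, ← reassoc_of% xc, reassoc_of% xd, ← reassoc_of% xe,
    reassoc_of% xb, ← xh, reassoc_of% xa]

/-- Evaluates the side containing `hat U α` and `γ`. The unit now stands behind two objects, so
`normRight_path` is needed to reduce to the hypothesis on `α`; naturality of the pentagon in its
third variable moves `i` into place. -/
theorem TriangleMap.hat {t v : T ⊠ M ⟶ T} {p : U ⊠ T ⟶ U} {y : U ⊠ M ⟶ U} {lam : lu M ⟶ i ▹ M ≫ h}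
    {t₀ : T ◃ i ≫ t ⟶ ru T} {α : Sq h t v} {a : t ⟶ v} (e : TriangleMap lam t₀ α a) (γ : Sq v p y) :
    as (U ⊠ T) 𝕀 M ◁ ((U ⊠ T) ◃₂ lam) ⊳ (as U T M ≫ U ◃ t ≫ p) ≫
        (asM (U ⊠ T) i M).inv ⊳ ((U ⊠ T) ◃ h ≫ as U T M ≫ U ◃ t ≫ p) ≫
        ((U ⊠ T) ◃ i) ▹ M ◁ (hat U α ⊳ p ≫ as U T M ▹ M ◁ (U ◃ t) ▹ M ◁ γ) ≫
        ((asR U T i).hom ▹₂ M) ⊳ ((U ◃ t) ▹ M ≫ p ▹ M ≫ y) ≫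
        as U T 𝕀 ▹ M ◁ ((U ◃₂ t₀) ▹₂ M) ⊳ (p ▹ M ≫ y) ≫ ((rightTri U T).hom ▹₂ M) ⊳ (p ▹ M ≫ y) =
      (midTri (U ⊠ T) M).hom ⊳ (as U T M ≫ U ◃ t ≫ p) ≫
        ru (U ⊠ T) ▹ M ◁ (as U T M ◁ (U ◃₂ a) ⊳ p ≫ γ) := by
  rw [TriangleMap] at e
  have xa := cellAt_exchange ((asR U T i).hom ▹₂ M) ((U ◃ t) ▹ M ◁ γ)
  have xb := congrArg (fun c => as U T 𝕀 ▹ M ◁ c) (cellAt_exchange ((U ◃₂ t₀) ▹₂ M) γ)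
  have xc := cellAt_exchange ((rightTri U T).hom ▹₂ M) γ
  have xd := cellAt_exchange ((asR U T i).hom ▹₂ M) ((asM U t M).inv ⊳ (U ◃ v ≫ p))
  have xe := cellAt_exchange ((asR U T i).hom ▹₂ M) (as U (T ⊠ M) M ◁ (U ◃₂ α) ⊳ p)
  have xf := congrArg (fun c => as U T 𝕀 ▹ M ◁ c)
    (cellAt_exchange (asM U (T ◃ i) M).inv ((U ◃₂ α) ⊳ p))
  have xg := congrArg (fun c => as U T 𝕀 ▹ M ◁ c ⊳ (U ◃ v ≫ p)) (asMp_naturality_inv U M t₀)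
  have xh := congrArg (fun c => as U T 𝕀 ▹ M ◁ as U (T ⊠ 𝕀) M ◁ (U ◃₂ c) ⊳ p) e
  have xi := congrArg (fun c => as U T 𝕀 ▹ M ◁ c) (cellAt_exchange (asM U (ru T) M).inv ((U ◃₂ a) ⊳ p))
  have xj := cellAt_exchange ((rightTri U T).hom ▹₂ M) (as U T M ◁ (U ◃₂ a) ⊳ p)
  have xk := congrArg (fun c => (as (U ⊠ T) 𝕀 M ◁ (asR U T (lu M)).hom ≫
    (pent U T 𝕀 M).inv ⊳ (U ◃ (T ◃ lu M))) ≫ c) (normRight_path U T M)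
  simp at xk
  replace xk := congrArg (fun c => c ⊳ (U ◃ t ≫ p)) xk
  have xl := asRp_naturality U T lam
  simp at xl
  replace xl := congrArg (fun c => as (U ⊠ T) 𝕀 M ◁ c ⊳ (U ◃ t ≫ p)) xl
  have xm := congrArg (fun c => (as (U ⊠ T) 𝕀 M ◁ (asR U T (i ▹ M)).hom ≫
    (pent U T 𝕀 M).inv ⊳ (U ◃ (T ◃ (i ▹ M)))) ≫ c ≫
    ((asR U T i).hom ▹₂ M) ⊳ (as U (T ⊠ M) M ≫ U ◃ as T M M)) (pent_naturality₃_inv U T i M)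
  simp at xm
  replace xm := congrArg (fun c => c ⊳ (U ◃ (T ◃ h) ≫ U ◃ t ≫ p)) xm
  have xo := cellAt_exchange (pent U T 𝕀 M).inv ((U ◃₂ (T ◃₂ lam)) ⊳ (U ◃ t ≫ p))
  have xn := cellAt_exchange (asM (U ⊠ T) i M).inv ((asR U T h).hom ⊳ (U ◃ t ≫ p))
  simp at xa xb xc xd xe xf xg xh xi xj xk xl xm xn xo
  simp [MonBicat.hat]
  rw [← reassoc_of% xa]
  rw [← reassoc_of% xb]
  rw [← xc]
  rw [← reassoc_of% xd]
  rw [← reassoc_of% xe]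
  rw [reassoc_of% xn]
  rw [← reassoc_of% xm]
  rw [reassoc_of% xf]
  rw [← reassoc_of% xg]
  rw [reassoc_of% xl]
  rw [← reassoc_of% xo]
  rw [reassoc_of% xh]
  rw [← reassoc_of% xi]
  rw [← reassoc_of% xj]
  rw [reassoc_of% xk]

/-- Put `lam` in front of the tetrahedron equation and the right unitor `x₀` behind it. The left
side collapses to `a` followed by `γ`. On the right, `ζ` slides out by interchange and the rest
collapses to `b`. The unit compatibility of `ζ` matches the right unitors of the two sides. -/
theorem Tetra.eq_of_triangleMap {t v : T ⊠ M ⟶ T} {p : U ⊠ T ⟶ U} {x y : U ⊠ M ⟶ U}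
    {lam : lu M ⟶ i ▹ M ≫ h} {t₀ : T ◃ i ≫ t ⟶ ru T} {x₀ : U ◃ i ≫ x ⟶ ru U} {α : Sq h t v}
    {β : Sq h x y} {γ : Sq v p y} {ζ : Sq t p x} {a : t ⟶ v} {b : x ⟶ y} (H : Tetra α β γ ζ)
    (hζ : UnitCompat i t₀ x₀ ζ) (hα : TriangleMap lam t₀ α a) (hβ : TriangleMap lam x₀ β b) :
    ζ ≫ p ▹ M ◁ b = as U T M ◁ (U ◃₂ a) ⊳ p ≫ γ := by
  have l := hα.hat γ
  have r := hβ.tensor p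
  rw [tetra_iff] at H
  rw [unitCompat_iff] at hζ
  replace H := congrArg (fun c => ((U ⊠ T) ◃ i) ▹ M ◁ c) H
  have xa := congrArg (fun c => (c ▹₂ M) ⊳ y) hζ
  have xb := congrArg (fun c => as (U ⊠ T) 𝕀 M ◁ c) (cellAt_exchange ((U ⊠ T) ◃₂ lam) ζ)
  have xc := cellAt_exchange (asM (U ⊠ T) i M).inv ((U ⊠ T) ◃ h ◁ ζ)
  have xd := cellAt_exchange (midTri (U ⊠ T) M).hom ζ
  simp at l r H xa xb xc xd
  apply whiskerLeft_injective (ru (U ⊠ T) ▹ M)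
  rw [← cancel_epi ((midTri (U ⊠ T) M).hom ⊳ (as U T M ≫ U ◃ t ≫ p))]
  simp
  rw [reassoc_of% xd, ← l, xa, ← r, ← reassoc_of% xb, ← reassoc_of% xc, ← reassoc_of% H]
  simp

theorem triangleMap_id_iff {a : T ⊠ M ⟶ T} {lam : lu M ⟶ i ▹ M ≫ h} {a₀ : T ◃ i ≫ a ⟶ ru T}
    {a₂ : Sq h a a} : TriangleMap lam a₀ a₂ (𝟙 a) ↔ Triangle lam a₀ a₂ := by
  rw [TriangleMap, triangle_iff, Bicategory.whiskerLeft_id, Category.comp_id]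

end TriangleMap

/-! ### Whiskering with the product detects whiskering with the unit -/

section Cancellation

variable {B : Type u₁} [Bicategory.{w₁, v₁} B] {C : Type u₂} [Bicategory.{w₂, v₂} C]

theorem whiskerLeft_eq_of_iso {a b c : B} {f f' : a ⟶ b} (τ : f ≅ f') {g k : b ⟶ c} {x x' : g ⟶ k}
    (hx : f ◁ x = f ◁ x') : f' ◁ x = f' ◁ x' := by
  rw [← cancel_epi (τ.hom ▷ g), ← whisker_exchange, ← whisker_exchange, hx]

/-- By `τ`, an equality after whiskering with `h` gives one after whiskering with `j ≫ l ≫ f`. By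
`σ`, the remaining cells can be viewed as cells into a composite starting with `i`, so `j` is
cancelled by the adjunction. Finally `l` is cancelled as an equivalence. -/
theorem whiskerLeft_eq_of_adjunction {a b c d e z : B} {i : a ⟶ b} {j : b ⟶ a} (adj : i ⊣ j)
    {l : a ⟶ c} [IsEquivalence l] {f : c ⟶ d} {n : b ⟶ d} (σ : l ≫ f ≅ i ≫ n) {k : b ⟶ e}
    {h : e ⟶ d} (τ : k ≫ h ≅ j ≫ l ≫ f) {g g' : d ⟶ z} {x x' : g ⟶ g'} (hx : h ◁ x = h ◁ x') :
    f ◁ x = f ◁ x' := by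
  have h₁ : (k ≫ h) ◁ x = (k ≫ h) ◁ x' := by simp [hx]
  have h₂ := whiskerLeft_eq_of_iso τ h₁
  have h₃ : j ◁ ((l ≫ f) ◁ x) = j ◁ ((l ≫ f) ◁ x') := by
    rwa [comp_whiskerLeft j (l ≫ f) x, comp_whiskerLeft j (l ≫ f) x', cancel_epi, cancel_mono] at h₂
  have h₄ : (l ≫ f) ◁ x ≫ σ.hom ▷ g' ≫ (α_ _ _ _).hom =
      (l ≫ f) ◁ x' ≫ σ.hom ▷ g' ≫ (α_ _ _ _).hom := by
    apply whiskerLeft_right_injective adj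
    rw [whiskerLeft_comp, h₃, ← whiskerLeft_comp]
  rw [cancel_mono] at h₄
  apply whiskerLeft_injective l
  simpa using h₄

theorem isEquivalence_map (F : B ⥤ᵖ C) {a b : B} (l : a ⟶ b) [IsEquivalence l] :
    IsEquivalence (F.map l) := by
  obtain ⟨l', ⟨η⟩, ⟨κ⟩⟩ := IsEquivalence.exists_inverse (e := l)
  exact ⟨F.map l', ⟨(F.mapComp _ _).symm ≪≫ F.map₂Iso η ≪≫ F.mapId _⟩,
    ⟨(F.mapComp _ _).symm ≪≫ F.map₂Iso κ ≪≫ F.mapId _⟩⟩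

/-- The form with a pseudofunctor is needed because the cancellation takes place after tensoring
once or twice on the right. -/
theorem map_whiskerLeft_eq_of_adjunction (F : B ⥤ᵖ C) {a b c d e : B} {i : a ⟶ b} {j : b ⟶ a}
    (adj : i ⊣ j) {l : a ⟶ c} [IsEquivalence l] {f : c ⟶ d} {n : b ⟶ d} (σ : l ≫ f ≅ i ≫ n)
    {k : b ⟶ e} {h : e ⟶ d} (τ : k ≫ h ≅ j ≫ l ≫ f) {z : C} {g g' : F.obj d ⟶ z} {x x' : g ⟶ g'}
    (hx : F.map h ◁ x = F.map h ◁ x') : F.map f ◁ x = F.map f ◁ x' := by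
  have := isEquivalence_map F l
  exact whiskerLeft_eq_of_adjunction (F.mapAdjunction adj)
    ((F.mapComp _ _).symm ≪≫ F.map₂Iso σ ≪≫ F.mapComp _ _)
    ((F.mapComp _ _).symm ≪≫ F.map₂Iso τ ≪≫ F.mapComp _ _ ≪≫
      whiskerLeftIso _ (F.mapComp _ _)) hx

end Cancellation

section UnitCancellation

open MonoidalStruct

local notation "𝕀" => unitObj _

variable {B : Type u} [Bicategory.{w, v} B] [MonoidalBicategory B] {C : Type u₂}
  [Bicategory.{w₂, v₂} C] {M : B} {i : 𝕀 ⟶ M} {j : M ⟶ 𝕀} {h : M ⊠ M ⟶ M}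

/-- The composite of `M ◃ i` with the product induced by an adjunction `i ⊣ j`. -/
def unitProd (φ : h ≅ j ▹ M ≫ lu M) : M ◃ i ≫ h ≅ j ▹ 𝕀 ≫ ru 𝕀 ≫ i :=
  whiskerLeftIso _ φ ≪≫ (α_ _ _ _).symm ≪≫ whiskerRightIso (inter j i).symm _ ≪≫ α_ _ _ _ ≪≫
    whiskerLeftIso _ (luNat i ≪≫ whiskerRightIso (luRu B) i)

theorem map_whiskerLeft_unit_eq (φ : h ≅ j ▹ M ≫ lu M) (adj : i ⊣ j)
    (F : B ⥤ᵖ C) {z : C} {g g' : F.obj M ⟶ z} {x x' : g ⟶ g'}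
    (hx : F.map h ◁ x = F.map h ◁ x') : F.map i ◁ x = F.map i ◁ x' :=
  map_whiskerLeft_eq_of_adjunction F (adjOn adj 𝕀) (ruNat i).symm (unitProd φ) hx

theorem tensor_whiskerLeft_unit_eq (φ : h ≅ j ▹ M ≫ lu M) (adj : i ⊣ j)
    {Y Z : B} {g g' : M ⊠ Y ⟶ Z} {x x' : g ⟶ g'}
    (hx : h ▹ Y ◁ x = h ▹ Y ◁ x') : i ▹ Y ◁ x = i ▹ Y ◁ x' :=
  map_whiskerLeft_unit_eq φ adj (tensorOn Y) hx

theorem tensor_tensor_whiskerLeft_unit_eq (φ : h ≅ j ▹ M ≫ lu M) (adj : i ⊣ j)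
    {Y Y' Z : B} {g g' : (M ⊠ Y) ⊠ Y' ⟶ Z} {x x' : g ⟶ g'}
    (hx : (h ▹ Y) ▹ Y' ◁ x = (h ▹ Y) ▹ Y' ◁ x') : (i ▹ Y) ▹ Y' ◁ x = (i ▹ Y) ▹ Y' ◁ x' :=
  map_whiskerLeft_unit_eq φ adj ((tensorOn Y).comp (tensorOn Y')) hx

end UnitCancellation

/-! ### The axiom relating left unitor and associator, and its mate -/

section LeftUnitor

open MonoidalStruct

local notation "𝕀" => unitObj _

variable {B : Type u} [Bicategory.{w, v} B] [MonoidalBicategory B]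

theorem counitAt_shift {X Y S R W : B} {i : X ⟶ Y} {j : Y ⟶ X} (adj : i ⊣ j) (s : S ⊠ R ⟶ S)
    (k : Y ⊠ S ⟶ W) :
    shift j s ⊳ (i ▹ S ≫ k) ≫ (j ▹ S) ▹ R ◁ shift i s ⊳ k ≫
        counitAt (adjOn (adjOn adj S) R) (as Y S R ≫ Y ◃ s ≫ k) =
      as Y S R ◁ Y ◃ s ◁ counitAt (adjOn adj S) k := by
  -- The counit preceded by the equivalence `ru Y`, made opaque. Naturality of the constraints can
  -- be applied to `c` as to any cell, and `ru Y` is cancelled at the end.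
  obtain ⟨c, hc⟩ : ∃ c : ru Y ≫ j ≫ i ⟶ ru Y, c = ru Y ◁ adj.counit ≫ (ρ_ (ru Y)).hom := ⟨_, rfl⟩
  have h₁ : c ▹₂ S ⊳ k = ru Y ▹ S ◁ counitAt (adjOn adj S) k := by rw [hc, rOn_counit]
  have h₂ : ((c ▹₂ S) ▹₂ R) ⊳ (as Y S R ≫ Y ◃ s ≫ k) =
      (ru Y ▹ S) ▹ R ◁ counitAt (adjOn (adjOn adj S) R) (as Y S R ≫ Y ◃ s ≫ k) := by
    rw [hc, rOn_counit_eq, rOn_counit]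
  apply whiskerLeft_injective ((ru Y ▹ S) ▹ R)
  have xa := congrArg (fun c => as (Y ⊠ 𝕀) S R ◁ c ⊳ k) (interLp_naturality_inv s c)
  have xb := congrArg (fun c => c ⊳ (Y ◃ s ≫ k)) (asLp_naturality_inv S R c)
  have xc := cellAt_exchange (asL (ru Y) S R).inv (Y ◃ s ◁ counitAt (adjOn adj S) k)
  have xd := congrArg (fun c => as (Y ⊠ 𝕀) S R ◁ c)
    (cellAt_exchange (inter (ru Y) s).inv (counitAt (adjOn adj S) k))
  have xe := congrArg (fun c => (ru Y ▹ S) ▹ R ◁ c)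
    (cellAt_exchange (asL j S R).inv ((inter i s).inv ⊳ k))
  have xf := cellAt_exchange (asL (ru Y) S R).inv ((inter j s).inv ⊳ (i ▹ S ≫ k))
  have xg := cellAt_exchange (asL (ru Y) S R).inv (j ▹ (S ⊠ R) ◁ (inter i s).inv ⊳ k)
  rw [← cancel_epi (as (Y ⊠ 𝕀) S R ◁ (inter (ru Y) s).inv ⊳ (j ▹ S ≫ i ▹ S ≫ k) ≫
    (asL (ru Y) S R).inv ⊳ (Y ◃ s ≫ j ▹ S ≫ i ▹ S ≫ k))]
  simp [h₁, h₂] at xa xb xc xd xe xf xg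
  simp [shift]
  rw [xc, reassoc_of% xd, reassoc_of% xa, xb, reassoc_of% xf, reassoc_of% xe, reassoc_of% xg]

variable {M : B} {i : 𝕀 ⟶ M} {j : M ⟶ 𝕀} {h m : M ⊠ M ⟶ M} (φ : h ≅ j ▹ M ≫ lu M) (adj : i ⊣ j)
  {lam : lu M ⟶ i ▹ M ≫ h}

instance {Z Z' S R : B} (p : Z ⟶ Z') (s : S ⊠ R ⟶ S) : IsIso (shift p s) := by
  unfold shift
  infer_instance

theorem homEquiv₁_lam_shift (hlam : (adjOn adj M).homEquiv₁ lam = φ.inv) :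
    shift j m ⊳ lu M ≫ (adjOn (adjOn adj M) M).homEquiv₁
        (as 𝕀 M M ◁ 𝕀 ◃ m ◁ lam ≫ shift i m ⊳ h) = as M M M ◁ M ◃ m ◁ φ.inv := by
  have xa := counitAt_shift adj m h
  have xb := cellAt_exchange (shift j m) lam
  have xc := congrArg (fun c => as M M M ◁ M ◃ m ◁ c) ((homEquiv₁_eq _ _).symm.trans hlam)
  rw [homEquiv₁_eq]
  simp at xa xb xc
  simp
  rw [reassoc_of% xb, xa, xc]

/-- The axiom for the induced left unitor, with the coherence square as associator and an arbitrary
`m`. Both sides are compared through their mates under the twice tensored adjunction, where `lam`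
turns into `φ.inv`. -/
theorem shiftLu_lam (hlam : (adjOn adj M).homEquiv₁ lam = φ.inv) :
    shiftLu m ≫ (lam ▹₂ M) ⊳ m =
      as 𝕀 M M ◁ 𝕀 ◃ m ◁ lam ≫ shift i m ⊳ h ≫ (i ▹ M) ▹ M ◁ slideOf φ m := by
  apply (adjOn (adjOn adj M) M).homEquiv₁.injective
  have xa := homEquiv₁_lam_shift (m := m) φ adj hlam
  have xb := homEquiv₁_rOn (adjOn adj M) M lam (k := m)
  have xc := homEquiv₁_comp (adjOn (adjOn adj M) M) (as 𝕀 M M ◁ 𝕀 ◃ m ◁ lam ≫ shift i m ⊳ h)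
    (slideOf φ m)
  rw [Category.assoc] at xc
  rw [homEquiv₁_comp_left, xb, hlam, xc, ← cancel_epi (shift j m ⊳ lu M), reassoc_of% xa]
  simp [slideOf]

/-- The axiom relating the left unitor and the associator is equivalent to its mate. -/
theorem lam_assoc_iff_mate (hlam : (adjOn adj M).homEquiv₁ lam = φ.inv) {κ : h ⟶ m} {α : Sq m m m} :
    as 𝕀 M M ◁ 𝕀 ◃ m ◁ (lam ≫ i ▹ M ◁ κ) ≫ shift i m ⊳ m ≫ (i ▹ M) ▹ M ◁ α =
        shiftLu m ≫ ((lam ≫ i ▹ M ◁ κ) ▹₂ M) ⊳ m ↔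
      slideOf φ m ≫ (κ ▹₂ M) ⊳ m = as M M M ◁ M ◃ m ◁ κ ≫ α := by
  have xa := shiftLu_lam (m := m) φ adj hlam
  have xb := cellAt_exchange (shift i m) κ
  have xc := homEquiv₁_lam_shift (m := m) φ adj hlam
  have xd {f : (M ⊠ M) ⊠ M ⟶ M} (θ : as M M M ≫ M ◃ m ≫ h ⟶ f) := homEquiv₁_comp (adjOn (adjOn adj M) M) (as 𝕀 M M ◁ 𝕀 ◃ m ◁ lam ≫ shift i m ⊳ h) θ
  simp at xb
  constructor
  · intro e
    simp at e
    rw [← reassoc_of% xb, reassoc_of% xa] at e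
    -- Passing to mates turns the common initial part, after `shift j m`, into the invertible cell
    -- `M ◃ m ◁ φ.inv`, which is then cancelled.
    have e' := congrArg (adjOn (adjOn adj M) M).homEquiv₁ e
    have y₁ := xd (slideOf φ m ≫ (κ ▹₂ M) ⊳ m)
    have y₂ := xd (as M M M ◁ M ◃ m ◁ κ ≫ α)
    simp at y₁ y₂
    rw [y₁, y₂] at e'
    replace e' := congrArg (fun c => shift j m ⊳ lu M ≫ c) e'
    simp only [reassoc_of% xc] at e'
    rw [← cancel_epi (as M M M ◁ M ◃ m ◁ φ.inv)]
    simpa using e'.symm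
  · intro e
    have e' := congrArg (fun c => (i ▹ M) ▹ M ◁ c) e
    simp at e'
    simp
    rw [← reassoc_of% xb, reassoc_of% xa, e']

end LeftUnitor

/-! ### The axiom relating the two unitors, and its mate -/

section RightUnitor

open MonoidalStruct

local notation "𝕀" => unitObj _

variable {B : Type u} [Bicategory.{w, v} B] [MonoidalBicategory B]

theorem counitAt_inter {X Y S S' W : B} {i : X ⟶ Y} {j : Y ⟶ X} (adj : i ⊣ j) (s : S ⟶ S')
    (k : Y ⊠ S' ⟶ W) :
    (inter j s).inv ⊳ (i ▹ S' ≫ k) ≫ j ▹ S ◁ (inter i s).inv ⊳ k ≫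
        counitAt (adjOn adj S) (Y ◃ s ≫ k) =
      Y ◃ s ◁ counitAt (adjOn adj S') k := by
  obtain ⟨c, hc⟩ : ∃ c : ru Y ≫ j ≫ i ⟶ ru Y, c = ru Y ◁ adj.counit ≫ (ρ_ (ru Y)).hom := ⟨_, rfl⟩
  have h₁ : c ▹₂ S' ⊳ k = ru Y ▹ S' ◁ counitAt (adjOn adj S') k := by rw [hc, rOn_counit]
  have h₂ : c ▹₂ S ⊳ (Y ◃ s ≫ k) = ru Y ▹ S ◁ counitAt (adjOn adj S) (Y ◃ s ≫ k) := by
    rw [hc, rOn_counit]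
  apply whiskerLeft_injective (ru Y ▹ S)
  have xa := congrArg (fun c => c ⊳ k) (interLp_naturality_inv s c)
  have xd := cellAt_exchange (inter (ru Y) s).inv (counitAt (adjOn adj S') k)
  rw [← cancel_epi ((inter (ru Y) s).inv ⊳ (j ▹ S' ≫ i ▹ S' ≫ k))]
  simp [h₁, h₂] at xa xd
  simp
  rw [xd, xa]

theorem counitAt_ru {X Y : B} {i : X ⟶ Y} {j : Y ⟶ X} (adj : i ⊣ j) :
    j ▹ 𝕀 ◁ (ruNat i).inv ≫ counitAt (adjOn adj 𝕀) (ru Y) =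
      (ruNat j).hom ⊳ i ≫ ru Y ◁ adj.counit ≫ (ρ_ (ru Y)).hom := by
  obtain ⟨c, hc⟩ : ∃ c : ru Y ≫ j ≫ i ⟶ ru Y, c = ru Y ◁ adj.counit ≫ (ρ_ (ru Y)).hom := ⟨_, rfl⟩
  have h₂ : c ▹₂ 𝕀 ⊳ ru Y = ru Y ▹ 𝕀 ◁ counitAt (adjOn adj 𝕀) (ru Y) := by
    rw [hc, rOn_counit]
  rw [← hc]
  apply whiskerLeft_injective (ru Y ▹ 𝕀)
  have xa := rup_naturality_inv c
  have xb : (ruNat (ru Y)).hom ⊳ (j ≫ i) ≫ ru (Y ⊠ 𝕀) ◁ c =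
      ru Y ▹ 𝕀 ◁ c ≫ (ruNat (ru Y)).hom := by
    have xc := whisker_exchange (ruNat (ru Y)).hom adj.counit
    rw [← cancel_mono (ρ_ _).hom] at xc
    simp at xc
    simp [hc, cellAt, Glue.iso, ← xc]
  simp [h₂] at xa
  replace xa := congrArg (fun d => ru Y ▹ 𝕀 ◁ (ruNat j).hom ⊳ i ≫
    (ruNat (ru Y)).hom ⊳ (j ≫ i) ≫ d) xa
  simp at xa
  rw [Bicategory.whiskerLeft_comp, ← xa, reassoc_of% xb]
  simp

variable {M : B} {i : 𝕀 ⟶ M} {j : M ⟶ 𝕀} {h m : M ⊠ M ⟶ M} (φ : h ≅ j ▹ M ≫ lu M) (adj : i ⊣ j)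
  {lam : lu M ⟶ i ▹ M ≫ h}

theorem homEquiv₁_lam_inter (hlam : (adjOn adj M).homEquiv₁ lam = φ.inv) :
    (inter j i).inv ⊳ lu M ≫ (adjOn adj 𝕀).homEquiv₁ (𝕀 ◃ i ◁ lam ≫ (inter i i).inv ⊳ h) =
      M ◃ i ◁ φ.inv := by
  have xa := counitAt_inter adj i h
  have xb := cellAt_exchange (inter j i).inv lam
  have xc := congrArg (fun c => M ◃ i ◁ c) ((homEquiv₁_eq _ _).symm.trans hlam)
  rw [homEquiv₁_eq]
  simp at xa xb xc
  simp
  rw [reassoc_of% xb, xa, xc]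

/-- The axiom relating the two unitors, for the induced structure. Both sides have the same mate: on
the left by naturality of `ru` against the counit, on the right because the mate of `lam` is
`φ.inv`. -/
theorem luRu_lam (hlam : (adjOn adj M).homEquiv₁ lam = φ.inv) :
    (luNat i).hom ≫ (luRu B).hom ⊳ i ≫ (ruNat i).inv =
      𝕀 ◃ i ◁ lam ≫ (inter i i).inv ⊳ h ≫ i ▹ 𝕀 ◁ rhoOf φ adj := by
  apply (adjOn adj 𝕀).homEquiv₁.injective
  have xa := homEquiv₁_lam_inter φ adj hlam
  have xb := counitAt_ru adj
  have xc := homEquiv₁_comp (adjOn adj 𝕀) (𝕀 ◃ i ◁ lam ≫ (inter i i).inv ⊳ h) (rhoOf φ adj)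
  rw [Category.assoc] at xc
  rw [homEquiv₁_comp_left, homEquiv₁_comp_left, homEquiv₁_eq, xb, xc,
    ← cancel_epi ((inter j i).inv ⊳ lu M), reassoc_of% xa]
  simp [rhoOf]

/-- The axiom relating the two unitors is equivalent to its mate. -/
theorem lam_rho_iff_mate (hlam : (adjOn adj M).homEquiv₁ lam = φ.inv) {κ : h ⟶ m}
    {rho : M ◃ i ≫ m ⟶ ru M} :
    (luNat i).inv ≫ 𝕀 ◃ i ◁ (lam ≫ i ▹ M ◁ κ) ≫ (inter i i).inv ⊳ m ≫ i ▹ 𝕀 ◁ rho ≫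
        (ruNat i).hom = (luRu B).hom ⊳ i ↔
      M ◃ i ◁ κ ≫ rho = rhoOf φ adj := by
  have xa := luRu_lam φ adj hlam
  have xb := cellAt_exchange (inter i i).inv κ
  have xc := homEquiv₁_lam_inter φ adj hlam
  have xd (θ : M ◃ i ≫ h ⟶ ru M) := homEquiv₁_comp (adjOn adj 𝕀)
    (𝕀 ◃ i ◁ lam ≫ (inter i i).inv ⊳ h) θ
  simp at xb
  rw [← cancel_epi (luNat i).hom, ← cancel_mono (ruNat i).inv]
  simp
  rw [xa, ← reassoc_of% xb]
  constructor
  · intro e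
    have e' := congrArg (adjOn adj 𝕀).homEquiv₁ e
    have y₁ := xd (M ◃ i ◁ κ ≫ rho)
    have y₂ := xd (rhoOf φ adj)
    simp at y₁ y₂
    rw [y₁, y₂] at e'
    replace e' := congrArg (fun c => (inter j i).inv ⊳ lu M ≫ c) e'
    simp only [reassoc_of% xc] at e'
    rw [← cancel_epi (M ◃ i ◁ φ.inv)]
    simpa using e'
  · intro e
    rw [← e]
    simp

/-- Whiskering by the unit detects equality of cells out of the unit. -/
theorem lam_rho_of_whisker (hlam : (adjOn adj M).homEquiv₁ lam = φ.inv) {κ : h ⟶ m}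
    {rho : M ◃ i ≫ m ⟶ ru M} (e : h ▹ 𝕀 ◁ (M ◃ i ◁ κ ≫ rho) = h ▹ 𝕀 ◁ rhoOf φ adj) :
    (luNat i).inv ≫ 𝕀 ◃ i ◁ (lam ≫ i ▹ M ◁ κ) ≫ (inter i i).inv ⊳ m ≫ i ▹ 𝕀 ◁ rho ≫
        (ruNat i).hom = (luRu B).hom ⊳ i := by
  have e' := tensor_whiskerLeft_unit_eq φ adj e
  have xa := luRu_lam φ adj hlam
  have xb := cellAt_exchange (inter i i).inv κ
  rw [← cancel_epi (luNat i).hom, ← cancel_mono (ruNat i).inv]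
  simp at e' xb
  simp
  rw [xa, ← reassoc_of% xb, e']

end RightUnitor

/-- Fullness of whiskering with an equivalence. The witness is `e' ◁ c` conjugated by `κ`, and it is
verified after whiskering with `e'`, which loses nothing. -/
theorem whiskerLeft_surjective {B : Type u} [Bicategory.{w, v} B] {X Y Z : B} (e : X ⟶ Y)
    [IsEquivalence e] {f g : Y ⟶ Z} (c : e ≫ f ⟶ e ≫ g) : ∃ d : f ⟶ g, e ◁ d = c := by
  obtain ⟨e', ⟨η⟩, ⟨κ⟩⟩ := IsEquivalence.exists_inverse (e := e)
  have : IsEquivalence e' := ⟨e, ⟨κ⟩, ⟨η⟩⟩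
  refine ⟨(λ_ f).inv ≫ κ.inv ▷ f ≫ (α_ _ _ _).hom ≫ e' ◁ c ≫ (α_ _ _ _).inv ≫ κ.hom ▷ g ≫
    (λ_ g).hom, whiskerLeft_injective e' ?_⟩
  generalize hd : (λ_ f).inv ≫ κ.inv ▷ f ≫ (α_ _ _ _).hom ≫ e' ◁ c ≫ (α_ _ _ _).inv ≫
    κ.hom ▷ g ≫ (λ_ g).hom = d
  have h₁ := whisker_exchange κ.hom d
  have h₂ : (λ_ f).hom ≫ d ≫ (λ_ g).inv = κ.inv ▷ f ≫ (α_ _ _ _).hom ≫ e' ◁ c ≫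
      (α_ _ _ _).inv ≫ κ.hom ▷ g := by
    rw [← hd]
    simp
  rw [id_whiskerLeft, h₂] at h₁
  simp at h₁
  rw [← cancel_mono ((α_ e' e g).inv ≫ κ.hom ▷ g)]
  simpa using h₁

/-! ### Skew monoidales versus the laws of a monad of oplax actions -/

section MonadLaws

open MonoidalStruct

local notation "𝕀" => unitObj _

variable {B : Type u} [Bicategory.{w, v} B] [MonoidalBicategory B]

/-- The laws satisfied by the simplices of a monad of oplax actions, where `h` is the product of
the induced skew monoidale with square `sₕ` and unitors `lam₀`, `rho₀`, and where `m` is an action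
with associator `a₂`, right unitor `rho`, degenerate square `sₘ`, unit square `θ` and
multiplication square `α`. -/
structure MonadLaws {M : B} {i : 𝕀 ⟶ M} {h m : M ⊠ M ⟶ M} (lam₀ : lu M ⟶ i ▹ M ≫ h)
    (rho₀ : M ◃ i ≫ h ⟶ ru M) (rho : M ◃ i ≫ m ⟶ ru M) (sₕ : Sq h h h) (sₘ : Sq m h m)
    (θ : Sq h h m) (a₂ : Sq h m m) (α : Sq m m m) : Prop where
  assoc : Tetra sₕ a₂ a₂ a₂
  assoc_unit : UnitCompat i rho₀ rho a₂
  triangle : Triangle lam₀ rho a₂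
  unit_middle : Tetra sₕ θ θ sₕ
  unit_right : Tetra sₕ a₂ θ θ
  unit_unit : UnitCompat i rho₀ rho θ
  unit_unit_mul : Tetra θ a₂ sₘ θ
  mul_unit : Tetra sₘ α sₘ θ
  unit_mul : Tetra θ a₂ α a₂
  mul_middle : Tetra sₘ α α a₂
  mul_right : Tetra a₂ a₂ α α
  mul_mul : Tetra α α α α
  mul_unitor : UnitCompat i rho rho α

variable {M : B} {i : 𝕀 ⟶ M} {j : M ⟶ 𝕀} {h m : M ⊠ M ⟶ M} (φ : h ≅ j ▹ M ≫ lu M) (adj : i ⊣ j)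
  {lam : lu M ⟶ i ▹ M ≫ h} {rho : M ◃ i ≫ m ⟶ ru M} {α : Sq m m m}

/-- There are two sources: the pentagon, and the coherence tetrahedron with all or all but one of
its edges `h`. Replacing edges along `κ` produces every mixed tetrahedron. The mate equation for the
associator is what permits changing the second and the fifth edge, and the one for `rho` gives the
unit conditions involving the induced right unitor. -/
theorem monadLaws_of_skew {κ : h ⟶ m} (pentagon : Tetra α α α α)
    (triangle : Triangle (lam ≫ i ▹ M ◁ κ) rho α)
    (lam_assoc : slideOf φ m ≫ (κ ▹₂ M) ⊳ m = as M M M ◁ M ◃ m ◁ κ ≫ α)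
    (assoc_rho : UnitCompat i rho rho α) (lam_rho : M ◃ i ◁ κ ≫ rho = rhoOf φ adj) :
    MonadLaws lam (rhoOf φ adj) rho (slideOf φ h) (slideOf φ m) (slideOf φ h ≫ h ▹ M ◁ κ)
      (as M M M ◁ (M ◃₂ κ) ⊳ m ≫ α) α := by
  have mul_middle : Tetra (slideOf φ m) α α (as M M M ◁ (M ◃₂ κ) ⊳ m ≫ α) :=
    pentagon.dinatural_snd κ lam_assoc
  have unit_mul := mul_middle.natural_fst κ
  rw [slideOf_naturality] at unit_mul
  have mul_unit : Tetra (slideOf φ m) α (slideOf φ m) (slideOf φ h ≫ h ▹ M ◁ κ) :=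
    (tetra_slideOf φ (slideOf φ m)).dinatural_mid κ lam_assoc
  have unit_unit_mul := mul_unit.natural_fst κ
  rw [slideOf_naturality] at unit_unit_mul
  have unit_right := tetra_dinatural_third κ |>.1 unit_unit_mul
  rw [slideOf_naturality] at unit_right
  have assoc_unit := assoc_rho.dinatural κ
  rw [lam_rho] at assoc_unit
  have unit_unit : UnitCompat i (rhoOf φ adj) rho (slideOf φ h ≫ h ▹ M ◁ κ) := by
    rw [← unitCompat_naturality, lam_rho]
    exact unitCompat_slideOf φ i _
  exact
    { assoc := tetra_dinatural_third κ |>.1 unit_mul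
      assoc_unit := assoc_unit
      triangle := triangle_dinatural κ |>.1 triangle
      unit_middle := (tetra_slideOf φ (slideOf φ h)).natural_last κ
      unit_right := unit_right
      unit_unit := unit_unit
      unit_unit_mul := unit_unit_mul
      mul_unit := mul_unit
      unit_mul := unit_mul
      mul_middle := mul_middle
      mul_right := pentagon.natural_fst κ
      mul_mul := pentagon
      mul_unitor := assoc_rho }

/-- The cell `κ` is `θ` with the unit filled in. Both formulas are instances of
`Tetra.eq_of_triangleMap`: faces that are regular or oplax action associators contribute identities
by the triangle axiom, and `θ` contributes `κ`. -/
theorem MonadLaws.exists_mate (hlam : (adjOn adj M).homEquiv₁ lam = φ.inv) {θ : Sq h h m}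
    {a₂ : Sq h m m}
    (L : MonadLaws lam (rhoOf φ adj) rho (slideOf φ h) (slideOf φ m) θ a₂ α) :
    ∃ κ : h ⟶ m, θ = slideOf φ h ≫ h ▹ M ◁ κ ∧ a₂ = as M M M ◁ (M ◃₂ κ) ⊳ m ≫ α := by
  obtain ⟨κ, hκ⟩ : ∃ κ : h ⟶ m, TriangleMap lam (rhoOf φ adj) θ κ := by
    -- Filling in the unit yields a cell whiskered with the equivalence `ru M ▹ M`; fullness strips
    -- it off.
    obtain ⟨κ, hκ⟩ := whiskerLeft_surjective (ru M ▹ M) ((midTri M M).inv ⊳ h ≫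
      as M 𝕀 M ◁ (M ◃₂ lam) ⊳ h ≫ (asM M i M).inv ⊳ (M ◃ h ≫ h) ≫ (M ◃ i) ▹ M ◁ θ ≫
        (rhoOf φ adj ▹₂ M) ⊳ m)
    refine ⟨κ, ?_⟩
    rw [TriangleMap, hκ]
    simp
  have e₁ := L.unit_middle.eq_of_triangleMap (unitCompat_slideOf φ i (rhoOf φ adj))
    (triangleMap_id_iff.2 (triangle_slideOf φ adj hlam)) hκ
  have e₂ := L.unit_mul.eq_of_triangleMap L.assoc_unit hκ (triangleMap_id_iff.2 L.triangle)
  refine ⟨κ, ?_, ?_⟩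
  · rw [e₁]
    simp
  · rw [← e₂]
    simp

instance {R : B} (r : M ⊠ R ⟶ M) : IsIso (slideOf φ r) := by
  unfold slideOf shiftLu
  infer_instance

/-- The law `mul_unit` is compared with the coherence tetrahedron having the same first and third
faces. After cancelling invertible cells the difference is the mate equation, still whiskered with
`h`. -/
theorem whiskerLeft_slideOf_mate {κ : h ⟶ m}
    (mul_unit : Tetra (slideOf φ m) α (slideOf φ m) (slideOf φ h ≫ h ▹ M ◁ κ)) :
    (h ▹ M) ▹ M ◁ (slideOf φ m ≫ (κ ▹₂ M) ⊳ m) = (h ▹ M) ▹ M ◁ (as M M M ◁ M ◃ m ◁ κ ≫ α) := by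
  have xa := (tetra_iff _ _ _ _).1 (tetra_slideOf φ (slideOf φ m))
  have xb := (tetra_iff _ _ _ _).1 mul_unit
  have xc := congrArg (fun c => as (M ⊠ M) M M ◁ c) (cellAt_exchange (inter h m).inv κ)
  have xd := cellAt_exchange (asL h M M).inv (M ◃ m ◁ κ)
  simp [shift] at xa xb xc xd
  rw [← reassoc_of% xc, ← reassoc_of% xd, reassoc_of% xa] at xb
  rw [← cancel_epi (as (M ⊠ M) M M ◁ (M ⊠ M) ◃ m ◁ slideOf φ h ≫
    as (M ⊠ M) M M ◁ (inter h m).inv ⊳ h ≫ (asL h M M).inv ⊳ (M ◃ m ≫ h))]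
  simpa using xb

/-- The same comparison for unit conditions: that of `θ` against that of the coherence square. -/
theorem whiskerLeft_rho_mate {κ : h ⟶ m}
    (unit_unit : UnitCompat i (rhoOf φ adj) rho (slideOf φ h ≫ h ▹ M ◁ κ)) :
    h ▹ 𝕀 ◁ (M ◃ i ◁ κ ≫ rho) = h ▹ 𝕀 ◁ rhoOf φ adj := by
  rw [← unitCompat_naturality, unitCompat_iff] at unit_unit
  have xa := (unitCompat_iff _ _ _ _).1 (unitCompat_slideOf φ i (rhoOf φ adj))
  rw [← cancel_epi ((asR M M i).inv ⊳ (M ◃ h ≫ h) ≫ (M ⊠ M) ◃ i ◁ slideOf φ h ≫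
    (inter h i).inv ⊳ h), ← cancel_mono (ruNat h).hom]
  simp at xa unit_unit
  simp
  rw [← xa, ← unit_unit]

/-- The mate equation is at hand only after whiskering with `h`. In the axiom it occurs whiskered
with `i`, and that instance follows by `tensor_tensor_whiskerLeft_unit_eq`. -/
theorem MonadLaws.lam_assoc (hlam : (adjOn adj M).homEquiv₁ lam = φ.inv) {κ : h ⟶ m}
    {a₂ : Sq h m m}
    (L : MonadLaws lam (rhoOf φ adj) rho (slideOf φ h) (slideOf φ m)
      (slideOf φ h ≫ h ▹ M ◁ κ) a₂ α) :
    as 𝕀 M M ◁ 𝕀 ◃ m ◁ (lam ≫ i ▹ M ◁ κ) ≫ shift i m ⊳ m ≫ (i ▹ M) ▹ M ◁ α =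
      shiftLu m ≫ ((lam ≫ i ▹ M ◁ κ) ▹₂ M) ⊳ m := by
  have xa := tensor_tensor_whiskerLeft_unit_eq φ adj (whiskerLeft_slideOf_mate φ L.mul_unit)
  have xb := shiftLu_lam (m := m) φ adj hlam
  have xc := cellAt_exchange (shift i m) κ
  simp at xa xc
  simp
  rw [← reassoc_of% xc, reassoc_of% xb, xa]

end MonadLaws

/-! ### Simplicial maps out of the Catalan simplicial set as finite data -/

section Pattern

variable {B : Type u} [Bicategory.{w, v} B] [MonoidalBicategory B]

/-- The images of the simplices of the Catalan simplicial set under a monad of oplax actions. -/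
structure Pattern (Z : ZeroSimplex B) where
  edge : Bool → OplaxAction Z.skew Z.obj
  tri (a b c : Bool) (h : (a || b) ≤ c) : Sq (edge a).act (edge b).act (edge c).act
  tri_is (a b c : Bool) (h : (a || b) ≤ c) : IsTwoSimplex (edge a) (edge b) (edge c) (tri a b c h)
  tetra (a b c ab bc abc : Bool) (h₁ : (a || b) ≤ ab) (h₂ : (a || bc) ≤ abc)
    (h₃ : (ab || c) ≤ abc) (h₄ : (b || c) ≤ bc) :
    Tetra (tri a b ab h₁) (tri a bc abc h₂) (tri ab c abc h₃) (tri b c bc h₄)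
  edge_false : (edge false).toActionData = Z.skew.regular
  tri_left (b : Bool) : HEq (tri false b b (by simp)) (edge b).act₂
  tri_right (b : Bool) : HEq (tri b false b (by simp)) (Z.slide (edge b).act)

theorem Pattern.tri_left_of_eq {Z : ZeroSimplex B} (P : Pattern Z) {a b : Bool} (ha : a = false)
    (h : (a || b) ≤ b) : HEq (P.tri a b b h) (P.edge b).act₂ := by
  subst ha
  exact P.tri_left b

theorem Pattern.tri_right_of_eq {Z : ZeroSimplex B} (P : Pattern Z) {a b : Bool} (hb : b = false)
    (h : (a || b) ≤ a) : HEq (P.tri a b a h) (Z.slide (P.edge a).act) := by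
  subst hb
  exact P.tri_right a

/-- The simplex of the given shape. -/
def Pattern.simplex {Z : ZeroSimplex B} (P : Pattern Z) {n : ℕ} (x : CatalanSimplex.{max u v w} n) :
    Simplex n (fun _ => Z) where
  edge i j h := P.edge (x.edge i j h)
  tri i j k h h' := P.tri _ _ _ (x.tri i j k h h')
  tri_is i j k h h' := P.tri_is _ _ _ (x.tri i j k h h')
  tetra i j k l h h' h'' := P.tetra _ _ _ _ _ _ _ _ _ _
  edge_self i := by rw [x.edge_self, P.edge_false]
  tri_left i j h := P.tri_left_of_eq (x.edge_self i) _
  tri_right i j h := P.tri_right_of_eq (x.edge_self j) _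

/-- The monad of oplax actions with the given images of simplices. -/
def Pattern.toMonad {Z : ZeroSimplex B} (P : Pattern Z) : MonadOfOplaxActions B where
  app n := ↾fun x => (⟨fun _ => Z, P.simplex x⟩ : SimplexCat B n.unop.len)
  naturality m n θ := by
    ext x
    rfl

theorem Simplex.ext_of_heq {n : ℕ} {X : Fin (n + 1) → ZeroSimplex B} {x y : Simplex n X}
    (he : ∀ i j h, x.edge i j h = y.edge i j h)
    (ht : ∀ i j k h h', HEq (x.tri i j k h h') (y.tri i j k h h')) : x = y := by
  obtain ⟨xe, xt, _, _, _, _, _⟩ := x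
  obtain ⟨ye, yt, _, _, _, _, _⟩ := y
  obtain rfl : xe = ye := by
    funext i j h
    exact he i j h
  obtain rfl : xt = yt := by
    funext i j k h h'
    exact eq_of_heq (ht i j k h h')
  rfl

/-- Of the two edges one is degenerate, and of the five triangles three are. Only the edge `true`
and the triangles with edges `(e, e, c)` and `(c, c, c)` are free. -/
theorem Pattern.ext_of_heq {Z : ZeroSimplex B} {P Q : Pattern Z}
    (he : (P.edge true).toActionData = (Q.edge true).toActionData)
    (hu : HEq (P.tri false false true (by simp)) (Q.tri false false true (by simp)))
    (hm : HEq (P.tri true true true (by simp)) (Q.tri true true true (by simp))) : P = Q := by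
  obtain ⟨e, t, _, _, ef, tl, tr⟩ := P
  obtain ⟨e', t', _, _, ef', tl', tr'⟩ := Q
  obtain rfl : e = e' := by
    funext b
    cases b
    · obtain ⟨a, ha⟩ : ∃ a, e false = a := ⟨_, rfl⟩
      obtain ⟨a', ha'⟩ : ∃ a, e' false = a := ⟨_, rfl⟩
      rw [ha] at ef ⊢
      rw [ha'] at ef' ⊢
      cases a
      cases a'
      simp only at ef ef'
      subst ef
      subst ef'
      rfl
    · obtain ⟨a, ha⟩ : ∃ a, e true = a := ⟨_, rfl⟩
      obtain ⟨a', ha'⟩ : ∃ a, e' true = a := ⟨_, rfl⟩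
      simp only at he
      rw [ha, ha'] at he ⊢
      cases a
      cases a'
      simp only at he
      subst he
      rfl
  obtain rfl : t = t' := by
    funext a b c h
    apply eq_of_heq
    rcases a <;> rcases b <;> rcases c <;> first | exact absurd h (by decide) | skip
    · exact (tl false).trans (tl' false).symm
    · exact hu
    · exact (tl true).trans (tl' true).symm
    · exact (tr true).trans (tr' true).symm
    · exact hm
  rfl

end Pattern

/-! ### Recovering the finite data from a simplicial map -/

section Reconstruction

variable {B : Type u} [Bicategory.{w, v} B] [MonoidalBicategory B]

theorem CatalanSimplex.edge_of_lt {n : ℕ} {x y : CatalanSimplex.{u} n}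
    (h : ∀ i j (h : i < j), x.edge i j h.le = y.edge i j h.le) : x = y := by
  ext i j hij
  rcases hij.eq_or_lt with rfl | hlt
  · rw [x.edge_self, y.edge_self]
  · rw [h i j hlt]

/-- The simplex of dimension at most two with the given edges. -/
def catalanTri (a b c : Bool) (h : (a || b) ≤ c) : CatalanSimplex.{u} 2 where
  edge i j _ := if i = 0 ∧ j = 1 then a else if i = 1 ∧ j = 2 then b else
    if i = 0 ∧ j = 2 then c else false
  edge_self := by decide +revert
  tri := by decide +revert

/-- The 1-simplex with the given edge. -/
def catalanEdge (a : Bool) : CatalanSimplex.{u} 1 where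
  edge i j _ := if i = 0 ∧ j = 1 then a else false
  edge_self := by decide +revert
  tri := by decide +revert

/-- The unique 0-simplex. -/
def catalanPoint : CatalanSimplex.{u} 0 where
  edge _ _ _ := false
  edge_self _ := rfl
  tri _ _ _ _ _ := le_rfl

/-- The monotone map picking out a chain of two vertices. -/
def edgeMap {n : ℕ} (i j : Fin (n + 1)) (h : i ≤ j) : SimplexCategory.mk 1 ⟶ SimplexCategory.mk n :=
  SimplexCategory.Hom.mk ⟨![i, j], by
    intro a b hab
    fin_cases a <;> fin_cases b <;> simp_all⟩

/-- The monotone map picking out a chain of three vertices. -/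
def triMap {n : ℕ} (i j k : Fin (n + 1)) (h : i ≤ j) (h' : j ≤ k) :
    SimplexCategory.mk 2 ⟶ SimplexCategory.mk n :=
  SimplexCategory.Hom.mk ⟨![i, j, k], by
    intro a b hab
    have := h.trans h'
    fin_cases a <;> fin_cases b <;> simp_all⟩

/-- The map picking out a vertex. -/
def pointMap {n : ℕ} (i : Fin (n + 1)) : SimplexCategory.mk 0 ⟶ SimplexCategory.mk n :=
  SimplexCategory.Hom.mk ⟨fun _ => i, fun _ _ _ => le_rfl⟩

theorem catalan_map_edgeMap {n : ℕ} (x : CatalanSimplex.{u} n) (i j : Fin (n + 1)) (h : i ≤ j) :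
    catalan.map (edgeMap i j h).op x = catalanEdge (x.edge i j h) := by
  apply CatalanSimplex.edge_of_lt
  intro a b hab
  fin_cases a <;> fin_cases b <;> first | exact absurd hab (by decide) | rfl

theorem catalan_map_triMap {n : ℕ} (x : CatalanSimplex.{u} n) (i j k : Fin (n + 1)) (h : i ≤ j)
    (h' : j ≤ k) : catalan.map (triMap i j k h h').op x =
      catalanTri (x.edge i j h) (x.edge j k h') (x.edge i k (h.trans h')) (x.tri i j k h h') := by
  apply CatalanSimplex.edge_of_lt
  intro a b hab
  fin_cases a <;> fin_cases b <;> first | exact absurd hab (by decide) | rfl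

theorem catalan_map_pointMap {n : ℕ} (x : CatalanSimplex.{u} n) (i : Fin (n + 1)) :
    catalan.map (pointMap i).op x = catalanPoint := by
  apply CatalanSimplex.edge_of_lt
  intro a b hab
  fin_cases a; fin_cases b; exact absurd hab (by decide)

variable (f : MonadOfOplaxActions B)

/-- The value of a monad of oplax actions on a simplex. -/
def valueAt {n : ℕ} (x : CatalanSimplex.{max u v w} n) : SimplexCat B n :=
  f.app (Opposite.op (SimplexCategory.mk n)) x

theorem valueAt_map {m n : ℕ} (θ : SimplexCategory.mk m ⟶ SimplexCategory.mk n)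
    (x : CatalanSimplex.{max u v w} n) :
    valueAt f (catalan.map θ.op x : CatalanSimplex.{max u v w} m) =
      (SimplexCat.reindex θ.toOrderHom).obj (valueAt f x) :=
  congrArg (fun g => g x) (f.naturality θ.op)

/-- The vertex of a monad of oplax actions. -/
def vertex : ZeroSimplex B := (valueAt f catalanPoint).1 0

/-- The Catalan simplicial set has a single 0-simplex, so by naturality all vertices of all values
coincide. Every value can hence be regarded as a simplex over a constant family. -/
theorem valueAt_fst {n : ℕ} (x : CatalanSimplex.{max u v w} n) :
    (valueAt f x).1 = fun _ => vertex f := by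
  funext i
  have h := valueAt_map f (pointMap i) x
  rw [catalan_map_pointMap] at h
  exact (congrArg (fun y : SimplexCat B 0 => y.1 0) h).symm

theorem exists_simplex {n : ℕ} (x : CatalanSimplex.{max u v w} n) :
    ∃ s : Simplex n (fun _ => vertex f), valueAt f x = ⟨fun _ => vertex f, s⟩ := by
  have h := valueAt_fst f x
  revert h
  generalize valueAt f x = y
  obtain ⟨X, s⟩ := y
  rintro rfl
  exact ⟨s, rfl⟩

end Reconstruction

section Reconstruction

variable {B : Type u} [Bicategory.{w, v} B] [MonoidalBicategory B]

/-- The 3-simplex with the given edges. -/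
def catalanTetra (a b c ab bc abc : Bool) (h₁ : (a || b) ≤ ab) (h₂ : (a || bc) ≤ abc)
    (h₃ : (ab || c) ≤ abc) (h₄ : (b || c) ≤ bc) : CatalanSimplex.{u} 3 where
  edge i j _ := if i = 0 ∧ j = 1 then a else if i = 1 ∧ j = 2 then b else
    if i = 2 ∧ j = 3 then c else if i = 0 ∧ j = 2 then ab else if i = 1 ∧ j = 3 then bc else
    if i = 0 ∧ j = 3 then abc else false
  edge_self i := by fin_cases i <;> rfl
  tri i j k h h' := by
    fin_cases i <;> fin_cases j <;> fin_cases k <;>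
      first | exact absurd h (by decide) | exact absurd h' (by decide) | (simp; done) | simpa

theorem IsTwoSimplex.congr {R S T : ZeroSimplex B} {s s' : OplaxAction R.skew S.obj}
    {t t' : OplaxAction S.skew T.obj} {v v' : OplaxAction R.skew T.obj} (hs : s = s') (ht : t = t')
    (hv : v = v') {α : Sq s.act t.act v.act} {α' : Sq s'.act t'.act v'.act} (hα : HEq α α')
    (H : IsTwoSimplex s t v α) : IsTwoSimplex s' t' v' α' := by
  subst hs ht hv hα
  exact H

theorem Tetra.congr {R S T U : B} {s s' : S ⊠ R ⟶ S} {t t' : T ⊠ S ⟶ T} {v v' : T ⊠ R ⟶ T}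
    {p p' : U ⊠ T ⟶ U} {x x' : U ⊠ S ⟶ U} {y y' : U ⊠ R ⟶ U} (hs : s = s') (ht : t = t')
    (hv : v = v') (hp : p = p') (hx : x = x') (hy : y = y') {α : Sq s t v} {α' : Sq s' t' v'}
    {β : Sq s x y} {β' : Sq s' x' y'} {γ : Sq v p y} {γ' : Sq v' p' y'} {ζ : Sq t p x}
    {ζ' : Sq t' p' x'} (hα : HEq α α') (hβ : HEq β β') (hγ : HEq γ γ') (hζ : HEq ζ ζ')
    (H : Tetra α β γ ζ) : Tetra α' β' γ' ζ' := by
  subst hs ht hv hp hx hy hα hβ hγ hζ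
  exact H

variable (f : MonadOfOplaxActions B)

/-- The value of a monad of oplax actions on a simplex, as a simplex with constant vertices. -/
noncomputable def simplexOf {n : ℕ} (x : CatalanSimplex.{max u v w} n) :
    Simplex n (fun _ => vertex f) :=
  (exists_simplex f x).choose

theorem valueAt_eq {n : ℕ} (x : CatalanSimplex.{max u v w} n) :
    valueAt f x = ⟨fun _ => vertex f, simplexOf f x⟩ :=
  (exists_simplex f x).choose_spec

/-- Naturality is an equality in a sum over families of vertices. As both families are constant at
the same vertex, the heterogeneous equality of the second components is an honest one. -/
theorem simplexOf_map {m n : ℕ} (θ : SimplexCategory.mk m ⟶ SimplexCategory.mk n)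
    (x : CatalanSimplex.{max u v w} n) :
    simplexOf f (catalan.map θ.op x : CatalanSimplex.{max u v w} m) =
      (Simplex.reindex θ.toOrderHom (fun _ => vertex f)).obj (simplexOf f x) := by
  have h := (valueAt_eq f _).symm.trans ((valueAt_map f θ x).trans (congrArg _ (valueAt_eq f x)))
  exact eq_of_heq (Sigma.mk.inj h).2

/-- The image of a 1-simplex. -/
noncomputable def edgeAt (b : Bool) : OplaxAction (vertex f).skew (vertex f).obj :=
  (simplexOf f (catalanEdge b)).edge 0 1 (by decide)

theorem simplexOf_edge {n : ℕ} (x : CatalanSimplex.{max u v w} n) (i j : Fin (n + 1)) (h : i ≤ j) :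
    (simplexOf f x).edge i j h = edgeAt f (x.edge i j h) := by
  have e := simplexOf_map f (edgeMap i j h) x
  rw [catalan_map_edgeMap] at e
  rw [edgeAt, e]
  rfl

/-- The image of a 2-simplex. -/
noncomputable def triAt (a b c : Bool) (h : (a || b) ≤ c) :
    Sq (edgeAt f a).act (edgeAt f b).act (edgeAt f c).act :=
  -- The edges of the value on a 2-simplex agree with the values on its edges only propositionally,
  -- whence the cast.
  cast (by rw [simplexOf_edge, simplexOf_edge, simplexOf_edge]; rfl)
    ((simplexOf f (catalanTri a b c h)).tri 0 1 2 (by decide) (by decide))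

theorem simplexOf_tri {n : ℕ} (x : CatalanSimplex.{max u v w} n) (i j k : Fin (n + 1)) (h : i ≤ j)
    (h' : j ≤ k) : HEq ((simplexOf f x).tri i j k h h') (triAt f _ _ _ (x.tri i j k h h')) := by
  have e := simplexOf_map f (triMap i j k h h') x
  rw [catalan_map_triMap] at e
  refine HEq.trans ?_ (cast_heq _ _).symm
  rw [e]
  rfl

theorem tetra_triAt (x : CatalanSimplex.{max u v w} 3) :
    Tetra (triAt f _ _ _ (x.tri 0 1 2 (by decide) (by decide)))
      (triAt f _ _ _ (x.tri 0 1 3 (by decide) (by decide)))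
      (triAt f _ _ _ (x.tri 0 2 3 (by decide) (by decide)))
      (triAt f _ _ _ (x.tri 1 2 3 (by decide) (by decide))) := by
  have e (i j : Fin 4) (h : i ≤ j) := congrArg (fun a => a.act) (simplexOf_edge f x i j h)
  exact ((simplexOf f x).tetra 0 1 2 3 (by decide) (by decide) (by decide)).congr (e 0 1 _)
    (e 1 2 _) (e 0 2 _) (e 2 3 _) (e 1 3 _) (e 0 3 _) (simplexOf_tri f x 0 1 2 _ _)
    (simplexOf_tri f x 0 1 3 _ _) (simplexOf_tri f x 0 2 3 _ _) (simplexOf_tri f x 1 2 3 _ _)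

/-- The pattern of a monad of oplax actions. -/
noncomputable def patternAt : Pattern (vertex f) where
  edge := edgeAt f
  tri := triAt f
  tri_is a b c h := ((simplexOf f (catalanTri a b c h)).tri_is 0 1 2 (by decide) (by decide)).congr
    (simplexOf_edge f _ _ _ _) (simplexOf_edge f _ _ _ _) (simplexOf_edge f _ _ _ _)
    (simplexOf_tri f _ _ _ _ _ _)
  tetra a b c ab bc abc h₁ h₂ h₃ h₄ := tetra_triAt f (catalanTetra a b c ab bc abc h₁ h₂ h₃ h₄)
  edge_false := by
    have e := simplexOf_edge f catalanPoint 0 0 le_rfl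
    exact (congrArg OplaxAction.toActionData e).symm.trans ((simplexOf f catalanPoint).edge_self 0)
  tri_left b := by
    have t := simplexOf_tri f (catalanEdge b) 0 0 1 le_rfl (by decide)
    have e := simplexOf_edge f (catalanEdge b) 0 1 (by decide)
    refine t.symm.trans (((simplexOf f (catalanEdge b)).tri_left 0 1 (by decide)).trans ?_)
    rw [e]
    rfl
  tri_right b := by
    have t := simplexOf_tri f (catalanEdge b) 0 1 1 (by decide) le_rfl
    have e := simplexOf_edge f (catalanEdge b) 0 1 (by decide)
    refine t.symm.trans (((simplexOf f (catalanEdge b)).tri_right 0 1 (by decide)).trans ?_)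
    rw [e]
    rfl

/-- A simplex is determined by its vertices, edges and triangles, and by naturality these are the
values on one- and two-dimensional faces. -/
theorem toMonad_patternAt : (patternAt f).toMonad = f := by
  ext n x
  refine Eq.trans ?_ (valueAt_eq f x).symm
  refine congrArg (Sigma.mk (fun _ => vertex f)) (Simplex.ext_of_heq ?_ ?_)
  · intro i j h
    exact (simplexOf_edge f x i j h).symm
  · intro i j k h h'
    exact (simplexOf_tri f x i j k h h').symm

end Reconstruction

/-! ### The bijection -/

section Main

variable {B : Type u} [Bicategory.{w, v} B] [MonoidalBicategory B]

theorem ZeroSimplex.regular_isOplaxAction (Z : ZeroSimplex B) :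
    Z.skew.regular.IsOplaxAction where
  assoc := by
    change Tetra (Z.slide Z.mul) (Z.slide Z.mul) (Z.slide Z.mul) (Z.slide Z.mul)
    rw [Z.slide_eq]
    exact tetra_slideOf (Iso.refl _) _
  assoc_unit := by
    change UnitCompat Z.unit Z.skew.rho Z.skew.rho (Z.slide Z.mul)
    rw [Z.slide_eq]
    exact unitCompat_slideOf (Iso.refl _) _ _
  triangle := Z.triangle

/-- The laws satisfied by the simplices of a monad of oplax actions with the given vertex. -/
abbrev ZeroSimplex.Laws (Z : ZeroSimplex B) {m : Z.obj ⊠ Z.obj ⟶ Z.obj}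
    (rho : 𝟙 Z.obj ⊠₁ Z.unit ≫ m ⟶ ru Z.obj) (θ : Sq Z.mul Z.mul m) (a₂ : Sq Z.mul m m)
    (α : Sq m m m) : Prop :=
  MonadLaws Z.skew.lam Z.skew.rho rho (Z.slide Z.mul) (Z.slide m) θ a₂ α

namespace RightSkewMonoidaleWithRightAdjoint

variable (M : RightSkewMonoidaleWithRightAdjoint B)

theorem lam_eq : M.data.lam = M.zero.skew.lam ≫ M.unit ⊠₁ 𝟙 M.obj ◁ M.mate := by
  apply (adjOn M.right.adj M.obj).homEquiv₁.injective
  have h := homEquiv₁_comp (adjOn M.right.adj M.obj) M.zero.skew.lam M.mate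
  refine M.mate_eq.symm.trans (Eq.trans ?_ h.symm)
  rw [M.zero.homEquiv₁_lam]
  exact (Category.id_comp _).symm

theorem laws : M.zero.Laws M.data.rho M.unitSq M.action.act₂ M.data.assoc := by
  have hl := M.lam_eq
  have h₁ := M.isSkew.triangle
  have h₂ := (lam_assoc_iff M.data).1 M.isSkew.lam_assoc
  have h₃ := (lam_rho_iff M.data).1 M.isSkew.lam_rho
  rw [hl] at h₁ h₂ h₃
  have h₂' := (lam_assoc_iff_mate (Iso.refl _) M.right.adj M.zero.homEquiv₁_lam).1 h₂
  have h₃' := (lam_rho_iff_mate (Iso.refl _) M.right.adj M.zero.homEquiv₁_lam).1 h₃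
  have L := monadLaws_of_skew (Iso.refl _) M.right.adj M.isSkew.pentagon h₁ h₂' M.isSkew.assoc_rho h₃'
  have hu : M.unitSq = slideOf (Iso.refl _) M.zero.mul ≫ M.zero.mul ⊠₁ 𝟙 M.obj ◁ M.mate := by
    rw [← M.zero.slide_eq]
    rfl
  unfold ZeroSimplex.Laws
  rw [M.zero.skew_rho, M.zero.slide_eq, M.zero.slide_eq, hu]
  have ha := congrArg (fun c => as M.obj M.obj M.obj ◁ c ≫ M.data.assoc)
    (whiskerRight_id_tHom₂ M.mate M.data.mul)
  exact Eq.mpr (congrArg (fun a₂ => MonadLaws _ _ _ _ _ _ a₂ M.data.assoc) ha) L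

end RightSkewMonoidaleWithRightAdjoint

namespace ZeroSimplex

variable (Z : ZeroSimplex B)

theorem tetra_slide {R S : B} {s : S ⊠ R ⟶ S} {t : Z.obj ⊠ S ⟶ Z.obj} {v : Z.obj ⊠ R ⟶ Z.obj}
    (α : Sq s t v) : Tetra α α (Z.slide v) (Z.slide t) := by
  rw [Z.slide_eq, Z.slide_eq]
  exact tetra_slideOf (Iso.refl _) α

/-- The square `θ` determines `κ` only after whiskering with the product, the coherence square being
invertible. This already determines `κ` whiskered with the unit, hence the left unitor. -/
theorem whiskerLeft_unit_eq {m : Z.obj ⊠ Z.obj ⟶ Z.obj} {κ κ' : Z.mul ⟶ m}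
    (h : Z.slide Z.mul ≫ Z.mul ⊠₁ 𝟙 Z.obj ◁ κ = Z.slide Z.mul ≫ Z.mul ⊠₁ 𝟙 Z.obj ◁ κ') :
    Z.unit ⊠₁ 𝟙 Z.obj ◁ κ = Z.unit ⊠₁ 𝟙 Z.obj ◁ κ' := by
  refine tensor_whiskerLeft_unit_eq (Iso.refl _) Z.right.adj ?_
  rw [Z.slide_eq] at h
  exact (cancel_epi (slideOf (Iso.refl Z.mul) Z.mul)).1 h

theorem unitCompat_slide {R : B} (i : unitObj B ⟶ R) {r : Z.obj ⊠ R ⟶ Z.obj}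
    (r₀ : 𝟙 Z.obj ⊠₁ i ≫ r ⟶ ru Z.obj) : UnitCompat i r₀ r₀ (Z.slide r) := by
  rw [Z.slide_eq]
  exact unitCompat_slideOf (Iso.refl _) i r₀

end ZeroSimplex

section OfLaws

variable {Z : ZeroSimplex B} {a : ActionData Z.skew Z.obj} {θ : Sq Z.mul Z.mul a.act}
  {α : Sq a.act a.act a.act}

/-- The images of the 1-simplices. -/
def edgeOf (a : ActionData Z.skew Z.obj) : Bool → ActionData Z.skew Z.obj
  | false => Z.skew.regular
  | true => a

/-- The images of the 2-simplices. -/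
def triOf (θ : Sq Z.mul Z.mul a.act) (α : Sq a.act a.act a.act) :
    ∀ b c d : Bool, (b || c) ≤ d → Sq (edgeOf a b).act (edgeOf a c).act (edgeOf a d).act
  | false, false, false, _ => Z.slide Z.mul
  | false, false, true, _ => θ
  | false, true, true, _ => a.act₂
  | true, false, true, _ => Z.slide a.act
  | true, true, true, _ => α
  | true, true, false, h => absurd h (by decide)
  | true, false, false, h => absurd h (by decide)
  | false, true, false, h => absurd h (by decide)

theorem isOplaxAction_edgeOf (L : Z.Laws a.act₀ θ a.act₂ α) : ∀ b : Bool, (edgeOf a b).IsOplaxAction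
  | false => Z.regular_isOplaxAction
  | true => ⟨L.assoc, L.assoc_unit, L.triangle⟩

/-- The images of the 1-simplices, as oplax actions. -/
def actionOf (L : Z.Laws a.act₀ θ a.act₂ α) (b : Bool) : OplaxAction Z.skew Z.obj := ⟨edgeOf a b, isOplaxAction_edgeOf L b⟩

theorem isTwoSimplex_triOf (L : Z.Laws a.act₀ θ a.act₂ α) : ∀ (b c d : Bool) (h : (b || c) ≤ d),
    IsTwoSimplex (actionOf L b) (actionOf L c) (actionOf L d) (triOf θ α b c d h)
  | false, false, false, _ => ⟨Z.tetra_slide _, Z.tetra_slide _, Z.unitCompat_slide _ _⟩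
  | false, false, true, _ => ⟨L.unit_middle, L.unit_right, L.unit_unit⟩
  | false, true, true, _ => ⟨L.assoc, L.assoc, L.assoc_unit⟩
  | true, false, true, _ => ⟨Z.tetra_slide _, Z.tetra_slide _, Z.unitCompat_slide _ _⟩
  | true, true, true, _ => ⟨L.mul_middle, L.mul_right, L.mul_unitor⟩
  | true, true, false, h => absurd h (by decide)
  | true, false, false, h => absurd h (by decide)
  | false, true, false, h => absurd h (by decide)

theorem tetra_triOf (L : Z.Laws a.act₀ θ a.act₂ α) (a' b c ab bc abc : Bool)
    (h₁ : (a' || b) ≤ ab) (h₂ : (a' || bc) ≤ abc)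
    (h₃ : (ab || c) ≤ abc) (h₄ : (b || c) ≤ bc) :
    Tetra (triOf θ α a' b ab h₁) (triOf θ α a' bc abc h₂) (triOf θ α ab c abc h₃)
      (triOf θ α b c bc h₄) := by
  -- Fourteen label combinations survive, the 3-simplices of the Catalan simplicial set. Each is one
  -- of the laws or a tetrahedron of coherence squares.
  rcases a' with _ | _ <;> rcases b with _ | _ <;> rcases c with _ | _ <;>
    rcases ab with _ | _ <;> (first | exact absurd h₁ (by decide) | skip) <;>
    rcases bc with _ | _ <;> (first | exact absurd h₄ (by decide) | skip) <;>
    rcases abc with _ | _ <;> (first | exact absurd h₂ (by decide) | exact absurd h₃ (by decide) |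
      skip) <;>
    first
      | exact L.assoc | exact L.unit_middle | exact L.unit_right | exact L.unit_unit_mul
      | exact L.mul_unit | exact L.unit_mul | exact L.mul_middle | exact L.mul_right
      | exact L.mul_mul | exact Z.tetra_slide _

/-- The pattern given by cells satisfying the laws. -/
def patternOf (L : Z.Laws a.act₀ θ a.act₂ α) : Pattern Z where
  edge := actionOf L
  tri := triOf θ α
  tri_is := isTwoSimplex_triOf L
  tetra := tetra_triOf L
  edge_false := rfl
  tri_left b := by cases b <;> rfl
  tri_right b := by cases b <;> rfl

end OfLaws

/-- The pattern of a right skew monoidale whose unit has a right adjoint. -/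
def RightSkewMonoidaleWithRightAdjoint.pattern (M : RightSkewMonoidaleWithRightAdjoint B) :
    Pattern M.zero :=
  patternOf (a := M.action) (θ := M.unitSq) (α := M.data.assoc) M.laws

theorem Pattern.laws {Z : ZeroSimplex B} (P : Pattern Z) :
    ∃ θ : Sq Z.mul Z.mul (P.edge true).act, HEq (P.tri false false true (by simp)) θ ∧
      Z.Laws (P.edge true).act₀ θ (P.edge true).act₂ (P.tri true true true (by simp)) := by
  obtain ⟨e, t, ts, te, ef, tl, tr⟩ := P
  -- Written as a conditional, the edge function reduces on `true` and `false`, so the heterogeneous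
  -- equations for degenerate triangles become equations.
  obtain ⟨⟨y, hy⟩, x, rfl⟩ : ∃ y x, e = fun b => bif b then x else y :=
    ⟨e false, e true, by funext b; cases b <;> rfl⟩
  obtain rfl : y = Z.skew.regular := ef
  have l₀ : t false false false _ = Z.slide Z.mul := eq_of_heq (tl false)
  have l₁ : t false true true _ = x.act₂ := eq_of_heq (tl true)
  have r₁ : t true false true _ = Z.slide x.act := eq_of_heq (tr true)
  refine ⟨t false false true _, HEq.rfl, ?_⟩
  exact
    { assoc := x.isOplax.assoc
      assoc_unit := x.isOplax.assoc_unit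
      triangle := x.isOplax.triangle
      unit_middle := (ts false false true (by simp)).middle
      unit_right := (ts false false true (by simp)).right
      unit_unit := (ts false false true (by simp)).unit
      unit_unit_mul := by
        have := te false false false true true true (by simp) (by simp) (by simp) (by simp)
        rwa [l₁, r₁] at this
      mul_unit := by
        have := te true false false true true true (by simp) (by simp) (by simp) (by simp)
        rwa [r₁] at this
      unit_mul := by
        have := te false false true true true true (by simp) (by simp) (by simp) (by simp)
        rwa [l₁] at this
      mul_middle := (ts true true true (by simp)).middle
      mul_right := (ts true true true (by simp)).right
      mul_mul := te true true true true true true (by simp) (by simp) (by simp) (by simp)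
      mul_unitor := (ts true true true (by simp)).unit }

/-- Surjectivity. Three of the skew axioms are read off from the laws, the triangle after moving `κ`
from the left unitor to the associator. The two axioms beginning with the left unitor come from the
mate equations whiskered with the product. -/
theorem Pattern.exists_toMonad_eq {Z : ZeroSimplex B} (P : Pattern Z) :
    ∃ M : RightSkewMonoidaleWithRightAdjoint B, M.pattern.toMonad = P.toMonad := by
  obtain ⟨θ, hθ, L⟩ := P.laws
  have L' := L
  unfold ZeroSimplex.Laws at L'
  rw [Z.skew_rho, Z.slide_eq, Z.slide_eq] at L'
  obtain ⟨κ, rfl, ha⟩ := L'.exists_mate (Iso.refl _) Z.right.adj Z.homEquiv₁_lam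
  let D : SkewData Z.unit :=
    { mul := (P.edge true).act
      assoc := P.tri true true true (by simp)
      -- This left unitor is chosen so that its mate is `κ`, as checked in `hκ`.
      lam := Z.skew.lam ≫ Z.unit ⊠₁ 𝟙 Z.obj ◁ κ
      rho := (P.edge true).act₀ }
  have hD : D.IsSkewMonoidale :=
    { pentagon := L.mul_mul
      triangle := (triangle_dinatural κ).2 (ha ▸ L.triangle)
      lam_assoc := (lam_assoc_iff D).2 (L'.lam_assoc (Iso.refl _) Z.right.adj Z.homEquiv₁_lam)
      assoc_rho := L.mul_unitor
      lam_rho := (lam_rho_iff D).2 (lam_rho_of_whisker (Iso.refl _) Z.right.adj Z.homEquiv₁_lam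
        (whiskerLeft_rho_mate (Iso.refl _) Z.right.adj L'.unit_unit)) }
  let M : RightSkewMonoidaleWithRightAdjoint B :=
    { obj := Z.obj
      unit := Z.unit
      data := D
      isSkew := hD
      right := Z.right }
  have hκ : M.mate = κ := by
    have h := homEquiv₁_comp (adjOn Z.right.adj Z.obj) Z.skew.lam κ
    refine M.mate_eq.trans (Eq.trans h ?_)
    rw [Z.homEquiv₁_lam]
    exact Category.id_comp _
  refine ⟨M, congrArg Pattern.toMonad (Pattern.ext_of_heq ?_ ?_ ?_)⟩
  · refine ActionData.ext rfl (heq_of_eq ?_) HEq.rfl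
    have h := congrArg (fun c => as Z.obj Z.obj Z.obj ◁ c ≫ D.assoc)
      (whiskerRight_id_tHom₂ M.mate D.mul)
    rw [hκ] at h
    refine Eq.trans ?_ (Eq.trans h ha.symm)
    rw [← hκ]
    rfl
  · refine HEq.trans (heq_of_eq ?_) hθ.symm
    rw [← Z.slide_eq, ← hκ]
    rfl
  · exact HEq.rfl

theorem RightSkewMonoidaleWithRightAdjoint.corresponds
    (M : RightSkewMonoidaleWithRightAdjoint B) : Corresponds M.pattern.toMonad M where
  mul := ⟨M.pattern.simplex catalanMul, rfl, rfl, rfl, rfl, HEq.rfl⟩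
  unit := ⟨M.pattern.simplex catalanUnit, rfl, rfl, HEq.rfl⟩

theorem toMonad_pattern_surjective : Function.Surjective
    fun M : RightSkewMonoidaleWithRightAdjoint B => M.pattern.toMonad := by
  intro f
  obtain ⟨M, h⟩ := (patternAt f).exists_toMonad_eq
  exact ⟨M, h.trans (toMonad_patternAt f)⟩

theorem RightSkewMonoidaleWithRightAdjoint.ext_of_pattern
    {M N : RightSkewMonoidaleWithRightAdjoint B} (hZ : M.zero = N.zero)
    (ha : HEq M.action N.action) (hα : HEq M.data.assoc N.data.assoc)
    (hθ : HEq M.unitSq N.unitSq) : M = N := by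
  have hM := M.lam_eq
  have hN := N.lam_eq
  obtain ⟨⟨R, i, ⟨m, α, lam, rho⟩, hs⟩, r⟩ := M
  obtain ⟨⟨S, j, ⟨m', α', lam', rho'⟩, hs'⟩, r'⟩ := N
  obtain ⟨rfl, h⟩ := ZeroSimplex.mk.inj hZ
  obtain ⟨rfl, rfl⟩ : i = j ∧ HEq r r' := by simpa using h
  have ha' := eq_of_heq ha
  obtain rfl : m = m' := congrArg ActionData.act ha'
  obtain rfl : rho = rho' := eq_of_heq (ActionData.ext_iff.1 ha').2.2
  obtain rfl : α = α' := eq_of_heq hα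
  -- The left unitors are not compared directly: each factors through its mate, and the unit squares
  -- determine the mates as far as the unit sees them.
  obtain rfl : lam = lam' := by
    refine hM.trans (Eq.trans (congrArg _ ?_) hN.symm)
    exact ZeroSimplex.whiskerLeft_unit_eq ⟨R, i, r⟩ (eq_of_heq hθ)
  rfl

theorem Simplex.heq_of_mk_eq {Z W : ZeroSimplex B} (h : Z = W) {n : ℕ}
    {x : Simplex n fun _ => Z} {y : Simplex n fun _ => W}
    (e : (⟨fun _ => Z, x⟩ : SimplexCat B n) = ⟨fun _ => W, y⟩) :
    (∀ i j hij, HEq (x.edge i j hij).toActionData (y.edge i j hij).toActionData) ∧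
      ∀ i j k hij hjk, HEq (x.tri i j k hij hjk) (y.tri i j k hij hjk) := by
  subst h
  obtain rfl : x = y := eq_of_heq (Sigma.mk.inj e).2
  exact ⟨fun _ _ _ => HEq.rfl, fun _ _ _ _ _ => HEq.rfl⟩

theorem toMonad_pattern_injective : Function.Injective
    fun M : RightSkewMonoidaleWithRightAdjoint B => M.pattern.toMonad := by
  intro M N h
  have h₁ : (⟨fun _ => M.zero, M.pattern.simplex catalanMul⟩ : SimplexCat B 2) =
      ⟨fun _ => N.zero, N.pattern.simplex catalanMul⟩ := congrArg
    (fun f : MonadOfOplaxActions B => f.app (Opposite.op (SimplexCategory.mk 2)) catalanMul) h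
  have h₂ : (⟨fun _ => M.zero, M.pattern.simplex catalanUnit⟩ : SimplexCat B 2) =
      ⟨fun _ => N.zero, N.pattern.simplex catalanUnit⟩ := congrArg
    (fun f : MonadOfOplaxActions B => f.app (Opposite.op (SimplexCategory.mk 2)) catalanUnit) h
  have hZ : M.zero = N.zero := congrFun (congrArg Sigma.fst h₁) 0
  have e₁ := Simplex.heq_of_mk_eq hZ h₁
  have e₂ := Simplex.heq_of_mk_eq hZ h₂
  exact RightSkewMonoidaleWithRightAdjoint.ext_of_pattern hZ (e₁.1 0 1 (by decide))
    (e₁.2 0 1 2 (by decide) (by decide)) (e₂.2 0 1 2 (by decide) (by decide))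

end Main

end MonBicat

theorem mainTheorem1 (B : Type u) [Bicategory.{w, v} B] [MonBicat.MonoidalBicategory B] :
    ∃ Φ : MonBicat.MonadOfOplaxActions B ≃ MonBicat.RightSkewMonoidaleWithRightAdjoint B,
      ∀ f : MonBicat.MonadOfOplaxActions B, MonBicat.Corresponds f (Φ f) := by
  let Ψ := Equiv.ofBijective
    (fun M : MonBicat.RightSkewMonoidaleWithRightAdjoint B => M.pattern.toMonad)
    ⟨MonBicat.toMonad_pattern_injective, MonBicat.toMonad_pattern_surjective⟩
  -- The explicit construction runs from skew monoidales to monads, so the required bijection is its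
  -- inverse, and the correspondence is checked on the reconstructed monad.
  refine ⟨Ψ.symm, fun f => ?_⟩
  have h := (Ψ.symm f).corresponds
  rwa [show (Ψ.symm f).pattern.toMonad = f from Ψ.apply_symm_apply f] at h
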